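/- **Local anomaly cancellation for M-theory on $M_{10}\times S^1/\mathbb Z_2$.** *Conventions.* Anomaly polynomials are invariant polynomials of degree 6 ("twelve-forms") in $R\in\mathfrak{so}(10)$ (or $\mathfrak{so}(1,9)$), with $\operatorname{tr}$ the vector trace, and $F\in\mathfrak g$, the Lie algebra (of dimension $n$) of the gauge group of one fixed plane, with $\operatorname{Tr}$ the adjoint trace. With $\hat A=\prod_{j=1}^5\frac{x_j/2}{\sinh(x_j/2)}$, $x_j$ the skew eigenvalues of $R/2\pi$, and $\mathrm{ch}(F)=\operatorname{Tr}e^{iF/2\pi}$, put $I^{(1/2)}=-2\pi[\hat A\,\mathrm{ch}(F)]_{12}$, $I^{(1/2)}_{grav}=-2\pi[\hat A]_{12}$, $I^{(3/2)}_{grav}=-2\pi[\hat A(\operatorname{tr}e^{iR/2\pi}-1)]_{12}$, and $I^{(untwisted)}=\frac12\cdot\frac12(-I^{(3/2)}_{grav}+I^{(1/2)}_{grav})$, $I^{(twisted)}=-\frac12 I^{(1/2)}$ with $F$ in the adjoint representation, $I^{(fields)}=I^{(untwisted)}+I^{(twisted)}$. Further $\operatorname{tr}F^2=\frac1{30}\operatorname{Tr}F^2$,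 $I_4=\frac1{16\pi^2}(\operatorname{tr}F^2-\frac12\operatorname{tr}R^2)$, $X_8=\frac1{(2\pi)^34!}(\frac18\operatorname{tr}R^4-\frac1{32}(\operatorname{tr}R^2)^2)$. **(1)** For every gauge algebra, $$I^{(fields)}=-\tfrac1{2(2\pi)^56!}\Big[\tfrac{496-2n}{1008}\operatorname{tr}R^6+\tfrac{-224-2n}{768}\operatorname{tr}R^4\operatorname{tr}R^2+\tfrac{320-10n}{9216}(\operatorname{tr}R^2)^3+\tfrac1{16}\operatorname{tr}R^4\operatorname{Tr}F^2+\tfrac5{64}(\operatorname{tr}R^2)^2\operatorname{Tr}F^2-\tfrac58\operatorname{tr}R^2\operatorname{Tr}F^4+\operatorname{Tr}F^6\Big],$$ and the irreducible term $\operatorname{tr}R^6$ is absent (that is, $I^{(fields)}$ depends on $R$ only through $\operatorname{tr}R^2$ and $\operatorname{tr}R^4$) if and only if $n=248$. **(2)** If the gauge group is $E_8$, then $n=248$ and $I^{(fields)}=-\frac\pi3 I_4^3-I_4\wedge X_8$. **(3)** Let the gauge group on each of the two planes be $E_8$, $\kappa=\kappa_{11}>0$, $\gamma,b\in\mathbb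 R$. Work over a coordinate patch $U\subset\mathbb R^{10}$ of $M_{10}$ on which the bundles are trivial, times $S^1$ with coordinate $\phi\in(-\pi,\pi]$; the fixed planes are $\phi_1=0$, $\phi_2=\pi$. Let $C=\tilde B\wedge d\phi$, let $A_i$ be the gauge potentials, and let $\Omega$ be an $\mathfrak{so}(1,10)$ spin connection on $U\times S^1$ which restricts to $\mathfrak{so}(1,9)$ connections $\bar\Omega_i$ on the planes. Let $\bar I_{4(i)}$ and $\bar\omega_i=\frac1{(4\pi)^2}(\operatorname{tr}(A_idA_i+\frac23A_i^3)-\frac12\operatorname{tr}(\bar\Omega_id\bar\Omega_i+\frac23\bar\Omega_i^3))$ be $I_4$ and its Chern–Simons form on the $i$-th plane, and $\bar\omega^1_i=\frac1{(4\pi)^2}(\operatorname{tr}\Lambda^g_idA_i-\frac12\operatorname{tr}\Lambda^Ld\bar\Omega_i)$, for $\phi$-independent parameters $\Lambda^g_i,\Lambda^L$ with compact support in $U$. Let $\delta_i=\delta(\phi-\phi_i)d\phi$ be regularised by smooth even non-negative approximations of the delta function, $\epsilon_i$ being the corresponding odd solution of $d\epsilon_i=2\delta_i-d\phi/\pi$.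 Put $$G=dC-(1-b)\gamma\sum_i\delta_i\wedge\bar\omega_i+b\gamma\sum_i\tfrac{\epsilon_i}2\bar I_{4(i)}-b\gamma\sum_i\tfrac{d\phi}{2\pi}\wedge\bar\omega_i,\qquad \tilde C=C+\tfrac b2\gamma\sum_i\epsilon_i\bar\omega_i,$$ $$\delta C=\gamma\sum_i\big[(b-1)\delta_i\wedge\bar\omega^1_i-\tfrac b{2\pi}d\phi\wedge\bar\omega^1_i\big],$$ $$\tilde S_{top}=-\frac1{24\kappa^2}\int\tilde C\wedge G\wedge G,\qquad S_{GS}=-\frac1{2(4\pi\kappa^2)^{1/3}}\int G\wedge X_7,$$ where $X_8=dX_7$, $\delta X_7=dX_6$ ($X_7$, $X_6$ the standard Chern–Simons and descent forms). Then $dG=\gamma\sum_i\delta_i\wedge\bar I_{4(i)}$, $\delta G=0$, and, when the regularisation is removed, $$\delta\tilde S_{top}\to\sum_i\frac{\gamma^3b^2}{96\kappa^2}\int_U\bar\omega^1_i\wedge\bar I_{4(i)}\wedge\bar I_{4(i)},\qquad \delta S_{GS}\to\sum_i\frac{\gamma}{2(4\pi\kappa^2)^{1/3}}\int_U\bar I_{4(i)}\wedge\bar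 X_6 .$$ By the descent equations $I_{12}=dI_{11}$, $\delta I_{11}=dI^1_{10}$ (valid on open subsets of $\mathbb R^N$ for all $N$) these two contributions of the $i$-th plane correspond to the polynomials $I^{(top)}=\frac{\gamma^3b^2}{96\kappa^2}I_4^3$ and $I^{(GS)}=\frac\gamma{2(4\pi\kappa^2)^{1/3}}I_4\wedge X_8$. **(4)** On each plane separately, for gauge group $E_8$: $-\frac\pi3I_4^3-I^{(top)}=0$ if and only if $b\ne0$ and $\gamma=-(32\pi\kappa^2/b^2)^{1/3}$; $-I_4\wedge X_8-I^{(GS)}=0$ if and only if $\gamma=-(32\pi\kappa^2)^{1/3}$; and the whole anomaly $iI^{(untwisted)}+iI^{(twisted)}-iI^{(top)}-iI^{(GS)}$ vanishes if and only if $\gamma=-(32\pi\kappa^2)^{1/3}$ and $b^2=1$, i.e. $b=\pm1$ (so $b=1$ if $b\ge0$). -/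

import Mathlib

open scoped ContDiff TensorProduct

noncomputable section

namespace HoravaWitten

/-! ### Anomaly polynomials

An anomaly polynomial is an invariant polynomial in the curvature two-forms, that is, a polynomial
function of `R ∈ 𝔰𝔬(10)` (or `𝔰𝔬(1,9)`) and `F ∈ 𝔤`.  A `2k`-form part is the part of degree `k`
in `(R, F)`; it is read off by scaling `(R, F)` to `(t R, t F)` and taking the coefficient
of `t ^ k`. -/

/-- The metric `diag(ε, 1, …, 1)`: Euclidean for `ε = 1`, Minkowskian for `ε = -1`. -/
def flatMetric (ε : ℝ) : Matrix (Fin 10) (Fin 10) ℝ :=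
  Matrix.diagonal fun a => if a = 0 then ε else 1

/-- `x₁, …, x₅` are skew eigenvalues of `R / 2π`:
the total Pontrjagin class `det (1 + s R / 2π)` equals `∏ⱼ (1 + s² xⱼ²)`. -/
def IsSkewEigenvalues (R : Matrix (Fin 10) (Fin 10) ℝ) (x : Fin 5 → ℂ) : Prop :=
  ∀ s : ℂ, (1 + (s / (2 * Real.pi)) • R.map Complex.ofReal).det = ∏ j, (1 + s ^ 2 * x j ^ 2)

/-- Skew eigenvalues of `R / 2π`. Everything below is even and symmetric in them. -/
def skewEigenvalues (R : Matrix (Fin 10) (Fin 10) ℝ) : Fin 5 → ℂ :=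
  Classical.epsilon (IsSkewEigenvalues R)

/-- The power series of `sinh (z / 2) / (z / 2)`. -/
def sinhRatio : PowerSeries ℂ :=
  PowerSeries.mk fun n => if Even n then 1 / ((2 : ℂ) ^ n * ((n + 1).factorial : ℂ)) else 0

/-- The Dirac genus `Â(R) = ∏ⱼ (xⱼ / 2) / sinh (xⱼ / 2)`, graded by the power of the curvature. -/
def diracGenus (R : Matrix (Fin 10) (Fin 10) ℝ) : PowerSeries ℂ :=
  ∏ j, PowerSeries.rescale (skewEigenvalues R j) sinhRatio⁻¹

/-- `tr exp (i M / 2π)`, graded by the power of the curvature. -/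
def chernCharacter {κ : Type*} [Fintype κ] [DecidableEq κ] (M : Matrix κ κ ℝ) : PowerSeries ℂ :=
  PowerSeries.mk fun k =>
    (Complex.I / (2 * Real.pi)) ^ k / (k.factorial : ℂ) * ((Matrix.trace (M ^ k) : ℝ) : ℂ)

section OneLoop

variable {κ : Type*} [Fintype κ] [DecidableEq κ]

/-- The twelve-form of a positive chirality spin-1/2 fermion, `-2π [Â ch(F)]₁₂`. -/
def spinHalf (R : Matrix (Fin 10) (Fin 10) ℝ) (F : Matrix κ κ ℝ) : ℂ :=
  -2 * Real.pi * PowerSeries.coeff 6 (diracGenus R * chernCharacter F)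

/-- Its purely gravitational part for a single fermion, `-2π [Â]₁₂`. -/
def spinHalfGrav (R : Matrix (Fin 10) (Fin 10) ℝ) : ℂ :=
  -2 * Real.pi * PowerSeries.coeff 6 (diracGenus R)

/-- Its pure gauge part, `-2π [ch(F)]₁₂`. -/
def spinHalfGauge (F : Matrix κ κ ℝ) : ℂ :=
  -2 * Real.pi * PowerSeries.coeff 6 (chernCharacter F)

/-- Its mixed part: what remains of the total. -/
def spinHalfMixed (R : Matrix (Fin 10) (Fin 10) ℝ) (F : Matrix κ κ ℝ) : ℂ :=
  spinHalf R F - spinHalfGauge F - (Fintype.card κ : ℂ) * spinHalfGrav R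

/-- The gravitational twelve-form of a positive chirality spin-3/2 fermion,
`-2π [Â (tr exp (i R / 2π) - 1)]₁₂`. -/
def spinThreeHalfGrav (R : Matrix (Fin 10) (Fin 10) ℝ) : ℂ :=
  -2 * Real.pi * PowerSeries.coeff 6 (diracGenus R * (chernCharacter R - 1))

/-- The untwisted fields on one plane: half the anomaly of a negative chirality Majorana-Weyl
gravitino and a positive chirality Majorana-Weyl spin-1/2 fermion (Euclidean chiralities). -/
def untwistedPoly (R : Matrix (Fin 10) (Fin 10) ℝ) : ℂ :=
  (1 / 2) * ((1 / 2) * (-spinThreeHalfGrav R + spinHalfGrav R))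

/-- The twisted fields on one plane: negative (Euclidean) chirality Majorana-Weyl gauginos in the
adjoint representation; `F` is the matrix of the field strength in that representation. -/
def twistedPoly (R : Matrix (Fin 10) (Fin 10) ℝ) (F : Matrix κ κ ℝ) : ℂ :=
  -(1 / 2) * ((Fintype.card κ : ℂ) * spinHalfGrav R + spinHalfMixed R F + spinHalfGauge F)

/-- The sum of the untwisted and the twisted anomaly polynomials of one plane. -/
def fieldsPoly (R : Matrix (Fin 10) (Fin 10) ℝ) (F : Matrix κ κ ℝ) : ℂ :=
  untwistedPoly R + twistedPoly R F

end OneLoop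

section Polynomials

/-! The following polynomials are evaluated both on real matrices (invariant polynomials) and on
matrices of differential forms. -/

variable {𝒜 : Type*} [Ring 𝒜] [Algebra ℝ 𝒜] {ι κ : Type*} [Fintype ι] [DecidableEq ι]
  [Fintype κ] [DecidableEq κ]

/-- `I₄ = (1 / 16π²) (tr F² - ½ tr R²)`, where `tr F² = (1/30) Tr F²` with `Tr` the trace in the
adjoint representation. -/
def fourForm (R : Matrix ι ι 𝒜) (F : Matrix κ κ 𝒜) : 𝒜 :=
  (1 / (16 * Real.pi ^ 2)) •
    ((1 / 30 : ℝ) • Matrix.trace (F ^ 2) - (1 / 2 : ℝ) • Matrix.trace (R ^ 2))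

/-- `X₈ = (1 / ((2π)³ 4!)) ((1/8) tr R⁴ - (1/32) (tr R²)²)`. -/
def eightForm (R : Matrix ι ι 𝒜) : 𝒜 :=
  (1 / ((2 * Real.pi) ^ 3 * 24)) •
    ((1 / 8 : ℝ) • Matrix.trace (R ^ 4) - (1 / 32 : ℝ) • Matrix.trace (R ^ 2) ^ 2)

/-- `(4πκ²)^{1/3}`. -/
def gsScale (kap : ℝ) : ℝ := (4 * Real.pi * kap ^ 2) ^ (1 / 3 : ℝ)

/-- The coefficient `γ³ b² / 96κ²` of the inflow of the topological term. -/
def topCoupling (kap γ b : ℝ) : ℝ := γ ^ 3 * b ^ 2 / (96 * kap ^ 2)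

/-- The coefficient `γ / (2 (4πκ²)^{1/3})` of the inflow of the Green-Schwarz term. -/
def gsCoupling (kap γ : ℝ) : ℝ := γ / (2 * gsScale kap)

/-- The (Minkowskian) twelve-form of the inflow of the topological term on one plane. -/
def topPoly (kap γ b : ℝ) (R : Matrix ι ι 𝒜) (F : Matrix κ κ 𝒜) : 𝒜 :=
  topCoupling kap γ b • fourForm R F ^ 3

/-- The (Minkowskian) twelve-form of the inflow of the Green-Schwarz term on one plane. -/
def gsPoly (kap γ : ℝ) (R : Matrix ι ι 𝒜) (F : Matrix κ κ 𝒜) : 𝒜 :=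
  gsCoupling kap γ • (fourForm R F * eightForm R)

end Polynomials

/-- All contributions to the anomaly of one plane,
`i I^{untwisted} + i I^{twisted} - i I^{top} - i I^{GS}`. -/
def planeAnomaly {κ : Type*} [Fintype κ] [DecidableEq κ] (kap γ b : ℝ)
    (R : Matrix (Fin 10) (Fin 10) ℝ) (F : Matrix κ κ ℝ) : ℂ :=
  Complex.I * untwistedPoly R + Complex.I * twistedPoly R F
    - Complex.I * ((topPoly kap γ b R F : ℝ) : ℂ) - Complex.I * ((gsPoly kap γ R F : ℝ) : ℂ)

/-! ### Gauge algebras -/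

section Gauge

variable (𝔤 : Type*) [LieRing 𝔤] [LieAlgebra ℝ 𝔤] [FiniteDimensional ℝ 𝔤]

/-- A real Lie algebra of type `E₈`: the root system of its complexification with respect to a
Cartan subalgebra has a base with the Cartan matrix `E₈`. -/
def IsTypeE8 : Prop :=
  ∃ (_ : LieAlgebra.IsKilling ℂ (ℂ ⊗[ℝ] 𝔤)) (H : LieSubalgebra ℂ (ℂ ⊗[ℝ] 𝔤))
    (_ : H.IsCartanSubalgebra) (b : (LieAlgebra.IsKilling.rootSystem H).Base)
    (e : b.support ≃ Fin 8), b.cartanMatrix.reindex e e = CartanMatrix.E₈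

variable {𝔤}

/-- The matrix of `F` in the adjoint representation. -/
def adMatrix (F : 𝔤) :
    Matrix (Fin (Module.finrank ℝ 𝔤)) (Fin (Module.finrank ℝ 𝔤)) ℝ :=
  LinearMap.toMatrix (Module.finBasis ℝ 𝔤) (Module.finBasis ℝ 𝔤) (LieAlgebra.ad ℝ 𝔤 F)

end Gauge

/-! ### Differential forms on open subsets of `ℝᴺ` -/

/-- Differential forms (of mixed degree); the covector `∑ aᵢ dxⁱ` is the vector `a`.
The product is the wedge product. -/
abbrev Form (N : ℕ) : Type := (Fin N → ℝ) → ExteriorAlgebra ℝ (Fin N → ℝ)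

/-- `dx^{i₁} ∧ ⋯ ∧ dx^{iₖ}` for `S = {i₁ < ⋯ < iₖ}`. -/
def monomial {N : ℕ} (S : Finset (Fin N)) : ExteriorAlgebra ℝ (Fin N → ℝ) :=
  ExteriorAlgebra.ιMulti ℝ S.card fun j => Pi.single (S.orderEmbOfFin rfl j) 1

/-- The coefficient of `monomial S`. -/
def coefficient {N : ℕ} (S : Finset (Fin N)) : ExteriorAlgebra ℝ (Fin N → ℝ) →ₗ[ℝ] ℝ :=
  ExteriorAlgebra.liftAlternating (R := ℝ) (Pi.single S.card
    (Matrix.detRowAlternating.compLinearMap (LinearMap.funLeft ℝ ℝ (S.orderEmbOfFin rfl))))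

/-- Smoothness of a form on a set. -/
def SmoothForm {N : ℕ} (U : Set (Fin N → ℝ)) (α : Form N) : Prop :=
  ∀ S, ContDiffOn ℝ ∞ (fun x => coefficient S (α x)) U

/-- The partial derivative of the coefficients of a form. -/
def partialDeriv {N : ℕ} (i : Fin N) (α : Form N) : Form N := fun x =>
  ∑ S, lineDeriv ℝ (fun y => coefficient S (α y)) x (Pi.single i 1) • monomial S

/-- The exterior derivative `dα = ∑ᵢ dxⁱ ∧ ∂ᵢ α`. -/
def extD {N : ℕ} (α : Form N) : Form N := fun x =>
  ∑ i, ExteriorAlgebra.ι ℝ (Pi.single i 1) * partialDeriv i α x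

/-- The derivative at `s = 0` of a one-parameter family of forms. -/
def variation {N : ℕ} (L : ℝ → Form N) : Form N := fun x =>
  ∑ S, deriv (fun s => coefficient S (L s x)) 0 • monomial S

/-! ### Connections, Chern-Simons forms and descent -/

section Connections

variable {N : ℕ} {κ ι : Type*}

/-- The matrix-valued one-form with components `ρ (a x μ)`. -/
def connectionForm {V : Type*} (ρ : V → Matrix κ κ ℝ) (a : (Fin N → ℝ) → Fin N → V) :
    Matrix κ κ (Form N) :=
  Matrix.of fun j k x => ExteriorAlgebra.ι ℝ fun μ => ρ (a x μ) j k

/-- The matrix-valued function with values `ρ (a x)`. -/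
def parameterForm {V : Type*} (ρ : V → Matrix κ κ ℝ) (a : (Fin N → ℝ) → V) :
    Matrix κ κ (Form N) :=
  Matrix.of fun j k x => algebraMap ℝ _ (ρ (a x) j k)

/-- The exterior derivative of a matrix of forms. -/
def matD (A : Matrix κ κ (Form N)) : Matrix κ κ (Form N) := A.map extD

variable [Fintype κ] [DecidableEq κ] [Fintype ι] [DecidableEq ι]

/-- The curvature `dA + A ∧ A`. -/
def curvature (A : Matrix κ κ (Form N)) : Matrix κ κ (Form N) := matD A + A * A

/-- The infinitesimal gauge transformation `δA = dΛ + [A, Λ]`. -/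
def gaugeVar (L A : Matrix κ κ (Form N)) : Matrix κ κ (Form N) := matD L + A * L - L * A

/-- The Chern-Simons three-form `tr (A dA + (2/3) A³)`. -/
def chernSimons3 (A : Matrix κ κ (Form N)) : Form N :=
  Matrix.trace (A * matD A + (2 / 3 : ℝ) • (A * A * A))

/-- The Chern-Simons seven-form `4 ∫₀¹ tr (A Fₜ³) dt` with `Fₜ = t dA + t² A²`. -/
def chernSimons7 (A : Matrix κ κ (Form N)) : Form N :=
  let H := matD A
  let S := A * A
  Matrix.trace (A * (H * H * H + (4 / 5 : ℝ) • (H * H * S + H * S * H + S * H * H)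
    + (2 / 3 : ℝ) • (H * S * S + S * H * S + S * S * H) + (4 / 7 : ℝ) • (S * S * S)))

/-- The six-form obtained by descent from `chernSimons7`,
`4 ∫₀¹ (1 - t) tr (Λ d (A Fₜ² + Fₜ A Fₜ + Fₜ² A)) dt`. -/
def descent6 (L A : Matrix κ κ (Form N)) : Form N :=
  let H := matD A
  let S := A * A
  Matrix.trace (L * matD ((1 / 3 : ℝ) • (A * H * H + H * A * H + H * H * A)
    + (1 / 5 : ℝ) • (A * H * S + A * S * H + H * A * S + S * A * H + H * S * A + S * H * A)
    + (2 / 5 : ℝ) • (A * S * S)))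

/-- The Chern-Simons form `ω = (1 / (4π)²) (tr (A dA + ⅔A³) - ½ tr (Ω dΩ + ⅔Ω³))` of `I₄`,
with `tr = (1/30) Tr` on the gauge part. -/
def threeForm (Ω : Matrix ι ι (Form N)) (A : Matrix κ κ (Form N)) : Form N :=
  (1 / (4 * Real.pi) ^ 2) • ((1 / 30 : ℝ) • chernSimons3 A - (1 / 2 : ℝ) • chernSimons3 Ω)

/-- `ω¹ = (1 / (4π)²) (tr (Λ^g dA) - ½ tr (Λ^L dΩ))`. -/
def twoForm (LL : Matrix ι ι (Form N)) (Lg : Matrix κ κ (Form N))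
    (Ω : Matrix ι ι (Form N)) (A : Matrix κ κ (Form N)) : Form N :=
  (1 / (4 * Real.pi) ^ 2) • ((1 / 30 : ℝ) • Matrix.trace (Lg * matD A)
    - (1 / 2 : ℝ) • Matrix.trace (LL * matD Ω))

/-- The Chern-Simons form `X₇` of `X₈`. -/
def sevenForm (Ω : Matrix ι ι (Form N)) : Form N :=
  (1 / ((2 * Real.pi) ^ 3 * 24)) • ((1 / 8 : ℝ) • chernSimons7 Ω
    - (1 / 32 : ℝ) • (chernSimons3 Ω * Matrix.trace (curvature Ω ^ 2)))

/-- The form `X₆` obtained from `X₇` by descent. -/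
def sixForm (LL Ω : Matrix ι ι (Form N)) : Form N :=
  (1 / ((2 * Real.pi) ^ 3 * 24)) • ((1 / 8 : ℝ) • descent6 LL Ω
    - (1 / 32 : ℝ) • (Matrix.trace (LL * matD Ω) * Matrix.trace (curvature Ω ^ 2)))

/-- `I₄` of a pair of connections. -/
def fourFormOf (Ω : Matrix ι ι (Form N)) (A : Matrix κ κ (Form N)) : Form N :=
  fourForm (curvature Ω) (curvature A)

end Connections

section Inflow

variable {N : ℕ} {κ ι : Type*} [Fintype κ] [DecidableEq κ] [Fintype ι] [DecidableEq ι]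

/-- The Chern-Simons type eleven-form `(γ³b²/96κ²) ω ∧ I₄ ∧ I₄` of the polynomial `topPoly`. -/
def topEleven (kap γ b : ℝ) (Ω : Matrix ι ι (Form N)) (A : Matrix κ κ (Form N)) : Form N :=
  topCoupling kap γ b • (threeForm Ω A * fourFormOf Ω A ^ 2)

/-- The ten-form `(γ³b²/96κ²) ω¹ ∧ I₄ ∧ I₄`. -/
def topTen (kap γ b : ℝ) (LL : Matrix ι ι (Form N)) (Lg : Matrix κ κ (Form N))
    (Ω : Matrix ι ι (Form N)) (A : Matrix κ κ (Form N)) : Form N :=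
  topCoupling kap γ b • (twoForm LL Lg Ω A * fourFormOf Ω A ^ 2)

/-- The Chern-Simons type eleven-form `(γ / (2 (4πκ²)^{1/3})) I₄ ∧ X₇` of the polynomial
`gsPoly`. -/
def gsEleven (kap γ : ℝ) (Ω : Matrix ι ι (Form N)) (A : Matrix κ κ (Form N)) : Form N :=
  gsCoupling kap γ • (fourFormOf Ω A * sevenForm Ω)

/-- The ten-form `(γ / (2 (4πκ²)^{1/3})) I₄ ∧ X₆`. -/
def gsTen (kap γ : ℝ) (LL : Matrix ι ι (Form N)) (Ω : Matrix ι ι (Form N))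
    (A : Matrix κ κ (Form N)) : Form N :=
  gsCoupling kap γ • (fourFormOf Ω A * sixForm LL Ω)

end Inflow

/-- The descent equations `dQ = P`, `δQ = dq`, in every dimension `N` and on every open subset `U`
of `ℝᴺ`, for a polynomial `P` in the curvatures of a spin connection and a gauge connection with
gauge algebra `𝔤`, a form `Q` built from the connections and a form `q` built from the
connections and from the parameters of an infinitesimal local Lorentz and gauge transformation. -/
def IsDescent (𝔤 : Type*) [LieRing 𝔤] [LieAlgebra ℝ 𝔤] [FiniteDimensional ℝ 𝔤]
    (P Q : ∀ N : ℕ, Matrix (Fin 10) (Fin 10) (Form N) →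
      Matrix (Fin (Module.finrank ℝ 𝔤)) (Fin (Module.finrank ℝ 𝔤)) (Form N) → Form N)
    (q : ∀ N : ℕ, Matrix (Fin 10) (Fin 10) (Form N) →
      Matrix (Fin (Module.finrank ℝ 𝔤)) (Fin (Module.finrank ℝ 𝔤)) (Form N) →
      Matrix (Fin 10) (Fin 10) (Form N) →
      Matrix (Fin (Module.finrank ℝ 𝔤)) (Fin (Module.finrank ℝ 𝔤)) (Form N) → Form N) : Prop :=
  ∀ (N : ℕ) (U : Set (Fin N → ℝ)), IsOpen U →
    ∀ (Ω : (Fin N → ℝ) → Fin N → Matrix (Fin 10) (Fin 10) ℝ) (A : (Fin N → ℝ) → Fin N → 𝔤)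
      (ΛL : (Fin N → ℝ) → Matrix (Fin 10) (Fin 10) ℝ) (Λg : (Fin N → ℝ) → 𝔤),
      (∀ μ a c, ContDiffOn ℝ ∞ (fun x => Ω x μ a c) U) →
      (∀ x μ, (flatMetric (-1)).IsSkewAdjoint (Ω x μ)) →
      (∀ μ (l : 𝔤 →ₗ[ℝ] ℝ), ContDiffOn ℝ ∞ (fun x => l (A x μ)) U) →
      (∀ a c, ContDiffOn ℝ ∞ (fun x => ΛL x a c) U) →
      (∀ x, (flatMetric (-1)).IsSkewAdjoint (ΛL x)) →
      (∀ l : 𝔤 →ₗ[ℝ] ℝ, ContDiffOn ℝ ∞ (fun x => l (Λg x)) U) →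
      let w := connectionForm id Ω
      let a := connectionForm adMatrix A
      let u := parameterForm id ΛL
      let v := parameterForm adMatrix Λg
      Set.EqOn (extD (Q N w a)) (P N (curvature w) (curvature a)) U ∧
      Set.EqOn (variation fun s : ℝ => Q N (w + s • gaugeVar u w) (a + s • gaugeVar v a))
        (extD (q N u v w a)) U

/-! ### The space `M₁₀ × S¹` over a coordinate patch `U ⊆ ℝ¹⁰` of `M₁₀`

Bulk points are `y : Fin 11 → ℝ`; the last coordinate is `φ`, of period `2π`. -/

/-- The fixed points `φ = 0` and `φ = π` of `φ ↦ -φ`. -/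
def fixedPoint : Fin 2 → ℝ := ![0, Real.pi]

/-- The part of the covering space `ℝ¹⁰ × ℝ` over `U`. -/
def bulkRegion (U : Set (Fin 10 → ℝ)) : Set (Fin 11 → ℝ) :=
  {y | (fun μ : Fin 10 => y μ.castSucc) ∈ U}

/-- `2π`-periodicity in `φ`. -/
def CirclePeriodic {V : Type*} (f : (Fin 11 → ℝ) → V) : Prop :=
  ∀ y, f (y + Pi.single (Fin.last 10) (2 * Real.pi)) = f y

/-- The integral of an eleven-form over `U × S¹`. -/
def bulkIntegral (U : Set (Fin 10 → ℝ)) (L : Form 11) : ℝ :=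
  ∫ y in {y | y ∈ bulkRegion U ∧ y (Fin.last 10) ∈ Set.Ioc (-Real.pi) Real.pi},
    coefficient Finset.univ (L y)

/-- The integral of a ten-form over `U`. -/
def planeIntegral (U : Set (Fin 10 → ℝ)) (L : Form 10) : ℝ :=
  ∫ x in U, coefficient Finset.univ (L x)

/-- Pull-back of a form from `M₁₀` to `M₁₀ × S¹`. -/
def pullBack (α : Form 10) : Form 11 := fun y =>
  ExteriorAlgebra.map (Function.ExtendByZero.linearMap ℝ (Fin.castSucc : Fin 10 → Fin 11))
    (α fun μ => y μ.castSucc)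

/-- The bar operation: drop all components containing `dφ` and set `φ = φ₀`. -/
def restrictTo (φ₀ : ℝ) (α : Form 11) : Form 10 := fun x =>
  ExteriorAlgebra.map (LinearMap.funLeft ℝ ℝ (Fin.castSucc : Fin 10 → Fin 11))
    (α (Fin.snoc x φ₀ : Fin 11 → ℝ))

/-- The one-form `dφ`. -/
def dphi : Form 11 := fun _ => ExteriorAlgebra.ι ℝ (Pi.single (Fin.last 10) 1)

/-- A regularisation of the periodic delta function at `φ = 0`. -/
structure IsDeltaSequence (ρ : ℕ → ℝ → ℝ) : Prop where
  smooth : ∀ n, ContDiff ℝ ∞ (ρ n)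
  periodic : ∀ n φ, ρ n (φ + 2 * Real.pi) = ρ n φ
  even : ∀ n φ, ρ n (-φ) = ρ n φ
  nonneg : ∀ n φ, 0 ≤ ρ n φ
  mass : ∀ n, ∫ φ in (-Real.pi)..Real.pi, ρ n φ = 1
  concentrated : ∀ r > 0, ∀ᶠ n in Filter.atTop, ∀ φ, r ≤ |φ| → |φ| ≤ Real.pi → ρ n φ = 0

/-- The regularisation of `δᵢ = δ(φ - φᵢ) dφ` by `ρ`. -/
def deltaForm (ρ : ℝ → ℝ) (i : Fin 2) : Form 11 := fun y =>
  ρ (y (Fin.last 10) - fixedPoint i) • ExteriorAlgebra.ι ℝ (Pi.single (Fin.last 10) 1)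

/-- The regularisation of `εᵢ`, where `ε₁(φ) = sig φ - φ / π` and `ε₂(φ) = ε₁(φ - π)`: the odd
solution of `dεᵢ = 2 δᵢ - dφ / π`. -/
def stepForm (ρ : ℝ → ℝ) (i : Fin 2) : Form 11 := fun y =>
  algebraMap ℝ _
    (∫ t in (0 : ℝ)..(y (Fin.last 10) - fixedPoint i), (2 * ρ t - 1 / Real.pi))

/-- The three-form `C`, the (eleven-dimensional) spin connection `Ω` and the gauge potentials on
the two planes, in the adjoint representation. -/
structure Config (n : ℕ) where
  C : Form 11
  Ω : Matrix (Fin 10 ⊕ Unit) (Fin 10 ⊕ Unit) (Form 11)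
  A : Fin 2 → Matrix (Fin n) (Fin n) (Form 10)

/-- The parameters of a local Lorentz transformation and of a gauge transformation on each
plane; they do not depend on `φ`. -/
structure Param (n : ℕ) where
  L : Matrix (Fin 10) (Fin 10) (Form 10)
  g : Fin 2 → Matrix (Fin n) (Fin n) (Form 10)

section Bulk

variable {n : ℕ}

/-- The spin connection of the `i`-th plane. -/
def planeSpin (Φ : Config n) (i : Fin 2) : Matrix (Fin 10) (Fin 10) (Form 10) :=
  (Φ.Ω.map (restrictTo (fixedPoint i))).toBlocks₁₁

/-- `Ī₄` on the `i`-th plane. -/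
def planeFour (Φ : Config n) (i : Fin 2) : Form 10 := fourFormOf (planeSpin Φ i) (Φ.A i)

/-- The Chern-Simons form of `Ī₄` on the `i`-th plane. -/
def planeThree (Φ : Config n) (i : Fin 2) : Form 10 := threeForm (planeSpin Φ i) (Φ.A i)

/-- `ω̄¹` on the `i`-th plane. -/
def planeTwo (Λ : Param n) (Φ : Config n) (i : Fin 2) : Form 10 :=
  twoForm Λ.L (Λ.g i) (planeSpin Φ i) (Φ.A i)

/-- The local Lorentz parameter in the bulk. -/
def bulkParam (Λ : Param n) : Matrix (Fin 10 ⊕ Unit) (Fin 10 ⊕ Unit) (Form 11) :=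
  Matrix.fromBlocks (Λ.L.map pullBack) 0 0 0

/-- The field strength `G = dC - (1-b) γ ∑ δᵢ ω̄ᵢ + b γ ∑ ½ εᵢ Ī₄ᵢ - b γ ∑ (dφ/2π) ω̄ᵢ`. -/
def fieldG (γ b : ℝ) (ρ : ℝ → ℝ) (Φ : Config n) : Form 11 :=
  extD Φ.C
    - ((1 - b) * γ) • ∑ i, deltaForm ρ i * pullBack (planeThree Φ i)
    + (b * γ / 2) • ∑ i, stepForm ρ i * pullBack (planeFour Φ i)
    - (b * γ / (2 * Real.pi)) • ∑ i, dphi * pullBack (planeThree Φ i)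

/-- The modified field `C̃ = C + (b/2) γ ∑ εᵢ ω̄ᵢ`. -/
def fieldCtilde (γ b : ℝ) (ρ : ℝ → ℝ) (Φ : Config n) : Form 11 :=
  Φ.C + (b * γ / 2) • ∑ i, stepForm ρ i * pullBack (planeThree Φ i)

/-- `δC = γ ∑ [(b-1) δᵢ ω̄¹ᵢ - (b/2π) dφ ω̄¹ᵢ]`. -/
def deltaC (γ b : ℝ) (ρ : ℝ → ℝ) (Λ : Param n) (Φ : Config n) : Form 11 :=
  γ • ∑ i, ((b - 1) • (deltaForm ρ i * pullBack (planeTwo Λ Φ i))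
    - (b / (2 * Real.pi)) • (dphi * pullBack (planeTwo Λ Φ i)))

/-- The fields transformed by the infinitesimal transformation with parameters `s Λ`. -/
def transformed (γ b : ℝ) (ρ : ℝ → ℝ) (Λ : Param n) (Φ : Config n) (s : ℝ) : Config n where
  C := Φ.C + s • deltaC γ b ρ Λ Φ
  Ω := Φ.Ω + s • gaugeVar (bulkParam Λ) Φ.Ω
  A := fun i => Φ.A i + s • gaugeVar (Λ.g i) (Φ.A i)

/-- The modified topological term, `-(1 / 24κ²) C̃ ∧ G ∧ G`. -/
def topLagrangian (kap γ b : ℝ) (ρ : ℝ → ℝ) (Φ : Config n) : Form 11 :=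
  (-(1 / (24 * kap ^ 2))) • (fieldCtilde γ b ρ Φ * fieldG γ b ρ Φ * fieldG γ b ρ Φ)

/-- The Green-Schwarz term, `-(1 / (2 (4πκ²)^{1/3})) G ∧ X₇`. -/
def gsLagrangian (kap γ b : ℝ) (ρ : ℝ → ℝ) (Φ : Config n) : Form 11 :=
  (-(1 / (2 * gsScale kap))) • (fieldG γ b ρ Φ * sevenForm Φ.Ω)

/-- The variation, under the transformation with parameters `Λ`, of the action on `U × S¹` with
the given Lagrangian. -/
def actionVariation (U : Set (Fin 10 → ℝ)) (Lag : Config n → Form 11) (γ b : ℝ) (ρ : ℝ → ℝ)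
    (Λ : Param n) (Φ : Config n) : ℝ :=
  bulkIntegral U (variation fun s => Lag (transformed γ b ρ Λ Φ s))

end Bulk

section Admissible

variable {𝔤 : Type*} [LieRing 𝔤] [LieAlgebra ℝ 𝔤] [FiniteDimensional ℝ 𝔤]

/-- Smooth fields on `U × S¹`: `C = B̃ ∧ dφ` for a two-form `B̃`, an `𝔰𝔬(1,10)`-valued spin
connection whose mixed components vanish on the two planes (these are fixed by the reflection
`φ ↦ -φ`), and `𝔤`-valued gauge potentials on the planes. -/
structure IsFieldConfig (𝔤 : Type*) [LieRing 𝔤] [LieAlgebra ℝ 𝔤] [FiniteDimensional ℝ 𝔤]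
    (U : Set (Fin 10 → ℝ)) (Φ : Config (Module.finrank ℝ 𝔤)) : Prop where
  form : ∃ B : Form 11, (∀ y, B y ∈ ⋀[ℝ]^2 (Fin 11 → ℝ)) ∧ SmoothForm (bulkRegion U) B ∧
    CirclePeriodic B ∧ Φ.C = B * dphi
  spin : ∃ Ω : (Fin 11 → ℝ) → Fin 11 → Matrix (Fin 10 ⊕ Unit) (Fin 10 ⊕ Unit) ℝ,
    (∀ μ a c, ContDiffOn ℝ ∞ (fun y => Ω y μ a c) (bulkRegion U)) ∧ CirclePeriodic Ω ∧
    (∀ y μ, (Matrix.fromBlocks (flatMetric (-1)) 0 0 1).IsSkewAdjoint (Ω y μ)) ∧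
    (∀ (i : Fin 2) (x : Fin 10 → ℝ) (μ a : Fin 10),
      Ω (Fin.snoc x (fixedPoint i) : Fin 11 → ℝ) μ.castSucc (Sum.inl a) (Sum.inr ()) = 0) ∧
    Φ.Ω = connectionForm id Ω
  gauge : ∀ i, ∃ A : (Fin 10 → ℝ) → Fin 10 → 𝔤,
    (∀ μ (l : 𝔤 →ₗ[ℝ] ℝ), ContDiffOn ℝ ∞ (fun x => l (A x μ)) U) ∧
    Φ.A i = connectionForm adMatrix A

/-- Smooth transformation parameters with compact support in `U`. -/
structure IsGaugeParam (𝔤 : Type*) [LieRing 𝔤] [LieAlgebra ℝ 𝔤] [FiniteDimensional ℝ 𝔤]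
    (U : Set (Fin 10 → ℝ)) (Λ : Param (Module.finrank ℝ 𝔤)) : Prop where
  lorentz : ∃ ΛL : (Fin 10 → ℝ) → Matrix (Fin 10) (Fin 10) ℝ,
    (∀ a c, ContDiffOn ℝ ∞ (fun x => ΛL x a c) U) ∧
    (∀ x, (flatMetric (-1)).IsSkewAdjoint (ΛL x)) ∧
    (∃ K ⊆ U, IsCompact K ∧ ∀ x ∉ K, ΛL x = 0) ∧
    Λ.L = parameterForm id ΛL
  gauge : ∀ i, ∃ Λg : (Fin 10 → ℝ) → 𝔤,
    (∀ l : 𝔤 →ₗ[ℝ] ℝ, ContDiffOn ℝ ∞ (fun x => l (Λg x)) U) ∧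
    (∃ K ⊆ U, IsCompact K ∧ ∀ x ∉ K, Λg x = 0) ∧
    Λ.g i = parameterForm adMatrix Λg

end Admissible

end HoravaWitten

end

set_option linter.unusedSectionVars false

/-! The theorem combines a one-loop computation, the invariant theory of E₈, the descent equations,
and a regularised integral on the circle.

One-loop polynomial. No diagonalisation of R is needed: skew-adjointness makes det(1 + sR/2π) an
even polynomial in s of degree at most 10, so it factors over ℂ as ∏(1 + s²xⱼ²)
(`exists_isSkewEigenvalues`). Multiplying such determinants over roots of unity turns tr R², tr R⁴,
tr R⁶ into power sums of the xⱼ² (`IsSkewEigenvalues.traces`), and expanding the genus to sixth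
order gives `fieldsPoly_eq`. The coefficient of tr R⁶ is proportional to 496 - 2n; two rotations
with equal tr R² and tr R⁴ but different tr R⁶ show that it must vanish if R is to enter only
through the former two.

Factorisation for E₈. This needs dim = 248, Tr F⁴ = (Tr F²)²/100 and Tr F⁶ = (Tr F²)³/7200. On a
Cartan subalgebra of the complexification the traces are power sums over the 240 roots, computed in
orthonormal coordinates (`sum_doubledRoots_pow_eq`); simple reflections identify the abstract root
system with Cartan matrix E₈ with these coordinates (`exists_coordinates`). Conjugates of Cartan
elements fill a neighbourhood of a regular element, and the relations are holomorphic and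
conjugation invariant, so they hold everywhere (`eq_zero_of_conjugation_invariant`).

Descent. In δA = dΛ + [A, Λ] the commutator acts as a derivation and has zero trace, so only the
inhomogeneous part dΛ has to be tracked (`HasTwistedDeriv.mul`, `HasTwistedDeriv.trace`). What
remains are identities between traces of words in A, dA, dΛ, settled by graded cyclicity
(`trace_ext_chernSimons7`, `chernSimons7_hasVariation`).

Inflow. The Bianchi identity and δG = 0 are direct computations, and δC̃ = γ∑(-δᵢω¹ᵢ +
(b/2)d(εᵢω¹ᵢ)). Because C = B̃ ∧ dφ, the product dφ ∧ G sees only the ε-terms of G. Integrating by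
parts with the Bianchi identity therefore leaves the densities (δᵢεₖεₗ + 2εᵢδₖεₗ) ω¹ᵢĪ₄ₖĪ₄ₗ
(`anomalyInflow_algebra`). Products of δ and ε have to be evaluated before the regularisation is
removed: d(ε³) integrates to zero over the circle, which gives ∫δε² → 1/3, while every product
mixing the planes tends to zero (`IsDeltaSequence.tendsto_triple`). Hence 1/3 + 2/3 = 1 on each
plane, and the inflow is local. In the Green-Schwarz term one integration by parts produces a single
δᵢ, which tests a continuous function of φ.

Cancellation. I₄³ and I₄X₈ are linearly independent (`coefficients_eq_zero`), so the polynomials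
cancel exactly when γ³b²/96κ² = -π/3 and γ/(2(4πκ²)^{1/3}) = -1. The second equation fixes γ, and
then the first says b² = 1. -/

namespace HoravaWitten

/-! ### Coordinates on the exterior algebra -/

section DualBasis

variable {N : ℕ}

theorem coefficient_ιMulti (S : Finset (Fin N)) (n : ℕ) (v : Fin n → Fin N → ℝ) :
    coefficient S (ExteriorAlgebra.ιMulti ℝ n v) =
      if h : S.card = n then
        Matrix.det (Matrix.of fun i j => v i (S.orderEmbOfFin h j)) else 0 := by
  unfold coefficient
  rw [ExteriorAlgebra.liftAlternating_apply_ιMulti]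
  split_ifs with h
  · subst h
    rw [Pi.single_eq_same]
    rfl
  · rw [Pi.single_eq_of_ne (Ne.symm h)]
    rfl

theorem coefficient_monomial (S T : Finset (Fin N)) :
    coefficient S (monomial T) = if S = T then 1 else 0 := by
  unfold monomial
  rw [coefficient_ιMulti]
  split_ifs with h hST hST
  · subst hST
    rw [← Matrix.det_one (n := Fin S.card) (R := ℝ)]
    congr 1
    ext i j
    simp [Matrix.one_apply, Pi.single_apply, eq_comm]
  -- The sets have equal size but differ, so the minor has a zero column: no factor of `monomial T`
  -- has a component along some i in S \ T.
  · obtain ⟨i, hiS, hiT⟩ : ∃ i ∈ S, i ∉ T := by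
      by_contra! hc
      exact hST (Finset.eq_of_subset_of_card_le hc h.ge)
    obtain ⟨k, hk⟩ : ∃ k, S.orderEmbOfFin h k = i := by
      have := Finset.range_orderEmbOfFin S h
      have hi : i ∈ Set.range (S.orderEmbOfFin h) := by rw [this]; exact hiS
      exact hi
    apply Matrix.det_eq_zero_of_column_eq_zero k
    intro j
    simp only [Matrix.of_apply, hk]
    apply Pi.single_eq_of_ne
    rintro rfl
    exact hiT (Finset.orderEmbOfFin_mem T rfl j)
  · exact absurd (hST ▸ rfl) h
  · rfl

/-- Spanning is imported from the standard basis of the exterior algebra; with the duality above it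
makes the functionals `coefficient S` the coordinates. -/
theorem basis_eq_monomial (S : Finset (Fin N)) :
    (Pi.basisFun ℝ (Fin N)).ExteriorAlgebra S = monomial S := by
  rw [ExteriorAlgebra.basis_apply]
  unfold monomial ExteriorAlgebra.ιMulti_family
  congr 1
  ext j k
  simp [Function.comp, Set.powersetCard.ofFinEmbEquiv]

theorem sum_coefficient_smul_monomial (a : ExteriorAlgebra ℝ (Fin N → ℝ)) :
    ∑ S, coefficient S a • monomial S = a := by
  conv_rhs => rw [← (Pi.basisFun ℝ (Fin N)).ExteriorAlgebra.sum_repr a]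
  have h : ∀ S, coefficient S a = (Pi.basisFun ℝ (Fin N)).ExteriorAlgebra.repr a S := by
    intro S
    conv_lhs => rw [← (Pi.basisFun ℝ (Fin N)).ExteriorAlgebra.sum_repr a]
    simp [basis_eq_monomial, coefficient_monomial]
  simp [h, basis_eq_monomial]

theorem coefficient_ext {a b : ExteriorAlgebra ℝ (Fin N → ℝ)}
    (h : ∀ S, coefficient S a = coefficient S b) : a = b := by
  rw [← sum_coefficient_smul_monomial a, ← sum_coefficient_smul_monomial b]
  simp [h]

theorem linearMap_apply_eq_sum {V : Type*} [AddCommGroup V] [Module ℝ V]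
    (l : ExteriorAlgebra ℝ (Fin N → ℝ) →ₗ[ℝ] V) (a : ExteriorAlgebra ℝ (Fin N → ℝ)) :
    l a = ∑ S, coefficient S a • l (monomial S) := by
  conv_lhs => rw [← sum_coefficient_smul_monomial a]
  simp

theorem coefficient_sum_smul_monomial (c : Finset (Fin N) → ℝ) (S : Finset (Fin N)) :
    coefficient S (∑ T, c T • monomial T) = c S := by
  simp [coefficient_monomial]

/-- Structure constants reduce the wedge product to products of real coefficients, so smoothness and
the product rule carry over from real functions without a norm on the exterior algebra. -/
theorem coefficient_mul_eq_sum (S : Finset (Fin N)) (a b : ExteriorAlgebra ℝ (Fin N → ℝ)) :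
    coefficient S (a * b) = ∑ T, ∑ T', coefficient T a * coefficient T' b *
      coefficient S (monomial T * monomial T') := by
  conv_lhs => rw [← sum_coefficient_smul_monomial a, ← sum_coefficient_smul_monomial b]
  rw [Finset.sum_mul_sum]
  simp only [map_sum, smul_mul_smul_comm, map_smul, smul_eq_mul]

end DualBasis

/-! ### Derivatives of curves in the exterior algebra -/

section CurveDerivative

variable {N : ℕ}

/-- The coefficients of the curve `c` have derivative at `0` given by `a`. -/
def HasCurveDeriv (c : ℝ → ExteriorAlgebra ℝ (Fin N → ℝ))
    (a : ExteriorAlgebra ℝ (Fin N → ℝ)) : Prop :=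
  ∀ S, HasDerivAt (fun t => coefficient S (c t)) (coefficient S a) 0

namespace HasCurveDeriv

variable {c c' : ℝ → ExteriorAlgebra ℝ (Fin N → ℝ)} {a a' : ExteriorAlgebra ℝ (Fin N → ℝ)}

theorem functional (h : HasCurveDeriv c a) (l : ExteriorAlgebra ℝ (Fin N → ℝ) →ₗ[ℝ] ℝ) :
    HasDerivAt (fun t => l (c t)) (l a) 0 := by
  rw [linearMap_apply_eq_sum l a,
    show (fun t => l (c t)) = fun t => ∑ S, coefficient S (c t) • l (monomial S) from
      funext fun t => linearMap_apply_eq_sum l _]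
  exact HasDerivAt.fun_sum fun S _ => (h S).mul_const _

theorem map {M : ℕ} (h : HasCurveDeriv c a)
    (T : ExteriorAlgebra ℝ (Fin N → ℝ) →ₗ[ℝ] ExteriorAlgebra ℝ (Fin M → ℝ)) :
    HasCurveDeriv (fun t => T (c t)) (T a) :=
  fun S => h.functional ((coefficient S).comp T)

theorem unique (h : HasCurveDeriv c a) (h' : HasCurveDeriv c a') : a = a' :=
  coefficient_ext fun S => (h S).unique (h' S)

theorem const (a : ExteriorAlgebra ℝ (Fin N → ℝ)) : HasCurveDeriv (fun _ => a) 0 := fun S => by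
  simpa using hasDerivAt_const (0 : ℝ) (coefficient S a)

theorem add (h : HasCurveDeriv c a) (h' : HasCurveDeriv c' a') :
    HasCurveDeriv (fun t => c t + c' t) (a + a') := fun S => by
  simpa using (h S).fun_add (h' S)

theorem smul (r : ℝ) (h : HasCurveDeriv c a) :
    HasCurveDeriv (fun t => r • c t) (r • a) := fun S => by
  simpa using (h S).const_mul r

theorem sum {ι : Type*} (s : Finset ι) {c : ι → ℝ → ExteriorAlgebra ℝ (Fin N → ℝ)}
    {a : ι → ExteriorAlgebra ℝ (Fin N → ℝ)} (h : ∀ i ∈ s, HasCurveDeriv (c i) (a i)) :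
    HasCurveDeriv (fun t => ∑ i ∈ s, c i t) (∑ i ∈ s, a i) := fun S => by
  simpa using HasDerivAt.fun_sum fun i hi => h i hi S

theorem mul (h : HasCurveDeriv c a) (h' : HasCurveDeriv c' a') :
    HasCurveDeriv (fun t => c t * c' t) (a * c' 0 + c 0 * a') := fun S => by
  rw [map_add, coefficient_mul_eq_sum, coefficient_mul_eq_sum,
    show (fun t => coefficient S (c t * c' t)) = fun t => ∑ T, ∑ T', coefficient T (c t) *
      coefficient T' (c' t) * coefficient S (monomial T * monomial T') from
      funext fun t => coefficient_mul_eq_sum S _ _]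
  simp only [← Finset.sum_add_distrib, ← add_mul]
  exact HasDerivAt.fun_sum fun T _ => HasDerivAt.fun_sum fun T' _ =>
    ((h T).fun_mul (h' T')).mul_const _

theorem congr (h : HasCurveDeriv c a) (hc : c' =ᶠ[nhds 0] c) : HasCurveDeriv c' a :=
  fun S => (h S).congr_of_eventuallyEq (hc.mono fun t ht => by simp [ht])

theorem linear (a b : ExteriorAlgebra ℝ (Fin N → ℝ)) :
    HasCurveDeriv (fun t : ℝ => a + t • b) b := fun S => by
  simpa using ((hasDerivAt_id (0 : ℝ)).mul_const (coefficient S b)).const_add (coefficient S a)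

end HasCurveDeriv

theorem variation_eq {L : ℝ → Form N} {x : Fin N → ℝ} {a : ExteriorAlgebra ℝ (Fin N → ℝ)}
    (h : HasCurveDeriv (fun s => L s x) a) : variation L x = a := by
  unfold variation
  rw [← sum_coefficient_smul_monomial a]
  exact Finset.sum_congr rfl fun S _ => by rw [(h S).deriv]

end CurveDerivative

/-! ### Parity and graded commutation -/

section Parity

variable {N : ℕ}

/-- Even elements of the exterior algebra, as far as commutation is concerned. -/
def IsEven (a : ExteriorAlgebra ℝ (Fin N → ℝ)) : Prop :=
  CliffordAlgebra.involute a = a ∧ ∀ b, a * b = b * a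

/-- Odd elements of the exterior algebra, as far as commutation is concerned. -/
def IsOdd (a : ExteriorAlgebra ℝ (Fin N → ℝ)) : Prop :=
  CliffordAlgebra.involute a = -a ∧ ∀ b, a * b = CliffordAlgebra.involute b * a

/-- Passing one generator costs one sign, which is exactly what `involute` records. -/
theorem ι_mul_eq_involute_mul (v : Fin N → ℝ) (b : ExteriorAlgebra ℝ (Fin N → ℝ)) :
    ExteriorAlgebra.ι ℝ v * b = CliffordAlgebra.involute b * ExteriorAlgebra.ι ℝ v := by
  induction b using CliffordAlgebra.left_induction with
  | algebraMap r => simp [Algebra.commutes]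
  | add x y hx hy => simp [mul_add, add_mul, hx, hy]
  | ι_mul x m hx =>
    have h : ExteriorAlgebra.ι ℝ v * ExteriorAlgebra.ι ℝ m
        = -(ExteriorAlgebra.ι ℝ m * ExteriorAlgebra.ι ℝ v) :=
      eq_neg_of_add_eq_zero_left (ExteriorAlgebra.ι_add_mul_swap v m)
    change ExteriorAlgebra.ι ℝ v * (ExteriorAlgebra.ι ℝ m * x) =
      CliffordAlgebra.involute (ExteriorAlgebra.ι ℝ m * x) * ExteriorAlgebra.ι ℝ v
    have h2 : CliffordAlgebra.involute (ExteriorAlgebra.ι ℝ m) = -ExteriorAlgebra.ι ℝ m :=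
      CliffordAlgebra.involute_ι m
    rw [← mul_assoc, h, neg_mul, mul_assoc, hx, map_mul, h2, neg_mul, neg_mul, mul_assoc]

theorem isOdd_ι (v : Fin N → ℝ) : IsOdd (ExteriorAlgebra.ι ℝ v) :=
  ⟨CliffordAlgebra.involute_ι v, ι_mul_eq_involute_mul v⟩

theorem isEven_algebraMap (r : ℝ) : IsEven (algebraMap ℝ (ExteriorAlgebra ℝ (Fin N → ℝ)) r) :=
  ⟨by simp, fun b => Algebra.commutes r b⟩

variable {a b : ExteriorAlgebra ℝ (Fin N → ℝ)}

theorem IsEven.zero : IsEven (0 : ExteriorAlgebra ℝ (Fin N → ℝ)) := ⟨by simp, by simp⟩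

theorem IsOdd.zero : IsOdd (0 : ExteriorAlgebra ℝ (Fin N → ℝ)) := ⟨by simp, by simp⟩

theorem IsEven.add (ha : IsEven a) (hb : IsEven b) : IsEven (a + b) :=
  ⟨by simp [ha.1, hb.1], fun c => by rw [add_mul, mul_add, ha.2, hb.2]⟩

theorem IsOdd.add (ha : IsOdd a) (hb : IsOdd b) : IsOdd (a + b) :=
  ⟨by simp [ha.1, hb.1, add_comm], fun c => by rw [add_mul, mul_add, ha.2, hb.2]⟩

theorem IsEven.smul (r : ℝ) (ha : IsEven a) : IsEven (r • a) :=
  ⟨by simp [ha.1], fun c => by simp [ha.2]⟩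

theorem IsOdd.smul (r : ℝ) (ha : IsOdd a) : IsOdd (r • a) :=
  ⟨by simp [ha.1], fun c => by simp [ha.2]⟩

theorem IsEven.neg (ha : IsEven a) : IsEven (-a) := by simpa using ha.smul (-1)

theorem IsOdd.neg (ha : IsOdd a) : IsOdd (-a) := by simpa using ha.smul (-1)

theorem IsEven.sub (ha : IsEven a) (hb : IsEven b) : IsEven (a - b) := by
  simpa [sub_eq_add_neg] using ha.add hb.neg

theorem IsOdd.sub (ha : IsOdd a) (hb : IsOdd b) : IsOdd (a - b) := by
  simpa [sub_eq_add_neg] using ha.add hb.neg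

theorem IsEven.sum {ι : Type*} {s : Finset ι} {f : ι → ExteriorAlgebra ℝ (Fin N → ℝ)}
    (h : ∀ i ∈ s, IsEven (f i)) : IsEven (∑ i ∈ s, f i) :=
  Finset.sum_induction _ _ (fun _ _ => IsEven.add) IsEven.zero h

theorem IsOdd.sum {ι : Type*} {s : Finset ι} {f : ι → ExteriorAlgebra ℝ (Fin N → ℝ)}
    (h : ∀ i ∈ s, IsOdd (f i)) : IsOdd (∑ i ∈ s, f i) :=
  Finset.sum_induction _ _ (fun _ _ => IsOdd.add) IsOdd.zero h

theorem IsEven.mul (ha : IsEven a) (hb : IsEven b) : IsEven (a * b) :=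
  ⟨by simp [ha.1, hb.1], fun c => by rw [mul_assoc, hb.2, ← mul_assoc, ha.2, mul_assoc]⟩

theorem IsEven.mul_odd (ha : IsEven a) (hb : IsOdd b) : IsOdd (a * b) :=
  ⟨by simp [ha.1, hb.1], fun c => by rw [mul_assoc, hb.2, ← mul_assoc, ha.2, mul_assoc]⟩

theorem IsOdd.mul_even (ha : IsOdd a) (hb : IsEven b) : IsOdd (a * b) := by
  rw [← hb.2]; exact hb.mul_odd ha

theorem IsOdd.mul (ha : IsOdd a) (hb : IsOdd b) : IsEven (a * b) :=
  ⟨by simp [ha.1, hb.1], fun c => by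
    rw [mul_assoc, hb.2, ← mul_assoc, ha.2, CliffordAlgebra.involute_involute, mul_assoc]⟩

theorem IsOdd.mul_comm_neg (ha : IsOdd a) (hb : IsOdd b) : a * b = -(b * a) := by
  rw [ha.2, hb.1, neg_mul]

theorem IsOdd.mul_self (ha : IsOdd a) : a * a = 0 := by
  have h := ha.mul_comm_neg ha
  have h2 : (2 : ℝ) • (a * a) = 0 := by rw [two_smul]; nth_rw 1 [h]; simp
  exact (smul_eq_zero.mp h2).resolve_left two_ne_zero

theorem IsOdd.mul_mul_self (ha : IsOdd a) (b : ExteriorAlgebra ℝ (Fin N → ℝ)) :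
    a * b * a = 0 := by
  rw [ha.2, mul_assoc, ha.mul_self, mul_zero]

theorem isEven_of_mem_exteriorPower_two (h : a ∈ ⋀[ℝ]^2 (Fin N → ℝ)) : IsEven a := by
  rw [ExteriorAlgebra.exteriorPower, pow_two] at h
  refine Submodule.mul_induction_on h ?_ fun _ _ => IsEven.add
  rintro _ ⟨v, rfl⟩ _ ⟨w, rfl⟩
  exact (isOdd_ι v).mul (isOdd_ι w)

/-- Both conditions defining parity are linear, and a linear identity along a curve passes to its
derivative. In this way partial derivatives inherit parity. -/
theorem HasCurveDeriv.eq_of_linear {M : ℕ} {c : ℝ → ExteriorAlgebra ℝ (Fin N → ℝ)}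
    (h : HasCurveDeriv c a)
    (T T' : ExteriorAlgebra ℝ (Fin N → ℝ) →ₗ[ℝ] ExteriorAlgebra ℝ (Fin M → ℝ))
    (hT : ∀ᶠ t in nhds 0, T (c t) = T' (c t)) : T a = T' a :=
  (h.map T).unique ((h.map T').congr hT)

theorem HasCurveDeriv.isEven {c : ℝ → ExteriorAlgebra ℝ (Fin N → ℝ)}
    (h : HasCurveDeriv c a) (hc : ∀ᶠ t in nhds 0, IsEven (c t)) : IsEven a :=
  ⟨h.eq_of_linear CliffordAlgebra.involute.toLinearMap LinearMap.id (hc.mono fun _ ht => ht.1),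
    fun b => h.eq_of_linear (LinearMap.mulRight ℝ b) (LinearMap.mulLeft ℝ b)
      (hc.mono fun _ ht => ht.2 b)⟩

theorem HasCurveDeriv.isOdd {c : ℝ → ExteriorAlgebra ℝ (Fin N → ℝ)}
    (h : HasCurveDeriv c a) (hc : ∀ᶠ t in nhds 0, IsOdd (c t)) : IsOdd a :=
  ⟨h.eq_of_linear CliffordAlgebra.involute.toLinearMap (-LinearMap.id)
      (hc.mono fun _ ht => ht.1),
    fun b => h.eq_of_linear (LinearMap.mulRight ℝ b)
      (LinearMap.mulLeft ℝ (CliffordAlgebra.involute b)) (hc.mono fun _ ht => ht.2 b)⟩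

end Parity

/-! ### Smooth forms and partial derivatives -/

section Smooth

variable {N M : ℕ} {U : Set (Fin N → ℝ)} {α β : Form N}

theorem SmoothForm.functional (h : SmoothForm U α)
    (l : ExteriorAlgebra ℝ (Fin N → ℝ) →ₗ[ℝ] ℝ) : ContDiffOn ℝ ∞ (fun x => l (α x)) U := by
  rw [show (fun x => l (α x)) = fun x => ∑ S, coefficient S (α x) • l (monomial S) from
      funext fun t => linearMap_apply_eq_sum l _]
  exact ContDiffOn.sum fun S _ => (h S).smul contDiffOn_const

theorem SmoothForm.const (a : ExteriorAlgebra ℝ (Fin N → ℝ)) : SmoothForm U fun _ => a :=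
  fun _ => contDiffOn_const

theorem SmoothForm.zero : SmoothForm U (0 : Form N) := SmoothForm.const 0

theorem SmoothForm.add (h : SmoothForm U α) (h' : SmoothForm U β) : SmoothForm U (α + β) :=
  fun S => by simpa using (h S).add (h' S)

theorem SmoothForm.smul (r : ℝ) (h : SmoothForm U α) : SmoothForm U (r • α) :=
  fun S => by simpa using (h S).const_smul r

theorem SmoothForm.neg (h : SmoothForm U α) : SmoothForm U (-α) := by
  simpa using h.smul (-1)

theorem SmoothForm.sub (h : SmoothForm U α) (h' : SmoothForm U β) : SmoothForm U (α - β) := by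
  simpa [sub_eq_add_neg] using h.add h'.neg

theorem SmoothForm.sum {ι : Type*} {s : Finset ι} {f : ι → Form N}
    (h : ∀ i ∈ s, SmoothForm U (f i)) : SmoothForm U (∑ i ∈ s, f i) :=
  Finset.sum_induction _ _ (fun _ _ => SmoothForm.add) SmoothForm.zero h

theorem SmoothForm.mul (h : SmoothForm U α) (h' : SmoothForm U β) : SmoothForm U (α * β) :=
  fun S => by
    rw [show (fun x => coefficient S ((α * β) x)) = fun x => ∑ T, ∑ T', coefficient T (α x) *
      coefficient T' (β x) * coefficient S (monomial T * monomial T') from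
      funext fun t => coefficient_mul_eq_sum S _ _]
    exact ContDiffOn.sum fun T _ => ContDiffOn.sum fun T' _ =>
      ((h T).mul (h' T')).mul contDiffOn_const

theorem SmoothForm.algebraMap {f : (Fin N → ℝ) → ℝ} (hf : ContDiffOn ℝ ∞ f U) :
    SmoothForm U fun x => algebraMap ℝ _ (f x) := fun S => by
  simp only [Algebra.algebraMap_eq_smul_one, map_smul]
  exact hf.smul contDiffOn_const

theorem SmoothForm.ι {f : (Fin N → ℝ) → Fin N → ℝ} (hf : ContDiffOn ℝ ∞ f U) :
    SmoothForm U fun x => ExteriorAlgebra.ι ℝ (f x) := fun S => by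
  have h : ∀ v : Fin N → ℝ, coefficient S (ExteriorAlgebra.ι ℝ v)
      = LinearMap.toContinuousLinearMap ((coefficient S).comp (ExteriorAlgebra.ι ℝ)) v :=
    fun _ => rfl
  simp only [h]
  exact (ContinuousLinearMap.contDiff _).comp_contDiffOn hf

theorem SmoothForm.map (T : ExteriorAlgebra ℝ (Fin N → ℝ) →ₗ[ℝ] ExteriorAlgebra ℝ (Fin M → ℝ))
    {V : Set (Fin M → ℝ)} {p : (Fin M → ℝ) → Fin N → ℝ} (hp : ContDiff ℝ ∞ p)
    (hV : Set.MapsTo p V U) (h : SmoothForm U α) : SmoothForm V fun y => T (α (p y)) :=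
  fun S => (h.functional ((coefficient S).comp T)).comp hp.contDiffOn hV

theorem coefficient_partialDeriv (i : Fin N) (S : Finset (Fin N)) (x : Fin N → ℝ) :
    coefficient S (partialDeriv i α x) =
      lineDeriv ℝ (fun y => coefficient S (α y)) x (Pi.single i 1) := by
  unfold partialDeriv
  rw [coefficient_sum_smul_monomial]

theorem SmoothForm.hasCurveDeriv (hU : IsOpen U) (h : SmoothForm U α) (i : Fin N)
    {x : Fin N → ℝ} (hx : x ∈ U) :
    HasCurveDeriv (fun t : ℝ => α (x + t • Pi.single i 1)) (partialDeriv i α x) := fun S => by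
  rw [coefficient_partialDeriv]
  exact (((h S).contDiffAt (hU.mem_nhds hx)).differentiableAt
    (by simp)).lineDifferentiableAt.hasLineDerivAt

theorem SmoothForm.partialDeriv (hU : IsOpen U) (h : SmoothForm U α) (i : Fin N) :
    SmoothForm U (partialDeriv i α) := fun S => by
  have h1 : ContDiffOn ℝ ∞ (fun x => fderiv ℝ (fun y => coefficient S (α y)) x
      (Pi.single i 1)) U :=
    ((h S).fderiv_of_isOpen hU (m := ∞) (by simp)).clm_apply contDiffOn_const
  refine h1.congr fun x hx => ?_
  rw [coefficient_partialDeriv]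
  exact (((h S).contDiffAt (hU.mem_nhds hx)).differentiableAt (by simp)).lineDeriv_eq_fderiv

theorem SmoothForm.extD (hU : IsOpen U) (h : SmoothForm U α) : SmoothForm U (extD α) := by
  have : HoravaWitten.extD α = ∑ i, (fun _ => ExteriorAlgebra.ι ℝ (Pi.single i 1)) *
      HoravaWitten.partialDeriv i α := by
    funext x
    simp [HoravaWitten.extD]
  rw [this]
  exact SmoothForm.sum fun i _ => (SmoothForm.const _).mul (h.partialDeriv hU i)

theorem partialDeriv_comm (hU : IsOpen U) (h : SmoothForm U α) (i j : Fin N) {x : Fin N → ℝ}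
    (hx : x ∈ U) :
    HoravaWitten.partialDeriv i (HoravaWitten.partialDeriv j α) x =
      HoravaWitten.partialDeriv j (HoravaWitten.partialDeriv i α) x := by
  apply coefficient_ext
  intro S
  set f := fun y => coefficient S (α y) with hf
  have two_le : (1 + 1 : WithTop ℕ∞) ≤ ∞ := by
    rw [one_add_one_eq_two]
    exact WithTop.coe_le_coe.mpr (le_top : (2 : ℕ∞) ≤ ⊤)
  have hfx : ContDiffAt ℝ ∞ f x := (h S).contDiffAt (hU.mem_nhds hx)
  have key : ∀ i j : Fin N, coefficient S (HoravaWitten.partialDeriv i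
      (HoravaWitten.partialDeriv j α) x) =
      fderiv ℝ (fderiv ℝ f) x (Pi.single i 1) (Pi.single j 1) := by
    intro i j
    rw [coefficient_partialDeriv]
    have h1 : (fun y => coefficient S (HoravaWitten.partialDeriv j α y)) =ᶠ[nhds x]
        fun y => fderiv ℝ f y (Pi.single j 1) := by
      filter_upwards [hU.mem_nhds hx] with y hy
      rw [coefficient_partialDeriv]
      exact (((h S).contDiffAt (hU.mem_nhds hy)).differentiableAt (by simp)).lineDeriv_eq_fderiv
    have hd : DifferentiableAt ℝ (fderiv ℝ f) x :=
      (hfx.fderiv_right (m := 1) two_le).differentiableAt (by simp)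
    rw [h1.lineDeriv_eq]
    rw [DifferentiableAt.lineDeriv_eq_fderiv (hd.clm_apply (differentiableAt_const _))]
    rw [fderiv_clm_apply hd (differentiableAt_const _)]
    simp
  rw [key, key]
  exact (hfx.isSymmSndFDerivAt (by simpa [one_add_one_eq_two] using two_le)).eq _ _

end Smooth

/-! ### The exterior derivative: graded Leibniz rule and d² = 0 -/

section ExteriorDerivative

variable {N M : ℕ} {U : Set (Fin N → ℝ)} {α β : Form N} {x : Fin N → ℝ}
  {a b : ExteriorAlgebra ℝ (Fin N → ℝ)}

/-- The form `α` is differentiable at `x`, with exterior derivative `a` there. -/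
def HasExtD (α : Form N) (a : ExteriorAlgebra ℝ (Fin N → ℝ)) (x : Fin N → ℝ) : Prop :=
  ∃ p : Fin N → ExteriorAlgebra ℝ (Fin N → ℝ),
    (∀ i, HasCurveDeriv (fun t : ℝ => α (x + t • Pi.single i 1)) (p i)) ∧
      a = ∑ i, ExteriorAlgebra.ι ℝ (Pi.single i 1) * p i

theorem partialDeriv_eq {i : Fin N} {p : ExteriorAlgebra ℝ (Fin N → ℝ)}
    (h : HasCurveDeriv (fun t : ℝ => α (x + t • Pi.single i 1)) p) : partialDeriv i α x = p :=
  coefficient_ext fun S => by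
    rw [coefficient_partialDeriv]
    exact HasLineDerivAt.lineDeriv (h S)

theorem tendsto_line (x v : Fin N → ℝ) :
    Filter.Tendsto (fun t : ℝ => x + t • v) (nhds 0) (nhds x) := by
  have : Continuous fun t : ℝ => x + t • v := by fun_prop
  simpa using this.tendsto 0

namespace HasExtD

theorem extD_eq (h : HasExtD α a x) : extD α x = a := by
  obtain ⟨p, hp, rfl⟩ := h
  exact Finset.sum_congr rfl fun i _ => by rw [partialDeriv_eq (hp i)]

theorem const (c : ExteriorAlgebra ℝ (Fin N → ℝ)) : HasExtD (fun _ => c) 0 x :=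
  ⟨fun _ => 0, fun _ => HasCurveDeriv.const c, by simp⟩

theorem zero : HasExtD (0 : Form N) 0 x := const 0

theorem add (h : HasExtD α a x) (h' : HasExtD β b x) : HasExtD (α + β) (a + b) x := by
  obtain ⟨p, hp, rfl⟩ := h
  obtain ⟨q, hq, rfl⟩ := h'
  exact ⟨p + q, fun i => (hp i).add (hq i), by simp [mul_add, Finset.sum_add_distrib]⟩

theorem smul (r : ℝ) (h : HasExtD α a x) : HasExtD (r • α) (r • a) x := by
  obtain ⟨p, hp, rfl⟩ := h
  exact ⟨r • p, fun i => (hp i).smul r, by simp [Finset.smul_sum]⟩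

theorem neg (h : HasExtD α a x) : HasExtD (-α) (-a) x := by simpa using h.smul (-1)

theorem sub (h : HasExtD α a x) (h' : HasExtD β b x) : HasExtD (α - β) (a - b) x := by
  simpa [sub_eq_add_neg] using h.add h'.neg

theorem sum {ι : Type*} (s : Finset ι) {f : ι → Form N}
    {g : ι → ExteriorAlgebra ℝ (Fin N → ℝ)} (h : ∀ i ∈ s, HasExtD (f i) (g i) x) :
    HasExtD (∑ i ∈ s, f i) (∑ i ∈ s, g i) x := by
  classical
  induction s using Finset.induction_on with
  | empty => simpa using zero
  | insert i s hi ih =>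
    rw [Finset.sum_insert hi, Finset.sum_insert hi]
    exact (h i (by simp)).add (ih fun j hj => h j (by simp [hj]))

/-- The sign arises when dxⁱ moves past the value of α; writing it as `involute` keeps the rule
valid for forms of mixed degree. -/
theorem mul (h : HasExtD α a x) (h' : HasExtD β b x) :
    HasExtD (α * β) (a * β x + CliffordAlgebra.involute (α x) * b) x := by
  obtain ⟨p, hp, rfl⟩ := h
  obtain ⟨q, hq, rfl⟩ := h'
  refine ⟨fun i => p i * β x + α x * q i, fun i => by simpa using (hp i).mul (hq i), ?_⟩
  simp only [mul_add, Finset.sum_add_distrib, Finset.sum_mul, Finset.mul_sum, ← mul_assoc]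
  simp only [ι_mul_eq_involute_mul _ (α x)]

theorem congr (h : HasExtD α a x) (hc : β =ᶠ[nhds x] α) : HasExtD β a x := by
  obtain ⟨p, hp, rfl⟩ := h
  exact ⟨p, fun i => (hp i).congr ((tendsto_line x _).eventually hc), rfl⟩

theorem isEven (h : HasExtD α a x) (hc : ∀ᶠ y in nhds x, IsOdd (α y)) : IsEven a := by
  obtain ⟨p, hp, rfl⟩ := h
  exact IsEven.sum fun i _ =>
    (isOdd_ι _).mul ((hp i).isOdd ((tendsto_line x _).eventually hc))

theorem isOdd (h : HasExtD α a x) (hc : ∀ᶠ y in nhds x, IsEven (α y)) : IsOdd a := by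
  obtain ⟨p, hp, rfl⟩ := h
  exact IsOdd.sum fun i _ =>
    (isOdd_ι _).mul_even ((hp i).isEven ((tendsto_line x _).eventually hc))

end HasExtD

theorem SmoothForm.hasExtD (hU : IsOpen U) (h : SmoothForm U α) (hx : x ∈ U) :
    HasExtD α (HoravaWitten.extD α x) x :=
  ⟨fun i => HoravaWitten.partialDeriv i α x, fun i => h.hasCurveDeriv hU i hx, rfl⟩

/-- Symmetric second derivatives are contracted with the antisymmetric dxⁱ ∧ dxʲ, so the double sum
equals its own negative. -/
theorem SmoothForm.hasExtD_extD (hU : IsOpen U) (h : SmoothForm U α) (hx : x ∈ U) :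
    HasExtD (HoravaWitten.extD α) 0 x := by
  refine ⟨fun i => HoravaWitten.partialDeriv i (HoravaWitten.extD α) x,
    fun i => (h.extD hU).hasCurveDeriv hU i hx, ?_⟩
  have h1 : ∀ i, HoravaWitten.partialDeriv i (HoravaWitten.extD α) x =
      ∑ j, ExteriorAlgebra.ι ℝ (Pi.single j 1) *
        HoravaWitten.partialDeriv i (HoravaWitten.partialDeriv j α) x := by
    intro i
    apply partialDeriv_eq
    refine HasCurveDeriv.sum _ fun j _ => ?_
    exact ((h.partialDeriv hU j).hasCurveDeriv hU i hx).map (LinearMap.mulLeft ℝ _)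
  simp only [h1, Finset.mul_sum, ← mul_assoc]
  set s := ∑ i, ∑ j, ExteriorAlgebra.ι ℝ (Pi.single i 1) * ExteriorAlgebra.ι ℝ (Pi.single j 1) *
    HoravaWitten.partialDeriv i (HoravaWitten.partialDeriv j α) x with hs
  have h2 : s = -s := by
    conv_lhs => rw [hs, Finset.sum_comm]
    rw [hs, ← Finset.sum_neg_distrib]
    refine Finset.sum_congr rfl fun i _ => ?_
    rw [← Finset.sum_neg_distrib]
    refine Finset.sum_congr rfl fun j _ => ?_
    rw [partialDeriv_comm hU h j i hx, (isOdd_ι _).mul_comm_neg (isOdd_ι _), neg_mul]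
  have h3 : (2 : ℝ) • s = 0 := by rw [two_smul]; nth_rw 1 [h2]; simp
  exact ((smul_eq_zero.mp h3).resolve_left two_ne_zero).symm

end ExteriorDerivative

/-! ### Matrices of even and odd elements; graded cyclicity of the trace -/

section MatrixParity

variable {N : ℕ} {κ : Type*}

/-- Matrices with even entries. -/
def MatEven (a : Matrix κ κ (ExteriorAlgebra ℝ (Fin N → ℝ))) : Prop := ∀ i j, IsEven (a i j)

/-- Matrices with odd entries. -/
def MatOdd (a : Matrix κ κ (ExteriorAlgebra ℝ (Fin N → ℝ))) : Prop := ∀ i j, IsOdd (a i j)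

/-- The grading involution on matrices. -/
def matInv (a : Matrix κ κ (ExteriorAlgebra ℝ (Fin N → ℝ))) :
    Matrix κ κ (ExteriorAlgebra ℝ (Fin N → ℝ)) :=
  a.map CliffordAlgebra.involute

variable {a b h k : Matrix κ κ (ExteriorAlgebra ℝ (Fin N → ℝ))}

theorem MatEven.matInv_eq (hh : MatEven h) : matInv h = h := by
  ext i j; exact (hh i j).1

theorem MatOdd.matInv_eq (ha : MatOdd a) : matInv a = -a := by
  ext i j; exact (ha i j).1

theorem MatEven.add (ha : MatEven a) (hb : MatEven b) : MatEven (a + b) :=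
  fun i j => (ha i j).add (hb i j)

theorem MatOdd.add (ha : MatOdd a) (hb : MatOdd b) : MatOdd (a + b) :=
  fun i j => (ha i j).add (hb i j)

theorem MatOdd.smul (r : ℝ) (ha : MatOdd a) : MatOdd (r • a) :=
  fun i j => (ha i j).smul r

variable [Fintype κ]

theorem MatEven.mul (ha : MatEven a) (hb : MatEven b) : MatEven (a * b) :=
  fun i j => IsEven.sum fun l _ => (ha i l).mul (hb l j)

theorem MatOdd.mul (ha : MatOdd a) (hb : MatOdd b) : MatEven (a * b) :=
  fun i j => IsEven.sum fun l _ => (ha i l).mul (hb l j)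

theorem MatEven.mul_odd (ha : MatEven a) (hb : MatOdd b) : MatOdd (a * b) :=
  fun i j => IsOdd.sum fun l _ => (ha i l).mul_odd (hb l j)

theorem MatOdd.mul_even (ha : MatOdd a) (hb : MatEven b) : MatOdd (a * b) :=
  fun i j => IsOdd.sum fun l _ => (ha i l).mul_even (hb l j)

theorem MatEven.trace (ha : MatEven a) : IsEven a.trace :=
  IsEven.sum fun i _ => ha i i

theorem MatOdd.trace (ha : MatOdd a) : IsOdd a.trace :=
  IsOdd.sum fun i _ => ha i i

theorem matInv_mul (a b : Matrix κ κ (ExteriorAlgebra ℝ (Fin N → ℝ))) :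
    matInv (a * b) = matInv a * matInv b := by
  ext i j; simp [matInv, Matrix.mul_apply, map_sum]

theorem MatEven.trace_mul_comm (hh : MatEven h)
    (w : Matrix κ κ (ExteriorAlgebra ℝ (Fin N → ℝ))) : (h * w).trace = (w * h).trace := by
  simp only [Matrix.trace, Matrix.diag, Matrix.mul_apply]
  rw [Finset.sum_comm]
  exact Finset.sum_congr rfl fun i _ => Finset.sum_congr rfl fun j _ => (hh j i).2 _

/-- Graded cyclicity: taking an odd factor round the trace costs the parity of the rest of the word,
recorded by `matInv`. -/
theorem MatOdd.trace_mul_comm (ha : MatOdd a)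
    (w : Matrix κ κ (ExteriorAlgebra ℝ (Fin N → ℝ))) :
    (a * w).trace = (matInv w * a).trace := by
  simp only [Matrix.trace, Matrix.diag, Matrix.mul_apply]
  rw [Finset.sum_comm]
  exact Finset.sum_congr rfl fun i _ => Finset.sum_congr rfl fun j _ => (ha j i).2 _

end MatrixParity

/-! ### Pointwise evaluation of matrices of forms -/

section Evaluation

variable {N : ℕ} {κ : Type*}

/-- The value at `x` of a matrix of forms. -/
def evalMat (x : Fin N → ℝ) (A : Matrix κ κ (Form N)) :
    Matrix κ κ (ExteriorAlgebra ℝ (Fin N → ℝ)) :=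
  A.map fun α => α x

variable (x : Fin N → ℝ) (A B : Matrix κ κ (Form N))

theorem evalMat_add : evalMat x (A + B) = evalMat x A + evalMat x B := rfl

theorem evalMat_sub : evalMat x (A - B) = evalMat x A - evalMat x B := rfl

theorem evalMat_smul (r : ℝ) : evalMat x (r • A) = r • evalMat x A := rfl

variable [Fintype κ]

theorem evalMat_mul : evalMat x (A * B) = evalMat x A * evalMat x B := by
  ext i j; simp [evalMat, Matrix.mul_apply, Finset.sum_apply]

theorem trace_apply : A.trace x = (evalMat x A).trace := by
  simp [evalMat, Matrix.trace, Finset.sum_apply]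

end Evaluation

/-! ### Exterior derivatives of matrices -/

section MatrixDerivative

variable {N : ℕ} {κ : Type*} {U : Set (Fin N → ℝ)} {x : Fin N → ℝ}
  {A B : Matrix κ κ (Form N)} {h k : Matrix κ κ (ExteriorAlgebra ℝ (Fin N → ℝ))}

/-- Entrywise `HasExtD`. -/
def MatHasExtD (A : Matrix κ κ (Form N)) (h : Matrix κ κ (ExteriorAlgebra ℝ (Fin N → ℝ)))
    (x : Fin N → ℝ) : Prop :=
  ∀ i j, HasExtD (A i j) (h i j) x

theorem MatHasExtD.matD_eq (hA : MatHasExtD A h x) : evalMat x (matD A) = h := by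
  ext i j; exact (hA i j).extD_eq

theorem MatHasExtD.add (hA : MatHasExtD A h x) (hB : MatHasExtD B k x) :
    MatHasExtD (A + B) (h + k) x := fun i j => (hA i j).add (hB i j)

theorem MatHasExtD.sub (hA : MatHasExtD A h x) (hB : MatHasExtD B k x) :
    MatHasExtD (A - B) (h - k) x := fun i j => (hA i j).sub (hB i j)

theorem MatHasExtD.smul (r : ℝ) (hA : MatHasExtD A h x) :
    MatHasExtD (r • A) (r • h) x := fun i j => (hA i j).smul r

variable [Fintype κ]

theorem MatHasExtD.mul (hA : MatHasExtD A h x) (hB : MatHasExtD B k x) :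
    MatHasExtD (A * B) (h * evalMat x B + matInv (evalMat x A) * k) x := by
  intro i j
  have : (A * B) i j = ∑ l, A i l * B l j := Matrix.mul_apply
  rw [this, Matrix.add_apply, Matrix.mul_apply, Matrix.mul_apply, ← Finset.sum_add_distrib]
  exact HasExtD.sum _ fun l _ => (hA i l).mul (hB l j)

theorem MatHasExtD.mul_of_odd (hA : MatHasExtD A h x) (hB : MatHasExtD B k x)
    (ho : MatOdd (evalMat x A)) :
    MatHasExtD (A * B) (h * evalMat x B - evalMat x A * k) x := by
  have := hA.mul hB
  rwa [ho.matInv_eq, neg_mul, ← sub_eq_add_neg] at this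

theorem MatHasExtD.mul_of_even (hA : MatHasExtD A h x) (hB : MatHasExtD B k x)
    (he : MatEven (evalMat x A)) :
    MatHasExtD (A * B) (h * evalMat x B + evalMat x A * k) x := by
  have := hA.mul hB
  rwa [he.matInv_eq] at this

theorem MatHasExtD.trace (hA : MatHasExtD A h x) : HasExtD A.trace h.trace x :=
  HasExtD.sum _ fun i _ => hA i i

end MatrixDerivative

/-! ### Gauge variations modulo commutators -/

section MatrixVariation

variable {N : ℕ} {κ : Type*} [Fintype κ]
  {c d : ℝ → Matrix κ κ (ExteriorAlgebra ℝ (Fin N → ℝ))}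
  {a a' b b' l : Matrix κ κ (ExteriorAlgebra ℝ (Fin N → ℝ))}

/-- The curve `c` starts at `a` with derivative `a' + [a, l]`. -/
def HasTwistedDeriv (l : Matrix κ κ (ExteriorAlgebra ℝ (Fin N → ℝ)))
    (c : ℝ → Matrix κ κ (ExteriorAlgebra ℝ (Fin N → ℝ)))
    (a a' : Matrix κ κ (ExteriorAlgebra ℝ (Fin N → ℝ))) : Prop :=
  c 0 = a ∧ ∀ i j, HasCurveDeriv (fun t => c t i j) ((a' + (a * l - l * a)) i j)

theorem HasTwistedDeriv.add (hc : HasTwistedDeriv l c a a') (hd : HasTwistedDeriv l d b b') :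
    HasTwistedDeriv l (fun t => c t + d t) (a + b) (a' + b') := by
  refine ⟨by simp [hc.1, hd.1], fun i j => ?_⟩
  rw [show a' + b' + ((a + b) * l - l * (a + b)) =
    (a' + (a * l - l * a)) + (b' + (b * l - l * b)) by rw [add_mul, mul_add]; abel]
  exact (hc.2 i j).add (hd.2 i j)

theorem HasTwistedDeriv.smul (r : ℝ) (hc : HasTwistedDeriv l c a a') :
    HasTwistedDeriv l (fun t => r • c t) (r • a) (r • a') := by
  refine ⟨by simp [hc.1], fun i j => ?_⟩
  rw [show r • a' + ((r • a) * l - l * (r • a)) = r • (a' + (a * l - l * a)) by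
    rw [smul_mul_assoc, mul_smul_comm, smul_add, smul_sub]]
  exact (hc.2 i j).smul r

/-- The bracket with l is a derivation, so it reproduces itself on products and only the
inhomogeneous parts follow the product rule explicitly. -/
theorem HasTwistedDeriv.mul (hc : HasTwistedDeriv l c a a') (hd : HasTwistedDeriv l d b b') :
    HasTwistedDeriv l (fun t => c t * d t) (a * b) (a' * b + a * b') := by
  refine ⟨by simp [hc.1, hd.1], fun i j => ?_⟩
  have h1 : HasCurveDeriv (fun t => ∑ r, c t i r * d t r j)
      (∑ r, ((a' + (a * l - l * a)) i r * d 0 r j + c 0 i r * (b' + (b * l - l * b)) r j)) :=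
    HasCurveDeriv.sum _ fun r _ => (hc.2 i r).mul (hd.2 r j)
  rw [Finset.sum_add_distrib, ← Matrix.mul_apply, ← Matrix.mul_apply, ← Matrix.add_apply,
    hc.1, hd.1] at h1
  simp only [← Matrix.mul_apply] at h1
  rw [show a' * b + a * b' + (a * b * l - l * (a * b)) =
    (a' + (a * l - l * a)) * b + a * (b' + (b * l - l * b)) by noncomm_ring]
  exact h1

/-- Even entries of l commute with everything, so the commutator is traceless and the inhomogeneous
part alone survives. -/
theorem HasTwistedDeriv.trace (hc : HasTwistedDeriv l c a a') (hl : MatEven l) :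
    HasCurveDeriv (fun t => (c t).trace) a'.trace := by
  have h1 : HasCurveDeriv (fun t => ∑ r, c t r r) (∑ r, (a' + (a * l - l * a)) r r) :=
    HasCurveDeriv.sum _ fun r _ => hc.2 r r
  have h2 : a'.trace = (a' + (a * l - l * a)).trace := by
    rw [Matrix.trace_add, Matrix.trace_sub, hl.trace_mul_comm]
    simp
  rw [h2]
  exact h1

end MatrixVariation

/-! ### Smooth connections and parameters -/

section Connection

variable {N : ℕ} {κ : Type*}

/-- Matrices of odd forms, smooth on `U`. -/
structure IsConnection (U : Set (Fin N → ℝ)) (A : Matrix κ κ (Form N)) : Prop where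
  smooth : ∀ i j, SmoothForm U (A i j)
  odd : ∀ y ∈ U, MatOdd (evalMat y A)

/-- Matrices of even forms, smooth on `U`. -/
structure IsParameter (U : Set (Fin N → ℝ)) (L : Matrix κ κ (Form N)) : Prop where
  smooth : ∀ i j, SmoothForm U (L i j)
  even : ∀ y ∈ U, MatEven (evalMat y L)

variable {U : Set (Fin N → ℝ)} {A L : Matrix κ κ (Form N)} {x : Fin N → ℝ}

theorem matHasExtD_of_smooth (hU : IsOpen U) (hA : ∀ i j, SmoothForm U (A i j)) (hx : x ∈ U) :
    MatHasExtD A (evalMat x (matD A)) x := fun i j => (hA i j).hasExtD hU hx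

theorem matHasExtD_matD_of_smooth (hU : IsOpen U) (hA : ∀ i j, SmoothForm U (A i j))
    (hx : x ∈ U) : MatHasExtD (matD A) 0 x := fun i j => (hA i j).hasExtD_extD hU hx

theorem IsConnection.matD_isParameter (hU : IsOpen U) (hA : IsConnection U A) :
    IsParameter U (matD A) where
  smooth i j := (hA.smooth i j).extD hU
  even _ hy i j := ((hA.smooth i j).hasExtD hU hy).isEven <|
    Filter.mem_of_superset (hU.mem_nhds hy) fun z hz => hA.odd z hz i j

theorem IsParameter.matD_isConnection (hU : IsOpen U) (hL : IsParameter U L) :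
    IsConnection U (matD L) where
  smooth i j := (hL.smooth i j).extD hU
  odd _ hy i j := ((hL.smooth i j).hasExtD hU hy).isOdd <|
    Filter.mem_of_superset (hU.mem_nhds hy) fun z hz => hL.even z hz i j

theorem IsParameter.add {L' : Matrix κ κ (Form N)} (hL : IsParameter U L)
    (hL' : IsParameter U L') : IsParameter U (L + L') where
  smooth i j := (hL.smooth i j).add (hL'.smooth i j)
  even y hy := (hL.even y hy).add (hL'.even y hy)

theorem IsConnection.add {B : Matrix κ κ (Form N)} (hA : IsConnection U A)
    (hB : IsConnection U B) : IsConnection U (A + B) where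
  smooth i j := (hA.smooth i j).add (hB.smooth i j)
  odd y hy := (hA.odd y hy).add (hB.odd y hy)

theorem IsConnection.smul (r : ℝ) (hA : IsConnection U A) : IsConnection U (r • A) where
  smooth i j := (hA.smooth i j).smul r
  odd y hy := (hA.odd y hy).smul r

variable [Fintype κ]

theorem smoothForm_mul {A B : Matrix κ κ (Form N)} (hA : ∀ i j, SmoothForm U (A i j))
    (hB : ∀ i j, SmoothForm U (B i j)) (i j : κ) : SmoothForm U ((A * B) i j) := by
  rw [Matrix.mul_apply]
  exact SmoothForm.sum fun l _ => (hA i l).mul (hB l j)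

theorem smoothForm_trace {A : Matrix κ κ (Form N)} (hA : ∀ i j, SmoothForm U (A i j)) :
    SmoothForm U A.trace := SmoothForm.sum fun l _ => hA l l

theorem IsConnection.mul {B : Matrix κ κ (Form N)} (hA : IsConnection U A)
    (hB : IsConnection U B) : IsParameter U (A * B) where
  smooth := smoothForm_mul hA.smooth hB.smooth
  even y hy := by rw [evalMat_mul]; exact (hA.odd y hy).mul (hB.odd y hy)

theorem IsConnection.mul_parameter (hA : IsConnection U A)
    (hL : IsParameter U L) : IsConnection U (A * L) where
  smooth := smoothForm_mul hA.smooth hL.smooth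
  odd y hy := by rw [evalMat_mul]; exact (hA.odd y hy).mul_even (hL.even y hy)

theorem IsParameter.mul_connection (hL : IsParameter U L)
    (hA : IsConnection U A) : IsConnection U (L * A) where
  smooth := smoothForm_mul hL.smooth hA.smooth
  odd y hy := by rw [evalMat_mul]; exact (hL.even y hy).mul_odd (hA.odd y hy)

theorem IsParameter.mul {L' : Matrix κ κ (Form N)} (hL : IsParameter U L)
    (hL' : IsParameter U L') : IsParameter U (L * L') where
  smooth := smoothForm_mul hL.smooth hL'.smooth
  even y hy := by rw [evalMat_mul]; exact (hL.even y hy).mul (hL'.even y hy)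

theorem IsConnection.curvature_isParameter (hU : IsOpen U) (hA : IsConnection U A) :
    IsParameter U (curvature A) :=
  (hA.matD_isParameter hU).add (hA.mul hA)

end Connection

/-! ### Trace identities for words in A and dA -/

section Words

variable {N : ℕ} {κ : Type*} [Fintype κ]
  {a h : Matrix κ κ (ExteriorAlgebra ℝ (Fin N → ℝ))}

/-- Here a and h stand for A and dA at a point, and h a - a h for d(A²). Graded cyclic rotation
brings every word to one representative. -/
theorem trace_ext_chernSimons3 (ha : MatOdd a) (hh : MatEven h) :
    (h * h + (2 / 3 : ℝ) • ((h * a - a * h) * a + a * a * h)).trace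
      = ((h + a * a) * (h + a * a)).trace := by
  have e1 : (a * (h * a)).trace = -(h * (a * a)).trace := by
    rw [ha.trace_mul_comm, (hh.mul_odd ha).matInv_eq, neg_mul, Matrix.trace_neg, mul_assoc]
  have e2 : (a * (a * h)).trace = (h * (a * a)).trace := by
    rw [← mul_assoc, (ha.mul ha).trace_mul_comm]
  -- Rotating one odd factor past the odd word a³ changes the sign, so this trace equals its own
  -- negative.
  have e3 : (a * (a * (a * a))).trace = 0 := by
    have := ha.trace_mul_comm (a * (a * a))
    rw [(ha.mul_even (ha.mul ha)).matInv_eq, neg_mul, Matrix.trace_neg, mul_assoc, mul_assoc] at this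
    have h2 : (2 : ℝ) • (a * (a * (a * a))).trace = 0 := by
      rw [two_smul]; nth_rw 1 [this]; simp
    exact (smul_eq_zero.mp h2).resolve_left two_ne_zero
  simp only [mul_add, add_mul, sub_mul, Matrix.trace_add, Matrix.trace_sub, Matrix.trace_smul,
    mul_assoc, e1, e2, e3]
  module

/-- The coefficients 1, 4/5, 2/3, 4/7 are 4∫tᵐdt for m = 3, 4, 5, 6. The rotations `e1` to `e22`
bring the words of form degree eight to the representatives ha⁶, h²a⁴, haha³, ha²ha², h³a² and
h²aha; an odd block passing an odd remainder gives a minus sign. After that only the rational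
coefficients are compared. -/
theorem trace_ext_chernSimons7 (ha : MatOdd a) (hh : MatEven h) :
    (h * (h * h * h + (4 / 5 : ℝ) • (h * h * (a * a) + h * (a * a) * h + a * a * h * h)
        + (2 / 3 : ℝ) • (h * (a * a) * (a * a) + a * a * h * (a * a) + a * a * (a * a) * h)
        + (4 / 7 : ℝ) • (a * a * (a * a) * (a * a)))
      - a * ((4 / 5 : ℝ) • (h * h * (h * a - a * h) + h * (h * a - a * h) * h
          + (h * a - a * h) * h * h)
        + (2 / 3 : ℝ) • (h * (h * a - a * h) * (a * a) + h * (a * a) * (h * a - a * h)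
          + ((h * a - a * h) * h * (a * a) + a * a * h * (h * a - a * h))
          + ((h * a - a * h) * (a * a) + a * a * (h * a - a * h)) * h)
        + (4 / 7 : ℝ) • (((h * a - a * h) * (a * a) + a * a * (h * a - a * h)) * (a * a)
          + a * a * (a * a) * (h * a - a * h)))).trace
      = ((h + a * a) * (h + a * a) * ((h + a * a) * (h + a * a))).trace := by
  have e1 : (a * (a * (a * (a * (a * (a * h)))))).trace = (h * (a * (a * (a * (a * (a * a)))))).trace := by
    rw [show (a * (a * (a * (a * (a * (a * h)))))) = (a * (a * (a * (a * (a * a))))) * h by simp only [mul_assoc],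
      (ha.mul (ha.mul_even (ha.mul (ha.mul_even (ha.mul ha))))).trace_mul_comm]
  have e2 : (a * (a * (a * (a * (a * (h * a)))))).trace = -(h * (a * (a * (a * (a * (a * a)))))).trace := by
    rw [show (a * (a * (a * (a * (a * (h * a)))))) = (a * (a * (a * (a * a)))) * (h * a) by simp only [mul_assoc],
      (ha.mul_even (ha.mul (ha.mul_even (ha.mul ha)))).trace_mul_comm,
      (hh.mul_odd ha).matInv_eq,
      neg_mul,
      Matrix.trace_neg]
    simp only [mul_assoc]
  have e3 : (a * (a * (a * (a * (h * (a * a)))))).trace = (h * (a * (a * (a * (a * (a * a)))))).trace := by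
    rw [show (a * (a * (a * (a * (h * (a * a)))))) = (a * (a * (a * a))) * (h * (a * a)) by simp only [mul_assoc],
      (ha.mul (ha.mul_even (ha.mul ha))).trace_mul_comm]
    simp only [mul_assoc]
  have e4 : (a * (a * (a * (a * (h * h))))).trace = (h * (h * (a * (a * (a * a))))).trace := by
    rw [show (a * (a * (a * (a * (h * h))))) = (a * (a * (a * a))) * (h * h) by simp only [mul_assoc],
      (ha.mul (ha.mul_even (ha.mul ha))).trace_mul_comm]
    simp only [mul_assoc]
  have e5 : (a * (a * (a * (h * (a * (a * a)))))).trace = -(h * (a * (a * (a * (a * (a * a)))))).trace := by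
    rw [show (a * (a * (a * (h * (a * (a * a)))))) = (a * (a * a)) * (h * (a * (a * a))) by simp only [mul_assoc],
      (ha.mul_even (ha.mul ha)).trace_mul_comm,
      (hh.mul_odd (ha.mul_even (ha.mul ha))).matInv_eq,
      neg_mul,
      Matrix.trace_neg]
    simp only [mul_assoc]
  have e6 : (a * (a * (a * (h * (a * h))))).trace = -(h * (a * (h * (a * (a * a))))).trace := by
    rw [show (a * (a * (a * (h * (a * h))))) = (a * (a * a)) * (h * (a * h)) by simp only [mul_assoc],
      (ha.mul_even (ha.mul ha)).trace_mul_comm,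
      (hh.mul_odd (ha.mul_even hh)).matInv_eq,
      neg_mul,
      Matrix.trace_neg]
    simp only [mul_assoc]
  have e7 : (a * (a * (a * (h * (h * a))))).trace = -(h * (h * (a * (a * (a * a))))).trace := by
    rw [show (a * (a * (a * (h * (h * a))))) = (a * (a * a)) * (h * (h * a)) by simp only [mul_assoc],
      (ha.mul_even (ha.mul ha)).trace_mul_comm,
      (hh.mul_odd (hh.mul_odd ha)).matInv_eq,
      neg_mul,
      Matrix.trace_neg]
    simp only [mul_assoc]
  have e8 : (a * (a * (h * (a * (a * (a * a)))))).trace = (h * (a * (a * (a * (a * (a * a)))))).trace := by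
    rw [show (a * (a * (h * (a * (a * (a * a)))))) = (a * a) * (h * (a * (a * (a * a)))) by simp only [mul_assoc],
      (ha.mul ha).trace_mul_comm]
    simp only [mul_assoc]
  have e9 : (a * (a * (h * (a * (a * h))))).trace = (h * (a * (a * (h * (a * a))))).trace := by
    rw [show (a * (a * (h * (a * (a * h))))) = (a * a) * (h * (a * (a * h))) by simp only [mul_assoc],
      (ha.mul ha).trace_mul_comm]
    simp only [mul_assoc]
  have e10 : (a * (a * (h * (h * (a * a))))).trace = (h * (h * (a * (a * (a * a))))).trace := by
    rw [show (a * (a * (h * (h * (a * a))))) = (a * a) * (h * (h * (a * a))) by simp only [mul_assoc],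
      (ha.mul ha).trace_mul_comm]
    simp only [mul_assoc]
  have e11 : (a * (a * (h * (h * h)))).trace = (h * (h * (h * (a * a)))).trace := by
    rw [show (a * (a * (h * (h * h)))) = (a * a) * (h * (h * h)) by simp only [mul_assoc],
      (ha.mul ha).trace_mul_comm]
    simp only [mul_assoc]
  have e12 : (a * (h * (a * (a * (a * (a * a)))))).trace = -(h * (a * (a * (a * (a * (a * a)))))).trace := by
    rw [ha.trace_mul_comm,
      (hh.mul_odd (ha.mul_even (ha.mul (ha.mul_even (ha.mul ha))))).matInv_eq,
      neg_mul,
      Matrix.trace_neg]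
    simp only [mul_assoc]
  have e13 : (a * (h * (a * (a * (a * h))))).trace = (h * (a * (h * (a * (a * a))))).trace := by
    rw [show (a * (h * (a * (a * (a * h))))) = (a * (h * (a * (a * a)))) * h by simp only [mul_assoc],
      (ha.mul (hh.mul_odd (ha.mul_even (ha.mul ha)))).trace_mul_comm]
  have e14 : (a * (h * (a * (a * (h * a))))).trace = -(h * (a * (a * (h * (a * a))))).trace := by
    rw [ha.trace_mul_comm,
      (hh.mul_odd (ha.mul_even (ha.mul (hh.mul_odd ha)))).matInv_eq,
      neg_mul,
      Matrix.trace_neg]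
    simp only [mul_assoc]
  have e15 : (a * (h * (a * (h * (a * a))))).trace = -(h * (a * (h * (a * (a * a))))).trace := by
    rw [ha.trace_mul_comm,
      (hh.mul_odd (ha.mul_even (hh.mul (ha.mul ha)))).matInv_eq,
      neg_mul,
      Matrix.trace_neg]
    simp only [mul_assoc]
  have e16 : (a * (h * (a * (h * h)))).trace = (h * (h * (a * (h * a)))).trace := by
    rw [show (a * (h * (a * (h * h)))) = (a * (h * a)) * (h * h) by simp only [mul_assoc],
      (ha.mul (hh.mul_odd ha)).trace_mul_comm]
    simp only [mul_assoc]
  have e17 : (a * (h * (h * (a * (a * a))))).trace = -(h * (h * (a * (a * (a * a))))).trace := by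
    rw [ha.trace_mul_comm,
      (hh.mul_odd (hh.mul_odd (ha.mul_even (ha.mul ha)))).matInv_eq,
      neg_mul,
      Matrix.trace_neg]
    simp only [mul_assoc]
  have e18 : (a * (h * (h * (a * h)))).trace = -(h * (h * (a * (h * a)))).trace := by
    rw [ha.trace_mul_comm,
      (hh.mul_odd (hh.mul_odd (ha.mul_even hh))).matInv_eq,
      neg_mul,
      Matrix.trace_neg]
    simp only [mul_assoc]
  have e19 : (a * (h * (h * (h * a)))).trace = -(h * (h * (h * (a * a)))).trace := by
    rw [ha.trace_mul_comm,
      (hh.mul_odd (hh.mul_odd (hh.mul_odd ha))).matInv_eq,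
      neg_mul,
      Matrix.trace_neg]
    simp only [mul_assoc]
  have e20 : (h * (a * (a * (a * (a * h))))).trace = (h * (h * (a * (a * (a * a))))).trace := by
    rw [show (h * (a * (a * (a * (a * h))))) = (h * (a * (a * (a * a)))) * h by simp only [mul_assoc],
      (hh.mul (ha.mul (ha.mul_even (ha.mul ha)))).trace_mul_comm]
  have e21 : (h * (a * (a * (h * h)))).trace = (h * (h * (h * (a * a)))).trace := by
    rw [show (h * (a * (a * (h * h)))) = (h * (a * a)) * (h * h) by simp only [mul_assoc],
      (hh.mul (ha.mul ha)).trace_mul_comm]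
    simp only [mul_assoc]
  have e22 : (h * (h * (a * (a * h)))).trace = (h * (h * (h * (a * a)))).trace := by
    rw [show (h * (h * (a * (a * h)))) = (h * (h * (a * a))) * h by simp only [mul_assoc],
      (hh.mul (hh.mul (ha.mul ha))).trace_mul_comm]
  have z : (a * (a * (a * (a * (a * (a * (a * a))))))).trace = 0 := by
    have := ha.trace_mul_comm (a * (a * (a * (a * (a * (a * a))))))
    rw [(ha.mul_even (ha.mul (ha.mul_even (ha.mul (ha.mul_even (ha.mul ha)))))).matInv_eq, neg_mul,
      Matrix.trace_neg] at this
    simp only [mul_assoc] at this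
    have h2 : (2 : ℝ) • (a * (a * (a * (a * (a * (a * (a * a))))))).trace = 0 := by
      rw [two_smul]; nth_rw 1 [this]; simp
    exact (smul_eq_zero.mp h2).resolve_left two_ne_zero
  simp only [mul_add, add_mul, sub_mul, mul_sub, Matrix.trace_add, Matrix.trace_sub,
    Matrix.trace_smul, mul_smul_comm, smul_add, smul_sub, mul_assoc, z,
    e1, e2, e3, e4, e5, e6, e7, e8, e9, e10, e11, e12, e13, e14, e15, e16, e17, e18, e19, e20, e21, e22]
  module

end Words

/-! ### Chern-Simons forms: differentials and variations -/

section ChernSimons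

variable {N : ℕ} {κ : Type*} [Fintype κ] {U : Set (Fin N → ℝ)}
  {A L : Matrix κ κ (Form N)} {x : Fin N → ℝ}

theorem evalMat_curvature (x : Fin N → ℝ) (A : Matrix κ κ (Form N)) :
    evalMat x (curvature A) = evalMat x (matD A) + evalMat x A * evalMat x A := by
  rw [curvature, evalMat_add, evalMat_mul]

theorem evalMat_pow [DecidableEq κ] (x : Fin N → ℝ) (A : Matrix κ κ (Form N)) (n : ℕ) :
    evalMat x (A ^ n) = evalMat x A ^ n := by
  induction n with
  | zero =>
    ext i j
    by_cases h : i = j <;> simp [evalMat, h]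
  | succ n ih => rw [pow_succ, pow_succ, evalMat_mul, ih]

theorem chernSimons3_hasExtD [DecidableEq κ] (hU : IsOpen U) (hA : IsConnection U A) (hx : x ∈ U) :
    HasExtD (chernSimons3 A) ((curvature A ^ 2).trace x) x := by
  have hd := matHasExtD_of_smooth hU hA.smooth hx
  have hdd := matHasExtD_matD_of_smooth hU hA.smooth hx
  have ho := hA.odd x hx
  have he := (hA.matD_isParameter hU).even x hx
  have h1 := ((hd.mul_of_odd hdd ho).add (((hd.mul_of_odd hd ho).mul_of_even hd
    (by rw [evalMat_mul]; exact ho.mul ho)).smul (2 / 3))).trace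
  rw [trace_apply, evalMat_pow, evalMat_curvature, sq, ← trace_ext_chernSimons3 ho he]
  rw [mul_zero, sub_zero, evalMat_mul] at h1
  exact h1

theorem chernSimons7_hasExtD [DecidableEq κ] (hU : IsOpen U) (hA : IsConnection U A) (hx : x ∈ U) :
    HasExtD (chernSimons7 A) ((curvature A ^ 4).trace x) x := by
  have hd := matHasExtD_of_smooth hU hA.smooth hx
  have hdd := matHasExtD_matD_of_smooth hU hA.smooth hx
  have ho := hA.odd x hx
  have he := (hA.matD_isParameter hU).even x hx
  have hS := hd.mul_of_odd hd ho
  have h1 := (hd.mul_of_odd (((hdd.mul hdd).mul hdd).add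
    (((((hdd.mul hdd).mul hS).add ((hdd.mul hS).mul hdd)).add ((hS.mul hdd).mul hdd)).smul (4 / 5))
    |>.add (((((hdd.mul hS).mul hS).add ((hS.mul hdd).mul hS)).add ((hS.mul hS).mul hdd)).smul
      (2 / 3)) |>.add (((hS.mul hS).mul hS).smul (4 / 7))) ho).trace
  simp only [evalMat_mul, evalMat_add, evalMat_smul, matInv_mul, ho.matInv_eq, he.matInv_eq,
    mul_zero, zero_mul, add_zero, zero_add, neg_mul_neg] at h1
  rw [trace_apply, evalMat_pow, evalMat_curvature, show (4 : ℕ) = 2 + 2 from rfl, pow_add, sq,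
    ← trace_ext_chernSimons7 ho he]
  rw [chernSimons7]
  exact h1

/-- A one-parameter family of connections on `U` which is the infinitesimal gauge transformation
of `A` with parameter `L`. -/
def IsGaugeFamily (U : Set (Fin N → ℝ)) (L A : Matrix κ κ (Form N))
    (As : ℝ → Matrix κ κ (Form N)) : Prop :=
  ∀ s, ∀ y ∈ U, evalMat y (As s) = evalMat y A + s • evalMat y (gaugeVar L A)

theorem hasTwistedDeriv_family (hx : x ∈ U) {As : ℝ → Matrix κ κ (Form N)}
    (hAs : IsGaugeFamily U L A As) :
    HasTwistedDeriv (evalMat x L) (fun s => evalMat x (As s)) (evalMat x A)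
      (evalMat x (matD L)) := by
  refine ⟨by simp [hAs 0 x hx], fun i j => ?_⟩
  simp only [hAs _ x hx, gaugeVar, evalMat_sub, evalMat_add, evalMat_mul]
  rw [← add_sub_assoc]
  exact HasCurveDeriv.linear _ _

theorem matHasExtD_family (hU : IsOpen U) (hx : x ∈ U) {As : ℝ → Matrix κ κ (Form N)}
    (hA : IsConnection U A) (hL : IsParameter U L)
    (hAs : IsGaugeFamily U L A As) (s : ℝ) :
    MatHasExtD (As s) (evalMat x (matD A) + s • (-(evalMat x A * evalMat x (matD L) +
        evalMat x (matD L) * evalMat x A) +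
      (evalMat x (matD A) * evalMat x L - evalMat x L * evalMat x (matD A)))) x := by
  have hd := matHasExtD_of_smooth hU hA.smooth hx
  have hl := matHasExtD_of_smooth hU hL.smooth hx
  have hll := matHasExtD_matD_of_smooth hU hL.smooth hx
  have h1 := hd.add ((((hll.add (hd.mul_of_odd hl (hA.odd x hx))).sub
    (hl.mul_of_even hd (hL.even x hx)))).smul s)
  have e : evalMat x (matD A) + s • (-(evalMat x A * evalMat x (matD L) +
        evalMat x (matD L) * evalMat x A) +
      (evalMat x (matD A) * evalMat x L - evalMat x L * evalMat x (matD A))) =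
      evalMat x (matD A) + s • (0 + (evalMat x (matD A) * evalMat x L -
        evalMat x A * evalMat x (matD L)) -
      (evalMat x (matD L) * evalMat x A + evalMat x L * evalMat x (matD A))) := by
    congr 2; abel
  rw [e]
  intro i j
  refine (h1 i j).congr ?_
  filter_upwards [hU.mem_nhds hx] with y hy
  exact congrFun (congrFun (hAs s y hy) i) j

/-- Applying d to dΛ + AΛ - ΛA gives the commutator [dA, Λ] and, because A is odd, an anticommutator
of A with dΛ. -/
theorem hasTwistedDeriv_matD_family (hU : IsOpen U) (hx : x ∈ U)
    {As : ℝ → Matrix κ κ (Form N)} (hA : IsConnection U A) (hL : IsParameter U L)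
    (hAs : IsGaugeFamily U L A As) :
    HasTwistedDeriv (evalMat x L) (fun s => evalMat x (matD (As s))) (evalMat x (matD A))
      (-(evalMat x A * evalMat x (matD L) + evalMat x (matD L) * evalMat x A)) := by
  have h := fun s => (matHasExtD_family hU hx hA hL hAs s).matD_eq
  refine ⟨by simp [h 0], fun i j => ?_⟩
  simp only [h]
  exact HasCurveDeriv.linear _ _

/-- Up to the commutator, δA = dΛ and δ(dA) = -(A dΛ + dΛ A). The terms quadratic in A then cancel
by graded cyclicity. -/
theorem chernSimons3_hasVariation (hU : IsOpen U) (hx : x ∈ U)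
    {As : ℝ → Matrix κ κ (Form N)} (hA : IsConnection U A) (hL : IsParameter U L)
    (hAs : IsGaugeFamily U L A As) :
    HasCurveDeriv (fun s => chernSimons3 (As s) x)
      (evalMat x (matD L) * evalMat x (matD A)).trace := by
  have h1 := hasTwistedDeriv_family hx hAs
  have h2 := hasTwistedDeriv_matD_family hU hx hA hL hAs
  have h3 := ((h1.mul h2).add (((h1.mul h1).mul h1).smul (2 / 3))).trace (hL.even x hx)
  have ho := hA.odd x hx
  have hm := (hL.matD_isConnection hU).odd x hx
  have e : (fun s => chernSimons3 (As s) x) = fun s => (evalMat x (As s) * evalMat x (matD (As s)) +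
      (2 / 3 : ℝ) • (evalMat x (As s) * evalMat x (As s) * evalMat x (As s))).trace := by
    funext s
    rw [chernSimons3, trace_apply, evalMat_add, evalMat_smul, evalMat_mul, evalMat_mul, evalMat_mul]
  rw [e]
  convert h3 using 1
  set a := evalMat x A
  set m := evalMat x (matD L)
  have e1 : (a * (m * a)).trace = (m * (a * a)).trace := by
    rw [← mul_assoc, (ho.mul hm).trace_mul_comm, ← mul_assoc, (ho.mul ho).trace_mul_comm]
  have e2 : (a * (a * m)).trace = (m * (a * a)).trace := by
    rw [← mul_assoc, (ho.mul ho).trace_mul_comm]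
  simp only [mul_add, add_mul, mul_neg, Matrix.trace_add, Matrix.trace_neg, Matrix.trace_smul,
    mul_assoc, e1, e2]
  module

theorem trace_curvature_sq_hasVariation [DecidableEq κ] (hU : IsOpen U) (hx : x ∈ U)
    {As : ℝ → Matrix κ κ (Form N)} (hA : IsConnection U A) (hL : IsParameter U L)
    (hAs : IsGaugeFamily U L A As) :
    HasCurveDeriv (fun s => (curvature (As s) ^ 2).trace x) 0 := by
  have h1 := hasTwistedDeriv_family hx hAs
  have h2 := hasTwistedDeriv_matD_family hU hx hA hL hAs
  have hF := h2.add (h1.mul h1)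
  -- The inhomogeneous part of the variation of the curvature vanishes: F only rotates by a
  -- commutator.
  rw [show -(evalMat x A * evalMat x (matD L) + evalMat x (matD L) * evalMat x A) +
    (evalMat x (matD L) * evalMat x A + evalMat x A * evalMat x (matD L)) = 0 by abel] at hF
  have h3 := (hF.mul hF).trace (hL.even x hx)
  rw [zero_mul, mul_zero, add_zero, Matrix.trace_zero] at h3
  simp only [trace_apply, evalMat_pow, evalMat_curvature]
  simp only [sq]
  exact h3

/-- The descent form is tr(Λ dX), so its differential is tr(dΛ dX) by d²X = 0. Expanding dX and the
variation in words with a single dΛ makes them agree. The common value is quantified because its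
explicit expansion is not needed again. -/
theorem chernSimons7_hasVariation (hU : IsOpen U) (hx : x ∈ U)
    {As : ℝ → Matrix κ κ (Form N)} (hA : IsConnection U A) (hL : IsParameter U L)
    (hAs : IsGaugeFamily U L A As) :
    ∃ v, HasCurveDeriv (fun s => chernSimons7 (As s) x) v ∧ HasExtD (descent6 L A) v x := by
  have h1 := hasTwistedDeriv_family hx hAs
  have h2 := hasTwistedDeriv_matD_family hU hx hA hL hAs
  have hS := h1.mul h1
  have h3 := (h1.mul (((h2.mul h2).mul h2).add
    (((((h2.mul h2).mul hS).add ((h2.mul hS).mul h2)).add ((hS.mul h2).mul h2)).smul (4 / 5))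
    |>.add (((((h2.mul hS).mul hS).add ((hS.mul h2).mul hS)).add ((hS.mul hS).mul h2)).smul
      (2 / 3)) |>.add (((hS.mul hS).mul hS).smul (4 / 7)))).trace (hL.even x hx)
  have ho := hA.odd x hx
  have he := (hA.matD_isParameter hU).even x hx
  have hm := (hL.matD_isConnection hU).odd x hx
  have hd := matHasExtD_of_smooth hU hA.smooth hx
  have hdd := matHasExtD_matD_of_smooth hU hA.smooth hx
  have hl := matHasExtD_of_smooth hU hL.smooth hx
  have hAp := hA.matD_isParameter hU
  have hSp := hA.mul hA
  have hX : IsConnection U ((1 / 3 : ℝ) • (A * matD A * matD A + matD A * A * matD A +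
        matD A * matD A * A)
      + (1 / 5 : ℝ) • (A * matD A * (A * A) + A * (A * A) * matD A + matD A * A * (A * A)
        + A * A * A * matD A + matD A * (A * A) * A + A * A * matD A * A)
      + (2 / 5 : ℝ) • (A * (A * A) * (A * A))) := by
    refine IsConnection.add (IsConnection.add ?_ ?_) ?_
    · exact ((((hA.mul_parameter hAp).mul_parameter hAp).add
        ((hAp.mul_connection hA).mul_parameter hAp)).add
        ((hAp.mul hAp).mul_connection hA)).smul _
    · exact (((((((hA.mul_parameter hAp).mul_parameter hSp).add
        ((hA.mul_parameter hSp).mul_parameter hAp)).add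
        ((hAp.mul_connection hA).mul_parameter hSp)).add
        ((hSp.mul_connection hA).mul_parameter hAp)).add
        ((hAp.mul hSp).mul_connection hA)).add ((hSp.mul hAp).mul_connection hA)).smul _
    · exact ((hA.mul_parameter hSp).mul_parameter hSp).smul _
  have hdS := hd.mul hd
  have hdX := ((((((hd.mul hdd).mul hdd).add ((hdd.mul hd).mul hdd)).add
      ((hdd.mul hdd).mul hd)).smul (1 / 3)).add
    ((((((((hd.mul hdd).mul hdS).add ((hd.mul hdS).mul hdd)).add ((hdd.mul hd).mul hdS)).add
      ((hdS.mul hd).mul hdd)).add ((hdd.mul hdS).mul hd)).add ((hdS.mul hdd).mul hd)).smul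
      (1 / 5))).add (((hd.mul hdS).mul hdS).smul (2 / 5))
  have hdesc := (hl.mul_of_even (matHasExtD_matD_of_smooth hU hX.smooth hx)
    (hL.even x hx)).trace
  rw [mul_zero, add_zero, hdX.matD_eq] at hdesc
  refine ⟨_, ?_, hdesc⟩
  simp only [chernSimons7, trace_apply, evalMat_add, evalMat_smul, evalMat_mul]
  convert h3 using 1
  simp only [matInv_mul, ho.matInv_eq, he.matInv_eq]
  set a := evalMat x A
  set h := evalMat x (matD A)
  set m := evalMat x (matD L)
  -- A word starting with `a` or `h` is rotated until its only factor `m` = dΛ stands first. This is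
  -- the normal form, and no rotation rule applies to it.
  have ra := fun w => ho.trace_mul_comm w
  have rh := fun w => he.trace_mul_comm w
  simp only [mul_zero, zero_mul, add_zero, zero_add, mul_add, add_mul, mul_neg, neg_mul, neg_neg,
    mul_assoc, neg_add_rev, smul_add, smul_neg, mul_smul_comm, Matrix.trace_add,
    Matrix.trace_smul, Matrix.trace_neg, ra, rh, matInv_mul, ho.matInv_eq, he.matInv_eq,
    hm.matInv_eq]
  module

end ChernSimons

/-! ### The forms I₄, ω, ω¹ and X₈, X₇, X₆ -/

section CharacteristicForms

variable {N : ℕ} {κ ι : Type*} [Fintype κ] [DecidableEq κ] [Fintype ι] [DecidableEq ι]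
  {U : Set (Fin N → ℝ)} {A Lg : Matrix κ κ (Form N)} {Ω LL : Matrix ι ι (Form N)} {x : Fin N → ℝ}

theorem IsConnection.smooth_chernSimons3 (hU : IsOpen U) (hA : IsConnection U A) :
    SmoothForm U (chernSimons3 A) :=
  smoothForm_trace ((hA.mul_parameter (hA.matD_isParameter hU)).add
    (((hA.mul hA).mul_connection hA).smul (2 / 3))).smooth

theorem IsConnection.odd_chernSimons3 (hU : IsOpen U) (hA : IsConnection U A) (hx : x ∈ U) :
    IsOdd (chernSimons3 A x) := by
  rw [chernSimons3, trace_apply]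
  exact (((hA.mul_parameter (hA.matD_isParameter hU)).add
    (((hA.mul hA).mul_connection hA).smul (2 / 3))).odd x hx).trace

theorem IsConnection.smooth_trace_sq (hU : IsOpen U) (hA : IsConnection U A) :
    SmoothForm U (curvature A ^ 2).trace := by
  rw [sq]
  exact smoothForm_trace ((hA.curvature_isParameter hU).mul (hA.curvature_isParameter hU)).smooth

theorem IsConnection.even_trace_sq (hU : IsOpen U) (hA : IsConnection U A) (hx : x ∈ U) :
    IsEven ((curvature A ^ 2).trace x) := by
  rw [sq, trace_apply]
  exact (((hA.curvature_isParameter hU).mul (hA.curvature_isParameter hU)).even x hx).trace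

/-- Closedness comes from exactness: tr F² is the differential of the Chern-Simons form, and d² = 0.
-/
theorem IsConnection.trace_sq_closed (hU : IsOpen U) (hA : IsConnection U A) (hx : x ∈ U) :
    HasExtD (curvature A ^ 2).trace 0 x := by
  refine ((hA.smooth_chernSimons3 hU).hasExtD_extD hU hx).congr ?_
  filter_upwards [hU.mem_nhds hx] with y hy
  exact (chernSimons3_hasExtD hU hA hy).extD_eq.symm

theorem trace_parameter_hasExtD (hU : IsOpen U) (hA : IsConnection U A) (hL : IsParameter U Lg)
    (hx : x ∈ U) :
    HasExtD (Lg * matD A).trace (evalMat x (matD Lg) * evalMat x (matD A)).trace x := by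
  have := ((matHasExtD_of_smooth hU hL.smooth hx).mul_of_even
    (matHasExtD_matD_of_smooth hU hA.smooth hx) (hL.even x hx)).trace
  rwa [mul_zero, add_zero] at this

theorem smooth_trace_parameter (hU : IsOpen U) (hA : IsConnection U A) (hL : IsParameter U Lg) :
    SmoothForm U (Lg * matD A).trace :=
  smoothForm_trace (hL.mul (hA.matD_isParameter hU)).smooth

theorem even_trace_parameter (hU : IsOpen U) (hA : IsConnection U A) (hL : IsParameter U Lg)
    (hx : x ∈ U) : IsEven ((Lg * matD A).trace x) := by
  rw [trace_apply]
  exact ((hL.mul (hA.matD_isParameter hU)).even x hx).trace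

theorem smooth_threeForm (hU : IsOpen U) (hΩ : IsConnection U Ω) (hA : IsConnection U A) :
    SmoothForm U (threeForm Ω A) :=
  (((hA.smooth_chernSimons3 hU).smul _).sub ((hΩ.smooth_chernSimons3 hU).smul _)).smul _

theorem odd_threeForm (hU : IsOpen U) (hΩ : IsConnection U Ω) (hA : IsConnection U A)
    (hx : x ∈ U) : IsOdd (threeForm Ω A x) :=
  (((hA.odd_chernSimons3 hU hx).smul _).sub ((hΩ.odd_chernSimons3 hU hx).smul _)).smul _

theorem smooth_fourFormOf (hU : IsOpen U) (hΩ : IsConnection U Ω) (hA : IsConnection U A) :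
    SmoothForm U (fourFormOf Ω A) :=
  (((hA.smooth_trace_sq hU).smul _).sub ((hΩ.smooth_trace_sq hU).smul _)).smul _

theorem even_fourFormOf (hU : IsOpen U) (hΩ : IsConnection U Ω) (hA : IsConnection U A)
    (hx : x ∈ U) : IsEven (fourFormOf Ω A x) :=
  (((hA.even_trace_sq hU hx).smul _).sub ((hΩ.even_trace_sq hU hx).smul _)).smul _

theorem threeForm_hasExtD (hU : IsOpen U) (hΩ : IsConnection U Ω) (hA : IsConnection U A)
    (hx : x ∈ U) : HasExtD (threeForm Ω A) (fourFormOf Ω A x) x := by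
  have := (((chernSimons3_hasExtD hU hA hx).smul (1 / 30)).sub
    ((chernSimons3_hasExtD hU hΩ hx).smul (1 / 2))).smul (1 / (4 * Real.pi) ^ 2)
  rw [show (4 * Real.pi) ^ 2 = 16 * Real.pi ^ 2 by ring] at this
  rw [threeForm, show (4 * Real.pi) ^ 2 = 16 * Real.pi ^ 2 by ring]
  exact this

theorem fourFormOf_closed (hU : IsOpen U) (hΩ : IsConnection U Ω) (hA : IsConnection U A)
    (hx : x ∈ U) : HasExtD (fourFormOf Ω A) 0 x := by
  have := (((hA.trace_sq_closed hU hx).smul (1 / 30)).sub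
    ((hΩ.trace_sq_closed hU hx).smul (1 / 2))).smul (1 / (16 * Real.pi ^ 2))
  simp only [smul_zero, sub_zero] at this
  exact this

theorem fourFormOf_sq_closed (hU : IsOpen U) (hΩ : IsConnection U Ω) (hA : IsConnection U A)
    (hx : x ∈ U) : HasExtD (fourFormOf Ω A ^ 2) 0 x := by
  have h := fourFormOf_closed hU hΩ hA hx
  have := h.mul h
  rwa [zero_mul, mul_zero, add_zero, ← sq] at this

theorem smooth_twoForm (hU : IsOpen U) (hΩ : IsConnection U Ω) (hA : IsConnection U A)
    (hLL : IsParameter U LL) (hLg : IsParameter U Lg) : SmoothForm U (twoForm LL Lg Ω A) :=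
  (((smooth_trace_parameter hU hA hLg).smul _).sub
    ((smooth_trace_parameter hU hΩ hLL).smul _)).smul _

theorem even_twoForm (hU : IsOpen U) (hΩ : IsConnection U Ω) (hA : IsConnection U A)
    (hLL : IsParameter U LL) (hLg : IsParameter U Lg) (hx : x ∈ U) :
    IsEven (twoForm LL Lg Ω A x) :=
  (((even_trace_parameter hU hA hLg hx).smul _).sub
    ((even_trace_parameter hU hΩ hLL hx).smul _)).smul _

variable {Ωs : ℝ → Matrix ι ι (Form N)} {As : ℝ → Matrix κ κ (Form N)}

theorem threeForm_descent (hU : IsOpen U) (hΩ : IsConnection U Ω) (hA : IsConnection U A)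
    (hLL : IsParameter U LL) (hLg : IsParameter U Lg)
    (hΩs : IsGaugeFamily U LL Ω Ωs) (hAs : IsGaugeFamily U Lg A As) (hx : x ∈ U) :
    HasCurveDeriv (fun s => threeForm (Ωs s) (As s) x) (extD (twoForm LL Lg Ω A) x) := by
  have h1 := (((trace_parameter_hasExtD hU hA hLg hx).smul (1 / 30)).sub
    ((trace_parameter_hasExtD hU hΩ hLL hx).smul (1 / 2))).smul (1 / (4 * Real.pi) ^ 2)
  have h2 := (((chernSimons3_hasVariation hU hx hA hLg hAs).smul (1 / 30)).add
    ((chernSimons3_hasVariation hU hx hΩ hLL hΩs).smul (-(1 / 2)))).smul (1 / (4 * Real.pi) ^ 2)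
  rw [twoForm, h1.extD_eq]
  simp only [neg_smul, ← sub_eq_add_neg] at h2
  exact h2

theorem fourFormOf_hasVariation (hU : IsOpen U) (hΩ : IsConnection U Ω) (hA : IsConnection U A)
    (hLL : IsParameter U LL) (hLg : IsParameter U Lg)
    (hΩs : IsGaugeFamily U LL Ω Ωs) (hAs : IsGaugeFamily U Lg A As) (hx : x ∈ U) :
    HasCurveDeriv (fun s => fourFormOf (Ωs s) (As s) x) 0 := by
  have h2 := (((trace_curvature_sq_hasVariation hU hx hA hLg hAs).smul (1 / 30)).add
    ((trace_curvature_sq_hasVariation hU hx hΩ hLL hΩs).smul (-(1 / 2)))).smul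
      (1 / (16 * Real.pi ^ 2))
  simp only [smul_zero, add_zero, neg_smul, ← sub_eq_add_neg] at h2
  exact h2

theorem sevenForm_hasExtD (hU : IsOpen U) (hΩ : IsConnection U Ω) (hx : x ∈ U) :
    HasExtD (sevenForm Ω) (eightForm (curvature Ω) x) x := by
  have := (((chernSimons7_hasExtD hU hΩ hx).smul (1 / 8)).sub
    (((chernSimons3_hasExtD hU hΩ hx).mul (hΩ.trace_sq_closed hU hx)).smul (1 / 32))).smul
      (1 / ((2 * Real.pi) ^ 3 * 24))
  rw [mul_zero, add_zero, ← sq] at this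
  exact this

theorem sevenForm_descent (hU : IsOpen U) (hΩ : IsConnection U Ω) (hLL : IsParameter U LL)
    (hΩs : IsGaugeFamily U LL Ω Ωs) (hx : x ∈ U) :
    HasCurveDeriv (fun s => sevenForm (Ωs s) x) (extD (sixForm LL Ω) x) ∧
      HasExtD (sixForm LL Ω) (extD (sixForm LL Ω) x) x := by
  obtain ⟨v, hv, hv'⟩ := chernSimons7_hasVariation hU hx hΩ hLL hΩs
  have h1 := ((hv'.smul (1 / 8)).sub
    (((trace_parameter_hasExtD hU hΩ hLL hx).mul (hΩ.trace_sq_closed hU hx)).smul (1 / 32))).smul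
      (1 / ((2 * Real.pi) ^ 3 * 24))
  have h2 := ((hv.smul (1 / 8)).add
    (((chernSimons3_hasVariation hU hx hΩ hLL hΩs).mul
      (trace_curvature_sq_hasVariation hU hx hΩ hLL hΩs)).smul (-(1 / 32)))).smul
      (1 / ((2 * Real.pi) ^ 3 * 24))
  -- The product rule evaluates the undifferentiated factor at s = 0, where the family has to be
  -- identified with the given connection.
  have h0 : evalMat x (Ωs 0) = evalMat x Ω := by simp [hΩs 0 x hx]
  have h0' : evalMat x (matD (Ωs 0)) = evalMat x (matD Ω) := by
    rw [(matHasExtD_family hU hx hΩ hLL hΩs 0).matD_eq]; simp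
  rw [mul_zero, add_zero] at h1 h2
  rw [trace_apply _ (curvature (Ωs 0) ^ 2), evalMat_pow, evalMat_curvature, h0, h0',
    ← evalMat_curvature, ← evalMat_pow, ← trace_apply] at h2
  simp only [neg_smul, ← sub_eq_add_neg] at h2
  rw [sixForm, h1.extD_eq]
  exact ⟨h2, h1⟩

end CharacteristicForms

/-! ### Connections and parameters with values in a Lie algebra -/

section Inputs

variable {N : ℕ} {κ : Type*} {U : Set (Fin N → ℝ)}

theorem isConnection_connectionForm {V : Type*} (ρ : V → Matrix κ κ ℝ)
    {a : (Fin N → ℝ) → Fin N → V}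
    (h : ∀ μ j k, ContDiffOn ℝ ∞ (fun x => ρ (a x μ) j k) U) :
    IsConnection U (connectionForm ρ a) where
  smooth j k := SmoothForm.ι (contDiffOn_pi.mpr fun μ => h μ j k)
  odd _ _ _ _ := isOdd_ι _

theorem isParameter_parameterForm {V : Type*} (ρ : V → Matrix κ κ ℝ)
    {a : (Fin N → ℝ) → V} (h : ∀ j k, ContDiffOn ℝ ∞ (fun x => ρ (a x) j k) U) :
    IsParameter U (parameterForm ρ a) where
  smooth j k := SmoothForm.algebraMap (h j k)
  even _ _ _ _ := isEven_algebraMap _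

variable {𝔤 : Type*} [LieRing 𝔤] [LieAlgebra ℝ 𝔤] [FiniteDimensional ℝ 𝔤]

/-- The entries of the adjoint representation as linear functionals. -/
noncomputable def adEntry (j k : Fin (Module.finrank ℝ 𝔤)) : 𝔤 →ₗ[ℝ] ℝ where
  toFun F := adMatrix F j k
  map_add' F G := by simp [adMatrix]
  map_smul' r F := by simp [adMatrix]

theorem isConnection_adMatrix {A : (Fin N → ℝ) → Fin N → 𝔤}
    (h : ∀ μ (l : 𝔤 →ₗ[ℝ] ℝ), ContDiffOn ℝ ∞ (fun x => l (A x μ)) U) :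
    IsConnection U (connectionForm adMatrix A) :=
  isConnection_connectionForm _ fun μ j k => h μ (adEntry j k)

theorem isParameter_adMatrix {Λ : (Fin N → ℝ) → 𝔤}
    (h : ∀ l : 𝔤 →ₗ[ℝ] ℝ, ContDiffOn ℝ ∞ (fun x => l (Λ x)) U) :
    IsParameter U (parameterForm adMatrix Λ) :=
  isParameter_parameterForm _ fun j k => h (adEntry j k)

end Inputs

/-! ### The descent equations for both inflow polynomials -/

section Descent

variable (𝔤 : Type*) [LieRing 𝔤] [LieAlgebra ℝ 𝔤] [FiniteDimensional ℝ 𝔤]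

theorem isGaugeFamily_add_smul {N : ℕ} {κ : Type*} [Fintype κ] (U : Set (Fin N → ℝ))
    (L A : Matrix κ κ (Form N)) : IsGaugeFamily U L A fun s => A + s • gaugeVar L A :=
  fun _ _ _ => rfl

/-- I₄ is closed and has zero variation, so both equations multiply dω = I₄ and δω = dω¹ by I₄². -/
theorem isDescent_top (kap γ b : ℝ) : IsDescent 𝔤
    (fun _ R F => topPoly kap γ b R F) (fun _ w a => topEleven kap γ b w a)
    (fun _ u v w a => topTen kap γ b u v w a) := by
  intro N U hU Ω A ΛL Λg hΩ _ hA hΛL _ hΛg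
  have hw := isConnection_connectionForm (U := U) id hΩ
  have ha := isConnection_adMatrix hA
  have hu := isParameter_parameterForm (U := U) id hΛL
  have hv := isParameter_adMatrix hΛg
  intro w a u v
  constructor
  · intro x hx
    have h := ((threeForm_hasExtD hU hw ha hx).mul (fourFormOf_sq_closed hU hw ha hx)).smul
      (topCoupling kap γ b)
    rw [mul_zero, add_zero] at h
    refine h.extD_eq.trans ?_
    change topCoupling kap γ b • (fourFormOf w a x * (fourFormOf w a ^ 2) x) =
      topCoupling kap γ b • (fourFormOf w a ^ 3) x
    rw [pow_succ' _ 2]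
    rfl
  · intro x hx
    have hws := isGaugeFamily_add_smul U u w
    have has := isGaugeFamily_add_smul U v a
    have h4 := fourFormOf_hasVariation hU hw ha hu hv hws has hx
    have h1 := ((threeForm_descent hU hw ha hu hv hws has hx).mul (h4.mul h4)).smul
      (topCoupling kap γ b)
    have h2 := (((smooth_twoForm hU hw ha hu hv).hasExtD hU hx).mul
      (fourFormOf_sq_closed hU hw ha hx)).smul (topCoupling kap γ b)
    simp only [zero_smul, add_zero, mul_zero, zero_mul] at h1 h2
    have h3 : HasCurveDeriv (fun s : ℝ => topEleven kap γ b (w + s • gaugeVar u w)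
        (a + s • gaugeVar v a) x)
        (topCoupling kap γ b • (extD (twoForm u v w a) x * (fourFormOf w a ^ 2) x)) := by
      simp only [topEleven, sq]
      exact h1
    exact (variation_eq h3).trans h2.extD_eq.symm

/-- The descent is carried by X₇ alone; I₄ is closed, invariant and even, so moving d past it costs
no sign. -/
theorem isDescent_gs (kap γ : ℝ) : IsDescent 𝔤
    (fun _ R F => gsPoly kap γ R F) (fun _ w a => gsEleven kap γ w a)
    (fun _ u _ w a => gsTen kap γ u w a) := by
  intro N U hU Ω A ΛL Λg hΩ _ hA hΛL _ hΛg
  have hw := isConnection_connectionForm (U := U) id hΩ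
  have ha := isConnection_adMatrix hA
  have hu := isParameter_parameterForm (U := U) id hΛL
  have hv := isParameter_adMatrix hΛg
  intro w a u v
  constructor
  · intro x hx
    have h := ((fourFormOf_closed hU hw ha hx).mul (sevenForm_hasExtD hU hw hx)).smul
      (gsCoupling kap γ)
    rw [zero_mul, zero_add, (even_fourFormOf hU hw ha hx).1] at h
    exact h.extD_eq
  · intro x hx
    have hws := isGaugeFamily_add_smul U u w
    have has := isGaugeFamily_add_smul U v a
    obtain ⟨h7, h6⟩ := sevenForm_descent hU hw hu hws hx
    have h1 := ((fourFormOf_hasVariation hU hw ha hu hv hws has hx).mul h7).smul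
      (gsCoupling kap γ)
    have h2 := ((fourFormOf_closed hU hw ha hx).mul h6).smul (gsCoupling kap γ)
    rw [zero_mul, zero_add] at h1 h2
    rw [(even_fourFormOf hU hw ha hx).1] at h2
    simp only [zero_smul, add_zero] at h1
    have h3 : HasCurveDeriv (fun s : ℝ => gsEleven kap γ (w + s • gaugeVar u w)
        (a + s • gaugeVar v a) x)
        (gsCoupling kap γ • (fourFormOf w a x * extD (sixForm u w) x)) := h1
    exact (variation_eq h3).trans h2.extD_eq.symm

end Descent

/-! ### Parity from the grading involution alone -/

section ParityCriterion

variable {N : ℕ} {a : ExteriorAlgebra ℝ (Fin N → ℝ)}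

/-- The halves fixed and negated by the involution automatically obey the right commutation rules.
Hence parity survives pull-back, whose image is not the whole algebra. -/
theorem isEven_add_involute_and_isOdd_sub_involute (a : ExteriorAlgebra ℝ (Fin N → ℝ)) :
    IsEven (a + CliffordAlgebra.involute a) ∧ IsOdd (a - CliffordAlgebra.involute a) := by
  induction a using CliffordAlgebra.left_induction with
  | algebraMap r =>
    simp only [AlgHom.commutes, sub_self]
    exact ⟨(isEven_algebraMap r).add (isEven_algebraMap r), IsOdd.zero⟩
  | add x y hx hy =>
    rw [map_add, add_add_add_comm, add_sub_add_comm]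
    exact ⟨hx.1.add hy.1, hx.2.add hy.2⟩
  | ι_mul x m hx =>
    have h : CliffordAlgebra.involute (CliffordAlgebra.ι 0 m * x) =
        -(ExteriorAlgebra.ι ℝ m * CliffordAlgebra.involute x) := by
      rw [map_mul, CliffordAlgebra.involute_ι, neg_mul]
    rw [h, ← sub_eq_add_neg, sub_neg_eq_add]
    change IsEven (ExteriorAlgebra.ι ℝ m * x - _) ∧ IsOdd (ExteriorAlgebra.ι ℝ m * x + _)
    rw [← mul_sub, ← mul_add]
    exact ⟨(isOdd_ι m).mul hx.2, (isOdd_ι m).mul_even hx.1⟩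

theorem isEven_of_involute_eq (h : CliffordAlgebra.involute a = a) : IsEven a := by
  have h1 := (isEven_add_involute_and_isOdd_sub_involute a).1.smul (1 / 2)
  rwa [h, ← two_smul ℝ a, smul_smul, one_div, inv_mul_cancel₀ two_ne_zero, one_smul] at h1

theorem isOdd_of_involute_eq (h : CliffordAlgebra.involute a = -a) : IsOdd a := by
  have h1 := (isEven_add_involute_and_isOdd_sub_involute a).2.smul (1 / 2)
  rwa [h, sub_neg_eq_add, ← two_smul ℝ a, smul_smul, one_div, inv_mul_cancel₀ two_ne_zero,
    one_smul] at h1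

theorem involute_map {M : ℕ} (f : (Fin N → ℝ) →ₗ[ℝ] Fin M → ℝ)
    (a : ExteriorAlgebra ℝ (Fin N → ℝ)) :
    CliffordAlgebra.involute (ExteriorAlgebra.map f a) =
      ExteriorAlgebra.map f (CliffordAlgebra.involute a) := by
  have : (CliffordAlgebra.involute.comp (ExteriorAlgebra.map f)) =
      ((ExteriorAlgebra.map f).comp CliffordAlgebra.involute) := by
    refine ExteriorAlgebra.hom_ext (LinearMap.ext fun v => ?_)
    have h1 : CliffordAlgebra.involute (ExteriorAlgebra.ι ℝ (f v)) = -ExteriorAlgebra.ι ℝ (f v) :=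
      CliffordAlgebra.involute_ι _
    have h2 : CliffordAlgebra.involute (ExteriorAlgebra.ι ℝ v) = -ExteriorAlgebra.ι ℝ v :=
      CliffordAlgebra.involute_ι _
    simp [h1, h2]
  exact DFunLike.congr_fun this a

theorem IsEven.map {M : ℕ} (f : (Fin N → ℝ) →ₗ[ℝ] Fin M → ℝ) (ha : IsEven a) :
    IsEven (ExteriorAlgebra.map f a) :=
  isEven_of_involute_eq (by rw [involute_map, ha.1])

theorem IsOdd.map {M : ℕ} (f : (Fin N → ℝ) →ₗ[ℝ] Fin M → ℝ) (ha : IsOdd a) :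
    IsOdd (ExteriorAlgebra.map f a) :=
  isOdd_of_involute_eq (by rw [involute_map, ha.1, map_neg])

end ParityCriterion

/-! ### Pull-back, restriction, δ and ε on M₁₀ × S¹ -/

section Naturality

/-- Forget the last coordinate. -/
def planePoint (y : Fin 11 → ℝ) : Fin 10 → ℝ := fun μ => y μ.castSucc

theorem contDiff_planePoint : ContDiff ℝ ∞ planePoint :=
  contDiff_pi.mpr fun μ => contDiff_apply ℝ ℝ (Fin.castSucc μ)

theorem contDiff_snoc (φ₀ : ℝ) :
    ContDiff ℝ ∞ fun x : Fin 10 → ℝ => (Fin.snoc x φ₀ : Fin 11 → ℝ) :=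
  contDiff_pi.mpr fun μ => by
    refine Fin.lastCases ?_ (fun i => ?_) μ
    · simpa [-Fin.reduceLast] using contDiff_const
    · simpa using contDiff_apply ℝ ℝ i

theorem mem_bulkRegion {U : Set (Fin 10 → ℝ)} {y : Fin 11 → ℝ} :
    y ∈ bulkRegion U ↔ planePoint y ∈ U := Iff.rfl

theorem isOpen_bulkRegion {U : Set (Fin 10 → ℝ)} (hU : IsOpen U) : IsOpen (bulkRegion U) :=
  hU.preimage contDiff_planePoint.continuous

theorem planePoint_snoc (x : Fin 10 → ℝ) (φ₀ : ℝ) :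
    planePoint (Fin.snoc x φ₀ : Fin 11 → ℝ) = x := by
  funext μ; simp [planePoint]

/-- Pull-back of covectors. -/
noncomputable def pullCovector :
    ExteriorAlgebra ℝ (Fin 10 → ℝ) →ₐ[ℝ] ExteriorAlgebra ℝ (Fin 11 → ℝ) :=
  ExteriorAlgebra.map (Function.ExtendByZero.linearMap ℝ (Fin.castSucc : Fin 10 → Fin 11))

/-- Restriction of covectors. -/
noncomputable def restrictCovector :
    ExteriorAlgebra ℝ (Fin 11 → ℝ) →ₐ[ℝ] ExteriorAlgebra ℝ (Fin 10 → ℝ) :=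
  ExteriorAlgebra.map (LinearMap.funLeft ℝ ℝ (Fin.castSucc : Fin 10 → Fin 11))

theorem pullBack_apply (α : Form 10) (y : Fin 11 → ℝ) :
    pullBack α y = pullCovector (α (planePoint y)) := rfl

theorem restrictTo_apply (φ₀ : ℝ) (α : Form 11) (x : Fin 10 → ℝ) :
    restrictTo φ₀ α x = restrictCovector (α (Fin.snoc x φ₀ : Fin 11 → ℝ)) := rfl

theorem pullCovector_single (i : Fin 10) :
    pullCovector (ExteriorAlgebra.ι ℝ (Pi.single i 1)) =
      ExteriorAlgebra.ι ℝ (Pi.single i.castSucc 1) := by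
  rw [pullCovector, ExteriorAlgebra.map_apply_ι]
  congr 1
  funext μ
  refine Fin.lastCases ?_ (fun j => ?_) μ
  · have h : ¬∃ j : Fin 10, j.castSucc = Fin.last 10 := by
      rintro ⟨j, hj⟩; exact (Fin.castSucc_lt_last j).ne hj
    change Function.extend Fin.castSucc (Pi.single i (1 : ℝ)) 0 (Fin.last 10) = _
    rw [Function.extend_apply' _ _ _ h, Pi.single_eq_of_ne (Fin.castSucc_lt_last i).ne']
    rfl
  · change Function.extend Fin.castSucc (Pi.single i (1 : ℝ)) 0 j.castSucc = _
    rw [(Fin.castSucc_injective 10).extend_apply]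
    simp [Pi.single_apply, Fin.castSucc_inj]

theorem restrictCovector_single (i : Fin 10) :
    restrictCovector (ExteriorAlgebra.ι ℝ (Pi.single i.castSucc 1)) =
      ExteriorAlgebra.ι ℝ (Pi.single i 1) := by
  rw [restrictCovector, ExteriorAlgebra.map_apply_ι]
  congr 1
  funext μ
  simp [LinearMap.funLeft_apply, Pi.single_apply, Fin.castSucc_inj]

theorem restrictCovector_single_last :
    restrictCovector (ExteriorAlgebra.ι ℝ (Pi.single (Fin.last 10) 1)) = 0 := by
  rw [restrictCovector, ExteriorAlgebra.map_apply_ι]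
  convert LinearMap.map_zero _
  funext μ
  simp [-Fin.reduceLast, LinearMap.funLeft_apply, (Fin.castSucc_lt_last μ).ne]

theorem restrictCovector_pullCovector (a : ExteriorAlgebra ℝ (Fin 10 → ℝ)) :
    restrictCovector (pullCovector a) = a := by
  have : restrictCovector.comp pullCovector = AlgHom.id ℝ _ := by
    apply ExteriorAlgebra.hom_ext
    refine (Pi.basisFun ℝ (Fin 10)).ext fun i => ?_
    simp [pullCovector_single, restrictCovector_single]
  exact DFunLike.congr_fun this a

theorem planePoint_add_castSucc (y : Fin 11 → ℝ) (t : ℝ) (i : Fin 10) :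
    planePoint (y + t • Pi.single i.castSucc 1) = planePoint y + t • Pi.single i 1 := by
  funext μ; simp [planePoint, Pi.single_apply, Fin.castSucc_inj]

theorem planePoint_add_last (y : Fin 11 → ℝ) (t : ℝ) :
    planePoint (y + t • Pi.single (Fin.last 10) 1) = planePoint y := by
  funext μ; simp [-Fin.reduceLast, planePoint, (Fin.castSucc_lt_last μ).ne]

theorem snoc_add_single (x : Fin 10 → ℝ) (φ₀ t : ℝ) (i : Fin 10) :
    (Fin.snoc (x + t • Pi.single i 1 : Fin 10 → ℝ) φ₀ : Fin 11 → ℝ) =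
      Fin.snoc x φ₀ + t • Pi.single i.castSucc 1 := by
  funext μ
  refine Fin.lastCases ?_ (fun j => ?_) μ
  · simp [-Fin.reduceLast, (Fin.castSucc_lt_last i).ne']
  · simp [Pi.single_apply, Fin.castSucc_inj]

theorem pullBack_hasExtD {α : Form 10} {y : Fin 11 → ℝ} {a : ExteriorAlgebra ℝ (Fin 10 → ℝ)}
    (h : HasExtD α a (planePoint y)) : HasExtD (pullBack α) (pullCovector a) y := by
  obtain ⟨p, hp, rfl⟩ := h
  refine ⟨Fin.snoc (fun i => pullCovector (p i)) 0, fun i => ?_, ?_⟩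
  · refine Fin.lastCases ?_ (fun j => ?_) i
    · simp only [pullBack_apply, planePoint_add_last, Fin.snoc_last]
      exact HasCurveDeriv.const _
    · simp only [pullBack_apply, planePoint_add_castSucc, Fin.snoc_castSucc]
      exact (hp j).map pullCovector.toLinearMap
  · conv_rhs => rw [Fin.sum_univ_castSucc]
    simp [-Fin.reduceLast, map_sum, pullCovector_single]

/-- Restriction kills dφ, and with it the one partial derivative that is not tangent to the plane.
-/
theorem restrictTo_hasExtD {α : Form 11} {φ₀ : ℝ} {x : Fin 10 → ℝ}
    {a : ExteriorAlgebra ℝ (Fin 11 → ℝ)} (h : HasExtD α a (Fin.snoc x φ₀)) :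
    HasExtD (restrictTo φ₀ α) (restrictCovector a) x := by
  obtain ⟨p, hp, rfl⟩ := h
  refine ⟨fun i => restrictCovector (p i.castSucc), fun i => ?_, ?_⟩
  · simp only [restrictTo_apply, snoc_add_single]
    exact (hp i.castSucc).map restrictCovector.toLinearMap
  · rw [Fin.sum_univ_castSucc]
    simp [-Fin.reduceLast, map_sum, restrictCovector_single, restrictCovector_single_last]

theorem SmoothForm.pullBack {U : Set (Fin 10 → ℝ)} {α : Form 10} (h : SmoothForm U α) :
    SmoothForm (bulkRegion U) (pullBack α) :=
  h.map pullCovector.toLinearMap contDiff_planePoint fun _ hy => hy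

theorem SmoothForm.restrictTo {U : Set (Fin 10 → ℝ)} {α : Form 11} (φ₀ : ℝ)
    (h : SmoothForm (bulkRegion U) α) : SmoothForm U (restrictTo φ₀ α) :=
  h.map restrictCovector.toLinearMap (contDiff_snoc φ₀) fun x hx => by
    rw [mem_bulkRegion, planePoint_snoc]; exact hx

theorem pullBack_mul (α β : Form 10) : pullBack (α * β) = pullBack α * pullBack β := by
  funext y; simp [pullBack_apply]

theorem dphi_apply (y : Fin 11 → ℝ) : dphi y = ExteriorAlgebra.ι ℝ (Pi.single (Fin.last 10) 1) := rfl

theorem isOdd_dphi (y : Fin 11 → ℝ) : IsOdd (dphi y) := isOdd_ι _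

theorem deltaForm_eq (ρ : ℝ → ℝ) (i : Fin 2) (y : Fin 11 → ℝ) :
    deltaForm ρ i y = ρ (y (Fin.last 10) - fixedPoint i) • dphi y := rfl

theorem hasExtD_of_hasDerivAt {f : ℝ → ℝ} {f' : ℝ} {y : Fin 11 → ℝ}
    (hf : HasDerivAt f f' (y (Fin.last 10))) (a : ExteriorAlgebra ℝ (Fin 11 → ℝ)) :
    HasExtD (fun z => f (z (Fin.last 10)) • a) (f' • (dphi y * a)) y := by
  refine ⟨Pi.single (Fin.last 10) (f' • a), fun i S => ?_, ?_⟩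
  · refine Fin.lastCases ?_ (fun j => ?_) i
    · have h1 : HasDerivAt (fun t : ℝ => y (Fin.last 10) + t) 1 0 :=
        (hasDerivAt_id (0 : ℝ)).const_add _
      have h2 : HasDerivAt f f' (y (Fin.last 10) + 0) := by simpa using hf
      have h3 := (h2.comp (0 : ℝ) h1).mul_const (coefficient S a)
      simpa [Function.comp_def] using h3
    · have : (Pi.single (Fin.last 10) (f' • a) : Fin 11 → _) j.castSucc = 0 :=
        Pi.single_eq_of_ne (Fin.castSucc_lt_last j).ne _
      rw [this]
      simpa [-Fin.reduceLast, Pi.single_apply, (Fin.castSucc_lt_last j).ne'] using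
        hasDerivAt_const (0 : ℝ) (f (y (Fin.last 10)) * coefficient S a)
  · rw [Finset.sum_eq_single (Fin.last 10)]
    · simp [dphi_apply]
    · intro j _ hj; rw [Pi.single_eq_of_ne hj, mul_zero]
    · simp

theorem smoothForm_of_contDiff {V : Set (Fin 11 → ℝ)} {f : ℝ → ℝ} (hf : ContDiff ℝ ∞ f)
    (a : ExteriorAlgebra ℝ (Fin 11 → ℝ)) :
    SmoothForm V fun z => f (z (Fin.last 10)) • a := fun S => by
  simp only [map_smul]
  exact ((hf.comp (contDiff_apply ℝ ℝ (Fin.last 10))).smul contDiff_const).contDiffOn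

theorem dphi_hasExtD (y : Fin 11 → ℝ) : HasExtD dphi 0 y := HasExtD.const _

theorem deltaForm_hasExtD {ρ : ℝ → ℝ} (hρ : ContDiff ℝ ∞ ρ) (i : Fin 2) (y : Fin 11 → ℝ) :
    HasExtD (deltaForm ρ i) 0 y := by
  have h1 : HasDerivAt (fun φ => ρ (φ - fixedPoint i))
      (deriv ρ (y (Fin.last 10) - fixedPoint i)) (y (Fin.last 10)) :=
    HasDerivAt.comp_sub_const (y (Fin.last 10)) (fixedPoint i)
      (hρ.differentiable (by simp)).differentiableAt.hasDerivAt
  have h2 := hasExtD_of_hasDerivAt h1 (dphi y)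
  rwa [(isOdd_dphi y).mul_self, smul_zero] at h2

/-- The regularised step function `ε₁`. -/
noncomputable def stepFun (ρ : ℝ → ℝ) (φ : ℝ) : ℝ :=
  ∫ t in (0 : ℝ)..φ, (2 * ρ t - 1 / Real.pi)

theorem stepForm_eq (ρ : ℝ → ℝ) (i : Fin 2) (y : Fin 11 → ℝ) :
    stepForm ρ i y = stepFun ρ (y (Fin.last 10) - fixedPoint i) • 1 :=
  Algebra.algebraMap_eq_smul_one _

theorem hasDerivAt_stepFun {ρ : ℝ → ℝ} (hρ : Continuous ρ) (φ : ℝ) :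
    HasDerivAt (stepFun ρ) (2 * ρ φ - 1 / Real.pi) φ := by
  have hc : Continuous fun t => 2 * ρ t - 1 / Real.pi := by fun_prop
  exact hc.integral_hasStrictDerivAt 0 φ |>.hasDerivAt

theorem contDiff_stepFun {ρ : ℝ → ℝ} (hρ : ContDiff ℝ ∞ ρ) : ContDiff ℝ ∞ (stepFun ρ) := by
  rw [contDiff_infty_iff_deriv]
  refine ⟨fun φ => (hasDerivAt_stepFun hρ.continuous φ).differentiableAt, ?_⟩
  have : deriv (stepFun ρ) = fun φ => 2 * ρ φ - 1 / Real.pi :=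
    funext fun φ => (hasDerivAt_stepFun hρ.continuous φ).deriv
  rw [this]
  fun_prop

theorem stepForm_hasExtD {ρ : ℝ → ℝ} (hρ : ContDiff ℝ ∞ ρ) (i : Fin 2) (y : Fin 11 → ℝ) :
    HasExtD (stepForm ρ i) ((2 : ℝ) • deltaForm ρ i y - (1 / Real.pi) • dphi y) y := by
  have h1 : HasDerivAt (fun φ => stepFun ρ (φ - fixedPoint i))
      (2 * ρ (y (Fin.last 10) - fixedPoint i) - 1 / Real.pi) (y (Fin.last 10)) :=
    HasDerivAt.comp_sub_const (y (Fin.last 10)) (fixedPoint i)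
      (hasDerivAt_stepFun hρ.continuous _)
  have h2 := hasExtD_of_hasDerivAt h1 1
  rw [mul_one, sub_smul, ← smul_smul, ← deltaForm_eq] at h2
  rw [show stepForm ρ i = _ from funext (stepForm_eq ρ i)]
  exact h2

theorem smooth_deltaForm {V : Set (Fin 11 → ℝ)} {ρ : ℝ → ℝ} (hρ : ContDiff ℝ ∞ ρ) (i : Fin 2) :
    SmoothForm V (deltaForm ρ i) :=
  smoothForm_of_contDiff (f := fun φ => ρ (φ - fixedPoint i)) (by fun_prop) _

theorem smooth_stepForm {V : Set (Fin 11 → ℝ)} {ρ : ℝ → ℝ} (hρ : ContDiff ℝ ∞ ρ) (i : Fin 2) :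
    SmoothForm V (stepForm ρ i) := by
  rw [show stepForm ρ i = _ from funext (stepForm_eq ρ i)]
  exact smoothForm_of_contDiff (f := fun φ => stepFun ρ (φ - fixedPoint i))
    ((contDiff_stepFun hρ).comp (contDiff_id.sub contDiff_const)) _

theorem smooth_dphi {V : Set (Fin 11 → ℝ)} : SmoothForm V dphi := SmoothForm.const _

theorem isEven_stepForm (ρ : ℝ → ℝ) (i : Fin 2) (y : Fin 11 → ℝ) : IsEven (stepForm ρ i y) :=
  isEven_algebraMap _

theorem isOdd_deltaForm (ρ : ℝ → ℝ) (i : Fin 2) (y : Fin 11 → ℝ) : IsOdd (deltaForm ρ i y) :=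
  (isOdd_dphi y).smul _

end Naturality

/-! ### Gauge transformations of field configurations -/

section FieldConfigurations

variable {𝔤 : Type*} [LieRing 𝔤] [LieAlgebra ℝ 𝔤] [FiniteDimensional ℝ 𝔤]
  {U : Set (Fin 10 → ℝ)} {Φ : Config (Module.finrank ℝ 𝔤)} {Λ : Param (Module.finrank ℝ 𝔤)}

theorem IsConnection.restrict {κ : Type*} {W : Matrix κ κ (Form 11)}
    (hW : IsConnection (bulkRegion U) W) (φ₀ : ℝ) : IsConnection U (W.map (restrictTo φ₀)) where
  smooth i j := (hW.smooth i j).restrictTo φ₀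
  odd x hx i j := (hW.odd _ (by rw [mem_bulkRegion, planePoint_snoc]; exact hx) i j).map _

theorem IsFieldConfig.spin_isConnection (hΦ : IsFieldConfig 𝔤 U Φ) :
    IsConnection (bulkRegion U) Φ.Ω := by
  obtain ⟨Ω, h1, -, -, -, h⟩ := hΦ.spin
  rw [h]
  exact isConnection_connectionForm id h1

theorem IsFieldConfig.planeSpin_isConnection (hΦ : IsFieldConfig 𝔤 U Φ) (i : Fin 2) :
    IsConnection U (planeSpin Φ i) where
  smooth a c := (hΦ.spin_isConnection.restrict (fixedPoint i)).smooth (Sum.inl a) (Sum.inl c)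
  odd x hx a c := (hΦ.spin_isConnection.restrict (fixedPoint i)).odd x hx (Sum.inl a) (Sum.inl c)

theorem IsFieldConfig.gauge_isConnection (hΦ : IsFieldConfig 𝔤 U Φ) (i : Fin 2) :
    IsConnection U (Φ.A i) := by
  obtain ⟨A, h1, h⟩ := hΦ.gauge i
  rw [h]
  exact isConnection_adMatrix h1

theorem IsGaugeParam.lorentz_isParameter (hΛ : IsGaugeParam 𝔤 U Λ) : IsParameter U Λ.L := by
  obtain ⟨L, h1, -, -, h⟩ := hΛ.lorentz
  rw [h]
  exact isParameter_parameterForm id h1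

theorem IsGaugeParam.gauge_isParameter (hΛ : IsGaugeParam 𝔤 U Λ) (i : Fin 2) :
    IsParameter U (Λ.g i) := by
  obtain ⟨L, h1, -, h⟩ := hΛ.gauge i
  rw [h]
  exact isParameter_adMatrix h1

theorem IsGaugeParam.bulk_isParameter (hΛ : IsGaugeParam 𝔤 U Λ) :
    IsParameter (bulkRegion U) (bulkParam Λ) where
  smooth i j := by
    rcases i with i | i <;> rcases j with j | j
    · exact (hΛ.lorentz_isParameter.smooth i j).pullBack
    all_goals exact SmoothForm.zero
  even y hy i j := by
    rcases i with i | i <;> rcases j with j | j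
    · exact (hΛ.lorentz_isParameter.even _ hy i j).map _
    all_goals exact IsEven.zero

theorem planeSpin_apply (Φ : Config (Module.finrank ℝ 𝔤)) (i : Fin 2) (a c : Fin 10)
    (x : Fin 10 → ℝ) : planeSpin Φ i a c x =
      restrictCovector (Φ.Ω (Sum.inl a) (Sum.inl c) (Fin.snoc x (fixedPoint i))) := rfl

theorem transformed_spin_apply (γ b : ℝ) (ρ : ℝ → ℝ) (s : ℝ) (j k : Fin 10 ⊕ Unit)
    (y : Fin 11 → ℝ) : (transformed γ b ρ Λ Φ s).Ω j k y =
      Φ.Ω j k y + s • gaugeVar (bulkParam Λ) Φ.Ω j k y := by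
  simp only [transformed, Matrix.add_apply, Matrix.smul_apply, Pi.add_apply, Pi.smul_apply]

/-- The parameter is independent of φ, so restriction recovers it; its remaining blocks are zero, so
the mixed components of Ω drop out of the upper-left block of the commutator. -/
theorem planeSpin_isGaugeFamily (hU : IsOpen U) (hΛ : IsGaugeParam 𝔤 U Λ)
    (γ b : ℝ) (ρ : ℝ → ℝ) (i : Fin 2) :
    IsGaugeFamily U Λ.L (planeSpin Φ i)
      (fun s => planeSpin (transformed γ b ρ Λ Φ s) i) := by
  intro s x hx
  ext a c
  have hd : extD (pullBack (Λ.L a c)) (Fin.snoc x (fixedPoint i)) =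
      pullCovector (extD (Λ.L a c) x) := by
    apply HasExtD.extD_eq
    apply pullBack_hasExtD
    rw [planePoint_snoc]
    exact (hΛ.lorentz_isParameter.smooth a c).hasExtD hU hx
  have h1 : gaugeVar Λ.L (planeSpin Φ i) a c x =
      restrictCovector (gaugeVar (bulkParam Λ) Φ.Ω (Sum.inl a) (Sum.inl c)
        (Fin.snoc x (fixedPoint i))) := by
    have hm : matD (bulkParam Λ) (Sum.inl a) (Sum.inl c) = extD (pullBack (Λ.L a c)) := by
      simp only [matD, bulkParam, Matrix.fromBlocks_apply₁₁, Matrix.map_apply]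
    have hm' : matD Λ.L a c = extD (Λ.L a c) := by
      simp only [matD, Matrix.map_apply]
    have hb : ∀ j k, bulkParam Λ (Sum.inl j) (Sum.inl k) = pullBack (Λ.L j k) := fun _ _ => by
      simp only [bulkParam, Matrix.fromBlocks_apply₁₁, Matrix.map_apply]
    have hb1 : ∀ j k, bulkParam Λ (Sum.inl j) (Sum.inr k) = 0 := fun _ _ => by
      simp only [bulkParam, Matrix.fromBlocks_apply₁₂, Matrix.zero_apply]
    have hb2 : ∀ j k, bulkParam Λ (Sum.inr j) (Sum.inl k) = 0 := fun _ _ => by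
      simp only [bulkParam, Matrix.fromBlocks_apply₂₁, Matrix.zero_apply]
    simp only [gaugeVar, Matrix.sub_apply, Matrix.add_apply,
      Matrix.mul_apply, Pi.add_apply, Pi.sub_apply, Fintype.sum_sum_type, Finset.sum_apply,
      Pi.mul_apply, hm, hm', hb, hb1, hb2, mul_zero, zero_mul,
      Finset.sum_const_zero, add_zero, hd, map_add, map_sub, map_sum, map_mul,
      restrictCovector_pullCovector, pullBack_apply, planePoint_snoc, planeSpin_apply]
  rw [Matrix.add_apply, Matrix.smul_apply]
  simp only [evalMat, Matrix.map_apply]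
  rw [h1, planeSpin_apply, planeSpin_apply, transformed_spin_apply, map_add, map_smul]

theorem gauge_isGaugeFamily (γ b : ℝ) (ρ : ℝ → ℝ) (i : Fin 2) :
    IsGaugeFamily U (Λ.g i) (Φ.A i) (fun s => (transformed γ b ρ Λ Φ s).A i) :=
  isGaugeFamily_add_smul _ _ _

theorem spin_isGaugeFamily (γ b : ℝ) (ρ : ℝ → ℝ) :
    IsGaugeFamily (bulkRegion U) (bulkParam Λ) Φ.Ω (fun s => (transformed γ b ρ Λ Φ s).Ω) :=
  isGaugeFamily_add_smul _ _ _

end FieldConfigurations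

theorem HasCurveDeriv.of_eq {N : ℕ} {c : ℝ → ExteriorAlgebra ℝ (Fin N → ℝ)}
    {a a' : ExteriorAlgebra ℝ (Fin N → ℝ)} (h : HasCurveDeriv c a) (e : a' = a) :
    HasCurveDeriv c a' := e ▸ h

theorem HasExtD.of_eq {N : ℕ} {α : Form N} {a a' : ExteriorAlgebra ℝ (Fin N → ℝ)}
    {x : Fin N → ℝ} (h : HasExtD α a x) (e : a' = a) : HasExtD α a' x := e ▸ h

/-! ### The field strength G: Bianchi identity and invariance -/

section FieldStrength

variable {𝔤 : Type*} [LieRing 𝔤] [LieAlgebra ℝ 𝔤] [FiniteDimensional ℝ 𝔤]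
  {U : Set (Fin 10 → ℝ)} {Φ : Config (Module.finrank ℝ 𝔤)} {Λ : Param (Module.finrank ℝ 𝔤)}
  {ρ : ℝ → ℝ} {y : Fin 11 → ℝ}

theorem IsFieldConfig.smooth_planeThree (hU : IsOpen U) (hΦ : IsFieldConfig 𝔤 U Φ) (i : Fin 2) :
    SmoothForm (bulkRegion U) (pullBack (planeThree Φ i)) :=
  (smooth_threeForm hU (hΦ.planeSpin_isConnection i) (hΦ.gauge_isConnection i)).pullBack

theorem IsFieldConfig.smooth_planeFour (hU : IsOpen U) (hΦ : IsFieldConfig 𝔤 U Φ) (i : Fin 2) :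
    SmoothForm (bulkRegion U) (pullBack (planeFour Φ i)) :=
  (smooth_fourFormOf hU (hΦ.planeSpin_isConnection i) (hΦ.gauge_isConnection i)).pullBack

theorem IsFieldConfig.smooth_planeTwo (hU : IsOpen U) (hΦ : IsFieldConfig 𝔤 U Φ)
    (hΛ : IsGaugeParam 𝔤 U Λ) (i : Fin 2) :
    SmoothForm (bulkRegion U) (pullBack (planeTwo Λ Φ i)) :=
  (smooth_twoForm hU (hΦ.planeSpin_isConnection i) (hΦ.gauge_isConnection i)
    hΛ.lorentz_isParameter (hΛ.gauge_isParameter i)).pullBack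

theorem IsFieldConfig.planeThree_hasExtD (hU : IsOpen U) (hΦ : IsFieldConfig 𝔤 U Φ) (i : Fin 2)
    (hy : y ∈ bulkRegion U) :
    HasExtD (pullBack (planeThree Φ i)) (pullBack (planeFour Φ i) y) y :=
  pullBack_hasExtD (threeForm_hasExtD hU (hΦ.planeSpin_isConnection i)
    (hΦ.gauge_isConnection i) hy)

theorem IsFieldConfig.planeFour_closed (hU : IsOpen U) (hΦ : IsFieldConfig 𝔤 U Φ) (i : Fin 2)
    (hy : y ∈ bulkRegion U) : HasExtD (pullBack (planeFour Φ i)) 0 y := by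
  have := pullBack_hasExtD (y := y) (fourFormOf_closed hU (hΦ.planeSpin_isConnection i)
    (hΦ.gauge_isConnection i) hy)
  rwa [map_zero] at this

theorem IsFieldConfig.even_planeFour (hU : IsOpen U) (hΦ : IsFieldConfig 𝔤 U Φ) (i : Fin 2)
    (hy : y ∈ bulkRegion U) : IsEven (pullBack (planeFour Φ i) y) :=
  (even_fourFormOf hU (hΦ.planeSpin_isConnection i) (hΦ.gauge_isConnection i) hy).map _

theorem IsFieldConfig.odd_planeThree (hU : IsOpen U) (hΦ : IsFieldConfig 𝔤 U Φ) (i : Fin 2)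
    (hy : y ∈ bulkRegion U) : IsOdd (pullBack (planeThree Φ i) y) :=
  (odd_threeForm hU (hΦ.planeSpin_isConnection i) (hΦ.gauge_isConnection i) hy).map _

theorem IsFieldConfig.even_planeTwo (hU : IsOpen U) (hΦ : IsFieldConfig 𝔤 U Φ)
    (hΛ : IsGaugeParam 𝔤 U Λ) (i : Fin 2) (hy : y ∈ bulkRegion U) :
    IsEven (pullBack (planeTwo Λ Φ i) y) :=
  (even_twoForm hU (hΦ.planeSpin_isConnection i) (hΦ.gauge_isConnection i)
    hΛ.lorentz_isParameter (hΛ.gauge_isParameter i) hy).map _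

theorem IsFieldConfig.smooth_C (hΦ : IsFieldConfig 𝔤 U Φ) : SmoothForm (bulkRegion U) Φ.C := by
  obtain ⟨B, -, hB, -, h⟩ := hΦ.form
  rw [h]
  exact hB.mul smooth_dphi

theorem IsFieldConfig.odd_C (hΦ : IsFieldConfig 𝔤 U Φ) (y : Fin 11 → ℝ) : IsOdd (Φ.C y) := by
  obtain ⟨B, hB, -, -, h⟩ := hΦ.form
  rw [h]
  exact (isEven_of_mem_exteriorPower_two (hB y)).mul_odd (isOdd_dphi y)

/-- From C = B̃ ∧ dφ follows dC = dB̃ ∧ dφ, which another dφ annihilates. -/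
theorem IsFieldConfig.dphi_mul_extD_C (hU : IsOpen U) (hΦ : IsFieldConfig 𝔤 U Φ)
    (hy : y ∈ bulkRegion U) : dphi y * extD Φ.C y = 0 := by
  obtain ⟨B, -, hB, -, h⟩ := hΦ.form
  have h1 := (hB.hasExtD (isOpen_bulkRegion hU) hy).mul (dphi_hasExtD y)
  rw [mul_zero, add_zero] at h1
  rw [h, h1.extD_eq, ← mul_assoc, (isOdd_dphi y).mul_mul_self]

theorem IsFieldConfig.even_extD_C (hU : IsOpen U) (hΦ : IsFieldConfig 𝔤 U Φ)
    (hy : y ∈ bulkRegion U) : IsEven (extD Φ.C y) :=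
  (hΦ.smooth_C.hasExtD (isOpen_bulkRegion hU) hy).isEven
    (Filter.Eventually.of_forall fun z => hΦ.odd_C z)

theorem fieldG_apply (γ b : ℝ) (ρ : ℝ → ℝ) (Φ : Config (Module.finrank ℝ 𝔤)) (y : Fin 11 → ℝ) :
    fieldG γ b ρ Φ y = extD Φ.C y
      - ((1 - b) * γ) • ∑ i, deltaForm ρ i y * pullBack (planeThree Φ i) y
      + (b * γ / 2) • ∑ i, stepForm ρ i y * pullBack (planeFour Φ i) y
      - (b * γ / (2 * Real.pi)) • ∑ i, dphi y * pullBack (planeThree Φ i) y := by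
  simp [fieldG]

theorem IsFieldConfig.smooth_fieldG (hU : IsOpen U) (hΦ : IsFieldConfig 𝔤 U Φ)
    (hρ : ContDiff ℝ ∞ ρ) (γ b : ℝ) : SmoothForm (bulkRegion U) (fieldG γ b ρ Φ) := by
  refine SmoothForm.sub (SmoothForm.add (SmoothForm.sub
    (hΦ.smooth_C.extD (isOpen_bulkRegion hU)) ?_) ?_) ?_
  · exact (SmoothForm.sum fun i _ =>
      (smooth_deltaForm hρ i).mul (hΦ.smooth_planeThree hU i)).smul _
  · exact (SmoothForm.sum fun i _ =>
      (smooth_stepForm hρ i).mul (hΦ.smooth_planeFour hU i)).smul _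
  · exact (SmoothForm.sum fun i _ => smooth_dphi.mul (hΦ.smooth_planeThree hU i)).smul _

theorem IsFieldConfig.even_fieldG (hU : IsOpen U) (hΦ : IsFieldConfig 𝔤 U Φ) (γ b : ℝ)
    (hy : y ∈ bulkRegion U) : IsEven (fieldG γ b ρ Φ y) := by
  rw [fieldG_apply]
  refine IsEven.sub (IsEven.add (IsEven.sub (hΦ.even_extD_C hU hy) ?_) ?_) ?_
  · exact (IsEven.sum fun i _ => (isOdd_deltaForm ρ i y).mul (hΦ.odd_planeThree hU i hy)).smul _
  · exact (IsEven.sum fun i _ => (isEven_stepForm ρ i y).mul (hΦ.even_planeFour hU i hy)).smul _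
  · exact (IsEven.sum fun i _ => (isOdd_dphi y).mul (hΦ.odd_planeThree hU i hy)).smul _

/-- The Bianchi identity `dG = γ ∑ δᵢ Ī₄ᵢ`. -/
theorem IsFieldConfig.fieldG_hasExtD (hU : IsOpen U) (hΦ : IsFieldConfig 𝔤 U Φ)
    (hρ : ContDiff ℝ ∞ ρ) (γ b : ℝ) (hy : y ∈ bulkRegion U) :
    HasExtD (fieldG γ b ρ Φ) (γ • ∑ i, deltaForm ρ i y * pullBack (planeFour Φ i) y) y := by
  have h0 := hΦ.smooth_C.hasExtD_extD (isOpen_bulkRegion hU) hy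
  have h1 := (HasExtD.sum Finset.univ fun i _ =>
    (deltaForm_hasExtD hρ i y).mul (hΦ.planeThree_hasExtD hU i hy)).smul ((1 - b) * γ)
  have h2 := (HasExtD.sum Finset.univ fun i _ =>
    (stepForm_hasExtD hρ i y).mul (hΦ.planeFour_closed hU i hy)).smul (b * γ / 2)
  have h3 := (HasExtD.sum Finset.univ fun i _ =>
    (dphi_hasExtD y).mul (hΦ.planeThree_hasExtD hU i hy)).smul (b * γ / (2 * Real.pi))
  have h := ((h0.sub h1).add h2).sub h3
  refine h.of_eq ?_
  -- The δ-terms add up with weights (1 - b) and b, the latter from dε = 2δ - dφ/π; the two dφ-terms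
  -- cancel.
  simp only [(isOdd_deltaForm ρ _ y).1, (isOdd_dphi y).1, zero_mul, mul_zero, zero_add, add_zero,
    neg_mul, sub_mul, smul_mul_assoc, Fin.sum_univ_two]
  have hpi := Real.pi_ne_zero
  match_scalars <;> field_simp <;> ring

/-- Every other term of G already contains dφ, for δ is a multiple of dφ. This is what makes the
inflow cubic in plane quantities. -/
theorem IsFieldConfig.dphi_mul_fieldG (hU : IsOpen U) (hΦ : IsFieldConfig 𝔤 U Φ) (γ b : ℝ)
    (hy : y ∈ bulkRegion U) : dphi y * fieldG γ b ρ Φ y =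
      dphi y * ((b * γ / 2) • ∑ i, stepForm ρ i y * pullBack (planeFour Φ i) y) := by
  have h1 : ∀ i, dphi y * (deltaForm ρ i y * pullBack (planeThree Φ i) y) = 0 := fun i => by
    rw [deltaForm_eq, smul_mul_assoc, mul_smul_comm, ← mul_assoc, (isOdd_dphi y).mul_self,
      zero_mul, smul_zero]
  have h2 : ∀ i, dphi y * (dphi y * pullBack (planeThree Φ i) y) = 0 := fun i => by
    rw [← mul_assoc, (isOdd_dphi y).mul_self, zero_mul]
  rw [fieldG_apply, mul_sub, mul_add, mul_sub, hΦ.dphi_mul_extD_C hU hy]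
  simp only [mul_smul_comm, Finset.mul_sum, h1, h2]
  simp

section Variation

variable (γ b : ℝ)

theorem IsFieldConfig.planeThree_hasVariation (hU : IsOpen U) (hΦ : IsFieldConfig 𝔤 U Φ)
    (hΛ : IsGaugeParam 𝔤 U Λ) (i : Fin 2) (hy : y ∈ bulkRegion U) :
    HasCurveDeriv (fun s => pullBack (planeThree (transformed γ b ρ Λ Φ s) i) y)
      (extD (pullBack (planeTwo Λ Φ i)) y) := by
  have h1 := threeForm_descent hU (hΦ.planeSpin_isConnection i) (hΦ.gauge_isConnection i)
    hΛ.lorentz_isParameter (hΛ.gauge_isParameter i)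
    (planeSpin_isGaugeFamily hU hΛ γ b ρ i) (gauge_isGaugeFamily γ b ρ i) hy
  have h2 : HasExtD (planeTwo Λ Φ i) (extD (planeTwo Λ Φ i) (planePoint y)) (planePoint y) :=
    (smooth_twoForm hU (hΦ.planeSpin_isConnection i) (hΦ.gauge_isConnection i)
      hΛ.lorentz_isParameter (hΛ.gauge_isParameter i)).hasExtD hU hy
  rw [(pullBack_hasExtD h2).extD_eq]
  have h3 := h1.map pullCovector.toLinearMap
  simp only [AlgHom.toLinearMap_apply] at h3
  simp only [pullBack_apply]
  refine h3.of_eq ?_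
  rfl

theorem IsFieldConfig.planeFour_hasVariation (hU : IsOpen U) (hΦ : IsFieldConfig 𝔤 U Φ)
    (hΛ : IsGaugeParam 𝔤 U Λ) (i : Fin 2) (hy : y ∈ bulkRegion U) :
    HasCurveDeriv (fun s => pullBack (planeFour (transformed γ b ρ Λ Φ s) i) y) 0 := by
  have h1 := fourFormOf_hasVariation hU (hΦ.planeSpin_isConnection i) (hΦ.gauge_isConnection i)
    hΛ.lorentz_isParameter (hΛ.gauge_isParameter i)
    (planeSpin_isGaugeFamily hU hΛ γ b ρ i) (gauge_isGaugeFamily γ b ρ i) hy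
  have h2 := h1.map pullCovector.toLinearMap
  have e : pullCovector.toLinearMap 0 = 0 := map_zero pullCovector.toLinearMap
  rw [e] at h2
  exact h2

theorem IsFieldConfig.planeTwo_hasExtD (hU : IsOpen U) (hΦ : IsFieldConfig 𝔤 U Φ)
    (hΛ : IsGaugeParam 𝔤 U Λ) (i : Fin 2) (hy : y ∈ bulkRegion U) :
    HasExtD (pullBack (planeTwo Λ Φ i)) (extD (pullBack (planeTwo Λ Φ i)) y) y :=
  (hΦ.smooth_planeTwo hU hΛ i).hasExtD (isOpen_bulkRegion hU) hy

theorem IsFieldConfig.deltaC_hasExtD (hU : IsOpen U) (hΦ : IsFieldConfig 𝔤 U Φ)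
    (hΛ : IsGaugeParam 𝔤 U Λ) (hρ : ContDiff ℝ ∞ ρ) (hy : y ∈ bulkRegion U) :
    HasExtD (deltaC γ b ρ Λ Φ)
      (γ • ∑ i, ((b - 1) • (-(deltaForm ρ i y * extD (pullBack (planeTwo Λ Φ i)) y))
        - (b / (2 * Real.pi)) • (-(dphi y * extD (pullBack (planeTwo Λ Φ i)) y)))) y := by
  have h := (HasExtD.sum Finset.univ fun i _ =>
    (((deltaForm_hasExtD hρ i y).mul (hΦ.planeTwo_hasExtD hU hΛ i hy)).smul (b - 1)).sub
    (((dphi_hasExtD y).mul (hΦ.planeTwo_hasExtD hU hΛ i hy)).smul (b / (2 * Real.pi)))).smul γ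
  simp only [(isOdd_deltaForm ρ _ y).1, (isOdd_dphi y).1, zero_mul, zero_add, neg_mul] at h
  exact h

/-- Gauge invariance of `G`. -/
theorem IsFieldConfig.fieldG_hasVariation (hU : IsOpen U) (hΦ : IsFieldConfig 𝔤 U Φ)
    (hΛ : IsGaugeParam 𝔤 U Λ) (hρ : ContDiff ℝ ∞ ρ) (hy : y ∈ bulkRegion U) :
    HasCurveDeriv (fun s => fieldG γ b ρ (transformed γ b ρ Λ Φ s) y) 0 := by
  have hC : ∀ s, extD (transformed γ b ρ Λ Φ s).C y = extD Φ.C y +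
      s • (γ • ∑ i, ((b - 1) • (-(deltaForm ρ i y * extD (pullBack (planeTwo Λ Φ i)) y))
        - (b / (2 * Real.pi)) • (-(dphi y * extD (pullBack (planeTwo Λ Φ i)) y)))) := fun s =>
    ((hΦ.smooth_C.hasExtD (isOpen_bulkRegion hU) hy).add
      ((hΦ.deltaC_hasExtD γ b hU hΛ hρ hy).smul s)).extD_eq
  have h0 := HasCurveDeriv.linear (extD Φ.C y)
    (γ • ∑ i, ((b - 1) • (-(deltaForm ρ i y * extD (pullBack (planeTwo Λ Φ i)) y))
        - (b / (2 * Real.pi)) • (-(dphi y * extD (pullBack (planeTwo Λ Φ i)) y))))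
  simp only [← hC] at h0
  have h1 := (HasCurveDeriv.sum Finset.univ fun i _ => (HasCurveDeriv.const (deltaForm ρ i y)).mul
    (hΦ.planeThree_hasVariation (ρ := ρ) γ b hU hΛ i hy)).smul (-((1 - b) * γ))
  have h2 := (HasCurveDeriv.sum Finset.univ fun i _ => (HasCurveDeriv.const (stepForm ρ i y)).mul
    (hΦ.planeFour_hasVariation (ρ := ρ) γ b hU hΛ i hy)).smul (b * γ / 2)
  have h3 := (HasCurveDeriv.sum Finset.univ fun i _ => (HasCurveDeriv.const (dphi y)).mul
    (hΦ.planeThree_hasVariation (ρ := ρ) γ b hU hΛ i hy)).smul (-(b * γ / (2 * Real.pi)))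
  have h := ((h0.add h1).add h2).add h3
  simp only [fieldG_apply, sub_eq_add_neg (_ : ExteriorAlgebra ℝ (Fin 11 → ℝ)), ← neg_smul]
  refine h.of_eq ?_
  -- Ī₄ is invariant, and the terms of d(δC) cancel the variations dω̄¹ multiplied by δ and by dφ
  -- separately.
  simp only [zero_mul, mul_zero, zero_add, add_zero, Fin.sum_univ_two]
  have hpi := Real.pi_ne_zero
  match_scalars <;> field_simp <;> ring

/-- All terms proportional to b combine into an exact form, because d(εω̄¹) = (2δ - dφ/π)ω̄¹ + ε
dω̄¹. This is the purpose of the correction in C̃. -/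
theorem IsFieldConfig.fieldCtilde_hasVariation (hU : IsOpen U) (hΦ : IsFieldConfig 𝔤 U Φ)
    (hΛ : IsGaugeParam 𝔤 U Λ) (hρ : ContDiff ℝ ∞ ρ) (hy : y ∈ bulkRegion U) :
    HasCurveDeriv (fun s => fieldCtilde γ b ρ (transformed γ b ρ Λ Φ s) y)
      (γ • ∑ i, (-(deltaForm ρ i y * pullBack (planeTwo Λ Φ i) y)
        + (b / 2) • extD (stepForm ρ i * pullBack (planeTwo Λ Φ i)) y)) := by
  have hd := fun i =>
    ((stepForm_hasExtD hρ i y).mul (hΦ.planeTwo_hasExtD hU hΛ i hy)).extD_eq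
  have h0 : HasCurveDeriv (fun s => (transformed γ b ρ Λ Φ s).C y) (deltaC γ b ρ Λ Φ y) :=
    HasCurveDeriv.linear _ _
  have h1 := (HasCurveDeriv.sum Finset.univ fun i _ => (HasCurveDeriv.const (stepForm ρ i y)).mul
    (hΦ.planeThree_hasVariation (ρ := ρ) γ b hU hΛ i hy)).smul (b * γ / 2)
  have h := h0.add h1
  have e2 : (fun s => fieldCtilde γ b ρ (transformed γ b ρ Λ Φ s) y) = fun s =>
      (transformed γ b ρ Λ Φ s).C y + (b * γ / 2) • ∑ i, stepForm ρ i y *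
        pullBack (planeThree (transformed γ b ρ Λ Φ s) i) y := by
    funext s
    simp [fieldCtilde]
  rw [e2]
  refine h.of_eq ?_
  simp only [hd, (isEven_stepForm ρ _ y).1, deltaC, Pi.smul_apply, Pi.add_apply, Pi.sub_apply,
    Pi.mul_apply, zero_mul, zero_add, sub_mul, smul_mul_assoc, Fin.sum_univ_two]
  have hpi := Real.pi_ne_zero
  match_scalars <;> field_simp <;> ring

end Variation

end FieldStrength

/-! ### Top-degree coefficients and the factor dφ -/

section TopDegree

theorem orderEmbOfFin_univ {n : ℕ} (h : (Finset.univ : Finset (Fin n)).card = n) (j : Fin n) :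
    (Finset.univ : Finset (Fin n)).orderEmbOfFin h j = j := by
  have := Finset.orderEmbOfFin_unique' h (f := RelEmbedding.refl _) fun x => Finset.mem_univ _
  rw [← this]
  rfl

theorem coefficient_univ_ιMulti {N n : ℕ} (v : Fin n → Fin N → ℝ) :
    coefficient Finset.univ (ExteriorAlgebra.ιMulti ℝ n v) =
      if h : N = n then Matrix.det (Matrix.of fun i j => v (Fin.cast h i) j) else 0 := by
  rw [coefficient_ιMulti]
  by_cases h : N = n
  · subst h
    rw [dif_pos (Finset.card_fin N), dif_pos rfl]
    simp only [orderEmbOfFin_univ]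
    rfl
  · rw [dif_neg h, dif_neg (by rwa [Finset.card_fin])]

/-- Laplace expansion along the row of dφ, whose only entry is in the last column, leaves the
determinant of the restricted covectors. -/
theorem coefficient_univ_last_mul (a : ExteriorAlgebra ℝ (Fin 11 → ℝ)) :
    coefficient Finset.univ (ExteriorAlgebra.ι ℝ (Pi.single (Fin.last 10) 1) * a) =
      coefficient Finset.univ (restrictCovector a) := by
  have : (coefficient Finset.univ).comp (LinearMap.mulLeft ℝ
      (ExteriorAlgebra.ι ℝ (Pi.single (Fin.last 10) (1 : ℝ)))) =
      (coefficient Finset.univ).comp restrictCovector.toLinearMap := by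
    refine ExteriorAlgebra.lhom_ext fun n => AlternatingMap.ext fun v => ?_
    simp only [LinearMap.compAlternatingMap_apply, LinearMap.comp_apply, LinearMap.mulLeft_apply,
      AlgHom.toLinearMap_apply, restrictCovector, ExteriorAlgebra.map_apply_ιMulti]
    have h1 : ExteriorAlgebra.ι ℝ (Pi.single (Fin.last 10) (1 : ℝ)) * ExteriorAlgebra.ιMulti ℝ n v
        = ExteriorAlgebra.ιMulti ℝ (n + 1) (Fin.cons (Pi.single (Fin.last 10) 1) v) := by
      rw [ExteriorAlgebra.ιMulti_succ_apply]
      rfl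
    rw [h1, coefficient_univ_ιMulti, coefficient_univ_ιMulti]
    by_cases h : n = 10
    · subst h
      rw [dif_pos rfl, dif_pos rfl, Matrix.det_succ_row_zero, Finset.sum_eq_single (Fin.last 10)]
      · simp only [Fin.cast_refl, Matrix.of_apply, id, Fin.cons_zero, Pi.single_eq_same]
        -- The sign is (-1)¹⁰ = 1, so integrating over φ introduces no orientation sign.
        rw [Fin.val_last, Even.neg_one_pow (by decide), one_mul, one_mul]
        congr 1
        ext i j
        simp [Matrix.submatrix_apply, LinearMap.funLeft_apply, -Fin.reduceLast]
      · intro j _ hj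
        simp [-Fin.reduceLast, Pi.single_eq_of_ne hj]
      · simp
    · rw [dif_neg (by omega), dif_neg (by omega)]
  exact DFunLike.congr_fun this a

end TopDegree

/-! ### Extension by zero -/

section CompactSupport

variable {U : Set (Fin 10 → ℝ)} {K : Set (Fin 10 → ℝ)} {α : Form 11}

/-- The form is smooth over the open set U and zero over the open complement of K, and these two
sets cover everything. -/
theorem smoothForm_univ_of_support (hKU : K ⊆ U) (hK : IsCompact K)
    (hU : IsOpen U) (h : SmoothForm (bulkRegion U) α) (h0 : ∀ y, planePoint y ∉ K → α y = 0) :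
    SmoothForm Set.univ α := fun S => by
  rw [contDiffOn_univ, contDiff_iff_contDiffAt]
  intro y
  by_cases hy : planePoint y ∈ U
  · exact (h S).contDiffAt ((isOpen_bulkRegion hU).mem_nhds hy)
  · have hy' : planePoint y ∈ Kᶜ := fun hh => hy (hKU hh)
    have h1 : ∀ᶠ z in nhds y, planePoint z ∈ Kᶜ :=
      contDiff_planePoint.continuous.continuousAt.eventually_mem
        (hK.isClosed.isOpen_compl.mem_nhds hy')
    refine (contDiffAt_const (c := (0 : ℝ))).congr_of_eventuallyEq ?_
    filter_upwards [h1] with z hz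
    rw [h0 z hz, map_zero]

theorem extD_eq_zero_of_support (hK : IsCompact K) (h0 : ∀ y, planePoint y ∉ K → α y = 0)
    {y : Fin 11 → ℝ} (hy : planePoint y ∉ K) : extD α y = 0 := by
  have h1 : ∀ᶠ z in nhds y, planePoint z ∈ Kᶜ :=
    contDiff_planePoint.continuous.continuousAt.eventually_mem
      (hK.isClosed.isOpen_compl.mem_nhds hy)
  refine (HasExtD.zero.congr ?_).extD_eq
  filter_upwards [h1] with z hz
  exact h0 z hz

end CompactSupport

/-! ### Integration over U × S¹: Stokes and Fubini -/

section BulkIntegral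

open MeasureTheory

/-- The part of the covering space over the period `(-π, π]`. -/
def periodSlab : Set (Fin 11 → ℝ) := {y | y (Fin.last 10) ∈ Set.Ioc (-Real.pi) Real.pi}

theorem mem_periodSlab {y : Fin 11 → ℝ} :
    y ∈ periodSlab ↔ y (Fin.last 10) ∈ Set.Ioc (-Real.pi) Real.pi := Iff.rfl

variable {K : Set (Fin 10 → ℝ)} {f : (Fin 11 → ℝ) → ℝ}

theorem exists_box (hK : IsCompact K) : ∃ M : ℝ, 0 < M ∧ ∀ x ∈ K, ∀ μ, |x μ| < M := by
  obtain ⟨M, hM⟩ := hK.isBounded.subset_ball 0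
  refine ⟨max M 1, by positivity, fun x hx μ => ?_⟩
  have := hM.trans (Metric.ball_subset_ball (le_max_left M 1)) hx
  rw [mem_ball_zero_iff] at this
  exact (norm_le_pi_norm x μ).trans_lt this

/-- The lower and upper corners of a box in the covering space. -/
def boxCorner (M t : ℝ) : Fin 11 → ℝ := Fin.snoc (fun _ : Fin 10 => M) t

theorem periodSlab_box (hf0 : ∀ y, planePoint y ∉ K → f y = 0) {M : ℝ}
    (hM : ∀ x ∈ K, ∀ μ, |x μ| < M) :
    (∫ y in periodSlab, f y) =
      ∫ y in Set.Icc (boxCorner (-M) (-Real.pi)) (boxCorner M Real.pi), f y := by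
  rw [volume_pi, ← setIntegral_congr_set Measure.univ_pi_Ioc_ae_eq_Icc]
  refine setIntegral_eq_of_subset_of_forall_sdiff_eq_zero ?_ ?_ ?_
  · exact measurableSet_Ioc.preimage (measurable_pi_apply _)
  · intro y hy
    have := hy (Fin.last 10) (Set.mem_univ _)
    simpa [boxCorner, mem_periodSlab, -Fin.reduceLast] using this
  · rintro y ⟨hy, hy'⟩
    refine hf0 y fun hK => hy' fun μ _ => ?_
    refine Fin.lastCases ?_ (fun μ => ?_) μ
    · simpa [boxCorner, -Fin.reduceLast] using mem_periodSlab.mp hy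
    · have := abs_lt.mp (hM _ hK μ)
      simpa [boxCorner] using ⟨this.1, this.2.le⟩

theorem integrableOn_periodSlab (hK : IsCompact K) (hf : Continuous f)
    (hf0 : ∀ y, planePoint y ∉ K → f y = 0) : IntegrableOn f periodSlab := by
  obtain ⟨M, -, hM⟩ := exists_box hK
  have h1 : IntegrableOn f (Set.Icc (boxCorner (-M) (-Real.pi)) (boxCorner M Real.pi)) :=
    hf.continuousOn.integrableOn_compact isCompact_Icc
  refine h1.of_forall_sdiff_eq_zero (measurableSet_Ioc.preimage (measurable_pi_apply _)) ?_
  rintro y ⟨hy, hy'⟩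
  refine hf0 y fun hK => hy' ⟨fun μ => ?_, fun μ => ?_⟩
  all_goals
    refine Fin.lastCases ?_ (fun μ => ?_) μ
    · simpa [boxCorner, -Fin.reduceLast] using (by first | exact hy.1.le | exact hy.2)
    · have := abs_lt.mp (hM _ hK μ)
      simpa [boxCorner] using (by first | exact this.1.le | exact this.2.le)

theorem bulkIntegral_eq {U : Set (Fin 10 → ℝ)} (hU : IsOpen U) (hKU : K ⊆ U) {L : Form 11}
    (hL : ∀ y ∈ bulkRegion U, coefficient Finset.univ (L y) = f y)
    (hf0 : ∀ y, planePoint y ∉ K → f y = 0) : bulkIntegral U L = ∫ y in periodSlab, f y := by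
  have hm : MeasurableSet periodSlab := measurableSet_Ioc.preimage (measurable_pi_apply _)
  have hm' : MeasurableSet {y | y ∈ bulkRegion U ∧ y (Fin.last 10) ∈
      Set.Ioc (-Real.pi) Real.pi} := (isOpen_bulkRegion hU).measurableSet.inter hm
  unfold bulkIntegral
  rw [setIntegral_congr_fun hm' fun y hy => hL y hy.1]
  refine (setIntegral_eq_of_subset_of_forall_sdiff_eq_zero hm (fun y hy => hy.2) ?_).symm
  rintro y ⟨hy, hy'⟩
  exact hf0 y fun h => hy' ⟨hKU h, hy⟩

/-- Stokes' theorem on `U × S¹`. -/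
theorem integral_extD_eq_zero (hK : IsCompact K) {α : Form 11} (hα : SmoothForm Set.univ α)
    (h0 : ∀ y, planePoint y ∉ K → α y = 0)
    (hper : ∀ y : Fin 11 → ℝ, α (y + Pi.single (Fin.last 10) (2 * Real.pi)) = α y) :
    (∫ y in periodSlab, coefficient Finset.univ (extD α y)) = 0 := by
  obtain ⟨M, hM0, hM⟩ := exists_box hK
  let l (i : Fin 11) : ExteriorAlgebra ℝ (Fin 11 → ℝ) →ₗ[ℝ] ℝ :=
    (coefficient Finset.univ).comp (LinearMap.mulLeft ℝ (ExteriorAlgebra.ι ℝ (Pi.single i 1)))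
  have hl : ∀ i, ContDiff ℝ ∞ fun y => l i (α y) := fun i =>
    contDiffOn_univ.mp (hα.functional (l i))
  have hd : ∀ i y, fderiv ℝ (fun y => l i (α y)) y (Pi.single i 1) =
      l i (partialDeriv i α y) := fun i y => by
    have h1 := (hα.hasCurveDeriv isOpen_univ i (Set.mem_univ y)).functional (l i)
    exact (((hl i).differentiable (by simp) y).hasFDerivAt.hasLineDerivAt _).unique h1
  have hsum : ∀ y, coefficient Finset.univ (extD α y) =
      ∑ i, fderiv ℝ (fun y => l i (α y)) y (Pi.single i 1) := fun y => by
    simp only [hd]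
    simp only [extD, map_sum, l, LinearMap.comp_apply, LinearMap.mulLeft_apply]
  have hle : boxCorner (-M) (-Real.pi) ≤ boxCorner M Real.pi := fun μ => by
    refine Fin.lastCases ?_ (fun μ => ?_) μ
    · simpa [boxCorner, -Fin.reduceLast] using Real.pi_pos.le
    · simpa [boxCorner] using hM0.le
  rw [periodSlab_box (fun y hy => by rw [extD_eq_zero_of_support hK h0 hy, map_zero]) hM]
  simp only [hsum]
  -- The top coefficient of dα is a divergence with components `l i (α y)`; the box contains K and
  -- exactly one period of φ.
  rw [integral_divergence_of_hasFDerivAt_off_countable' _ _ hle (fun i y => l i (α y))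
    (fun i => fderiv ℝ (fun y => l i (α y))) ∅ Set.countable_empty
    (fun i => (hl i).continuous.continuousOn)
    (fun x _ i => ((hl i).differentiable (by simp) x).hasFDerivAt)]
  · refine Finset.sum_eq_zero fun i _ => ?_
    refine Fin.lastCases ?_ (fun μ => ?_) i
    -- The faces φ = ±π cancel by periodicity.
    · rw [sub_eq_zero]
      refine integral_congr_ae (Filter.Eventually.of_forall fun x => ?_)
      simp only [boxCorner, Fin.snoc_last]
      rw [← hper ((Fin.last 10).insertNth (-Real.pi) x)]
      congr 2
      funext ν
      refine Fin.lastCases ?_ (fun ν => ?_) ν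
      · simp [-Fin.reduceLast]; ring
      · simp [-Fin.reduceLast, (Fin.castSucc_lt_last ν).ne]
    -- The other faces lie outside the support.
    · have hz : ∀ (t : ℝ) (x : Fin 10 → ℝ), M ≤ |t| →
          l μ.castSucc (α (μ.castSucc.insertNth t x)) = 0 := fun t x ht => by
        rw [h0, map_zero]
        intro hK
        have := hM _ hK μ
        rw [planePoint, Fin.insertNth_apply_same] at this
        exact absurd ht this.not_ge
      simp only [boxCorner, Fin.snoc_castSucc]
      rw [show (fun x : Fin 10 → ℝ => l μ.castSucc (α (μ.castSucc.insertNth M x))) = 0 from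
          funext fun x => hz _ _ (le_abs_self M),
        show (fun x : Fin 10 → ℝ => l μ.castSucc (α (μ.castSucc.insertNth (-M) x))) = 0 from
          funext fun x => hz _ _ (by rw [abs_neg]; exact le_abs_self M)]
      simp
  · refine Continuous.integrableOn_Icc ?_
    refine continuous_finsetSum _ fun i _ => ?_
    exact ((hl i).continuous_fderiv (by simp)).clm_apply continuous_const

/-- Fubini's theorem on `U × S¹`. -/
theorem integral_periodSlab (hK : IsCompact K) (hf : Continuous f)
    (hf0 : ∀ y, planePoint y ∉ K → f y = 0) :
    (∫ y in periodSlab, f y) =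
      ∫ φ in (-Real.pi)..Real.pi, ∫ x in K, f (Fin.snoc x φ : Fin 11 → ℝ) := by
  have he := volume_preserving_piFinSuccAbove (fun _ : Fin 11 => ℝ) (Fin.last 10)
  have hpre : periodSlab = MeasurableEquiv.piFinSuccAbove (fun _ : Fin 11 => ℝ) (Fin.last 10) ⁻¹'
      (Set.Ioc (-Real.pi) Real.pi ×ˢ Set.univ) := by
    ext y
    simp [periodSlab, -Fin.reduceLast]
  have hsymm : ∀ p : ℝ × (Fin 10 → ℝ),
      (MeasurableEquiv.piFinSuccAbove (fun _ : Fin 11 => ℝ) (Fin.last 10)).symm p =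
        (Fin.snoc p.2 p.1 : Fin 11 → ℝ) := fun p => by
    change (Fin.last 10).insertNth (α := fun _ => ℝ) p.1 p.2 = _
    rw [Fin.insertNth_last']
  have h1 : (∫ y in periodSlab, f y) = ∫ p in Set.Ioc (-Real.pi) Real.pi ×ˢ Set.univ,
      f (Fin.snoc p.2 p.1 : Fin 11 → ℝ) := by
    rw [hpre, ← he.setIntegral_preimage_emb (MeasurableEquiv.measurableEmbedding _)]
    simp only [← hsymm, MeasurableEquiv.symm_apply_apply]
  have h2 : IntegrableOn (fun p : ℝ × (Fin 10 → ℝ) => f (Fin.snoc p.2 p.1 : Fin 11 → ℝ))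
      (Set.Ioc (-Real.pi) Real.pi ×ˢ Set.univ) (volume.prod volume) := by
    have := integrableOn_periodSlab hK hf hf0
    rw [← Measure.volume_eq_prod, ← he.integrableOn_comp_preimage
      (MeasurableEquiv.measurableEmbedding _), ← hpre]
    refine this.congr_fun (fun y _ => ?_) (measurableSet_Ioc.preimage (measurable_pi_apply _))
    simp only [Function.comp_apply, ← hsymm, MeasurableEquiv.symm_apply_apply]
  rw [h1, Measure.volume_eq_prod, setIntegral_prod _ h2,
    intervalIntegral.integral_of_le (by linarith [Real.pi_pos])]
  refine integral_congr_ae (Filter.Eventually.of_forall fun φ => ?_)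
  refine setIntegral_eq_of_subset_of_forall_sdiff_eq_zero MeasurableSet.univ
    (Set.subset_univ _) ?_
  rintro x ⟨-, hx⟩
  exact hf0 _ (by rwa [planePoint_snoc])

theorem continuous_fiberIntegral (hK : IsCompact K) (hf : Continuous f) :
    Continuous fun φ : ℝ => ∫ x in K, f (Fin.snoc x φ : Fin 11 → ℝ) := by
  refine continuous_parametric_integral_of_continuous ?_ hK
  refine hf.comp (continuous_pi fun μ => ?_)
  refine Fin.lastCases ?_ (fun i => ?_) μ
  · simpa [-Fin.reduceLast] using continuous_fst
  · simpa using (continuous_apply i).comp' continuous_snd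

end BulkIntegral

/-! ### Periodicity in φ -/

section Periodicity

variable {κ : Type*} [Fintype κ] {α β : Form 11}

theorem CirclePeriodic.add (h : CirclePeriodic α) (h' : CirclePeriodic β) :
    CirclePeriodic (α + β) := fun y => by rw [Pi.add_apply, Pi.add_apply, h, h']

theorem CirclePeriodic.sub (h : CirclePeriodic α) (h' : CirclePeriodic β) :
    CirclePeriodic (α - β) := fun y => by rw [Pi.sub_apply, Pi.sub_apply, h, h']

theorem CirclePeriodic.mul (h : CirclePeriodic α) (h' : CirclePeriodic β) :
    CirclePeriodic (α * β) := fun y => by rw [Pi.mul_apply, Pi.mul_apply, h, h']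

theorem CirclePeriodic.smul (r : ℝ) (h : CirclePeriodic α) : CirclePeriodic (r • α) := fun y => by
  rw [Pi.smul_apply, Pi.smul_apply, h]

theorem CirclePeriodic.sum {ι : Type*} {s : Finset ι} {f : ι → Form 11}
    (h : ∀ i ∈ s, CirclePeriodic (f i)) : CirclePeriodic (∑ i ∈ s, f i) := fun y => by
  simp only [Finset.sum_apply]
  exact Finset.sum_congr rfl fun i hi => h i hi y

theorem CirclePeriodic.extD (h : CirclePeriodic α) : CirclePeriodic (extD α) := fun y => by
  have h1 : ∀ (i : Fin 11) (t : ℝ), α (y + Pi.single (Fin.last 10) (2 * Real.pi) +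
      t • Pi.single i 1) = α (y + t • Pi.single i 1) := fun i t => by rw [add_right_comm, h]
  simp only [HoravaWitten.extD, partialDeriv, lineDeriv, h1]

theorem circlePeriodic_pullBack (α : Form 10) : CirclePeriodic (pullBack α) := fun y => by
  rw [pullBack_apply, pullBack_apply]
  congr 2
  funext μ
  simp [planePoint, -Fin.reduceLast, (Fin.castSucc_lt_last μ).ne]

theorem circlePeriodic_dphi : CirclePeriodic dphi := fun _ => rfl

theorem circlePeriodic_deltaForm {ρ : ℝ → ℝ} (hρ : ∀ φ, ρ (φ + 2 * Real.pi) = ρ φ) (i : Fin 2) :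
    CirclePeriodic (deltaForm ρ i) := fun y => by
  unfold deltaForm
  rw [Pi.add_apply, Pi.single_eq_same, add_sub_right_comm, hρ]

/-- The subtraction of 1/π balances the mass: 2ρ - 1/π integrates to 2 - 2 = 0 over a period. -/
theorem stepFun_periodic {ρ : ℝ → ℝ} (hc : Continuous ρ) (hρ : ∀ φ, ρ (φ + 2 * Real.pi) = ρ φ)
    (hm : ∫ φ in (-Real.pi)..Real.pi, ρ φ = 1) (φ : ℝ) :
    stepFun ρ (φ + 2 * Real.pi) = stepFun ρ φ := by
  have hg : Continuous fun t => 2 * ρ t - 1 / Real.pi := by fun_prop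
  have hint : ∀ a b, IntervalIntegrable (fun t => 2 * ρ t - 1 / Real.pi) MeasureTheory.volume a b :=
    fun a b => hg.intervalIntegrable a b
  have hp : Function.Periodic (fun t => 2 * ρ t - 1 / Real.pi) (2 * Real.pi) := fun t => by
    simp only [hρ]
  have h1 : ∫ t in (-Real.pi)..Real.pi, (2 * ρ t - 1 / Real.pi) = 0 := by
    rw [intervalIntegral.integral_sub ((hc.const_mul (2 : ℝ)).intervalIntegrable _ _)
      (continuous_const.intervalIntegrable _ _), intervalIntegral.integral_const_mul, hm,
      intervalIntegral.integral_const, smul_eq_mul]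
    have := Real.pi_ne_zero
    field_simp
    ring
  unfold stepFun
  rw [← intervalIntegral.integral_add_adjacent_intervals (hint 0 φ) (hint φ _),
    hp.intervalIntegral_add_eq φ (-Real.pi), show -Real.pi + 2 * Real.pi = Real.pi by ring, h1,
    add_zero]

theorem circlePeriodic_stepForm {ρ : ℝ → ℝ} (hc : Continuous ρ)
    (hρ : ∀ φ, ρ (φ + 2 * Real.pi) = ρ φ) (hm : ∫ φ in (-Real.pi)..Real.pi, ρ φ = 1)
    (i : Fin 2) : CirclePeriodic (stepForm ρ i) := fun y => by
  rw [stepForm_eq, stepForm_eq, Pi.add_apply, Pi.single_eq_same, add_sub_right_comm,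
    stepFun_periodic hc hρ hm]

/-- Matrices of `2π`-periodic forms. -/
def MatPeriodic (M : Matrix κ κ (Form 11)) : Prop := ∀ i j, CirclePeriodic (M i j)

variable {M M' : Matrix κ κ (Form 11)}

theorem MatPeriodic.add (h : MatPeriodic M) (h' : MatPeriodic M') : MatPeriodic (M + M') :=
  fun i j => (h i j).add (h' i j)

theorem MatPeriodic.smul (r : ℝ) (h : MatPeriodic M) : MatPeriodic (r • M) :=
  fun i j => (h i j).smul r

theorem MatPeriodic.mul (h : MatPeriodic M) (h' : MatPeriodic M') : MatPeriodic (M * M') :=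
  fun i j => by
    rw [Matrix.mul_apply]
    exact CirclePeriodic.sum fun k _ => (h i k).mul (h' k j)

theorem matD_apply {N : ℕ} {κ : Type*} (A : Matrix κ κ (Form N)) (i j : κ) :
    matD A i j = extD (A i j) := by
  simp only [matD, Matrix.map_apply]

theorem MatPeriodic.matD (h : MatPeriodic M) : MatPeriodic (matD M) := fun i j => by
  rw [matD_apply]
  exact (h i j).extD

theorem MatPeriodic.trace (h : MatPeriodic M) : CirclePeriodic M.trace :=
  CirclePeriodic.sum fun i _ => h i i

theorem MatPeriodic.sixForm [DecidableEq κ] (hL : MatPeriodic M) (h : MatPeriodic M') :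
    CirclePeriodic (sixForm M M') := by
  have hd := h.matD
  have hS := h.mul h
  unfold HoravaWitten.sixForm descent6 curvature
  rw [sq]
  refine CirclePeriodic.smul _ (CirclePeriodic.sub (CirclePeriodic.smul _ (MatPeriodic.trace
    (hL.mul (MatPeriodic.matD ?_)))) (CirclePeriodic.smul _ (CirclePeriodic.mul
    (hL.mul hd).trace ((hd.add hS).mul (hd.add hS)).trace)))
  refine MatPeriodic.add (MatPeriodic.add ?_ ?_) ?_
  · exact ((((h.mul hd).mul hd).add ((hd.mul h).mul hd)).add ((hd.mul hd).mul h)).smul _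
  · exact (((((((h.mul hd).mul hS).add ((h.mul hS).mul hd)).add ((hd.mul h).mul hS)).add
      ((hS.mul h).mul hd)).add ((hd.mul hS).mul h)).add ((hS.mul hd).mul h)).smul _
  · exact ((h.mul hS).mul hS).smul _

end Periodicity

/-! ### Supports of the descent forms -/

section Support

variable {N : ℕ} {κ ι : Type*} [Fintype κ] [Fintype ι]

theorem trace_mul_apply_eq_zero {L : Matrix κ κ (Form N)} {x : Fin N → ℝ}
    (hL : ∀ i j, L i j x = 0) (M : Matrix κ κ (Form N)) : (L * M).trace x = 0 := by
  simp [Matrix.trace, Matrix.mul_apply, hL]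

variable [DecidableEq κ] [DecidableEq ι]

theorem twoForm_apply_eq_zero {LL : Matrix ι ι (Form N)} {Lg : Matrix κ κ (Form N)}
    {x : Fin N → ℝ} (hLL : ∀ i j, LL i j x = 0) (hLg : ∀ i j, Lg i j x = 0)
    (Ω : Matrix ι ι (Form N)) (A : Matrix κ κ (Form N)) : twoForm LL Lg Ω A x = 0 := by
  simp [twoForm, trace_mul_apply_eq_zero hLL, trace_mul_apply_eq_zero hLg]

theorem sixForm_apply_eq_zero {LL : Matrix ι ι (Form N)} {x : Fin N → ℝ}
    (hLL : ∀ i j, LL i j x = 0) (Ω : Matrix ι ι (Form N)) : sixForm LL Ω x = 0 := by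
  simp [sixForm, descent6, trace_mul_apply_eq_zero hLL]

end Support

/-! ### Restriction of X₆ to a plane -/

section Restriction

variable {κ : Type*} [Fintype κ] {U : Set (Fin 10 → ℝ)} {φ₀ : ℝ}

/-- `M` is smooth over `U` and restricts to `M'` on the plane at `φ₀`. -/
structure RestrictsTo (U : Set (Fin 10 → ℝ)) (φ₀ : ℝ) (M : Matrix κ κ (Form 11))
    (M' : Matrix κ κ (Form 10)) : Prop where
  smooth : ∀ i j, SmoothForm (bulkRegion U) (M i j)
  eqOn : ∀ i j, Set.EqOn (restrictTo φ₀ (M i j)) (M' i j) U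

variable {M₁ M₂ : Matrix κ κ (Form 11)} {M₁' M₂' : Matrix κ κ (Form 10)}

theorem RestrictsTo.add (h₁ : RestrictsTo U φ₀ M₁ M₁') (h₂ : RestrictsTo U φ₀ M₂ M₂') :
    RestrictsTo U φ₀ (M₁ + M₂) (M₁' + M₂') where
  smooth i j := (h₁.smooth i j).add (h₂.smooth i j)
  eqOn i j x hx := by
    have e₁ := h₁.eqOn i j hx
    have e₂ := h₂.eqOn i j hx
    rw [restrictTo_apply] at e₁ e₂ ⊢
    rw [Matrix.add_apply, Matrix.add_apply, Pi.add_apply, Pi.add_apply, map_add, e₁, e₂]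

theorem RestrictsTo.smul (r : ℝ) (h₁ : RestrictsTo U φ₀ M₁ M₁') :
    RestrictsTo U φ₀ (r • M₁) (r • M₁') where
  smooth i j := (h₁.smooth i j).smul r
  eqOn i j x hx := by
    have e₁ := h₁.eqOn i j hx
    rw [restrictTo_apply] at e₁ ⊢
    rw [Matrix.smul_apply, Matrix.smul_apply, Pi.smul_apply, Pi.smul_apply, map_smul, e₁]

theorem RestrictsTo.mul (h₁ : RestrictsTo U φ₀ M₁ M₁') (h₂ : RestrictsTo U φ₀ M₂ M₂') :
    RestrictsTo U φ₀ (M₁ * M₂) (M₁' * M₂') where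
  smooth i j := by
    rw [Matrix.mul_apply]
    exact SmoothForm.sum fun k _ => (h₁.smooth i k).mul (h₂.smooth k j)
  eqOn i j x hx := by
    rw [restrictTo_apply, Matrix.mul_apply, Matrix.mul_apply, Finset.sum_apply, Finset.sum_apply,
      map_sum]
    refine Finset.sum_congr rfl fun k _ => ?_
    have e₁ := h₁.eqOn i k hx
    have e₂ := h₂.eqOn k j hx
    rw [restrictTo_apply] at e₁ e₂
    rw [Pi.mul_apply, Pi.mul_apply, map_mul, e₁, e₂]

theorem RestrictsTo.matD (hU : IsOpen U) (h₁ : RestrictsTo U φ₀ M₁ M₁') :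
    RestrictsTo U φ₀ (matD M₁) (matD M₁') where
  smooth i j := by
    rw [matD_apply]
    exact (h₁.smooth i j).extD (isOpen_bulkRegion hU)
  eqOn i j x hx := by
    rw [matD_apply, matD_apply]
    have hx' : (Fin.snoc x φ₀ : Fin 11 → ℝ) ∈ bulkRegion U := by
      rw [mem_bulkRegion, planePoint_snoc]; exact hx
    have h := restrictTo_hasExtD ((h₁.smooth i j).hasExtD (isOpen_bulkRegion hU) hx')
    refine (h.congr ?_).extD_eq.symm
    filter_upwards [hU.mem_nhds hx] with z hz
    exact (h₁.eqOn i j hz).symm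

theorem RestrictsTo.trace (h₁ : RestrictsTo U φ₀ M₁ M₁') :
    Set.EqOn (restrictTo φ₀ M₁.trace) M₁'.trace U := fun x hx => by
  rw [restrictTo_apply, Matrix.trace, Matrix.trace, Finset.sum_apply, Finset.sum_apply, map_sum]
  exact Finset.sum_congr rfl fun k _ => h₁.eqOn k k hx

/-- X₆ is built from sums, products, traces and d, with each of which restriction commutes. -/
theorem RestrictsTo.sixForm [DecidableEq κ] (hU : IsOpen U) (hL : RestrictsTo U φ₀ M₁ M₁')
    (h : RestrictsTo U φ₀ M₂ M₂') :
    Set.EqOn (restrictTo φ₀ (sixForm M₁ M₂)) (sixForm M₁' M₂') U := fun x hx => by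
  have hd := h.matD hU
  have hS := h.mul h
  have h1 := (hL.mul hd).trace hx
  have h2 := ((hd.add hS).mul (hd.add hS)).trace hx
  have h3 := (hL.mul (RestrictsTo.matD hU (RestrictsTo.add (RestrictsTo.add
    (((((h.mul hd).mul hd).add ((hd.mul h).mul hd)).add ((hd.mul hd).mul h)).smul (1 / 3))
    ((((((((h.mul hd).mul hS).add ((h.mul hS).mul hd)).add ((hd.mul h).mul hS)).add
      ((hS.mul h).mul hd)).add ((hd.mul hS).mul h)).add ((hS.mul hd).mul h)).smul (1 / 5)))
    (((h.mul hS).mul hS).smul (2 / 5))))).trace hx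
  rw [restrictTo_apply] at h1 h2 h3 ⊢
  unfold HoravaWitten.sixForm descent6 curvature
  simp only [sq, Pi.smul_apply, Pi.sub_apply, Pi.mul_apply, map_smul, map_sub, map_mul]
  rw [h1, h2, h3]

end Restriction

/-! ### Reduction from 𝔰𝔬(1,10) to 𝔰𝔬(1,9) -/

section Blocks

variable {N : ℕ} {ι κ : Type*} [Fintype ι] [Fintype κ] [DecidableEq ι] [DecidableEq κ]

theorem matD_fromBlocks (A : Matrix ι ι (Form N)) :
    matD (Matrix.fromBlocks A 0 0 (0 : Matrix κ κ (Form N))) =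
      Matrix.fromBlocks (matD A) 0 0 0 := by
  have h0 : extD (0 : Form N) = 0 := funext fun x => HasExtD.zero.extD_eq
  rw [matD, Matrix.fromBlocks_map]
  congr 1 <;> ext i j <;> simp [h0]

theorem trace_fromBlocks_zero (A : Matrix ι ι (Form N)) :
    (Matrix.fromBlocks A 0 0 (0 : Matrix κ κ (Form N))).trace = A.trace := by
  simp [Matrix.trace, Fintype.sum_sum_type]

/-- A vanishing last block contributes nothing to any product or trace, so the eleven-dimensional X₆
of such a connection is the ten-dimensional one. -/
theorem sixForm_fromBlocks (L A : Matrix ι ι (Form N)) :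
    sixForm (Matrix.fromBlocks L 0 0 (0 : Matrix κ κ (Form N))) (Matrix.fromBlocks A 0 0 0) =
      sixForm L A := by
  simp only [sixForm, descent6, curvature, sq, matD_fromBlocks, Matrix.fromBlocks_multiply,
    Matrix.fromBlocks_add, Matrix.fromBlocks_smul, Matrix.mul_zero, Matrix.zero_mul, add_zero, smul_zero,
    trace_fromBlocks_zero]

end Blocks

/-! ### Varying the Lagrangians: exact form plus inflow density -/

section InflowDensities

variable {𝔤 : Type*} [LieRing 𝔤] [LieAlgebra ℝ 𝔤] [FiniteDimensional ℝ 𝔤]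
  {U : Set (Fin 10 → ℝ)} {Φ : Config (Module.finrank ℝ 𝔤)} {Λ : Param (Module.finrank ℝ 𝔤)}
  {ρ : ℝ → ℝ} {y : Fin 11 → ℝ}

theorem IsGaugeParam.exists_support (hΛ : IsGaugeParam 𝔤 U Λ) :
    ∃ K ⊆ U, IsCompact K ∧ ∀ x ∉ K, (∀ a c, Λ.L a c x = 0) ∧ ∀ i j k, Λ.g i j k x = 0 := by
  obtain ⟨L, -, -, ⟨K, hKU, hK, hL⟩, hL'⟩ := hΛ.lorentz
  choose g _ hg hg' using hΛ.gauge
  choose Kg hKgU hKg hg using hg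
  refine ⟨K ∪ ⋃ i, Kg i, Set.union_subset hKU (Set.iUnion_subset hKgU),
    hK.union (isCompact_iUnion hKg), fun x hx => ⟨fun a c => ?_, fun i j k => ?_⟩⟩
  · rw [hL']
    simp only [parameterForm, Matrix.of_apply, hL x fun h => hx (Or.inl h)]
    simp
  · rw [hg']
    simp only [parameterForm, Matrix.of_apply,
      hg i x fun h => hx (Or.inr (Set.mem_iUnion_of_mem i h))]
    simp [adMatrix]

theorem planeTwo_eq_zero {x : Fin 10 → ℝ}
    (h : (∀ a c, Λ.L a c x = 0) ∧ ∀ i j k, Λ.g i j k x = 0) (i : Fin 2) :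
    planeTwo Λ Φ i x = 0 := twoForm_apply_eq_zero h.1 (h.2 i) _ _

theorem bulkSix_eq_zero (h : ∀ a c, Λ.L a c (planePoint y) = 0) :
    sixForm (bulkParam Λ) Φ.Ω y = 0 := by
  refine sixForm_apply_eq_zero (fun i j => ?_) _
  rcases i with i | i <;> rcases j with j | j
  · simp only [bulkParam, Matrix.fromBlocks_apply₁₁, Matrix.map_apply, pullBack_apply, h, map_zero]
  all_goals rfl

theorem bulkParam_restrictsTo (hΛ : IsGaugeParam 𝔤 U Λ) (φ₀ : ℝ) :
    RestrictsTo U φ₀ (bulkParam Λ) (Matrix.fromBlocks Λ.L 0 0 0) where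
  smooth := hΛ.bulk_isParameter.smooth
  eqOn i j x _ := by
    rw [restrictTo_apply]
    rcases i with i | i <;> rcases j with j | j
    · simp only [bulkParam, Matrix.fromBlocks_apply₁₁, Matrix.map_apply, pullBack_apply,
        planePoint_snoc, restrictCovector_pullCovector]
    all_goals exact map_zero restrictCovector

/-- One mixed block vanishes on the plane by assumption; skew-adjointness takes care of the other
mixed block and of the 1 × 1 corner. -/
theorem IsFieldConfig.spin_restrictsTo (hΦ : IsFieldConfig 𝔤 U Φ) (i : Fin 2) :
    RestrictsTo U (fixedPoint i) Φ.Ω (Matrix.fromBlocks (planeSpin Φ i) 0 0 0) where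
  smooth := hΦ.spin_isConnection.smooth
  eqOn j k x _ := by
    obtain ⟨Ω, -, -, hskew, hmix, hΩ⟩ := hΦ.spin
    have hentry : ∀ j k, (∀ μ : Fin 10, Ω (Fin.snoc x (fixedPoint i) : Fin 11 → ℝ) μ.castSucc j k
        = 0) → restrictTo (fixedPoint i) (Φ.Ω j k) x = 0 := fun j k h => by
      rw [restrictTo_apply, hΩ]
      simp only [connectionForm, Matrix.of_apply, id, restrictCovector,
        ExteriorAlgebra.map_apply_ι]
      convert LinearMap.map_zero _
      funext μ
      exact h μ
    have hs : ∀ μ (j k : Fin 10 ⊕ Unit), _ = _ := fun μ j k =>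
      congrFun (congrFun (hskew (Fin.snoc x (fixedPoint i) : Fin 11 → ℝ) μ) j) k
    simp only [Matrix.mul_apply, Fintype.sum_sum_type, Matrix.transpose_apply,
      Matrix.neg_apply] at hs
    rcases j with j | j <;> rcases k with k | k
    · exact (planeSpin_apply Φ i j k x).symm
    · exact hentry _ _ fun μ => hmix i x μ j
    · refine hentry _ _ fun μ => ?_
      have := hs μ.castSucc (Sum.inl k) (Sum.inr j)
      simpa [hmix, flatMetric, Matrix.diagonal_apply] using this
    · refine hentry _ _ fun μ => ?_
      have := hs μ.castSucc (Sum.inr k) (Sum.inr j)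
      simp at this
      linarith

/-- The bulk form `X₆` restricts to the form `X₆` of a plane. -/
theorem IsFieldConfig.restrictTo_six (hU : IsOpen U) (hΦ : IsFieldConfig 𝔤 U Φ)
    (hΛ : IsGaugeParam 𝔤 U Λ) (i : Fin 2) :
    Set.EqOn (restrictTo (fixedPoint i) (sixForm (bulkParam Λ) Φ.Ω))
      (sixForm Λ.L (planeSpin Φ i)) U := by
  have := (bulkParam_restrictsTo hΛ (fixedPoint i)).sixForm hU (hΦ.spin_restrictsTo i)
  rwa [sixForm_fromBlocks] at this

theorem transformed_zero (γ b : ℝ) : transformed γ b ρ Λ Φ 0 = Φ := by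
  simp [transformed]

/-- The letters stand for D = dφ, W = ω̄¹, I = Ī₄, dW = d(εω̄¹) and X = d(εω̄¹GG), with c = κ². The
term -δω̄¹GG yields rᵢeₖeₗ after replacing G twice by its ε-part. The term (b/2)d(εω̄¹)GG equals
(b/2)X minus terms in which d acts on G; these give 2eᵢrₖeₗ. Each ε-part carries bγ/2, whence
γ³b²/96c. -/
theorem anomalyInflow_algebra {R : Type*} [Ring R] [Algebra ℝ R] (γ b c : ℝ) (r e : Fin 2 → ℝ)
    (D G : R) (W I X dW : Fin 2 → R) (hW : ∀ i a, W i * a = a * W i)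
    (hI : ∀ i a, I i * a = a * I i)
    (hDG : D * G = D * ((b * γ / 2) • ∑ k, e k • I k))
    (hX : ∀ i, X i = dW i * G * G + (2 : ℝ) • ((e i • W i) * (γ • ∑ j, r j • (D * I j)) * G)) :
    (-(1 / (24 * c))) • ((γ • ∑ i, (-(r i • (D * W i)) + (b / 2) • dW i)) * G * G) =
      (-(γ * b / (48 * c))) • ∑ i, X i + (γ ^ 3 * b ^ 2 / (96 * c)) •
        ∑ i, ∑ k, ∑ l, (r i * (e k * e l) + 2 * (e i * (r k * e l))) •
          (D * (W i * (I k * I l))) := by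
  set S := (b * γ / 2) • ∑ k, e k • I k with hS
  have hSc : ∀ a, S * a = a * S := fun a => by
    rw [hS, smul_mul_assoc, mul_smul_comm, Finset.sum_mul, Finset.mul_sum]
    simp only [smul_mul_assoc, mul_smul_comm, hI]
  -- The ε-part S of G is central, so D can be brought next to the second G and the substitution
  -- repeated.
  have hDGG : D * G * G = D * S * S := by
    rw [hDG, mul_assoc, hSc G, ← mul_assoc, hDG]
  have h1 : ∀ i, D * W i * G * G = D * (W i * (S * S)) := fun i => by
    rw [← hW i D, mul_assoc (W i * D), mul_assoc (W i), ← mul_assoc D G, hDGG,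
      ← mul_assoc D (W i), ← hW i D, mul_assoc (W i) D, mul_assoc D S]
  have h2 : ∀ i j, W i * (D * I j) * G = D * (W i * (I j * S)) := fun i j => by
    rw [mul_assoc, mul_assoc D, hI j G, ← mul_assoc D G, hDG, mul_assoc D S, ← hI j S,
      ← mul_assoc, hW i D, mul_assoc]
  have h3 : ∀ i, dW i * G * G = X i - (2 * γ * e i) • ∑ j, r j • (D * (W i * (I j * S))) :=
    fun i => by
      rw [hX, eq_sub_iff_add_eq]
      simp only [smul_mul_assoc, mul_smul_comm, Finset.mul_sum, Finset.sum_mul, h2, Finset.smul_sum,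
        smul_smul]
      congr 1
      refine Finset.sum_congr rfl fun j _ => ?_
      congr 1
      ring
  have hI10 : I 1 * I 0 = I 0 * I 1 := hI 1 _
  simp only [smul_mul_assoc, Finset.sum_mul, add_mul, neg_mul, h1, h3]
  simp only [hS, Fin.sum_univ_two, smul_mul_assoc, mul_smul_comm, mul_add, add_mul, hI10]
  match_scalars <;> field_simp <;> ring

theorem pullBack_triple (Φ : Config (Module.finrank ℝ 𝔤)) (Λ : Param (Module.finrank ℝ 𝔤))
    (i k l : Fin 2) (y : Fin 11 → ℝ) :
    pullBack (planeTwo Λ Φ i * (planeFour Φ k * planeFour Φ l)) y =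
      pullBack (planeTwo Λ Φ i) y * (pullBack (planeFour Φ k) y * pullBack (planeFour Φ l) y) := by
  rw [pullBack_mul, pullBack_mul]
  rfl

/-- The variation of the topological term is an exact form plus the anomaly inflow density. -/
theorem IsFieldConfig.topLagrangian_variation (hU : IsOpen U) (hΦ : IsFieldConfig 𝔤 U Φ)
    (hΛ : IsGaugeParam 𝔤 U Λ) (hρ : ContDiff ℝ ∞ ρ) (kap γ b : ℝ) (hy : y ∈ bulkRegion U) :
    variation (fun s => topLagrangian kap γ b ρ (transformed γ b ρ Λ Φ s)) y =
      extD ((-(γ * b / (48 * kap ^ 2))) • ∑ i, stepForm ρ i * pullBack (planeTwo Λ Φ i) *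
          fieldG γ b ρ Φ * fieldG γ b ρ Φ) y
      + topCoupling kap γ b • ∑ i, ∑ k, ∑ l,
        (ρ (y (Fin.last 10) - fixedPoint i) * (stepFun ρ (y (Fin.last 10) - fixedPoint k) *
            stepFun ρ (y (Fin.last 10) - fixedPoint l))
          + 2 * (stepFun ρ (y (Fin.last 10) - fixedPoint i) *
            (ρ (y (Fin.last 10) - fixedPoint k) * stepFun ρ (y (Fin.last 10) - fixedPoint l)))) •
          (dphi y * pullBack (planeTwo Λ Φ i * (planeFour Φ k * planeFour Φ l)) y) := by
  have hG := hΦ.even_fieldG (ρ := ρ) hU γ b hy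
  have hW := fun i => hΦ.even_planeTwo hU hΛ i hy
  have hI := fun i => hΦ.even_planeFour hU i hy
  have hv := (((hΦ.fieldCtilde_hasVariation γ b hU hΛ hρ hy).mul
    (hΦ.fieldG_hasVariation γ b hU hΛ hρ hy)).mul
    (hΦ.fieldG_hasVariation γ b hU hΛ hρ hy)).smul (-(1 / (24 * kap ^ 2)))
  rw [mul_zero, mul_zero, add_zero, add_zero, transformed_zero] at hv
  have hdW := fun i => (((smooth_stepForm (V := bulkRegion U) hρ i).mul
    (hΦ.smooth_planeTwo hU hΛ i)).hasExtD (isOpen_bulkRegion hU) hy)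
  have hdG := hΦ.fieldG_hasExtD hU hρ γ b hy
  -- The factor of the exact form is -1/(24κ²) times γb/2.
  have hX := (HasExtD.sum Finset.univ fun i _ => ((hdW i).mul hdG).mul hdG).smul
    (-(γ * b / (48 * kap ^ 2)))
  have halg := anomalyInflow_algebra γ b (kap ^ 2) (fun i => ρ (y (Fin.last 10) - fixedPoint i))
    (fun i => stepFun ρ (y (Fin.last 10) - fixedPoint i)) (dphi y) (fieldG γ b ρ Φ y)
    (fun i => pullBack (planeTwo Λ Φ i) y) (fun i => pullBack (planeFour Φ i) y)
    (fun i => (extD (stepForm ρ i * pullBack (planeTwo Λ Φ i)) y * fieldG γ b ρ Φ y +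
        CliffordAlgebra.involute ((stepForm ρ i * pullBack (planeTwo Λ Φ i)) y) *
          (γ • ∑ i, deltaForm ρ i y * pullBack (planeFour Φ i) y)) * fieldG γ b ρ Φ y +
      CliffordAlgebra.involute ((stepForm ρ i * pullBack (planeTwo Λ Φ i) * fieldG γ b ρ Φ) y) *
        (γ • ∑ i, deltaForm ρ i y * pullBack (planeFour Φ i) y))
    (fun i => extD (stepForm ρ i * pullBack (planeTwo Λ Φ i)) y)
    (fun i => (hW i).2) (fun i => (hI i).2) ?_ ?_
  · have hv' : variation (fun s => topLagrangian kap γ b ρ (transformed γ b ρ Λ Φ s)) y = _ :=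
      variation_eq hv
    refine hv'.trans ?_
    rw [hX.extD_eq]
    simp only [deltaForm_eq, smul_mul_assoc, pullBack_triple] at halg ⊢
    exact halg
  · rw [hΦ.dphi_mul_fieldG hU γ b hy]
    simp only [stepForm_eq, smul_mul_assoc, one_mul]
  · intro i
    have hE : IsEven ((stepForm ρ i * pullBack (planeTwo Λ Φ i)) y) :=
      (isEven_stepForm ρ i y).mul (hW i)
    have hEG : IsEven ((stepForm ρ i * pullBack (planeTwo Λ Φ i) * fieldG γ b ρ Φ) y) :=
      hE.mul hG
    have hEe : (stepForm ρ i * pullBack (planeTwo Λ Φ i)) y =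
        stepFun ρ (y (Fin.last 10) - fixedPoint i) • pullBack (planeTwo Λ Φ i) y := by
      rw [Pi.mul_apply, stepForm_eq, smul_mul_assoc, one_mul]
    have hEGe : (stepForm ρ i * pullBack (planeTwo Λ Φ i) * fieldG γ b ρ Φ) y =
        (stepForm ρ i * pullBack (planeTwo Λ Φ i)) y * fieldG γ b ρ Φ y := rfl
    rw [hE.1, hEG.1, hEGe, hEe]
    simp only [deltaForm_eq, smul_mul_assoc]
    rw [add_mul, add_assoc, two_smul, mul_assoc _ (fieldG γ b ρ Φ y) (γ • _), hG.2 (γ • _),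
      ← mul_assoc]
    simp only [smul_mul_assoc]

/-- The variation of the Green-Schwarz term is an exact form plus the anomaly inflow density. -/
theorem IsFieldConfig.gsLagrangian_variation (hU : IsOpen U) (hΦ : IsFieldConfig 𝔤 U Φ)
    (hΛ : IsGaugeParam 𝔤 U Λ) (hρ : ContDiff ℝ ∞ ρ) (kap γ b : ℝ) (hy : y ∈ bulkRegion U) :
    variation (fun s => gsLagrangian kap γ b ρ (transformed γ b ρ Λ Φ s)) y =
      extD ((-(1 / (2 * gsScale kap))) • (fieldG γ b ρ Φ * sixForm (bulkParam Λ) Φ.Ω)) y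
      + gsCoupling kap γ • ∑ i, ρ (y (Fin.last 10) - fixedPoint i) •
          (dphi y * (pullBack (planeFour Φ i) * sixForm (bulkParam Λ) Φ.Ω) y) := by
  have hG := hΦ.even_fieldG (ρ := ρ) hU γ b hy
  obtain ⟨h7, h6⟩ := sevenForm_descent (isOpen_bulkRegion hU) hΦ.spin_isConnection
    hΛ.bulk_isParameter (spin_isGaugeFamily γ b ρ) hy
  have hv := ((hΦ.fieldG_hasVariation γ b hU hΛ hρ hy).mul h7).smul (-(1 / (2 * gsScale kap)))
  rw [zero_mul, zero_add, transformed_zero] at hv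
  -- Since G is even and invariant, the variation is a multiple of G ∧ dX₆ = d(G ∧ X₆) - dG ∧ X₆,
  -- and the Bianchi identity supplies dG.
  have hX := ((hΦ.fieldG_hasExtD hU hρ γ b hy).mul h6).smul (-(1 / (2 * gsScale kap)))
  have hv' : variation (fun s => gsLagrangian kap γ b ρ (transformed γ b ρ Λ Φ s)) y = _ :=
    variation_eq hv
  rw [hG.1] at hX
  rw [hX.extD_eq]
  refine hv'.trans ?_
  simp only [deltaForm_eq, smul_mul_assoc, Pi.mul_apply, Fin.sum_univ_two, add_mul, mul_assoc,
    gsCoupling]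
  match_scalars <;> field_simp <;> ring

end InflowDensities

/-! ### Regularised products of δ and ε -/

section DeltaLimits

open MeasureTheory

variable {ρ : ℝ → ℝ}

theorem integral_period_shift {F : ℝ → ℝ} (hF : ∀ φ, F (φ + 2 * Real.pi) = F φ) (c : ℝ) :
    ∫ φ in (-Real.pi)..Real.pi, F (φ + c) = ∫ φ in (-Real.pi)..Real.pi, F φ := by
  have hp : Function.Periodic F (2 * Real.pi) := hF
  rw [intervalIntegral.integral_comp_add_right, show Real.pi + c = -Real.pi + c + 2 * Real.pi by ring,
    hp.intervalIntegral_add_eq _ (-Real.pi), show -Real.pi + 2 * Real.pi = Real.pi by ring]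

theorem stepFun_neg (heven : ∀ φ, ρ (-φ) = ρ φ) (φ : ℝ) : stepFun ρ (-φ) = -stepFun ρ φ := by
  have h := intervalIntegral.integral_comp_neg (a := 0) (b := φ)
    (fun t => 2 * ρ t - 1 / Real.pi)
  simp only [heven, neg_zero] at h
  rw [stepFun, intervalIntegral.integral_symm, stepFun, h]

/-- The bound is 2 · 1 + 1: a partial mass of ρ is at most one, and so is |φ|/π. It is uniform in
the regularisation and serves for domination. -/
theorem abs_stepFun_le (hc : Continuous ρ) (hnn : ∀ φ, 0 ≤ ρ φ)
    (hm : ∫ φ in (-Real.pi)..Real.pi, ρ φ = 1) {φ : ℝ} (hφ : |φ| ≤ Real.pi) :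
    |stepFun ρ φ| ≤ 3 := by
  have hpi := Real.pi_pos
  have hφ' := abs_le.mp hφ
  have h1 : |∫ t in (0 : ℝ)..φ, ρ t| ≤ 1 := by
    rw [← abs_one, ← hm]
    refine intervalIntegral.abs_integral_mono_interval (μ := volume) ?_
      (Filter.Eventually.of_forall hnn) (hc.intervalIntegrable _ _)
    rw [Set.uIoc_of_le (by linarith : -Real.pi ≤ Real.pi)]
    exact Set.Ioc_subset_Ioc (le_min (by linarith) hφ'.1) (max_le hpi.le hφ'.2)
  have h2 : stepFun ρ φ = 2 * (∫ t in (0 : ℝ)..φ, ρ t) - φ / Real.pi := by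
    unfold stepFun
    rw [intervalIntegral.integral_sub ((hc.const_mul (2 : ℝ)).intervalIntegrable _ _)
      (continuous_const.intervalIntegrable _ _), intervalIntegral.integral_const_mul,
      intervalIntegral.integral_const, smul_eq_mul]
    ring
  have h3 : |φ / Real.pi| ≤ 1 := by
    rw [abs_div, abs_of_pos hpi]
    exact (div_le_one hpi).mpr hφ
  rw [h2]
  rw [abs_le] at h1 h3 ⊢
  constructor <;> linarith [h1.1, h1.2, h3.1, h3.2]

theorem integral_half (hc : Continuous ρ) (heven : ∀ φ, ρ (-φ) = ρ φ)
    (hm : ∫ φ in (-Real.pi)..Real.pi, ρ φ = 1) : ∫ φ in (0 : ℝ)..Real.pi, ρ φ = 1 / 2 := by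
  have h := intervalIntegral.integral_comp_neg (a := 0) (b := Real.pi) ρ
  simp only [heven, neg_zero] at h
  have h2 := intervalIntegral.integral_add_adjacent_intervals
    (hc.intervalIntegrable (μ := volume) (-Real.pi) 0) (hc.intervalIntegrable 0 Real.pi)
  linarith

/-- By evenness half of the mass lies in [0, π]; once all of that half has been collected, ε has its
unregularised value. -/
theorem stepFun_eq_of_vanish (hc : Continuous ρ) (heven : ∀ φ, ρ (-φ) = ρ φ)
    (hm : ∫ φ in (-Real.pi)..Real.pi, ρ φ = 1) {r : ℝ}
    (hr : ∀ φ, r ≤ |φ| → |φ| ≤ Real.pi → ρ φ = 0) {φ : ℝ} (h0 : 0 ≤ φ) (h1 : r ≤ φ)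
    (h2 : φ ≤ Real.pi) : stepFun ρ φ = 1 - φ / Real.pi := by
  have h3 : ∫ t in φ..Real.pi, ρ t = 0 := by
    rw [intervalIntegral.integral_congr (g := fun _ => 0)]
    · simp
    · intro t ht
      rw [Set.uIcc_of_le h2] at ht
      have : |t| = t := abs_of_nonneg (h0.trans ht.1)
      exact hr t (by rw [this]; exact h1.trans ht.1) (by rw [this]; exact ht.2)
  have h4 := intervalIntegral.integral_add_adjacent_intervals
    (hc.intervalIntegrable (μ := volume) 0 φ) (hc.intervalIntegrable φ Real.pi)
  rw [h3, integral_half hc heven hm, add_zero] at h4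
  unfold stepFun
  rw [intervalIntegral.integral_sub ((hc.const_mul (2 : ℝ)).intervalIntegrable _ _)
    (continuous_const.intervalIntegrable _ _), intervalIntegral.integral_const_mul, h4,
    intervalIntegral.integral_const, smul_eq_mul]
  ring

/-- `∫ δ ε² = (1 / 2π) ∫ ε²`, because `d(ε³) = 3 ε² (2 δ - dφ / π)`. -/
theorem integral_mul_stepFun_sq (hc : Continuous ρ) (hper : ∀ φ, ρ (φ + 2 * Real.pi) = ρ φ)
    (hm : ∫ φ in (-Real.pi)..Real.pi, ρ φ = 1) :
    ∫ φ in (-Real.pi)..Real.pi, ρ φ * (stepFun ρ φ * stepFun ρ φ) =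
      (1 / (2 * Real.pi)) * ∫ φ in (-Real.pi)..Real.pi, stepFun ρ φ ^ 2 := by
  have hd := fun φ => hasDerivAt_stepFun hc φ
  have hE : Continuous (stepFun ρ) := continuous_iff_continuousAt.mpr fun φ => (hd φ).continuousAt
  have h3 : ∀ φ, HasDerivAt (fun t => stepFun ρ t ^ 3)
      (3 * stepFun ρ φ ^ 2 * (2 * ρ φ - 1 / Real.pi)) φ := fun φ => by
    simpa using (hd φ).fun_pow 3
  have h := intervalIntegral.integral_eq_sub_of_hasDerivAt (a := -Real.pi) (b := Real.pi)
    (fun φ _ => h3 φ) (Continuous.intervalIntegrable (by fun_prop) _ _)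
  have hp : stepFun ρ Real.pi = stepFun ρ (-Real.pi) := by
    rw [← stepFun_periodic hc hper hm (-Real.pi)]
    congr 1
    ring
  rw [hp, sub_self] at h
  have e : (fun φ => 3 * stepFun ρ φ ^ 2 * (2 * ρ φ - 1 / Real.pi)) = fun φ =>
      6 * (ρ φ * (stepFun ρ φ * stepFun ρ φ)) - (3 / Real.pi) * stepFun ρ φ ^ 2 := by
    funext φ; ring
  rw [e, intervalIntegral.integral_sub (Continuous.intervalIntegrable (by fun_prop) _ _)
    (Continuous.intervalIntegrable (by fun_prop) _ _), intervalIntegral.integral_const_mul,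
    intervalIntegral.integral_const_mul] at h
  have := Real.pi_pos
  field_simp at h ⊢
  linarith

variable {ρ : ℕ → ℝ → ℝ}

/-- Convergence of a delta sequence against locally uniformly convergent functions. -/
theorem IsDeltaSequence.tendsto_integral (hρ : IsDeltaSequence ρ) {g : ℕ → ℝ → ℝ} {l : ℝ}
    (hg : ∀ n, Continuous (g n))
    (h : ∀ ε > 0, ∃ r > 0, ∀ᶠ n in Filter.atTop, ∀ φ, |φ| < r → |g n φ - l| ≤ ε) :
    Filter.Tendsto (fun n => ∫ φ in (-Real.pi)..Real.pi, ρ n φ * g n φ) Filter.atTop (nhds l) := by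
  have hpi := Real.pi_pos
  rw [Metric.tendsto_atTop']
  intro ε hε
  obtain ⟨r, hr, hev⟩ := h (ε / 2) (half_pos hε)
  have hev2 := hev.and (hρ.concentrated r hr)
  obtain ⟨n₀, hn₀⟩ := Filter.eventually_atTop.mp hev2
  refine ⟨n₀, fun n hn => ?_⟩
  obtain ⟨h1, h2⟩ := hn₀ n hn.le
  have hc := (hρ.smooth n).continuous
  have e : (∫ φ in (-Real.pi)..Real.pi, ρ n φ * g n φ) - l =
      ∫ φ in (-Real.pi)..Real.pi, ρ n φ * (g n φ - l) := by
    have := hg n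
    simp only [mul_sub]
    rw [intervalIntegral.integral_sub (Continuous.intervalIntegrable (by fun_prop) _ _)
      (Continuous.intervalIntegrable (by fun_prop) _ _), intervalIntegral.integral_mul_const,
      hρ.mass, one_mul]
  have hle : -Real.pi ≤ Real.pi := by linarith
  rw [Real.dist_eq, e]
  refine lt_of_le_of_lt ?_ (half_lt_self hε)
  have h3 : ‖∫ φ in (-Real.pi)..Real.pi, ρ n φ * (g n φ - l)‖ ≤
      ∫ φ in (-Real.pi)..Real.pi, ρ n φ * (ε / 2) := by
    refine intervalIntegral.norm_integral_le_of_norm_le hle ?_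
      (Continuous.intervalIntegrable (by fun_prop) _ _)
    refine Filter.Eventually.of_forall fun φ hφ => ?_
    rw [norm_mul, Real.norm_of_nonneg (hρ.nonneg n φ)]
    by_cases hφr : |φ| < r
    · exact mul_le_mul_of_nonneg_left (h1 φ hφr) (hρ.nonneg n φ)
    · rw [h2 φ (not_lt.mp hφr) (abs_le.mpr ⟨hφ.1.le, hφ.2⟩), zero_mul, zero_mul]
  rwa [intervalIntegral.integral_mul_const, hρ.mass, one_mul] at h3

theorem IsDeltaSequence.tendsto_integral_continuous (hρ : IsDeltaSequence ρ) {g : ℝ → ℝ}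
    (hg : Continuous g) (hper : ∀ φ, g (φ + 2 * Real.pi) = g φ) (c : ℝ) :
    Filter.Tendsto (fun n => ∫ φ in (-Real.pi)..Real.pi, ρ n (φ - c) * g φ) Filter.atTop
      (nhds (g c)) := by
  have e : ∀ n, ∫ φ in (-Real.pi)..Real.pi, ρ n (φ - c) * g φ =
      ∫ φ in (-Real.pi)..Real.pi, ρ n φ * g (φ + c) := fun n => by
    rw [← integral_period_shift (F := fun φ => ρ n (φ - c) * g φ) (c := c)]
    · simp only [add_sub_cancel_right]
    · intro φ
      rw [add_sub_right_comm, hρ.periodic, hper]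
  simp only [e]
  refine hρ.tendsto_integral (fun n => by fun_prop) fun ε hε => ?_
  obtain ⟨r, hr, h⟩ := Metric.continuousAt_iff.mp (hg.continuousAt (x := c)) ε hε
  refine ⟨r, hr, Filter.Eventually.of_forall fun n φ hφ => ?_⟩
  exact (h (x := φ + c) (by simpa [Real.dist_eq] using hφ)).le

/-- Near one plane the step function of the other has no jump and is linear, vanishing on the plane
itself. This is why mixed products disappear. -/
theorem IsDeltaSequence.stepFun_sub_pi (hρ : IsDeltaSequence ρ) :
    ∀ᶠ n in Filter.atTop, ∀ φ, |φ| < 1 → stepFun (ρ n) (φ - Real.pi) = -(φ / Real.pi) := by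
  -- Radius 1 suffices since π > 3: for |φ| < 1 the distance π - |φ| to the other plane exceeds 1.
  filter_upwards [hρ.concentrated 1 one_pos] with n hn φ hφ
  have hpi := Real.pi_gt_three
  have hc := (hρ.smooth n).continuous
  have hφ' := abs_lt.mp hφ
  have hpi0 := Real.pi_ne_zero
  rcases le_total 0 φ with h | h
  · rw [← neg_sub, stepFun_neg (hρ.even n),
      stepFun_eq_of_vanish hc (hρ.even n) (hρ.mass n) hn] <;> try linarith
    field_simp
    ring
  · rw [← stepFun_periodic hc (hρ.periodic n) (hρ.mass n),
      show φ - Real.pi + 2 * Real.pi = φ + Real.pi by ring,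
      stepFun_eq_of_vanish hc (hρ.even n) (hρ.mass n) hn] <;> try linarith
    field_simp
    ring

theorem IsDeltaSequence.continuous_stepFun (hρ : IsDeltaSequence ρ) (n : ℕ) :
    Continuous (stepFun (ρ n)) := (contDiff_stepFun (hρ.smooth n)).continuous

/-- The identity ∫δε² = (1/2π)∫ε² replaces a product of singular factors by an integral of bounded
functions, with limit (1/π)∫₀^π (1 - φ/π)² dφ = 1/3. Setting ε to a fixed value on the plane
beforehand would lose this number. -/
theorem IsDeltaSequence.tendsto_sq (hρ : IsDeltaSequence ρ) :
    Filter.Tendsto (fun n => ∫ φ in (-Real.pi)..Real.pi, ρ n φ *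
      (stepFun (ρ n) φ * stepFun (ρ n) φ)) Filter.atTop (nhds (1 / 3)) := by
  have hpi := Real.pi_pos
  have h1 : Filter.Tendsto (fun n => ∫ φ in (0 : ℝ)..Real.pi, stepFun (ρ n) φ ^ 2) Filter.atTop
      (nhds (∫ φ in (0 : ℝ)..Real.pi, (1 - φ / Real.pi) ^ 2)) := by
    -- The dominating constant is the square of the bound |ε| ≤ 3.
    refine intervalIntegral.tendsto_integral_filter_of_dominated_convergence (fun _ => 9) ?_ ?_
      intervalIntegrable_const ?_
    · exact Filter.Eventually.of_forall fun n =>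
        ((hρ.continuous_stepFun n).pow 2).aestronglyMeasurable
    · refine Filter.Eventually.of_forall fun n => Filter.Eventually.of_forall fun φ hφ => ?_
      rw [Set.uIoc_of_le hpi.le] at hφ
      have := abs_stepFun_le (hρ.smooth n).continuous (hρ.nonneg n) (hρ.mass n)
        (abs_le.mpr ⟨by linarith [hφ.1], hφ.2⟩)
      rw [Real.norm_eq_abs, abs_pow]
      nlinarith [abs_nonneg (stepFun (ρ n) φ)]
    · refine Filter.Eventually.of_forall fun φ hφ => ?_
      rw [Set.uIoc_of_le hpi.le] at hφ
      refine tendsto_const_nhds.congr' ?_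
      filter_upwards [hρ.concentrated φ hφ.1] with n hn
      rw [stepFun_eq_of_vanish (hρ.smooth n).continuous (hρ.even n) (hρ.mass n) hn hφ.1.le le_rfl
        hφ.2]
  have h2 : ∫ φ in (0 : ℝ)..Real.pi, (1 - φ / Real.pi) ^ 2 = Real.pi / 3 := by
    have hd : ∀ φ : ℝ, HasDerivAt (fun t => -(Real.pi / 3) * (1 - t / Real.pi) ^ 3)
        ((1 - φ / Real.pi) ^ 2) φ := fun φ => by
      have h := (((hasDerivAt_id' φ).div_const Real.pi).const_sub 1).fun_pow 3
      refine (h.const_mul (-(Real.pi / 3))).congr_deriv ?_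
      push_cast
      field_simp
    rw [intervalIntegral.integral_eq_sub_of_hasDerivAt (fun φ _ => hd φ)
      (Continuous.intervalIntegrable (by fun_prop) _ _)]
    field_simp
    ring
  have h3 : ∀ n, ∫ φ in (-Real.pi)..Real.pi, stepFun (ρ n) φ ^ 2 =
      2 * ∫ φ in (0 : ℝ)..Real.pi, stepFun (ρ n) φ ^ 2 := fun n => by
    have hE := hρ.continuous_stepFun n
    have h := intervalIntegral.integral_comp_neg (a := 0) (b := Real.pi)
      (fun φ => stepFun (ρ n) φ ^ 2)
    simp only [stepFun_neg (hρ.even n), neg_zero, neg_sq] at h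
    rw [← intervalIntegral.integral_add_adjacent_intervals (b := 0)
      (Continuous.intervalIntegrable (by fun_prop) _ _)
      (Continuous.intervalIntegrable (by fun_prop) _ _), ← h]
    ring
  have e : ∀ n, ∫ φ in (-Real.pi)..Real.pi, ρ n φ * (stepFun (ρ n) φ * stepFun (ρ n) φ) =
      1 / Real.pi * ∫ φ in (0 : ℝ)..Real.pi, stepFun (ρ n) φ ^ 2 := fun n => by
    rw [integral_mul_stepFun_sq (hρ.smooth n).continuous (hρ.periodic n) (hρ.mass n), h3]
    field_simp
  simp only [e]
  rw [h2] at h1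
  convert h1.const_mul (1 / Real.pi) using 2
  field_simp

/-- On the shrinking support of δ one factor stays bounded by 3 and the other is -φ/π, which tends
to zero. -/
theorem IsDeltaSequence.tendsto_mixed (hρ : IsDeltaSequence ρ) :
    Filter.Tendsto (fun n => ∫ φ in (-Real.pi)..Real.pi, ρ n φ *
      (stepFun (ρ n) φ * stepFun (ρ n) (φ - Real.pi))) Filter.atTop (nhds 0) := by
  have hpi := Real.pi_gt_three
  refine hρ.tendsto_integral (fun n => by have := hρ.continuous_stepFun n; fun_prop)
    fun ε hε => ⟨min 1 ε, lt_min one_pos hε, ?_⟩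
  filter_upwards [hρ.stepFun_sub_pi] with n hn φ hφ
  rw [lt_min_iff] at hφ
  have h3 := abs_stepFun_le (hρ.smooth n).continuous (hρ.nonneg n) (hρ.mass n)
    (φ := φ) (by linarith)
  have h4 : |φ| / Real.pi ≤ ε / 3 := by
    have := abs_nonneg φ
    gcongr
    linarith
  rw [hn φ hφ.1, sub_zero, abs_mul, abs_neg, abs_div, abs_of_pos Real.pi_pos]
  calc _ ≤ 3 * (ε / 3) := by gcongr
    _ = ε := by ring

theorem IsDeltaSequence.tendsto_opposite (hρ : IsDeltaSequence ρ) :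
    Filter.Tendsto (fun n => ∫ φ in (-Real.pi)..Real.pi, ρ n φ *
      (stepFun (ρ n) (φ - Real.pi) * stepFun (ρ n) (φ - Real.pi))) Filter.atTop (nhds 0) := by
  have hpi := Real.pi_gt_three
  refine hρ.tendsto_integral (fun n => by have := hρ.continuous_stepFun n; fun_prop)
    fun ε hε => ⟨min 1 ε, lt_min one_pos hε, ?_⟩
  filter_upwards [hρ.stepFun_sub_pi] with n hn φ hφ
  rw [lt_min_iff] at hφ
  have h5 := abs_nonneg φ
  have h4 : |φ| / Real.pi ≤ ε := (div_le_self h5 (by linarith)).trans hφ.2.le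
  have h6 : |φ| / Real.pi ≤ 1 := (div_le_self h5 (by linarith)).trans hφ.1.le
  rw [hn φ hφ.1, sub_zero, abs_mul, abs_neg, abs_div, abs_of_pos Real.pi_pos]
  calc _ ≤ 1 * ε := by gcongr
    _ = ε := one_mul ε

/-- Shifting φ by π exchanges the planes, so δ may be taken at φ = 0; the cases are then ε², ε times
the opposite step function, and the square of the latter. -/
theorem IsDeltaSequence.tendsto_triple (hρ : IsDeltaSequence ρ) (i k l : Fin 2) :
    Filter.Tendsto (fun n => ∫ φ in (-Real.pi)..Real.pi, ρ n (φ - fixedPoint i) *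
      (stepFun (ρ n) (φ - fixedPoint k) * stepFun (ρ n) (φ - fixedPoint l))) Filter.atTop
      (nhds (if i = k ∧ i = l then 1 / 3 else 0)) := by
  have hstep : ∀ n φ, stepFun (ρ n) (φ + Real.pi) = stepFun (ρ n) (φ - Real.pi) := fun n φ => by
    rw [← stepFun_periodic (hρ.smooth n).continuous (hρ.periodic n) (hρ.mass n) (φ - Real.pi)]
    congr 1
    ring
  have hq : ∀ n φ c, stepFun (ρ n) (φ + 2 * Real.pi - c) = stepFun (ρ n) (φ - c) := fun n φ c => by
    rw [add_sub_right_comm,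
      stepFun_periodic (hρ.smooth n).continuous (hρ.periodic n) (hρ.mass n)]
  have hshift : ∀ n a b, ∫ φ in (-Real.pi)..Real.pi, ρ n (φ - Real.pi) *
        (stepFun (ρ n) (φ - a) * stepFun (ρ n) (φ - b)) = ∫ φ in (-Real.pi)..Real.pi, ρ n φ *
        (stepFun (ρ n) (φ + Real.pi - a) * stepFun (ρ n) (φ + Real.pi - b)) := fun n a b => by
    rw [← integral_period_shift (F := fun φ => ρ n (φ - Real.pi) *
        (stepFun (ρ n) (φ - a) * stepFun (ρ n) (φ - b))) (c := Real.pi)]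
    · simp only [add_sub_cancel_right]
    · intro φ
      rw [add_sub_right_comm, hρ.periodic, hq, hq]
  have h00 : ∀ n, _ = _ := fun n => hshift n 0 0
  have h01 : ∀ n, _ = _ := fun n => hshift n 0 Real.pi
  have h10 : ∀ n, _ = _ := fun n => hshift n Real.pi 0
  have h11 : ∀ n, _ = _ := fun n => hshift n Real.pi Real.pi
  simp only [sub_zero, add_sub_cancel_right, hstep] at h00 h01 h10 h11
  fin_cases i <;> fin_cases k <;> fin_cases l <;>
    simp only [fixedPoint, Fin.zero_eta, Fin.mk_one, Fin.isValue, Matrix.cons_val_zero,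
      Matrix.cons_val_one, sub_zero, and_self, zero_ne_one, one_ne_zero, and_false, false_and,
      if_true, if_false, Matrix.cons_val_fin_one]
  · exact hρ.tendsto_sq
  · exact hρ.tendsto_mixed
  · simpa only [mul_comm (stepFun _ (_ - _))] using hρ.tendsto_mixed
  · exact hρ.tendsto_opposite
  · simpa only [h00] using hρ.tendsto_opposite
  · simpa only [h01, mul_comm (stepFun _ (_ - _))] using hρ.tendsto_mixed
  · simpa only [h10] using hρ.tendsto_mixed
  · simpa only [h11] using hρ.tendsto_sq

end DeltaLimits

/-! ### Integration over the circle direction -/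

section FiberIntegration

open MeasureTheory

variable {K U : Set (Fin 10 → ℝ)}

theorem restrictTo_pullBack (φ : ℝ) (α : Form 10) : restrictTo φ (pullBack α) = α := by
  funext x
  rw [restrictTo_apply, pullBack_apply, planePoint_snoc, restrictCovector_pullCovector]

theorem planeIntegral_eq (hU : IsOpen U) (hKU : K ⊆ U) {α : Form 10} (h0 : ∀ x ∉ K, α x = 0) :
    planeIntegral U α = ∫ x in K, coefficient Finset.univ (α x) :=
  setIntegral_eq_of_subset_of_forall_sdiff_eq_zero hU.measurableSet hKU fun x hx => by
    rw [h0 x hx.2, map_zero]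

theorem planeIntegral_smul (r : ℝ) (α : Form 10) :
    planeIntegral U (r • α) = r * planeIntegral U α := by
  unfold planeIntegral
  rw [← integral_const_mul]
  simp

theorem planeIntegral_congr (hU : IsOpen U) {α β : Form 10} (h : Set.EqOn α β U) :
    planeIntegral U α = planeIntegral U β :=
  setIntegral_congr_fun hU.measurableSet fun x hx => by simp only [h hx]

theorem snoc_add_last (x : Fin 10 → ℝ) (φ t : ℝ) :
    (Fin.snoc x φ + Pi.single (Fin.last 10) t : Fin 11 → ℝ) = Fin.snoc x (φ + t) := by
  funext μ
  refine Fin.lastCases ?_ (fun μ => ?_) μ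
  · simp [-Fin.reduceLast]
  · simp [-Fin.reduceLast, (Fin.castSucc_lt_last μ).ne]

variable {η : Form 11}

theorem restrictTo_eq_zero (h0 : ∀ y, planePoint y ∉ K → η y = 0) (φ : ℝ) {x : Fin 10 → ℝ}
    (hx : x ∉ K) : restrictTo φ η x = 0 := by
  rw [restrictTo_apply, h0 _ (by rwa [planePoint_snoc]), map_zero]

theorem continuous_planeIntegral (hU : IsOpen U) (hKU : K ⊆ U) (hK : IsCompact K)
    (hη : SmoothForm Set.univ η) (h0 : ∀ y, planePoint y ∉ K → η y = 0) :
    Continuous fun φ => planeIntegral U (restrictTo φ η) := by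
  simp only [fun φ => planeIntegral_eq hU hKU fun x hx => restrictTo_eq_zero h0 φ hx]
  have hc : Continuous fun y => coefficient Finset.univ (restrictCovector (η y)) :=
    (contDiffOn_univ.mp (hη.functional
      ((coefficient Finset.univ).comp restrictCovector.toLinearMap))).continuous
  exact continuous_fiberIntegral hK hc

theorem integral_dphi_mul (hU : IsOpen U) (hKU : K ⊆ U) (hK : IsCompact K)
    (hη : SmoothForm Set.univ η) (h0 : ∀ y, planePoint y ∉ K → η y = 0) {s : ℝ → ℝ}
    (hs : Continuous s) :
    IntegrableOn (fun y => s (y (Fin.last 10)) * coefficient Finset.univ (dphi y * η y))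
      periodSlab ∧
    ∫ y in periodSlab, s (y (Fin.last 10)) * coefficient Finset.univ (dphi y * η y) =
      ∫ φ in (-Real.pi)..Real.pi, s φ * planeIntegral U (restrictTo φ η) := by
  have hc : Continuous fun y => coefficient Finset.univ (dphi y * η y) :=
    (contDiffOn_univ.mp ((smooth_dphi.mul hη) Finset.univ)).continuous
  have hf : Continuous fun y : Fin 11 → ℝ =>
      s (y (Fin.last 10)) * coefficient Finset.univ (dphi y * η y) :=
    (hs.comp (continuous_apply _)).mul hc
  have hf0 : ∀ y, planePoint y ∉ K →
      s (y (Fin.last 10)) * coefficient Finset.univ (dphi y * η y) = 0 := fun y hy => by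
    rw [h0 y hy, mul_zero, map_zero, mul_zero]
  refine ⟨integrableOn_periodSlab hK hf hf0, ?_⟩
  rw [integral_periodSlab hK hf hf0]
  refine intervalIntegral.integral_congr fun φ _ => ?_
  simp only [Fin.snoc_last, dphi_apply, coefficient_univ_last_mul,
    fun φ => planeIntegral_eq hU hKU fun x hx => restrictTo_eq_zero h0 φ hx]
  rw [integral_const_mul]
  rfl

/-- The integral over `U × S¹` of an exact form plus forms `s(φ) dφ ∧ η`. -/
theorem bulkIntegral_exact_add_sum (hU : IsOpen U) (hKU : K ⊆ U) (hK : IsCompact K) {β L : Form 11}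
    (hβ : SmoothForm (bulkRegion U) β) (hβ0 : ∀ y, planePoint y ∉ K → β y = 0)
    (hβp : CirclePeriodic β) {J : Type*} [Fintype J] {s : J → ℝ → ℝ} (hs : ∀ j, Continuous (s j))
    {η : J → Form 11} (hη : ∀ j, SmoothForm (bulkRegion U) (η j))
    (hη0 : ∀ j y, planePoint y ∉ K → η j y = 0) (c : ℝ)
    (hL : ∀ y ∈ bulkRegion U,
      L y = extD β y + c • ∑ j, s j (y (Fin.last 10)) • (dphi y * η j y)) :
    bulkIntegral U L =
      c * ∑ j, ∫ φ in (-Real.pi)..Real.pi, s j φ * planeIntegral U (restrictTo φ (η j)) := by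
  have hβ' := smoothForm_univ_of_support hKU hK hU hβ hβ0
  have hη' := fun j => smoothForm_univ_of_support hKU hK hU (hη j) (hη0 j)
  have hsum := fun j => integral_dphi_mul hU hKU hK (hη' j) (hη0 j) (hs j)
  have hd : IntegrableOn (fun y => coefficient Finset.univ (extD β y)) periodSlab := by
    refine integrableOn_periodSlab hK ?_ fun y hy => ?_
    · exact (contDiffOn_univ.mp ((hβ'.extD isOpen_univ) Finset.univ)).continuous
    · rw [extD_eq_zero_of_support hK hβ0 hy, map_zero]
  rw [bulkIntegral_eq (K := K) (f := fun y => coefficient Finset.univ (extD β y) + c * ∑ j,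
    s j (y (Fin.last 10)) * coefficient Finset.univ (dphi y * η j y)) hU hKU]
  -- Stokes removes the exact part; compact support makes every remaining term integrable.
  · rw [integral_add hd, integral_extD_eq_zero hK hβ' hβ0 hβp, zero_add, integral_const_mul,
      integral_finsetSum _ fun j _ => (hsum j).1]
    · simp only [fun j => (hsum j).2]
    · exact (integrable_finsetSum _ fun j _ => (hsum j).1).const_mul c
  · intro y hy
    rw [hL y hy]
    simp
  · intro y hy
    rw [extD_eq_zero_of_support hK hβ0 hy]
    simp [hη0 _ y hy]

end FiberIntegration

/-! ### Smoothness of X₆ -/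

section SixForm

variable {N : ℕ} {κ : Type*} [Fintype κ] [DecidableEq κ] {U : Set (Fin N → ℝ)}
  {L A : Matrix κ κ (Form N)}

theorem smooth_sixForm (hU : IsOpen U) (hA : IsConnection U A) (hL : IsParameter U L) :
    SmoothForm U (sixForm L A) := by
  have hAp := hA.matD_isParameter hU
  have hSp := hA.mul hA
  refine SmoothForm.smul _ (SmoothForm.sub (SmoothForm.smul _ ?_) (SmoothForm.smul _
    ((smooth_trace_parameter hU hA hL).mul (hA.smooth_trace_sq hU))))
  refine smoothForm_trace (hL.mul (IsConnection.matD_isParameter hU (IsConnection.add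
    (IsConnection.add ?_ ?_) ?_))).smooth
  · exact ((((hA.mul_parameter hAp).mul_parameter hAp).add
      ((hAp.mul_connection hA).mul_parameter hAp)).add
      ((hAp.mul hAp).mul_connection hA)).smul _
  · exact (((((((hA.mul_parameter hAp).mul_parameter hSp).add
      ((hA.mul_parameter hSp).mul_parameter hAp)).add
      ((hAp.mul_connection hA).mul_parameter hSp)).add
      ((hSp.mul_connection hA).mul_parameter hAp)).add
      ((hAp.mul hSp).mul_connection hA)).add ((hSp.mul hAp).mul_connection hA)).smul _
  · exact ((hA.mul_parameter hSp).mul_parameter hSp).smul _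

end SixForm

/-! ### The inflow when the regularisation is removed -/

section Inflow

open MeasureTheory

variable {𝔤 : Type*} [LieRing 𝔤] [LieAlgebra ℝ 𝔤] [FiniteDimensional ℝ 𝔤]
  {U : Set (Fin 10 → ℝ)} {Φ : Config (Module.finrank ℝ 𝔤)} {Λ : Param (Module.finrank ℝ 𝔤)}

theorem IsFieldConfig.circlePeriodic_C (hΦ : IsFieldConfig 𝔤 U Φ) : CirclePeriodic Φ.C := by
  obtain ⟨B, -, -, hB, h⟩ := hΦ.form
  rw [h]
  exact CirclePeriodic.mul hB circlePeriodic_dphi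

theorem IsFieldConfig.matPeriodic_spin (hΦ : IsFieldConfig 𝔤 U Φ) : MatPeriodic Φ.Ω := by
  obtain ⟨Ω, -, hp, -, -, h⟩ := hΦ.spin
  intro i j y
  rw [h]
  simp only [connectionForm, Matrix.of_apply, hp y]

theorem matPeriodic_bulkParam : MatPeriodic (bulkParam Λ) := by
  intro i j
  rcases i with i | i <;> rcases j with j | j
  · exact circlePeriodic_pullBack _
  all_goals exact fun y => rfl

variable {ρ : ℕ → ℝ → ℝ}

theorem IsDeltaSequence.circlePeriodic_stepForm (hρ : IsDeltaSequence ρ) (n : ℕ) (i : Fin 2) :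
    CirclePeriodic (stepForm (ρ n) i) :=
  HoravaWitten.circlePeriodic_stepForm (hρ.smooth n).continuous (hρ.periodic n) (hρ.mass n) i

theorem IsFieldConfig.circlePeriodic_fieldG (hΦ : IsFieldConfig 𝔤 U Φ) (hρ : IsDeltaSequence ρ)
    (n : ℕ) (γ b : ℝ) : CirclePeriodic (fieldG γ b (ρ n) Φ) := by
  refine CirclePeriodic.sub (CirclePeriodic.add (CirclePeriodic.sub
    hΦ.circlePeriodic_C.extD ?_) ?_) ?_
  · exact (CirclePeriodic.sum fun i _ => (circlePeriodic_deltaForm (hρ.periodic n) i).mul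
      (circlePeriodic_pullBack _)).smul _
  · exact (CirclePeriodic.sum fun i _ => (hρ.circlePeriodic_stepForm n i).mul
      (circlePeriodic_pullBack _)).smul _
  · exact (CirclePeriodic.sum fun i _ => circlePeriodic_dphi.mul
      (circlePeriodic_pullBack _)).smul _

/-- The forms ω̄¹ᵢĪ₄ₖĪ₄ₗ do not depend on φ, so each action variation is a finite sum of constants
times regularised integrals, and only the limits of the latter matter. -/
theorem IsFieldConfig.tendsto_topLagrangian (hU : IsOpen U) (hΦ : IsFieldConfig 𝔤 U Φ)
    (hΛ : IsGaugeParam 𝔤 U Λ) (hρ : IsDeltaSequence ρ) (kap γ b : ℝ) :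
    Filter.Tendsto
      (fun n => actionVariation U (topLagrangian kap γ b (ρ n)) γ b (ρ n) Λ Φ) Filter.atTop
      (nhds (∑ i, planeIntegral U (topTen kap γ b Λ.L (Λ.g i) (planeSpin Φ i) (Φ.A i)))) := by
  obtain ⟨K, hKU, hK, hK0⟩ := hΛ.exists_support
  have hW0 : ∀ i y, planePoint y ∉ K → pullBack (planeTwo Λ Φ i) y = 0 := fun i y hy => by
    rw [pullBack_apply, planeTwo_eq_zero (hK0 _ hy), map_zero]
  let s (n : ℕ) (j : Fin 2 × Fin 2 × Fin 2) (φ : ℝ) : ℝ :=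
    ρ n (φ - fixedPoint j.1) * (stepFun (ρ n) (φ - fixedPoint j.2.1) *
      stepFun (ρ n) (φ - fixedPoint j.2.2)) + 2 * (ρ n (φ - fixedPoint j.2.1) *
      (stepFun (ρ n) (φ - fixedPoint j.1) * stepFun (ρ n) (φ - fixedPoint j.2.2)))
  let η (j : Fin 2 × Fin 2 × Fin 2) : Form 10 :=
    planeTwo Λ Φ j.1 * (planeFour Φ j.2.1 * planeFour Φ j.2.2)
  have hval : ∀ n, actionVariation U (topLagrangian kap γ b (ρ n)) γ b (ρ n) Λ Φ =
      topCoupling kap γ b * ∑ j, (∫ φ in (-Real.pi)..Real.pi, s n j φ) *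
        planeIntegral U (η j) := fun n => by
    have hE := hρ.continuous_stepFun n
    have hR := (hρ.smooth n).continuous
    have hG := hΦ.smooth_fieldG hU (hρ.smooth n) γ b
    rw [actionVariation, bulkIntegral_exact_add_sum (J := Fin 2 × Fin 2 × Fin 2) hU hKU hK
      (β := (-(γ * b / (48 * kap ^ 2))) • ∑ i, stepForm (ρ n) i * pullBack (planeTwo Λ Φ i) *
          fieldG γ b (ρ n) Φ * fieldG γ b (ρ n) Φ) (s := s n) (η := fun j => pullBack (η j))
      (c := topCoupling kap γ b)]
    · simp only [restrictTo_pullBack, intervalIntegral.integral_mul_const]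
    · exact (SmoothForm.sum fun i _ => (((smooth_stepForm (hρ.smooth n) i).mul
        (hΦ.smooth_planeTwo hU hΛ i)).mul hG).mul hG).smul _
    · intro y hy
      simp [hW0 _ y hy]
    · exact (CirclePeriodic.sum fun i _ => (((hρ.circlePeriodic_stepForm n i).mul
        (circlePeriodic_pullBack _)).mul (hΦ.circlePeriodic_fieldG hρ n γ b)).mul
          (hΦ.circlePeriodic_fieldG hρ n γ b)).smul _
    · intro j
      simp only [s]
      fun_prop
    · intro j
      simp only [η, pullBack_mul]
      exact (hΦ.smooth_planeTwo hU hΛ _).mul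
        ((hΦ.smooth_planeFour hU _).mul (hΦ.smooth_planeFour hU _))
    · intro j y hy
      simp only [η, pullBack_triple, hW0 _ y hy, zero_mul]
    · intro y hy
      refine (hΦ.topLagrangian_variation hU hΛ (hρ.smooth n) kap γ b hy).trans ?_
      refine congrArg (fun a => extD _ y + topCoupling kap γ b • a) ?_
      simp only [Fintype.sum_prod_type, s, η]
      refine Finset.sum_congr rfl fun i _ => Finset.sum_congr rfl fun k _ =>
        Finset.sum_congr rfl fun l _ => ?_
      congr 1
      ring
  -- On the diagonal the limit is 1/3 + 2 · 1/3 = 1, elsewhere 0: the anomaly is local to each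
  -- plane.
  have hlim : ∀ j : Fin 2 × Fin 2 × Fin 2, Filter.Tendsto
      (fun n => ∫ φ in (-Real.pi)..Real.pi, s n j φ) Filter.atTop
      (nhds (if j.1 = j.2.1 ∧ j.1 = j.2.2 then 1 else 0)) := fun j => by
    have h := (hρ.tendsto_triple j.1 j.2.1 j.2.2).add
      ((hρ.tendsto_triple j.2.1 j.1 j.2.2).const_mul 2)
    have e : ∀ n, ∫ φ in (-Real.pi)..Real.pi, s n j φ = (∫ φ in (-Real.pi)..Real.pi,
        ρ n (φ - fixedPoint j.1) * (stepFun (ρ n) (φ - fixedPoint j.2.1) *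
          stepFun (ρ n) (φ - fixedPoint j.2.2))) + 2 * ∫ φ in (-Real.pi)..Real.pi,
        ρ n (φ - fixedPoint j.2.1) * (stepFun (ρ n) (φ - fixedPoint j.1) *
          stepFun (ρ n) (φ - fixedPoint j.2.2)) := fun n => by
      have hE := hρ.continuous_stepFun n
      have hR := (hρ.smooth n).continuous
      rw [← intervalIntegral.integral_const_mul, ← intervalIntegral.integral_add
        (Continuous.intervalIntegrable (by fun_prop) _ _)
        (Continuous.intervalIntegrable (by fun_prop) _ _)]
    simp only [e]
    convert h using 2
    obtain ⟨i, k, l⟩ := j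
    by_cases hik : i = k
    · subst hik
      by_cases hil : i = l <;> simp [hil]
      norm_num
    · simp [hik, Ne.symm hik]
  simp only [hval]
  have := (tendsto_finsetSum Finset.univ fun j _ =>
    (hlim j).mul_const (planeIntegral U (η j))).const_mul (topCoupling kap γ b)
  convert this using 2
  rw [Finset.mul_sum, Fintype.sum_prod_type]
  simp only [Fintype.sum_prod_type, Fin.sum_univ_two, topTen, planeIntegral_smul, sq]
  simp [η, planeTwo, planeFour]

/-- A single δ tests the integral over U of the restriction to the slice φ, which is continuous and
periodic in φ. The limit is its value on the plane, where X₆ reduces to its ten-dimensional form. -/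
theorem IsFieldConfig.tendsto_gsLagrangian (hU : IsOpen U) (hΦ : IsFieldConfig 𝔤 U Φ)
    (hΛ : IsGaugeParam 𝔤 U Λ) (hρ : IsDeltaSequence ρ) (kap γ b : ℝ) :
    Filter.Tendsto
      (fun n => actionVariation U (gsLagrangian kap γ b (ρ n)) γ b (ρ n) Λ Φ) Filter.atTop
      (nhds (∑ i, planeIntegral U (gsTen kap γ Λ.L (planeSpin Φ i) (Φ.A i)))) := by
  obtain ⟨K, hKU, hK, hK0⟩ := hΛ.exists_support
  have h60 : ∀ y, planePoint y ∉ K → sixForm (bulkParam Λ) Φ.Ω y = 0 := fun y hy =>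
    bulkSix_eq_zero (hK0 _ hy).1
  have h6 : SmoothForm (bulkRegion U) (sixForm (bulkParam Λ) Φ.Ω) :=
    smooth_sixForm (isOpen_bulkRegion hU) hΦ.spin_isConnection hΛ.bulk_isParameter
  let η (i : Fin 2) : Form 11 := pullBack (planeFour Φ i) * sixForm (bulkParam Λ) Φ.Ω
  have hη : ∀ i, SmoothForm (bulkRegion U) (η i) := fun i => (hΦ.smooth_planeFour hU i).mul h6
  have hη0 : ∀ i y, planePoint y ∉ K → η i y = 0 := fun i y hy => by
    simp only [η, Pi.mul_apply, h60 y hy, mul_zero]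
  have h6p : CirclePeriodic (sixForm (bulkParam Λ) Φ.Ω) :=
    matPeriodic_bulkParam.sixForm hΦ.matPeriodic_spin
  have hval : ∀ n, actionVariation U (gsLagrangian kap γ b (ρ n)) γ b (ρ n) Λ Φ =
      gsCoupling kap γ * ∑ i, ∫ φ in (-Real.pi)..Real.pi, ρ n (φ - fixedPoint i) *
        planeIntegral U (restrictTo φ (η i)) := fun n => by
    have hR := (hρ.smooth n).continuous
    rw [actionVariation, bulkIntegral_exact_add_sum hU hKU hK
      (β := (-(1 / (2 * gsScale kap))) • (fieldG γ b (ρ n) Φ * sixForm (bulkParam Λ) Φ.Ω))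
      (s := fun i φ => ρ n (φ - fixedPoint i)) (η := η) (c := gsCoupling kap γ)]
    · exact ((hΦ.smooth_fieldG hU (hρ.smooth n) γ b).mul h6).smul _
    · intro y hy
      simp [h60 y hy]
    · exact ((hΦ.circlePeriodic_fieldG hρ n γ b).mul h6p).smul _
    · intro j
      fun_prop
    · exact hη
    · exact hη0
    · exact fun y hy => hΦ.gsLagrangian_variation hU hΛ (hρ.smooth n) kap γ b hy
  have hlim : ∀ i, Filter.Tendsto (fun n => ∫ φ in (-Real.pi)..Real.pi,
      ρ n (φ - fixedPoint i) * planeIntegral U (restrictTo φ (η i))) Filter.atTop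
      (nhds (planeIntegral U (restrictTo (fixedPoint i) (η i)))) := fun i => by
    refine hρ.tendsto_integral_continuous (continuous_planeIntegral hU hKU hK
      (smoothForm_univ_of_support hKU hK hU (hη i) (hη0 i)) (hη0 i)) (fun φ => ?_) _
    have hηp : CirclePeriodic (η i) := (circlePeriodic_pullBack _).mul h6p
    have hr : restrictTo (φ + 2 * Real.pi) (η i) = restrictTo φ (η i) := by
      funext x
      rw [restrictTo_apply, restrictTo_apply, ← snoc_add_last, hηp]
    simp only [hr]
  simp only [hval]
  have := (tendsto_finsetSum Finset.univ fun i _ => hlim i).const_mul (gsCoupling kap γ)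
  convert this using 2
  rw [Finset.mul_sum]
  refine Finset.sum_congr rfl fun i _ => ?_
  rw [gsTen, planeIntegral_smul]
  congr 1
  refine planeIntegral_congr hU fun x hx => ?_
  have h := hΦ.restrictTo_six hU hΛ i hx
  rw [restrictTo_apply] at h ⊢
  simp only [η, Pi.mul_apply, map_mul, h, pullBack_apply, planePoint_snoc,
    restrictCovector_pullCovector]
  rfl

end Inflow

/-! ### Skew eigenvalues and traces of powers -/

section SkewEigenvalues

open Polynomial Matrix

/-- Splitting off a root r, nonzero as Q(0) = 1, gives the factor 1 - s/r; missing degree is filled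
with zeros. -/
theorem exists_prod_one_add_mul (n : ℕ) (Q : ℂ[X]) (hn : Q.natDegree ≤ n) (h0 : Q.coeff 0 = 1) :
    ∃ y : Fin n → ℂ, ∀ s : ℂ, Q.eval s = ∏ j, (1 + s * y j) := by
  induction n generalizing Q with
  | zero =>
    refine ⟨Fin.elim0, fun s => ?_⟩
    rw [eq_C_of_natDegree_le_zero hn, h0]
    simp
  | succ n ih =>
    by_cases hd : Q.natDegree = 0
    · refine ⟨0, fun s => ?_⟩
      rw [eq_C_of_natDegree_le_zero hd.le, h0]
      simp
    · obtain ⟨r, hr⟩ := IsAlgClosed.exists_root Q fun h => hd (natDegree_eq_of_degree_eq_some h)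
      obtain ⟨P, rfl⟩ := dvd_iff_isRoot.mpr hr
      have hr0 : r ≠ 0 := by
        rintro rfl
        simp at h0
      have hP : P ≠ 0 := by
        rintro rfl
        simp at h0
      have hdeg : (C (-r) * P).natDegree ≤ n := by
        rw [natDegree_mul (X_sub_C_ne_zero r) hP, natDegree_X_sub_C] at hn
        rw [natDegree_C_mul (neg_ne_zero.mpr hr0)]
        omega
      have hc : (C (-r) * P).coeff 0 = 1 := by
        rw [mul_coeff_zero] at h0 ⊢
        simpa using h0
      obtain ⟨y, hy⟩ := ih _ hdeg hc
      refine ⟨Fin.cons (-r⁻¹) y, fun s => ?_⟩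
      rw [Fin.prod_univ_succ]
      simp only [Fin.cons_zero, Fin.cons_succ, ← hy]
      simp only [eval_mul, eval_sub, eval_X, eval_C]
      field_simp
      ring

/-- Conjugation by the metric, whose square is 1 in both signatures, turns 1 - sM into the transpose
of 1 + sM. So the determinant is even in s; as a polynomial in s² it has degree at most 5, and
complex square roots of its parameters are the xⱼ. -/
theorem exists_isSkewEigenvalues {ε : ℝ} (hε : ε = 1 ∨ ε = -1)
    {R : Matrix (Fin 10) (Fin 10) ℝ} (hR : (flatMetric ε).IsSkewAdjoint R) :
    ∃ x, IsSkewEigenvalues R x := by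
  set J := (flatMetric ε).map Complex.ofReal with hJ
  set M := ((1 / (2 * Real.pi) : ℝ) : ℂ) • R.map Complex.ofReal with hM
  have hJJ : J * J = 1 := by
    have h1 : flatMetric ε * flatMetric ε = 1 := by
      rw [flatMetric, Matrix.diagonal_mul_diagonal, ← Matrix.diagonal_one]
      congr 1
      funext a
      rcases hε with rfl | rfl <;> split_ifs <;> norm_num
    have h2 : J * J = (flatMetric ε * flatMetric ε).map Complex.ofReal :=
      ((Complex.ofRealHom.mapMatrix (m := Fin 10)).map_mul (flatMetric ε) (flatMetric ε)).symm
    rw [h2, h1]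
    exact Matrix.map_one _ Complex.ofReal_zero Complex.ofReal_one
  have hskew : Mᵀ * J = J * -M := by
    have h1 : Rᵀ * flatMetric ε = flatMetric ε * -R := hR
    have h2 := congrArg (fun A : Matrix (Fin 10) (Fin 10) ℝ => A.map Complex.ofRealHom) h1
    simp only [Matrix.map_mul, Matrix.transpose_map] at h2
    have h3 : (-R).map Complex.ofRealHom = -(R.map Complex.ofReal) := by
      ext i j; simp
    rw [h3] at h2
    rw [hM, Matrix.transpose_smul, Matrix.smul_mul, ← smul_neg, Matrix.mul_smul]
    exact congrArg _ h2
  have heven : ∀ s : ℂ, (1 + s • M).det = (1 + (-s) • M).det := fun s => by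
    have h1 : J * (1 + (-s) • M) * J = (1 + s • M)ᵀ := by
      have h2 : Mᵀ = J * -M * J := by rw [← hskew, mul_assoc, hJJ, mul_one]
      rw [Matrix.transpose_add, Matrix.transpose_one, Matrix.transpose_smul, h2, mul_add, add_mul,
        mul_one, hJJ]
      simp
    have h3 : J.det * J.det = 1 := by rw [← Matrix.det_mul, hJJ, Matrix.det_one]
    rw [← Matrix.det_transpose (1 + s • M), ← h1, Matrix.det_mul, Matrix.det_mul, mul_right_comm,
      h3, one_mul]
  set p : ℂ[X] := ((X : ℂ[X]) • M.map C + (1 : Matrix (Fin 10) (Fin 10) ℂ).map C).det with hpdef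
  have hp : ∀ s, p.eval s = (1 + s • M).det := fun s => by
    rw [hpdef, ← coe_evalRingHom, RingHom.map_det]
    refine congrArg Matrix.det ?_
    ext i j
    by_cases hij : i = j <;> simp [hij, add_comm] <;> ring
  have hpe : p.comp (C (-1) * X) = p := Polynomial.funext fun s => by
    rw [eval_comp, eval_mul, eval_C, eval_X, hp, hp, heven s, neg_one_mul]
  have hodd : ∀ k, ¬ 2 ∣ k → p.coeff k = 0 := fun k hk => by
    have h1 := congrArg (fun q => q.coeff k) hpe
    simp only [comp_C_mul_X_coeff] at h1
    rw [Odd.neg_one_pow (Nat.odd_iff.mpr (by omega))] at h1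
    linear_combination (-(1 / 2 : ℂ)) * h1
  -- An even polynomial in s is a polynomial in s².
  have hexp : expand ℂ 2 (contract 2 p) = p := by
    ext k
    rw [coeff_expand two_pos]
    split_ifs with hk
    · rw [coeff_contract two_ne_zero, Nat.div_mul_cancel hk]
    · rw [hodd k hk]
  have hdeg : (contract 2 p).natDegree ≤ 5 := by
    have h1 : p.natDegree ≤ 10 := by
      exact (natDegree_det_X_add_C_le M 1).trans_eq (Fintype.card_fin 10)
    rw [← hexp, natDegree_expand] at h1
    omega
  have h0 : (contract 2 p).coeff 0 = 1 := by
    rw [coeff_contract two_ne_zero, zero_mul, hpdef, coeff_det_X_add_C_zero, Matrix.det_one]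
  obtain ⟨y, hy⟩ := exists_prod_one_add_mul 5 _ hdeg h0
  choose x hx using fun j => IsAlgClosed.exists_pow_nat_eq (y j) two_pos
  refine ⟨x, fun s => ?_⟩
  have h1 : (s / (2 * Real.pi)) • R.map Complex.ofReal = s • M := by
    rw [hM, smul_smul]
    refine congrArg (· • _) ?_
    push_cast
    ring
  rw [h1, ← hp, ← hexp, expand_eval, hy]
  simp only [hx]

theorem isSkewEigenvalues_skewEigenvalues {ε : ℝ} (hε : ε = 1 ∨ ε = -1)
    {R : Matrix (Fin 10) (Fin 10) ℝ} (hR : (flatMetric ε).IsSkewAdjoint R) :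
    IsSkewEigenvalues R (skewEigenvalues R) :=
  Classical.epsilon_spec (exists_isSkewEigenvalues hε hR)

/-- Compare linear coefficients in u. This needs only the determinant, so N may fail to be
diagonalisable. -/
theorem trace_eq_of_det {N : Matrix (Fin 10) (Fin 10) ℂ} {c : Fin 5 → ℂ}
    (h : ∀ u : ℂ, (1 + u • N).det = ∏ j, (1 + u * c j) ^ 2) : N.trace = 2 * ∑ j, c j := by
  have h1 : (1 + (X : ℂ[X]) • N.map C).det = ∏ j, (1 + X * C (c j)) ^ 2 :=
    Polynomial.funext fun u => by
      rw [eval_prod]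
      simp only [eval_pow, eval_add, eval_one, eval_mul, eval_X, eval_C, ← h]
      rw [← coe_evalRingHom, RingHom.map_det]
      refine congrArg Matrix.det ?_
      ext i j
      by_cases hij : i = j <;> simp [hij] <;> ring
  have h2 : ∀ q : ℂ[X], q.coeff 1 = (derivative q).eval 0 := fun q => by
    rw [← coeff_zero_eq_eval_zero, coeff_derivative]
    simp
  rw [← Matrix.coeff_det_one_add_X_smul_one, h1, h2]
  have h3 : ∀ a : ℂ, (derivative ((1 + X * C a) ^ 2)).eval 0 = 2 * a := fun a => by
    simp [sq, two_mul]
  have h4 : ∀ a : ℂ, ((1 + X * C a) ^ 2).eval 0 = 1 := fun a => by simp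
  simp only [Fin.prod_univ_five, Fin.sum_univ_five, derivative_mul, eval_add, eval_mul, h3, h4]
  ring

/-- With u = t² the matrix is (1 + tM)(1 - tM) for M = R/2π, and both factors have the same
determinant. -/
theorem IsSkewEigenvalues.det_sq {R : Matrix (Fin 10) (Fin 10) ℝ} {x : Fin 5 → ℂ}
    (h : IsSkewEigenvalues R x) (u : ℂ) :
    (1 + u • (-((1 / (4 * Real.pi ^ 2) : ℂ) • (R ^ 2).map Complex.ofReal))).det =
      ∏ j, (1 + u * x j ^ 2) ^ 2 := by
  obtain ⟨t, rfl⟩ := IsAlgClosed.exists_pow_nat_eq u two_pos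
  have h1 := h t
  have h2 := h (-t)
  rw [Finset.prod_pow, sq (∏ j, _)]
  conv_rhs => enter [1]; rw [← h1]
  rw [neg_sq] at h2
  rw [← h2, ← Matrix.det_mul]
  congr 1
  have e : (R ^ 2).map Complex.ofReal = R.map Complex.ofReal * R.map Complex.ofReal := by
    rw [sq]
    exact Matrix.map_mul (f := Complex.ofRealHom)
  have hpi : (Real.pi : ℂ) ≠ 0 := Complex.ofReal_ne_zero.mpr Real.pi_ne_zero
  rw [e, add_mul, one_mul, mul_add, mul_one, Matrix.smul_mul, Matrix.mul_smul]
  match_scalars <;> field_simp <;> ring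

theorem det_one_add_smul_sq {N : Matrix (Fin 10) (Fin 10) ℂ} {c : Fin 5 → ℂ}
    (h : ∀ u : ℂ, (1 + u • N).det = ∏ j, (1 + u * c j) ^ 2) (u : ℂ) :
    (1 + u • N ^ 2).det = ∏ j, (1 + u * c j ^ 2) ^ 2 := by
  obtain ⟨t, ht⟩ := IsAlgClosed.exists_pow_nat_eq (-u) two_pos
  have e : 1 + u • N ^ 2 = (1 + t • N) * (1 + (-t) • N) := by
    rw [add_mul, one_mul, mul_add, mul_one, Matrix.smul_mul, Matrix.mul_smul, ← sq,
      show u = -t ^ 2 by rw [ht]; ring]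
    module
  rw [e, Matrix.det_mul, h, h, ← Finset.prod_mul_distrib]
  refine Finset.prod_congr rfl fun j _ => ?_
  rw [show u = -t ^ 2 by rw [ht]; ring]
  ring

/-- Taking u = t³, the matrix 1 + t³N³ is the product of 1 + twᵏN over the cube roots of unity;
squares were treated in the same way with signs ±1. -/
theorem det_one_add_smul_cube {N : Matrix (Fin 10) (Fin 10) ℂ} {c : Fin 5 → ℂ}
    (h : ∀ u : ℂ, (1 + u • N).det = ∏ j, (1 + u * c j) ^ 2) (u : ℂ) :
    (1 + u • N ^ 3).det = ∏ j, (1 + u * c j ^ 3) ^ 2 := by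
  obtain ⟨t, rfl⟩ := IsAlgClosed.exists_pow_nat_eq u three_pos
  -- A primitive cube root of unity is (v - 1)/2 with v² = -3.
  obtain ⟨w, hw⟩ : ∃ w : ℂ, w ^ 2 + w + 1 = 0 := by
    obtain ⟨v, hv⟩ := IsAlgClosed.exists_pow_nat_eq (-3 : ℂ) two_pos
    exact ⟨(v - 1) / 2, by linear_combination (1 / 4 : ℂ) * hv⟩
  have e : 1 + t ^ 3 • N ^ 3 = (1 + t • N) * (1 + (t * w) • N) * (1 + (t * w ^ 2) • N) := by
    have h3 : N ^ 3 = N * N * N := by rw [pow_succ, sq]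
    have e1 : (1 + t • N) * (1 + (t * w) • N) * (1 + (t * w ^ 2) • N) = 1 + (t * (w ^ 2 + w + 1)) • N
        + (t ^ 2 * w * (w ^ 2 + w + 1)) • (N * N) + (t ^ 3 * w ^ 3) • (N * N * N) := by
      simp only [add_mul, one_mul, mul_add, mul_one, Matrix.smul_mul, Matrix.mul_smul]
      module
    have hw3 : w ^ 3 = 1 := by linear_combination (w - 1) * hw
    rw [e1, hw, hw3, h3]
    simp
  rw [e, Matrix.det_mul, Matrix.det_mul, h, h, h, ← Finset.prod_mul_distrib,
    ← Finset.prod_mul_distrib]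
  refine Finset.prod_congr rfl fun j _ => ?_
  rw [← mul_pow, ← mul_pow]
  congr 1
  linear_combination (t * c j + t ^ 2 * w * c j ^ 2 + t ^ 3 * c j ^ 3 * (w - 1)) * hw

/-- The traces of the even powers of `R` are power sums of the skew eigenvalues. -/
theorem IsSkewEigenvalues.traces {R : Matrix (Fin 10) (Fin 10) ℝ} {x : Fin 5 → ℂ}
    (h : IsSkewEigenvalues R x) :
    (((R ^ 2).trace : ℝ) : ℂ) = -8 * Real.pi ^ 2 * ∑ j, x j ^ 2 ∧
    (((R ^ 4).trace : ℝ) : ℂ) = 32 * Real.pi ^ 4 * ∑ j, (x j ^ 2) ^ 2 ∧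
    (((R ^ 6).trace : ℝ) : ℂ) = -128 * Real.pi ^ 6 * ∑ j, (x j ^ 2) ^ 3 := by
  have hd := h.det_sq
  have h1 := trace_eq_of_det hd
  have h2 := trace_eq_of_det (det_one_add_smul_sq hd)
  have h3 := trace_eq_of_det (det_one_add_smul_cube hd)
  have ht : ∀ k, (((R ^ k).trace : ℝ) : ℂ) = ((R ^ k).map Complex.ofReal).trace := fun k => by
    simp [Matrix.trace]
  have hp : ∀ k m, ((R ^ k).map Complex.ofReal) ^ m = (R ^ (k * m)).map Complex.ofReal :=
    fun k m => by
      rw [pow_mul]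
      exact ((Complex.ofRealHom.mapMatrix (m := Fin 10)).map_pow (R ^ k) m).symm
  have hpi : (Real.pi : ℂ) ≠ 0 := Complex.ofReal_ne_zero.mpr Real.pi_ne_zero
  have hodd : ∀ A : Matrix (Fin 10) (Fin 10) ℂ, (-A) ^ 3 = -A ^ 3 := fun A => Odd.neg_pow (by decide) A
  rw [neg_sq, _root_.smul_pow, hp, Matrix.trace_smul, smul_eq_mul, ← ht] at h2
  rw [hodd, _root_.smul_pow, hp, Matrix.trace_neg, Matrix.trace_smul, smul_eq_mul, ← ht] at h3
  rw [Matrix.trace_neg, Matrix.trace_smul, smul_eq_mul, ← ht] at h1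
  generalize ∑ j, x j ^ 2 = s₁ at *
  generalize ∑ j, (x j ^ 2) ^ 2 = s₂ at *
  generalize ∑ j, (x j ^ 2) ^ 3 = s₃ at *
  norm_num at h2 h3
  refine ⟨?_, ?_, ?_⟩
  · field_simp at h1
    linear_combination (-1 : ℂ) * h1
  · field_simp at h2
    linear_combination h2
  · field_simp at h3
    linear_combination (-1 : ℂ) * h3

end SkewEigenvalues

/-! ### The Dirac genus and the one-loop polynomial -/

section Genus

/-- `f = 1 + a z² + b z⁴ + c z⁶ + O(z⁷)`. -/
structure HasEvenCoeffs (f : PowerSeries ℂ) (a b c : ℂ) : Prop where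
  zero : PowerSeries.coeff 0 f = 1
  one : PowerSeries.coeff 1 f = 0
  two : PowerSeries.coeff 2 f = a
  three : PowerSeries.coeff 3 f = 0
  four : PowerSeries.coeff 4 f = b
  five : PowerSeries.coeff 5 f = 0
  six : PowerSeries.coeff 6 f = c

theorem HasEvenCoeffs.mul {f g : PowerSeries ℂ} {a b c a' b' c' : ℂ} (hf : HasEvenCoeffs f a b c)
    (hg : HasEvenCoeffs g a' b' c') :
    HasEvenCoeffs (f * g) (a + a') (b + b' + a * a') (c + c' + a * b' + b * a') := by
  obtain ⟨f0, f1, f2, f3, f4, f5, f6⟩ := hf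
  obtain ⟨g0, g1, g2, g3, g4, g5, g6⟩ := hg
  constructor <;>
  · simp only [PowerSeries.coeff_mul, Finset.Nat.sum_antidiagonal_eq_sum_range_succ_mk,
      Finset.sum_range_succ, Finset.sum_range_zero, Nat.sub_zero, Nat.reduceSub,
      f0, f1, f2, f3, f4, f5, f6, g0, g1, g2, g3, g4, g5, g6, Nat.sub_self]
    ring

theorem HasEvenCoeffs.coeff_six_mul {f : PowerSeries ℂ} {a b c : ℂ} (hf : HasEvenCoeffs f a b c)
    (g : PowerSeries ℂ) :
    PowerSeries.coeff 6 (f * g) = PowerSeries.coeff 6 g + a * PowerSeries.coeff 4 g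
      + b * PowerSeries.coeff 2 g + c * PowerSeries.coeff 0 g := by
  obtain ⟨f0, f1, f2, f3, f4, f5, f6⟩ := hf
  simp only [PowerSeries.coeff_mul, Finset.Nat.sum_antidiagonal_eq_sum_range_succ_mk,
    Finset.sum_range_succ, Finset.sum_range_zero, Nat.sub_zero, Nat.reduceSub,
    f0, f1, f2, f3, f4, f5, f6, Nat.sub_self]
  ring

theorem HasEvenCoeffs.rescale {f : PowerSeries ℂ} {a b c : ℂ} (hf : HasEvenCoeffs f a b c)
    (x : ℂ) : HasEvenCoeffs (PowerSeries.rescale x f) (x ^ 2 * a) (x ^ 4 * b) (x ^ 6 * c) := by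
  obtain ⟨f0, f1, f2, f3, f4, f5, f6⟩ := hf
  constructor <;> simp only [PowerSeries.coeff_rescale, f0, f1, f2, f3, f4, f5, f6] <;> ring

theorem hasEvenCoeffs_sinhRatio : HasEvenCoeffs sinhRatio (1 / 24) (1 / 1920) (1 / 322560) := by
  constructor <;> simp only [sinhRatio, PowerSeries.coeff_mk] <;>
    first
    | (rw [if_pos (by decide)]; norm_num [Nat.factorial])
    | rw [if_neg (by decide)]

/-- The coefficients of the inverse series are solved for recursively, degree by degree, from f ·
f⁻¹ = 1. -/
theorem hasEvenCoeffs_sinhRatio_inv :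
    HasEvenCoeffs sinhRatio⁻¹ (-1 / 24) (7 / 5760) (-31 / 967680) := by
  have h1 : sinhRatio * sinhRatio⁻¹ = 1 := PowerSeries.mul_inv_cancel _ (by
    rw [← PowerSeries.coeff_zero_eq_constantCoeff_apply, hasEvenCoeffs_sinhRatio.zero]
    exact one_ne_zero)
  obtain ⟨f0, f1, f2, f3, f4, f5, f6⟩ := hasEvenCoeffs_sinhRatio
  have h : ∀ n, PowerSeries.coeff n (sinhRatio * sinhRatio⁻¹) = if n = 0 then 1 else 0 := fun n => by
    rw [h1, PowerSeries.coeff_one]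
  simp only [PowerSeries.coeff_mul, Finset.Nat.sum_antidiagonal_eq_sum_range_succ_mk] at h
  generalize sinhRatio⁻¹ = g at h
  have h0 := h 0
  have h1 := h 1
  have h2 := h 2
  have h3 := h 3
  have h4 := h 4
  have h5 := h 5
  have h6 := h 6
  simp only [Finset.sum_range_succ, Finset.sum_range_zero, Nat.sub_zero, Nat.reduceSub,
    f0, f1, f2, f3, f4, f5, f6, Nat.sub_self, if_true, OfNat.ofNat_ne_zero,
    one_ne_zero, if_false] at h0 h1 h2 h3 h4 h5 h6
  have g0 : PowerSeries.coeff 0 g = 1 := by linear_combination h0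
  have g1 : PowerSeries.coeff 1 g = 0 := by linear_combination h1
  have g2 : PowerSeries.coeff 2 g = -1 / 24 := by rw [g0] at h2; linear_combination h2
  have g3 : PowerSeries.coeff 3 g = 0 := by rw [g1] at h3; linear_combination h3
  have g4 : PowerSeries.coeff 4 g = 7 / 5760 := by rw [g0, g2] at h4; linear_combination h4
  have g5 : PowerSeries.coeff 5 g = 0 := by rw [g1, g3] at h5; linear_combination h5
  have g6 : PowerSeries.coeff 6 g = -31 / 967680 := by
    rw [g0, g2, g4] at h6
    linear_combination h6
  exact ⟨g0, g1, g2, g3, g4, g5, g6⟩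

theorem hasEvenCoeffs_prod (x : Fin 5 → ℂ) :
    HasEvenCoeffs (∏ j, PowerSeries.rescale (x j) sinhRatio⁻¹) (-(∑ j, x j ^ 2) / 24)
      ((∑ j, x j ^ 2) ^ 2 / 1152 + (∑ j, (x j ^ 2) ^ 2) / 2880)
      (-(∑ j, x j ^ 2) ^ 3 / 82944 - (∑ j, x j ^ 2) * (∑ j, (x j ^ 2) ^ 2) / 69120
        - (∑ j, (x j ^ 2) ^ 3) / 181440) := by
  have h := fun j => hasEvenCoeffs_sinhRatio_inv.rescale (x j)
  have h1 := (((h 0).mul (h 1)).mul (h 2)).mul (h 3) |>.mul (h 4)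
  rw [Fin.prod_univ_five]
  simp only [Fin.sum_univ_five]
  convert h1 using 1 <;> ring

/-- The coefficients of the Dirac genus in terms of the traces of the powers of `R`. -/
theorem hasEvenCoeffs_diracGenus {ε : ℝ} (hε : ε = 1 ∨ ε = -1)
    {R : Matrix (Fin 10) (Fin 10) ℝ} (hR : (flatMetric ε).IsSkewAdjoint R) :
    HasEvenCoeffs (diracGenus R) (((R ^ 2).trace / (192 * Real.pi ^ 2) : ℝ) : ℂ)
      (((R ^ 2).trace ^ 2 / (73728 * Real.pi ^ 4) + (R ^ 4).trace / (92160 * Real.pi ^ 4) : ℝ) : ℂ)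
      (((R ^ 2).trace ^ 3 / (42467328 * Real.pi ^ 6)
        + (R ^ 2).trace * (R ^ 4).trace / (17694720 * Real.pi ^ 6)
        + (R ^ 6).trace / (23224320 * Real.pi ^ 6) : ℝ) : ℂ) := by
  obtain ⟨h1, h2, h3⟩ := (isSkewEigenvalues_skewEigenvalues hε hR).traces
  have h := hasEvenCoeffs_prod (skewEigenvalues R)
  have hpi : (Real.pi : ℂ) ≠ 0 := Complex.ofReal_ne_zero.mpr Real.pi_ne_zero
  rw [diracGenus]
  generalize ∑ j, skewEigenvalues R j ^ 2 = s₁ at *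
  generalize ∑ j, (skewEigenvalues R j ^ 2) ^ 2 = s₂ at *
  generalize ∑ j, (skewEigenvalues R j ^ 2) ^ 3 = s₃ at *
  convert h using 1 <;> push_cast <;> simp only [h1, h2, h3] <;> field_simp <;> ring

variable {κ : Type*} [Fintype κ] [DecidableEq κ]

theorem coeff_chernCharacter_zero (M : Matrix κ κ ℝ) :
    PowerSeries.coeff 0 (chernCharacter M) = Fintype.card κ := by
  simp [chernCharacter]

theorem coeff_chernCharacter_two (M : Matrix κ κ ℝ) :
    PowerSeries.coeff 2 (chernCharacter M) = ((-(M ^ 2).trace / (8 * Real.pi ^ 2) : ℝ) : ℂ) := by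
  simp only [chernCharacter, PowerSeries.coeff_mk, div_pow, Complex.I_sq]
  push_cast [Nat.factorial]
  ring

theorem coeff_chernCharacter_four (M : Matrix κ κ ℝ) :
    PowerSeries.coeff 4 (chernCharacter M) = (((M ^ 4).trace / (384 * Real.pi ^ 4) : ℝ) : ℂ) := by
  simp only [chernCharacter, PowerSeries.coeff_mk, div_pow, Complex.I_pow_four]
  push_cast [Nat.factorial]
  ring

theorem coeff_chernCharacter_six (M : Matrix κ κ ℝ) :
    PowerSeries.coeff 6 (chernCharacter M) =
      ((-(M ^ 6).trace / (46080 * Real.pi ^ 6) : ℝ) : ℂ) := by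
  have h : Complex.I ^ 6 = -1 := by rw [show 6 = 2 * 3 from rfl, pow_mul, Complex.I_sq]; norm_num
  simp only [chernCharacter, PowerSeries.coeff_mk, div_pow, h]
  push_cast [Nat.factorial]
  ring

/-- The polynomial of the untwisted and twisted fields on one plane. -/
theorem fieldsPoly_eq {ε : ℝ} (hε : ε = 1 ∨ ε = -1)
    {R : Matrix (Fin 10) (Fin 10) ℝ} (hR : (flatMetric ε).IsSkewAdjoint R) (M : Matrix κ κ ℝ) :
    fieldsPoly R M = ((-(1 / (2 * (2 * Real.pi) ^ 5 * 720)) *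
          ((496 - 2 * (Fintype.card κ : ℝ)) / 1008 * (R ^ 6).trace
            + (-224 - 2 * (Fintype.card κ : ℝ)) / 768 * ((R ^ 4).trace * (R ^ 2).trace)
            + (320 - 10 * (Fintype.card κ : ℝ)) / 9216 * (R ^ 2).trace ^ 3
            + 1 / 16 * ((R ^ 4).trace * (M ^ 2).trace)
            + 5 / 64 * ((R ^ 2).trace ^ 2 * (M ^ 2).trace)
            - 5 / 8 * ((R ^ 2).trace * (M ^ 4).trace)
            + (M ^ 6).trace) : ℝ) : ℂ) := by
  have h := hasEvenCoeffs_diracGenus hε hR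
  have hpi : (Real.pi : ℂ) ≠ 0 := Complex.ofReal_ne_zero.mpr Real.pi_ne_zero
  simp only [fieldsPoly, untwistedPoly, twistedPoly, spinThreeHalfGrav, spinHalfMixed, spinHalf,
    spinHalfGrav, spinHalfGauge, h.coeff_six_mul, h.six, map_sub, PowerSeries.coeff_one,
    coeff_chernCharacter_zero, coeff_chernCharacter_two, coeff_chernCharacter_four,
    coeff_chernCharacter_six, if_true, OfNat.ofNat_ne_zero, if_false, Fintype.card_fin]
  push_cast
  field_simp
  ring

end Genus

/-! ### Test rotations -/

section Rotations

open scoped Matrix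

/-- The generator of rotations with angular velocities `a`, `b`, `c` in the coordinate planes
`(1,2)`, `(3,4)`, `(5,6)`. -/
def rotationGenerator (a b c : ℝ) : Matrix (Fin 10) (Fin 10) ℝ :=
  Matrix.of fun i j => if j = (![0, 2, 1, 4, 3, 6, 5, 7, 8, 9] : Fin 10 → Fin 10) i then
    (![0, a, -a, b, -b, c, -c, 0, 0, 0] : Fin 10 → ℝ) i else 0

theorem isSkewAdjoint_rotationGenerator (ε a b c : ℝ) :
    (flatMetric ε).IsSkewAdjoint (rotationGenerator a b c) := by
  change (rotationGenerator a b c)ᵀ * flatMetric ε = flatMetric ε * -rotationGenerator a b c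
  ext i j
  rw [flatMetric, Matrix.mul_diagonal, Matrix.diagonal_mul]
  fin_cases i <;> fin_cases j <;> simp [rotationGenerator]

theorem rotationGenerator_sq (a b c : ℝ) :
    rotationGenerator a b c ^ 2 = Matrix.diagonal
      (![0, -a ^ 2, -a ^ 2, -b ^ 2, -b ^ 2, -c ^ 2, -c ^ 2, 0, 0, 0] : Fin 10 → ℝ) := by
  ext i j
  rw [sq, Matrix.mul_apply]
  simp only [rotationGenerator, Matrix.of_apply, ite_mul, zero_mul, Finset.sum_ite_eq',
    Finset.mem_univ, if_true, Matrix.diagonal_apply]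
  rw [show (![0, 2, 1, 4, 3, 6, 5, 7, 8, 9] : Fin 10 → Fin 10)
    ((![0, 2, 1, 4, 3, 6, 5, 7, 8, 9] : Fin 10 → Fin 10) i) = i by revert i; decide,
    mul_ite, mul_zero]
  refine if_congr eq_comm ?_ rfl
  fin_cases i <;> simp <;> ring

theorem trace_rotationGenerator_pow (a b c : ℝ) (k : ℕ) (hk : k ≠ 0) :
    (rotationGenerator a b c ^ (2 * k)).trace =
      2 * ((-a ^ 2) ^ k + (-b ^ 2) ^ k + (-c ^ 2) ^ k) := by
  rw [pow_mul, rotationGenerator_sq, Matrix.diagonal_pow, Matrix.trace_diagonal]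
  simp [Fin.sum_univ_succ, hk]
  ring

theorem trace_rotationGenerator (a b c : ℝ) :
    (rotationGenerator a b c ^ 2).trace = -2 * (a ^ 2 + b ^ 2 + c ^ 2) ∧
    (rotationGenerator a b c ^ 4).trace = 2 * (a ^ 4 + b ^ 4 + c ^ 4) ∧
    (rotationGenerator a b c ^ 6).trace = -2 * (a ^ 6 + b ^ 6 + c ^ 6) := by
  refine ⟨(trace_rotationGenerator_pow a b c 1 one_ne_zero).trans ?_,
    (trace_rotationGenerator_pow a b c 2 two_ne_zero).trans ?_,
    (trace_rotationGenerator_pow a b c 3 three_ne_zero).trans ?_⟩ <;> ring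

end Rotations

/-! ### Absence of tr R⁶, factorisation and cancellation -/

section Planes

variable {𝔤 : Type*} [LieRing 𝔤] [LieAlgebra ℝ 𝔤] [FiniteDimensional ℝ 𝔤]

theorem adMatrix_zero : adMatrix (0 : 𝔤) = 0 := by
  simp [adMatrix]

/-- The term `tr R⁶` is absent exactly in dimension `248`. -/
theorem fieldsPoly_reducible_iff {ε : ℝ} (hε : ε = 1 ∨ ε = -1) :
    (∃ Q : ℝ → ℝ → 𝔤 → ℂ, ∀ R : Matrix (Fin 10) (Fin 10) ℝ, (flatMetric ε).IsSkewAdjoint R →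
      ∀ F : 𝔤, fieldsPoly R (adMatrix F) = Q (R ^ 2).trace (R ^ 4).trace F) ↔
    Module.finrank ℝ 𝔤 = 248 := by
  constructor
  · rintro ⟨Q, hQ⟩
    -- The angular velocities (0, √3, √3) and (1, 1, 2) have equal sums of squares, 6, and of fourth
    -- powers, 18, but sums of sixth powers 54 and 66. With F = 0 only the coefficient of tr R⁶
    -- separates them.
    have h1 := hQ _ (isSkewAdjoint_rotationGenerator ε 0 √3 √3) 0
    have h2 := hQ _ (isSkewAdjoint_rotationGenerator ε 1 1 2) 0
    rw [fieldsPoly_eq hε (isSkewAdjoint_rotationGenerator ε _ _ _)] at h1 h2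
    obtain ⟨a2, a4, a6⟩ := trace_rotationGenerator 0 √3 √3
    obtain ⟨b2, b4, b6⟩ := trace_rotationGenerator 1 1 2
    have s2 : √3 ^ 2 = 3 := Real.sq_sqrt (by norm_num)
    have s4 : √3 ^ 4 = 9 := by rw [show 4 = 2 * 2 from rfl, pow_mul, s2]; norm_num
    have s6 : √3 ^ 6 = 27 := by rw [show 6 = 2 * 3 from rfl, pow_mul, s2]; norm_num
    have e2 : (rotationGenerator 0 √3 √3 ^ 2).trace = -12 := by rw [a2, s2]; norm_num
    have e4 : (rotationGenerator 0 √3 √3 ^ 4).trace = 36 := by rw [a4, s4]; norm_num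
    have e6 : (rotationGenerator 0 √3 √3 ^ 6).trace = -108 := by rw [a6, s6]; norm_num
    have f2 : (rotationGenerator 1 1 2 ^ 2).trace = -12 := by rw [b2]; norm_num
    have f4 : (rotationGenerator 1 1 2 ^ 4).trace = 36 := by rw [b4]; norm_num
    have f6 : (rotationGenerator 1 1 2 ^ 6).trace = -132 := by rw [b6]; norm_num
    rw [e2, e4, e6] at h1
    rw [f2, f4, f6, ← h1, Complex.ofReal_inj] at h2
    have hpi := Real.pi_ne_zero
    have h3 : -(1 / (2 * (2 * Real.pi) ^ 5 * 720)) ≠ 0 := by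
      rw [neg_ne_zero]
      positivity
    have h4 := mul_left_cancel₀ h3 h2
    rw [Fintype.card_fin] at h4
    have h5 : (Module.finrank ℝ 𝔤 : ℝ) = 248 := by linarith
    exact_mod_cast h5
  · intro hn
    refine ⟨fun t₂ t₄ F => ((-(1 / (2 * (2 * Real.pi) ^ 5 * 720)) *
      ((-224 - 2 * 248) / 768 * (t₄ * t₂) + (320 - 10 * 248) / 9216 * t₂ ^ 3
        + 1 / 16 * (t₄ * (adMatrix F ^ 2).trace) + 5 / 64 * (t₂ ^ 2 * (adMatrix F ^ 2).trace)
        - 5 / 8 * (t₂ * (adMatrix F ^ 4).trace) + (adMatrix F ^ 6).trace) : ℝ) : ℂ),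
      fun R hR F => ?_⟩
    have hn' : (Module.finrank ℝ 𝔤 : ℝ) = 248 := by exact_mod_cast hn
    rw [fieldsPoly_eq hε hR, Fintype.card_fin, hn']
    push_cast
    ring

theorem eq_neg_rpow_third_iff {x γ : ℝ} (hx : 0 ≤ x) : γ = -x ^ (1 / 3 : ℝ) ↔ γ ^ 3 = -x := by
  have h : (x ^ (1 / 3 : ℝ)) ^ 3 = x := by
    rw [← Real.rpow_natCast, ← Real.rpow_mul hx]
    norm_num
  rw [← (Odd.strictMono_pow (R := ℝ) (n := 3) (by decide)).injective.eq_iff, Odd.neg_pow (by decide), h]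

/-- The condition b ≠ 0 has to be stated: division by zero would turn the formula for γ into γ = 0,
whereas the coupling vanishes at b = 0. -/
theorem topCoupling_eq_iff {kap : ℝ} (hk : 0 < kap) (γ b : ℝ) :
    topCoupling kap γ b = -(Real.pi / 3) ↔
      b ≠ 0 ∧ γ = -(32 * Real.pi * kap ^ 2 / b ^ 2) ^ (1 / 3 : ℝ) := by
  have hpi := Real.pi_pos
  rw [topCoupling, eq_neg_rpow_third_iff (by positivity)]
  constructor
  · intro h
    have hb : b ≠ 0 := by
      rintro rfl
      simp at h
    refine ⟨hb, ?_⟩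
    field_simp at h ⊢
    linarith
  · rintro ⟨hb, h⟩
    rw [h]
    field_simp
    norm_num

/-- The normalisation absorbs the factor 2 into the cube root, as 32 = 2³ · 4. -/
theorem gsCoupling_eq_iff {kap : ℝ} (hk : 0 < kap) (γ : ℝ) :
    gsCoupling kap γ = -1 ↔ γ = -(32 * Real.pi * kap ^ 2) ^ (1 / 3 : ℝ) := by
  have hpi := Real.pi_pos
  have h1 : 0 < gsScale kap := Real.rpow_pos_of_pos (by positivity) _
  have h2 : (32 * Real.pi * kap ^ 2) ^ (1 / 3 : ℝ) = 2 * gsScale kap := by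
    rw [show 32 * Real.pi * kap ^ 2 = 2 ^ 3 * (4 * Real.pi * kap ^ 2) by ring,
      Real.mul_rpow (by positivity) (by positivity), gsScale, ← Real.rpow_natCast,
      ← Real.rpow_mul (by norm_num)]
    norm_num
  rw [h2, gsCoupling, div_eq_iff (by positivity)]
  constructor <;> intro h <;> linarith

theorem topCoupling_and_gsCoupling_iff {kap : ℝ} (hk : 0 < kap) (γ b : ℝ) :
    topCoupling kap γ b = -(Real.pi / 3) ∧ gsCoupling kap γ = -1 ↔
      γ = -(32 * Real.pi * kap ^ 2) ^ (1 / 3 : ℝ) ∧ (b = 1 ∨ b = -1) := by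
  have hpi := Real.pi_pos
  rw [gsCoupling_eq_iff hk, and_comm]
  refine and_congr_right fun h => ?_
  rw [eq_neg_rpow_third_iff (by positivity)] at h
  rw [topCoupling, h, ← sq_eq_one_iff]
  constructor <;> intro h1
  · field_simp at h1
    linarith
  · rw [h1]
    field_simp
    norm_num

/-- `I₄` and `X₈` for a rotation and vanishing gauge field. -/
theorem fourForm_rotation (a b c : ℝ) :
    fourForm (rotationGenerator a b c) (adMatrix (0 : 𝔤)) =
      1 / (16 * Real.pi ^ 2) * (a ^ 2 + b ^ 2 + c ^ 2) := by
  rw [fourForm, adMatrix_zero, (trace_rotationGenerator a b c).1]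
  simp

theorem eightForm_rotation (a b c : ℝ) :
    eightForm (rotationGenerator a b c) = 1 / ((2 * Real.pi) ^ 3 * 24) *
      (1 / 4 * (a ^ 4 + b ^ 4 + c ^ 4) - 1 / 8 * (a ^ 2 + b ^ 2 + c ^ 2) ^ 2) := by
  rw [eightForm, (trace_rotationGenerator a b c).1, (trace_rotationGenerator a b c).2.1]
  simp only [smul_eq_mul]
  ring

/-- A combination of `I₄³` and `I₄ X₈` vanishes only if its coefficients do. -/
theorem coefficients_eq_zero {ε p q : ℝ}
    (h : ∀ R : Matrix (Fin 10) (Fin 10) ℝ, (flatMetric ε).IsSkewAdjoint R → ∀ F : 𝔤,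
      p * fourForm R (adMatrix F) ^ 3 + q * (fourForm R (adMatrix F) * eightForm R) = 0) :
    p = 0 ∧ q = 0 := by
  -- For velocities (1, 1, 0) the form X₈ vanishes, which isolates p; for (1, 0, 0) it does not,
  -- which then isolates q.
  have h1 := h _ (isSkewAdjoint_rotationGenerator ε 1 1 0) 0
  have h2 := h _ (isSkewAdjoint_rotationGenerator ε 1 0 0) 0
  rw [fourForm_rotation, eightForm_rotation] at h1 h2
  have hpi := Real.pi_ne_zero
  have hp : p = 0 := by
    norm_num at h1
    exact h1
  refine ⟨hp, ?_⟩
  rw [hp] at h2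
  norm_num at h2
  exact h2

theorem topPoly_cancel_iff {ε kap : ℝ} (hk : 0 < kap) (γ b : ℝ) :
    (∀ R : Matrix (Fin 10) (Fin 10) ℝ, (flatMetric ε).IsSkewAdjoint R → ∀ F : 𝔤,
      -(Real.pi / 3) * fourForm R (adMatrix F) ^ 3 - topPoly kap γ b R (adMatrix F) = 0) ↔
    b ≠ 0 ∧ γ = -(32 * Real.pi * kap ^ 2 / b ^ 2) ^ (1 / 3 : ℝ) := by
  rw [← topCoupling_eq_iff hk]
  constructor
  · intro h
    have h1 := (coefficients_eq_zero (𝔤 := 𝔤) (ε := ε) (p := -(Real.pi / 3) - topCoupling kap γ b)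
      (q := 0) fun R hR F => by
        have h2 := h R hR F
        rw [topPoly, smul_eq_mul] at h2
        linear_combination h2).1
    linarith
  · intro h R _ F
    rw [topPoly, h, smul_eq_mul, sub_self]

theorem gsPoly_cancel_iff {ε kap : ℝ} (hk : 0 < kap) (γ : ℝ) :
    (∀ R : Matrix (Fin 10) (Fin 10) ℝ, (flatMetric ε).IsSkewAdjoint R → ∀ F : 𝔤,
      -(fourForm R (adMatrix F) * eightForm R) - gsPoly kap γ R (adMatrix F) = 0) ↔
    γ = -(32 * Real.pi * kap ^ 2) ^ (1 / 3 : ℝ) := by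
  rw [← gsCoupling_eq_iff hk]
  constructor
  · intro h
    have h1 := (coefficients_eq_zero (𝔤 := 𝔤) (ε := ε) (p := 0) (q := -1 - gsCoupling kap γ)
      fun R hR F => by
        have h2 := h R hR F
        rw [gsPoly, smul_eq_mul] at h2
        linear_combination h2).2
    linarith
  · intro h R _ F
    rw [gsPoly, h, smul_eq_mul]
    ring

theorem planeAnomaly_eq_zero_iff {ε kap : ℝ} (hk : 0 < kap) (γ b : ℝ)
    (hfac : ∀ R : Matrix (Fin 10) (Fin 10) ℝ, (flatMetric ε).IsSkewAdjoint R → ∀ F : 𝔤,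
      fieldsPoly R (adMatrix F) = ((-(Real.pi / 3) * fourForm R (adMatrix F) ^ 3
        - fourForm R (adMatrix F) * eightForm R : ℝ) : ℂ)) :
    (∀ R : Matrix (Fin 10) (Fin 10) ℝ, (flatMetric ε).IsSkewAdjoint R → ∀ F : 𝔤,
      planeAnomaly kap γ b R (adMatrix F) = 0) ↔
    γ = -(32 * Real.pi * kap ^ 2) ^ (1 / 3 : ℝ) ∧ (b = 1 ∨ b = -1) := by
  have key : ∀ R : Matrix (Fin 10) (Fin 10) ℝ, (flatMetric ε).IsSkewAdjoint R → ∀ F : 𝔤,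
      planeAnomaly kap γ b R (adMatrix F) = Complex.I *
        (((-(Real.pi / 3) - topCoupling kap γ b) * fourForm R (adMatrix F) ^ 3
          + (-1 - gsCoupling kap γ) * (fourForm R (adMatrix F) * eightForm R) : ℝ) : ℂ) :=
    fun R hR F => by
      have h := hfac R hR F
      rw [fieldsPoly] at h
      rw [planeAnomaly, topPoly, gsPoly, ← mul_add, h, ← mul_sub, ← mul_sub]
      push_cast [smul_eq_mul]
      ring
  rw [← topCoupling_and_gsCoupling_iff hk]
  constructor
  · intro h
    have h1 := coefficients_eq_zero (𝔤 := 𝔤) (ε := ε) (p := -(Real.pi / 3) - topCoupling kap γ b)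
      (q := -1 - gsCoupling kap γ) fun R hR F => by
        have h2 := h R hR F
        rw [key R hR F, mul_eq_zero, or_iff_right Complex.I_ne_zero] at h2
        exact_mod_cast h2
    exact ⟨by linarith [h1.1], by linarith [h1.2]⟩
  · rintro ⟨h1, h2⟩ R hR F
    rw [key R hR F, h1, h2]
    simp

/-- The factorisation of the anomaly in dimension `248`, for a gauge algebra without independent
Casimir invariants of degrees four and six. -/
theorem fieldsPoly_factorisation {ε : ℝ} (hε : ε = 1 ∨ ε = -1)
    (hn : Module.finrank ℝ 𝔤 = 248)
    (h4 : ∀ F : 𝔤, (adMatrix F ^ 4).trace = (adMatrix F ^ 2).trace ^ 2 / 100)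
    (h6 : ∀ F : 𝔤, (adMatrix F ^ 6).trace = (adMatrix F ^ 2).trace ^ 3 / 7200)
    {R : Matrix (Fin 10) (Fin 10) ℝ} (hR : (flatMetric ε).IsSkewAdjoint R) (F : 𝔤) :
    fieldsPoly R (adMatrix F) = ((-(Real.pi / 3) * fourForm R (adMatrix F) ^ 3
      - fourForm R (adMatrix F) * eightForm R : ℝ) : ℂ) := by
  have hn' : (Module.finrank ℝ 𝔤 : ℝ) = 248 := by exact_mod_cast hn
  rw [fieldsPoly_eq hε hR, Fintype.card_fin, hn', h4, h6, Complex.ofReal_inj, fourForm, eightForm]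
  simp only [smul_eq_mul]
  have hpi := Real.pi_ne_zero
  field_simp
  ring

end Planes

/-! ### Power sums over the roots of E₈ -/

section PowerSums

theorem sum_piFinset_succ {M : Type*} [AddCommMonoid M] (s : Finset ℤ) (n : ℕ)
    (g : (Fin (n + 1) → ℤ) → M) :
    ∑ v ∈ Fintype.piFinset (fun _ : Fin (n + 1) => s), g v =
      ∑ c ∈ s, ∑ v ∈ Fintype.piFinset (fun _ : Fin n => s), g (Fin.cons c v) := by
  rw [← Finset.sum_product']
  symm
  refine Finset.sum_nbij' (fun p => Fin.cons p.1 p.2) (fun v => (v 0, fun i => v i.succ)) ?_ ?_ ?_ ?_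
    ?_
  · rintro ⟨c, v⟩ h
    simp only [Finset.mem_product, Fintype.mem_piFinset] at h ⊢
    exact Fin.cases h.1 h.2
  · intro v h
    simp only [Finset.mem_product, Fintype.mem_piFinset] at h ⊢
    exact ⟨h 0, fun i => h _⟩
  · intro p _
    simp
  · intro v _
    exact Fin.cons_self_tail v
  · intro p _
    rfl

/-- The sum of `(x ± a₁ ± ⋯ ± aₙ)ᵏ` over all signs. -/
def signSum (n k : ℕ) (x : ℂ) (a : Fin n → ℂ) : ℂ :=
  ∑ v ∈ Fintype.piFinset (fun _ : Fin n => ({1, -1} : Finset ℤ)), (x + ∑ i, (v i : ℂ) * a i) ^ k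

theorem signSum_succ (n k : ℕ) (x : ℂ) (a : Fin (n + 1) → ℂ) :
    signSum (n + 1) k x a = signSum n k (x + a 0) (Fin.tail a) + signSum n k (x - a 0) (Fin.tail a) := by
  simp only [signSum, sum_piFinset_succ, Fin.sum_univ_succ, Fin.cons_zero, Fin.cons_succ]
  rw [Finset.sum_pair (by norm_num)]
  simp [Fin.tail, add_assoc, sub_eq_add_neg]

theorem signSum_zero (k : ℕ) (x : ℂ) (a : Fin 0 → ℂ) : signSum 0 k x a = x ^ k := by
  simp [signSum]

/-- The offset x is kept general so that the recursion on the number of signs, which shifts x by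
±a₀, closes. -/
theorem signSum_eq (n : ℕ) (x : ℂ) (a : Fin n → ℂ) :
    signSum n 0 x a = 2 ^ n ∧
    signSum n 2 x a = 2 ^ n * (x ^ 2 + ∑ i, a i ^ 2) ∧
    signSum n 4 x a = 2 ^ n * (x ^ 4 + 6 * x ^ 2 * ∑ i, a i ^ 2 + 3 * (∑ i, a i ^ 2) ^ 2
      - 2 * ∑ i, a i ^ 4) ∧
    signSum n 6 x a = 2 ^ n * (x ^ 6 + 15 * x ^ 4 * ∑ i, a i ^ 2
      + 15 * x ^ 2 * (3 * (∑ i, a i ^ 2) ^ 2 - 2 * ∑ i, a i ^ 4)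
      + 15 * (∑ i, a i ^ 2) ^ 3 - 30 * (∑ i, a i ^ 2) * (∑ i, a i ^ 4) + 16 * ∑ i, a i ^ 6) := by
  induction n generalizing x with
  | zero => simp [signSum_zero]
  | succ n ih =>
    obtain ⟨h0, h2, h4, h6⟩ := ih (x + a 0) (Fin.tail a)
    obtain ⟨g0, g2, g4, g6⟩ := ih (x - a 0) (Fin.tail a)
    simp only [signSum_succ, Fin.sum_univ_succ, h0, h2, h4, h6, g0, g2, g4, g6, Fin.tail]
    refine ⟨?_, ?_, ?_, ?_⟩ <;> ring

/-- The alternating sum of `(x ± a₁ ± ⋯ ± aₙ)ᵏ` over all signs vanishes for `k < n`. -/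
theorem sum_prod_mul_pow_eq_zero (n k : ℕ) (hk : k < n) (x : ℂ) (a : Fin n → ℂ) :
    ∑ v ∈ Fintype.piFinset (fun _ : Fin n => ({1, -1} : Finset ℤ)),
      ((∏ i, v i : ℤ) : ℂ) * (x + ∑ i, (v i : ℂ) * a i) ^ k = 0 := by
  induction n generalizing k with
  | zero => omega
  | succ n ih =>
    simp only [sum_piFinset_succ, Fin.sum_univ_succ, Fin.prod_univ_succ, Fin.cons_zero,
      Fin.cons_succ]
    rw [Finset.sum_pair (by norm_num), ← Finset.sum_add_distrib]
    -- The difference over the first sign cancels the top power, so only exponents j < k remain and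
    -- the induction hypothesis applies with one sign fewer.
    have h : ∀ v : Fin n → ℤ, ((1 * ∏ i, v i : ℤ) : ℂ) * (x + (((1 : ℤ) : ℂ) * a 0
        + ∑ i, (v i : ℂ) * a i.succ)) ^ k + ((-1 * ∏ i, v i : ℤ) : ℂ) * (x + (((-1 : ℤ) : ℂ) * a 0
        + ∑ i, (v i : ℂ) * a i.succ)) ^ k =
        ∑ j ∈ Finset.range k, (k.choose j * (a 0 ^ (k - j) - (-a 0) ^ (k - j))) *
          (((∏ i, v i : ℤ) : ℂ) * (x + ∑ i, (v i : ℂ) * a i.succ) ^ j) := fun v => by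
      generalize ∑ i, (v i : ℂ) * a i.succ = t
      generalize ∏ i, v i = p
      push_cast
      rw [show x + (1 * a 0 + t) = (x + t) + a 0 by ring,
        show x + (-1 * a 0 + t) = (x + t) + -a 0 by ring, add_pow, add_pow,
        Finset.sum_range_succ, Finset.sum_range_succ, mul_add, mul_add, Finset.mul_sum,
        Finset.mul_sum, add_add_add_comm, ← Finset.sum_add_distrib]
      simp only [Nat.sub_self, pow_zero]
      rw [show ∀ u : ℂ, 1 * (p : ℂ) * (u * 1 * (k.choose k)) + -1 * p * (u * 1 * (k.choose k)) = 0 from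
        fun u => by ring, add_zero]
      exact Finset.sum_congr rfl fun j _ => by ring
    rw [Finset.sum_congr rfl fun v _ => h v, Finset.sum_comm]
    refine Finset.sum_eq_zero fun j hj => ?_
    rw [← Finset.mul_sum, ih j (by have := Finset.mem_range.mp hj; omega), mul_zero]

/-- The sum of `(x + ∑ wᵢ aᵢ)ᵏ` over all `w ∈ {0, ±1}ⁿ` of square length `m`. -/
def shortSum (n : ℕ) (m : ℤ) (k : ℕ) (x : ℂ) (a : Fin n → ℂ) : ℂ :=
  ∑ w ∈ Fintype.piFinset (fun _ : Fin n => ({0, 1, -1} : Finset ℤ)),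
    if ∑ i, w i ^ 2 = m then (x + ∑ i, (w i : ℂ) * a i) ^ k else 0

theorem shortSum_succ (n : ℕ) (m : ℤ) (k : ℕ) (x : ℂ) (a : Fin (n + 1) → ℂ) :
    shortSum (n + 1) m k x a = shortSum n m k x (Fin.tail a)
      + shortSum n (m - 1) k (x + a 0) (Fin.tail a)
      + shortSum n (m - 1) k (x - a 0) (Fin.tail a) := by
  simp only [shortSum, sum_piFinset_succ, Fin.sum_univ_succ, Fin.cons_zero, Fin.cons_succ]
  rw [Finset.sum_insert (by decide), Finset.sum_pair (by norm_num)]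
  have h : ∀ z, 1 + z = m ↔ z = m + -1 := fun z => by omega
  simp [Fin.tail, add_assoc, sub_eq_add_neg, h]

theorem shortSum_neg (n k : ℕ) (x : ℂ) (a : Fin n → ℂ) : shortSum n (-1) k x a = 0 := by
  refine Finset.sum_eq_zero fun w _ => if_neg ?_
  have : 0 ≤ ∑ i, w i ^ 2 := Finset.sum_nonneg fun i _ => sq_nonneg _
  omega

theorem shortSum_zero (n k : ℕ) (x : ℂ) (a : Fin n → ℂ) : shortSum n 0 k x a = x ^ k := by
  induction n generalizing x with
  | zero => simp [shortSum]
  | succ n ih => rw [shortSum_succ, ih, zero_sub, shortSum_neg, shortSum_neg, add_zero, add_zero]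

theorem shortSum_one (n k : ℕ) (x : ℂ) (a : Fin n → ℂ) :
    shortSum n 1 k x a = ∑ i, ((x + a i) ^ k + (x - a i) ^ k) := by
  induction n with
  | zero => simp [shortSum]
  | succ n ih =>
    rw [shortSum_succ, ih, sub_self, shortSum_zero, shortSum_zero, Fin.sum_univ_succ]
    simp only [Fin.tail]
    ring

theorem shortSum_one_eq (n : ℕ) (x : ℂ) (a : Fin n → ℂ) :
    shortSum n 1 0 x a = 2 * n ∧
    shortSum n 1 2 x a = 2 * n * x ^ 2 + 2 * ∑ i, a i ^ 2 ∧
    shortSum n 1 4 x a = 2 * n * x ^ 4 + 12 * x ^ 2 * (∑ i, a i ^ 2) + 2 * ∑ i, a i ^ 4 ∧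
    shortSum n 1 6 x a = 2 * n * x ^ 6 + 30 * x ^ 4 * (∑ i, a i ^ 2)
      + 30 * x ^ 2 * (∑ i, a i ^ 4) + 2 * ∑ i, a i ^ 6 := by
  simp only [shortSum_one]
  induction n with
  | zero => simp
  | succ n ih =>
    obtain ⟨h0, h2, h4, h6⟩ := ih (Fin.tail a)
    simp only [Fin.tail] at h0 h2 h4 h6
    simp only [Fin.sum_univ_succ, h0, h2, h4, h6]
    push_cast
    refine ⟨?_, ?_, ?_, ?_⟩ <;> ring

theorem shortSum_two_eq (n : ℕ) (a : Fin n → ℂ) :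
    shortSum n 2 0 0 a = 2 * n * (n - 1) ∧
    shortSum n 2 2 0 a = 4 * (n - 1) * ∑ i, a i ^ 2 ∧
    shortSum n 2 4 0 a = 4 * (n - 4) * (∑ i, a i ^ 4) + 12 * (∑ i, a i ^ 2) ^ 2 ∧
    shortSum n 2 6 0 a = 4 * (n - 16) * (∑ i, a i ^ 6)
      + 60 * (∑ i, a i ^ 2) * (∑ i, a i ^ 4) := by
  induction n with
  | zero => simp [shortSum]
  | succ n ih =>
    obtain ⟨h0, h2, h4, h6⟩ := ih (Fin.tail a)
    obtain ⟨f0, f2, f4, f6⟩ := shortSum_one_eq n (a 0) (Fin.tail a)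
    obtain ⟨g0, g2, g4, g6⟩ := shortSum_one_eq n (-a 0) (Fin.tail a)
    simp only [shortSum_succ, Fin.sum_univ_succ, zero_add, zero_sub, show (2 : ℤ) - 1 = 1 by norm_num,
      h0, h2, h4, h6, f0, f2, f4, f6, g0, g2, g4, g6, Fin.tail]
    push_cast
    refine ⟨?_, ?_, ?_, ?_⟩ <;> ring

/-- The roots of `E₈`, in twice the standard orthonormal coordinates: the vectors with entries
`±1` of product `1`, and the vectors with two non-zero entries, equal to `±2`. -/
def doubledRoots : Finset (Fin 8 → ℤ) :=
  (Fintype.piFinset (fun _ : Fin 8 => ({1, -1} : Finset ℤ))).filter (fun v => ∏ i, v i = 1) ∪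
  ((Fintype.piFinset (fun _ : Fin 8 => ({0, 1, -1} : Finset ℤ))).filter
    (fun w => ∑ i, w i ^ 2 = 2)).image (fun w i => 2 * w i)

theorem sum_doubledRoots {M : Type*} [AddCommMonoid M] (g : (Fin 8 → ℤ) → M) :
    ∑ v ∈ doubledRoots, g v =
      ∑ v ∈ (Fintype.piFinset (fun _ : Fin 8 => ({1, -1} : Finset ℤ))).filter
        (fun v => ∏ i, v i = 1), g v +
      ∑ w ∈ (Fintype.piFinset (fun _ : Fin 8 => ({0, 1, -1} : Finset ℤ))).filter
        (fun w => ∑ i, w i ^ 2 = 2), g (fun i => 2 * w i) := by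
  rw [doubledRoots, Finset.sum_union, Finset.sum_image]
  · intro w _ w' _ h
    funext i
    have := congrFun h i
    simpa using this
  · rw [Finset.disjoint_left]
    intro v h1 h2
    rw [Finset.mem_filter, Fintype.mem_piFinset] at h1
    obtain ⟨w, _, rfl⟩ := Finset.mem_image.mp h2
    have := h1.1 0
    simp only [Finset.mem_insert, Finset.mem_singleton] at this
    omega

/-- Averaging with the product of signs selects the 128 vectors of product 1; the alternating part
vanishes below degree eight. The other roots are twice the short vectors, hence 2ᵏ. -/
theorem sum_doubledRoots_pow (k : ℕ) (hk : k < 8) (t : Fin 8 → ℂ) :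
    ∑ v ∈ doubledRoots, (∑ i, (v i : ℂ) * t i) ^ k =
      1 / 2 * signSum 8 k 0 t + 2 ^ k * shortSum 8 2 k 0 t := by
  rw [sum_doubledRoots]
  congr 1
  · have h := sum_prod_mul_pow_eq_zero 8 k hk 0 t
    have h' := congrArg (signSum 8 k 0 t + ·) h
    simp only [add_zero] at h'
    rw [← h', signSum, ← Finset.sum_add_distrib, Finset.mul_sum, Finset.sum_filter]
    refine Finset.sum_congr rfl fun v hv => ?_
    rw [Fintype.mem_piFinset] at hv
    have hp : ∏ i, v i = 1 ∨ ∏ i, v i = -1 := by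
      rw [← sq_eq_one_iff, ← Finset.prod_pow]
      refine Finset.prod_eq_one fun i _ => ?_
      have := hv i
      simp only [Finset.mem_insert, Finset.mem_singleton] at this
      rcases this with h | h <;> rw [h] <;> norm_num
    rcases hp with h | h <;> rw [h] <;> norm_num
    ring
  · rw [shortSum, Finset.mul_sum, Finset.sum_filter]
    refine Finset.sum_congr rfl fun w _ => ?_
    split_ifs
    · rw [zero_add, ← mul_pow, Finset.mul_sum]
      push_cast
      simp only [mul_assoc]
    · rw [mul_zero]

/-- The quartic and sextic sums that are not powers of ∑tᵢ² cancel between the two families of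
roots: -256 + 256 for ∑tᵢ⁴, 2048 - 2048 for ∑tᵢ⁶ and -3840 + 3840 for the mixed term. -/
theorem sum_doubledRoots_pow_eq (t : Fin 8 → ℂ) :
    doubledRoots.card = 240 ∧
    ∑ v ∈ doubledRoots, (∑ i, (v i : ℂ) * t i) ^ 2 = 240 * ∑ i, t i ^ 2 ∧
    ∑ v ∈ doubledRoots, (∑ i, (v i : ℂ) * t i) ^ 4 = 576 * (∑ i, t i ^ 2) ^ 2 ∧
    ∑ v ∈ doubledRoots, (∑ i, (v i : ℂ) * t i) ^ 6 = 1920 * (∑ i, t i ^ 2) ^ 3 := by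
  obtain ⟨h0, h2, h4, h6⟩ := signSum_eq 8 0 t
  obtain ⟨g0, g2, g4, g6⟩ := shortSum_two_eq 8 t
  have hc := sum_doubledRoots_pow 0 (by norm_num) t
  rw [h0, g0] at hc
  rw [sum_doubledRoots_pow _ (by norm_num), sum_doubledRoots_pow _ (by norm_num),
    sum_doubledRoots_pow _ (by norm_num), h2, h4, h6, g2, g4, g6]
  refine ⟨?_, ?_, ?_, ?_⟩
  · rw [Finset.sum_congr rfl fun _ _ => pow_zero _, Finset.sum_const, nsmul_one] at hc
    have hc' : (doubledRoots.card : ℂ) = ((240 : ℕ) : ℂ) := hc.trans (by norm_num)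
    exact Nat.cast_injective hc'
  all_goals
    push_cast
    ring

end PowerSums

/-! ### Roots as shortest vectors of the E₈ lattice -/

section Lattice

/-- The vectors of the `E₈` lattice, in twice the standard orthonormal coordinates. -/
def InDoubledLattice (v : Fin 8 → ℤ) : Prop :=
  (∀ i, 2 ∣ v i - v 0) ∧ 4 ∣ ∑ i, v i

/-- For signs x, y the difference xy - 1 - (x - 1) - (y - 1) = (x - 1)(y - 1) is divisible by 4. So
for eight signs the product is 1 exactly when 4 divides the sum. -/
theorem four_dvd_prod_sub (n : ℕ) (v : Fin n → ℤ) (hv : ∀ i, v i = 1 ∨ v i = -1) :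
    4 ∣ ∏ i, v i - 1 - ∑ i, (v i - 1) := by
  induction n with
  | zero => simp
  | succ n ih =>
    have h := ih (fun i => v i.succ) fun i => hv _
    rw [Fin.prod_univ_succ, Fin.sum_univ_succ]
    have hp : ∏ i : Fin n, v i.succ = 1 ∨ ∏ i : Fin n, v i.succ = -1 := by
      rw [← sq_eq_one_iff, ← Finset.prod_pow]
      refine Finset.prod_eq_one fun i _ => ?_
      rcases hv i.succ with h | h <;> rw [h] <;> norm_num
    rcases hp with h1 | h1 <;> rw [h1] at h ⊢ <;> rcases hv 0 with h2 | h2 <;> rw [h2] <;> omega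

theorem mem_doubledRoots_iff (v : Fin 8 → ℤ) :
    v ∈ doubledRoots ↔ InDoubledLattice v ∧ ∑ i, v i ^ 2 = 8 := by
  rw [doubledRoots, Finset.mem_union, Finset.mem_image, Finset.mem_filter, Fintype.mem_piFinset]
  simp only [Finset.mem_filter, Fintype.mem_piFinset, Finset.mem_insert, Finset.mem_singleton]
  constructor
  · rintro (⟨h1, h2⟩ | ⟨w, ⟨h1, h2⟩, rfl⟩)
    · refine ⟨⟨fun i => ?_, ?_⟩, ?_⟩
      · rcases h1 i with h | h <;> rcases h1 0 with h' | h' <;> rw [h, h'] <;> norm_num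
      · have h3 := four_dvd_prod_sub 8 v h1
        rw [h2, Finset.sum_sub_distrib] at h3
        simp only [Finset.sum_const, Finset.card_univ, Fintype.card_fin, nsmul_eq_mul, Nat.cast_ofNat] at h3
        omega
      · rw [Finset.sum_congr rfl fun i _ => show v i ^ 2 = 1 by
          rcases h1 i with h | h <;> rw [h] <;> norm_num]
        simp
    · refine ⟨⟨fun i => ?_, ?_⟩, ?_⟩
      · change 2 ∣ 2 * w i - 2 * w 0
        omega
      · rw [← Finset.mul_sum]
        have h3 : 2 ∣ ∑ i, (w i ^ 2 - w i) := Finset.dvd_sum fun i _ => by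
          rcases h1 i with h | h | h <;> rw [h] <;> norm_num
        rw [Finset.sum_sub_distrib, h2] at h3
        omega
      · simp only [mul_pow]
        rw [← Finset.mul_sum, h2]
        norm_num
  · rintro ⟨⟨h1, h2⟩, h3⟩
    -- All entries have the parity of the first. Even entries halve to a vector of square length 2;
    -- eight odd entries with squares summing to 8 must all be ±1.
    rcases Int.even_or_odd (v 0) with h0 | h0
    · right
      have h4 : ∀ i, 2 ∣ v i := fun i => by
        have := h1 i
        obtain ⟨c, hc⟩ := h0
        omega
      choose w hw using h4
      obtain rfl : v = fun i => 2 * w i := funext hw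
      have h5 : ∑ i, w i ^ 2 = 2 := by
        simp only [mul_pow, ← Finset.mul_sum] at h3
        omega
      refine ⟨w, ⟨fun i => ?_, h5⟩, rfl⟩
      have h6 : w i ^ 2 ≤ 2 := h5 ▸ Finset.single_le_sum (f := fun i => w i ^ 2)
        (fun i _ => sq_nonneg _) (Finset.mem_univ i)
      have h7 : w i ≤ 1 := by nlinarith
      have h8 : -1 ≤ w i := by nlinarith
      omega
    · left
      have h4 : ∀ i, v i ≠ 0 := fun i hi => by
        have := h1 i
        obtain ⟨c, hc⟩ := h0
        omega
      have h5 : ∀ i, 1 ≤ v i ^ 2 := fun i => by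
        have := h4 i
        have : 0 < v i ^ 2 := by positivity
        omega
      have h6 : ∑ i, (v i ^ 2 - 1) = 0 := by
        rw [Finset.sum_sub_distrib, h3]
        simp
      have h7 : ∀ i, v i = 1 ∨ v i = -1 := fun i => by
        rw [← sq_eq_one_iff]
        have := (Finset.sum_eq_zero_iff_of_nonneg fun i _ => sub_nonneg.mpr (h5 i)).mp h6 i
          (Finset.mem_univ i)
        omega
      refine ⟨h7, ?_⟩
      have h8 := four_dvd_prod_sub 8 v h7
      rw [Finset.sum_sub_distrib] at h8
      simp only [Finset.sum_const, Finset.card_univ, Fintype.card_fin, nsmul_eq_mul, Nat.cast_ofNat] at h8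
      have hp : ∏ i, v i = 1 ∨ ∏ i, v i = -1 := by
        rw [← sq_eq_one_iff, ← Finset.prod_pow]
        exact Finset.prod_eq_one fun i _ => sq_eq_one_iff.mpr (h7 i)
      omega

end Lattice

/-! ### Simple roots and simple reflections -/

section SimpleRoots

open scoped Matrix

/-- The simple roots of `E₈`, in twice the standard orthonormal coordinates. -/
def doubledSimple : Matrix (Fin 8) (Fin 8) ℤ :=
  !![ 1, -1, -1, -1, -1, -1, -1, 1;
      2, 2, 0, 0, 0, 0, 0, 0;
      -2, 2, 0, 0, 0, 0, 0, 0;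
      0, -2, 2, 0, 0, 0, 0, 0;
      0, 0, -2, 2, 0, 0, 0, 0;
      0, 0, 0, -2, 2, 0, 0, 0;
      0, 0, 0, 0, -2, 2, 0, 0;
      0, 0, 0, 0, 0, -2, 2, 0]

theorem doubledSimple_mul_transpose : doubledSimple * doubledSimpleᵀ = 4 • CartanMatrix.E₈ := by
  decide

theorem inDoubledLattice_doubledSimple (i : Fin 8) : InDoubledLattice (doubledSimple i) := by
  revert i
  unfold InDoubledLattice
  decide

theorem InDoubledLattice.sub_smul {u v : Fin 8 → ℤ} (hv : InDoubledLattice v)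
    (hu : InDoubledLattice u) (p : ℤ) : InDoubledLattice (v - p • u) := by
  refine ⟨fun i => ?_, ?_⟩
  · have h : (v - p • u) i - (v - p • u) 0 = (v i - v 0) - p * (u i - u 0) := by
      simp only [Pi.sub_apply, Pi.smul_apply, smul_eq_mul]
      ring
    rw [h]
    exact dvd_sub (hv.1 i) (Dvd.dvd.mul_left (hu.1 i) p)
  · simp only [Pi.sub_apply, Pi.smul_apply, smul_eq_mul, Finset.sum_sub_distrib, ← Finset.mul_sum]
    exact dvd_sub hv.2 (Dvd.dvd.mul_left hu.2 p)

/-- Only the first simple root has a last entry, so its coefficient is v₇, and the others follow by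
back-substitution. Congruence of the entries mod 2 makes each division by two possible. -/
theorem InDoubledLattice.exists_eq_vecMul {v : Fin 8 → ℤ} (hv : InDoubledLattice v) :
    ∃ n : Fin 8 → ℤ, v = n ᵥ* doubledSimple := by
  obtain ⟨h1, h2⟩ := hv
  choose m hm using h1
  obtain ⟨t, ht⟩ := h2
  simp only [Fin.sum_univ_eight] at ht
  have e1 := hm 1
  have e2 := hm 2
  have e3 := hm 3
  have e4 := hm 4
  have e5 := hm 5
  have e6 := hm 6
  have e7 := hm 7
  obtain ⟨n7, h7⟩ : ∃ n7, v 6 + v 7 = 2 * n7 := ⟨v 0 + m 6 + m 7, by omega⟩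
  obtain ⟨n6, h6⟩ : ∃ n6, v 5 + v 7 + 2 * n7 = 2 * n6 := ⟨v 0 + m 5 + m 7 + n7, by omega⟩
  obtain ⟨n5, h5⟩ : ∃ n5, v 4 + v 7 + 2 * n6 = 2 * n5 := ⟨v 0 + m 4 + m 7 + n6, by omega⟩
  obtain ⟨n4, h4⟩ : ∃ n4, v 3 + v 7 + 2 * n5 = 2 * n4 := ⟨v 0 + m 3 + m 7 + n5, by omega⟩
  obtain ⟨n3, h3⟩ : ∃ n3, v 2 + v 7 + 2 * n4 = 2 * n3 := ⟨v 0 + m 2 + m 7 + n4, by omega⟩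
  -- The only division by four, which is where divisibility of the entry sum enters.
  obtain ⟨n1, h1⟩ : ∃ n1, v 0 + v 1 + 2 * n3 = 4 * n1 := by
    refine ⟨t + v 7, ?_⟩
    omega
  obtain ⟨n2, h2⟩ : ∃ n2, v 0 - v 7 = 2 * n1 - 2 * n2 := ⟨n1 + m 7, by omega⟩
  refine ⟨![v 7, n1, n2, n3, n4, n5, n6, n7], funext fun i => ?_⟩
  fin_cases i <;> simp [Matrix.vecMul, dotProduct, Fin.sum_univ_eight, doubledSimple] <;> omega

theorem dotProduct_doubledSimple_self (i : Fin 8) : doubledSimple i ⬝ᵥ doubledSimple i = 8 := by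
  revert i
  decide

theorem doubledSimple_mem (i : Fin 8) : doubledSimple i ∈ doubledRoots := by
  rw [mem_doubledRoots_iff]
  refine ⟨inDoubledLattice_doubledSimple i, ?_⟩
  rw [← dotProduct_doubledSimple_self i]
  exact Finset.sum_congr rfl fun j _ => sq _

theorem four_dvd_dotProduct {v : Fin 8 → ℤ} (hv : InDoubledLattice v) (i : Fin 8) :
    4 ∣ v ⬝ᵥ doubledSimple i := by
  obtain ⟨n, rfl⟩ := hv.exists_eq_vecMul
  have h : (n ᵥ* doubledSimple) ⬝ᵥ doubledSimple i = (n ᵥ* (4 • CartanMatrix.E₈)) i := by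
    rw [← doubledSimple_mul_transpose, ← Matrix.vecMul_vecMul]
    rfl
  rw [h, Matrix.vecMul_smul]
  exact ⟨(n ᵥ* CartanMatrix.E₈) i, by simp⟩

/-- This is the simple reflection: it preserves the lattice, and the square length because -2p · 4p
+ 8p² = 0. In doubled coordinates inner products carry a factor 4. -/
theorem sub_smul_mem_doubledRoots {v : Fin 8 → ℤ} (hv : v ∈ doubledRoots) {i : Fin 8} {p : ℤ}
    (hp : v ⬝ᵥ doubledSimple i = 4 * p) : v - p • doubledSimple i ∈ doubledRoots := by
  rw [mem_doubledRoots_iff] at hv ⊢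
  refine ⟨hv.1.sub_smul (inDoubledLattice_doubledSimple i) p, ?_⟩
  have h := dotProduct_doubledSimple_self i
  have h8 := hv.2
  simp only [dotProduct] at hp h
  have e : ∑ j, (v - p • doubledSimple i) j ^ 2 = ∑ j, v j ^ 2
      - 2 * p * ∑ j, v j * doubledSimple i j
      + p ^ 2 * ∑ j, doubledSimple i j * doubledSimple i j := by
    rw [Finset.mul_sum, Finset.mul_sum, ← Finset.sum_sub_distrib, ← Finset.sum_add_distrib]
    refine Finset.sum_congr rfl fun j _ => ?_
    simp only [Pi.sub_apply, Pi.smul_apply, smul_eq_mul]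
    ring
  rw [e, hp, h, h8]
  ring

/-- Every root is obtained from simple roots by simple reflections. -/
theorem doubledRoots_induction {P : (Fin 8 → ℤ) → Prop} (h0 : ∀ i, P (doubledSimple i))
    (hneg : ∀ v, P v → P (-v))
    (hrefl : ∀ v ∈ doubledRoots, ∀ i p, v ⬝ᵥ doubledSimple i = 4 * p →
      P (v - p • doubledSimple i) → P v) {v : Fin 8 → ℤ} (hv : v ∈ doubledRoots) : P v := by
  obtain ⟨n, hn⟩ := ((mem_doubledRoots_iff v).mp hv).1.exists_eq_vecMul
  -- Induction on the sum of absolute coefficients; no division into positive and negative roots is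
  -- needed.
  induction hN : ∑ i, (n i).natAbs using Nat.strong_induction_on generalizing v n with
  | _ N ih =>
    have hv' := (mem_doubledRoots_iff v).mp hv
    have hvv : ∑ i, n i * (v ⬝ᵥ doubledSimple i) = 8 := by
      rw [← hv'.2]
      have e : ∀ j, v j ^ 2 = v j * (n ᵥ* doubledSimple) j := fun j => by rw [← hn, sq]
      simp only [e, Matrix.vecMul, dotProduct, Finset.mul_sum]
      rw [Finset.sum_comm]
      exact Finset.sum_congr rfl fun j _ => Finset.sum_congr rfl fun i _ => by ring
    -- Some term of the positive square length is positive, so reflecting at that i moves the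
    -- coefficient towards zero.
    obtain ⟨i, -, hi⟩ : ∃ i ∈ Finset.univ, 0 < n i * (v ⬝ᵥ doubledSimple i) := by
      by_contra! h
      have := Finset.sum_nonpos h
      omega
    obtain ⟨p, hp⟩ := four_dvd_dotProduct hv'.1 i
    have hbound : ∀ s : ℤ, ∑ j, (v j - s * doubledSimple i j) ^ 2 = 8 - 8 * s * p + 8 * s ^ 2 :=
      fun s => by
        have h := dotProduct_doubledSimple_self i
        have h8 := hv'.2
        simp only [dotProduct] at hp h
        have e : ∑ j, (v j - s * doubledSimple i j) ^ 2 = ∑ j, v j ^ 2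
            - 2 * s * ∑ j, v j * doubledSimple i j
            + s ^ 2 * ∑ j, doubledSimple i j * doubledSimple i j := by
          rw [Finset.mul_sum, Finset.mul_sum, ← Finset.sum_sub_distrib, ← Finset.sum_add_distrib]
          exact Finset.sum_congr rfl fun j _ => by ring
        rw [e, hp, h, h8]
        ring
    have hzero : ∀ s : ℤ, ∑ j, (v j - s * doubledSimple i j) ^ 2 = 0 → v = s • doubledSimple i :=
      fun s hs => funext fun j => by
        have := (Finset.sum_eq_zero_iff_of_nonneg fun j _ => sq_nonneg _).mp hs j (Finset.mem_univ j)
        have := pow_eq_zero_iff two_ne_zero |>.mp this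
        simp only [Pi.smul_apply, smul_eq_mul]
        omega
    -- The square lengths of v ∓ αᵢ are nonnegative, so |p| ≤ 2, with equality only for v = ±αᵢ;
    -- otherwise p = ±1 and the reflection shortens the expansion.
    have hpos : ∀ s : ℤ, 0 ≤ 8 - 8 * s * p + 8 * s ^ 2 := fun s =>
      hbound s ▸ Finset.sum_nonneg fun j _ => sq_nonneg _
    have hp2 : p ≤ 2 := by have := hpos 1; omega
    have hp2' : -2 ≤ p := by have := hpos (-1); omega
    have hstep : (n i - p).natAbs < (n i).natAbs → P v := fun hlt => by
      refine hrefl v hv i p hp (ih (∑ k, ((n - p • Pi.single i 1 : Fin 8 → ℤ) k).natAbs) ?_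
        (sub_smul_mem_doubledRoots hv hp) (n - p • Pi.single i 1) ?_ rfl)
      · rw [← hN]
        refine Finset.sum_lt_sum (fun k _ => ?_) ⟨i, Finset.mem_univ i, ?_⟩
        · by_cases hk : k = i
          · subst hk
            simpa using hlt.le
          · simp [hk]
        · simpa using hlt
      · rw [Matrix.sub_vecMul, ← hn, Matrix.smul_vecMul, Matrix.single_one_vecMul]
        rfl
    rw [hp] at hi
    have hn0 : n i ≠ 0 := by
      rintro h
      simp [h] at hi
    have hp0 : p ≠ 0 := by
      rintro h
      simp [h] at hi
    have hcases : p = 1 ∨ p = -1 ∨ p = 2 ∨ p = -2 := by omega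
    rcases hcases with rfl | rfl | rfl | rfl
    · exact hstep (by omega)
    · exact hstep (by omega)
    · have := hzero 1 (by rw [hbound]; norm_num)
      rw [this, one_smul]
      exact h0 i
    · have := hzero (-1) (by rw [hbound]; norm_num)
      rw [this, neg_smul, one_smul]
      exact hneg _ (h0 i)

end SimpleRoots

/-! ### Coordinates for an abstract root system of type E₈ -/

section RootCoordinates

open scoped Matrix

theorem neg_mem_doubledRoots {v : Fin 8 → ℤ} (hv : v ∈ doubledRoots) : -v ∈ doubledRoots := by
  rw [mem_doubledRoots_iff] at hv ⊢
  refine ⟨?_, by simpa using hv.2⟩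
  have h : InDoubledLattice 0 := ⟨fun i => by simp, by simp⟩
  simpa using h.sub_smul hv.1 1

/-- The vectors 4eᵢ lie in the lattice, so their expansions in simple roots form an integral inverse
up to the factor 4. -/
theorem exists_mul_doubledSimple : ∃ D : Matrix (Fin 8) (Fin 8) ℤ, D * doubledSimple = 4 := by
  have h : ∀ i, InDoubledLattice (Pi.single i 4 : Fin 8 → ℤ) := fun i => by
    revert i
    unfold InDoubledLattice
    decide
  choose D hD using fun i => (h i).exists_eq_vecMul
  refine ⟨Matrix.of D, ?_⟩
  ext i j
  have h1 : (Matrix.of D * doubledSimple) i j = (D i ᵥ* doubledSimple) j := rfl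
  rw [h1, ← hD, show (4 : Matrix (Fin 8) (Fin 8) ℤ) = Matrix.diagonal fun _ => 4 from rfl,
    Matrix.diagonal_apply, Pi.single_apply]
  simp [eq_comm]

theorem mul_doubledSimple_comm {D : Matrix (Fin 8) (Fin 8) ℤ} (hD : D * doubledSimple = 4) :
    doubledSimple * D = 4 := by
  let φ := (Int.castRingHom ℚ).mapMatrix (m := Fin 8)
  have hφ : Function.Injective φ := Matrix.map_injective Int.cast_injective
  have h1 : ((1 / 4 : ℚ) • φ D) * φ doubledSimple = 1 := by
    rw [Matrix.smul_mul, ← map_mul, hD, map_ofNat]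
    ext i j
    simp [show (4 : Matrix (Fin 8) (Fin 8) ℚ) = Matrix.diagonal fun _ => 4 from rfl,
      Matrix.diagonal_apply, Matrix.one_apply]
  rw [mul_eq_one_comm, Matrix.mul_smul, ← map_mul] at h1
  apply hφ
  rw [map_ofNat, show φ (doubledSimple * D) = (4 : ℚ) • ((1 / 4 : ℚ) • φ (doubledSimple * D)) by
    rw [smul_smul]; norm_num, h1]
  ext i j
  simp [show (4 : Matrix (Fin 8) (Fin 8) ℚ) = Matrix.diagonal fun _ => 4 from rfl,
    Matrix.diagonal_apply, Matrix.one_apply]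

variable {ι M N : Type*} [Fintype ι] [AddCommGroup M] [Module ℂ M] [AddCommGroup N] [Module ℂ N]
  {P : RootPairing ι ℂ M N} [P.IsRootSystem] [P.IsCrystallographic] [P.IsReduced]

/-- The roots of a root system of type `E₈` in orthonormal coordinates. -/
theorem exists_coordinates (b : P.Base) (e : b.support ≃ Fin 8)
    (h : b.cartanMatrix.reindex e e = CartanMatrix.E₈) :
    ∃ β : Fin 8 → M, LinearIndependent ℂ β ∧ ∀ m : M, m ∈ Set.range P.root ↔
      ∃ v ∈ doubledRoots, ∑ j, (v j : ℂ) • β j = m := by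
  obtain ⟨D, hD⟩ := exists_mul_doubledSimple
  have hBD := mul_doubledSimple_comm hD
  let α : Fin 8 → M := fun i => P.root (e.symm i)
  -- Solves αᵢ = ∑ Bᵢⱼ βⱼ for an orthonormal frame, B being the matrix of simple roots.
  let β : Fin 8 → M := fun j => (1 / 4 : ℂ) • ∑ i, (D j i : ℂ) • α i
  have hαβ : ∀ i, ∑ j, (doubledSimple i j : ℂ) • β j = α i := fun i => by
    simp only [β, Finset.smul_sum, smul_smul]
    rw [Finset.sum_comm]
    simp only [← Finset.sum_smul]
    have h1 : ∀ k, ∑ j, (doubledSimple i j : ℂ) * (1 / 4 * (D j k : ℂ)) = if i = k then 1 else 0 :=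
      fun k => by
        have h2 : (doubledSimple * D) i k = if i = k then 4 else 0 := by
          rw [hBD, show (4 : Matrix (Fin 8) (Fin 8) ℤ) = Matrix.diagonal fun _ => 4 from rfl,
            Matrix.diagonal_apply]
        rw [Matrix.mul_apply] at h2
        have h3 := congrArg (fun z : ℤ => (1 / 4 : ℂ) * z) h2
        push_cast [Finset.mul_sum] at h3
        rw [Finset.sum_congr rfl fun j _ => mul_left_comm _ _ _, h3]
        split_ifs <;> norm_num
    rw [Finset.sum_congr rfl fun k _ => congrArg (· • α k) (h1 k)]
    simp
  have hpair : ∀ (v : Fin 8 → ℤ) (i : Fin 8), P.toLinearMap (∑ j, (v j : ℂ) • β j)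
      (P.coroot (e.symm i)) = 1 / 4 * ((v ⬝ᵥ doubledSimple i : ℤ) : ℂ) := fun v i => by
    have h1 : ∀ k, P.toLinearMap (α k) (P.coroot (e.symm i)) = (CartanMatrix.E₈ k i : ℂ) := fun k => by
      rw [← h]
      exact (P.algebraMap_pairingIn ℤ _ _).symm
    have h2 : ∀ j, P.toLinearMap (β j) (P.coroot (e.symm i)) = 1 / 4 * (doubledSimple i j : ℂ) :=
      fun j => by
        simp only [β, map_smul, map_sum, LinearMap.smul_apply, LinearMap.sum_apply, h1, smul_eq_mul]
        have h3 : (D * (4 • CartanMatrix.E₈)) j i = 4 * doubledSimple i j := by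
          rw [← doubledSimple_mul_transpose, ← Matrix.mul_assoc, hD,
            show (4 : Matrix (Fin 8) (Fin 8) ℤ) = Matrix.diagonal fun _ => 4 from rfl,
            Matrix.diagonal_mul]
          rfl
        rw [Matrix.mul_smul, Matrix.smul_apply, nsmul_eq_mul] at h3
        have h4 : (D * CartanMatrix.E₈) j i = doubledSimple i j := by
          push_cast at h3
          omega
        rw [← h4, Matrix.mul_apply]
        push_cast
        rfl
    simp only [map_sum, map_smul, LinearMap.sum_apply, LinearMap.smul_apply, h2, dotProduct,
      smul_eq_mul]
    push_cast [Finset.mul_sum]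
    exact Finset.sum_congr rfl fun j _ => by ring
  have hsub : ∀ (v : Fin 8 → ℤ) (p : ℤ) (i : Fin 8),
      ∑ j, ((v - p • doubledSimple i) j : ℂ) • β j = ∑ j, (v j : ℂ) • β j - (p : ℂ) • α i :=
    fun v p i => by
      rw [← hαβ, Finset.smul_sum, ← Finset.sum_sub_distrib]
      refine Finset.sum_congr rfl fun j _ => ?_
      simp only [Pi.sub_apply, Pi.smul_apply, smul_eq_mul]
      push_cast
      module
  have hneg : ∀ v : Fin 8 → ℤ, ∑ j, ((-v) j : ℂ) • β j = -∑ j, (v j : ℂ) • β j := fun v => by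
    rw [← Finset.sum_neg_distrib]
    refine Finset.sum_congr rfl fun j _ => ?_
    simp
  have hrefl : ∀ i k, P.root (P.reflectionPerm i k) =
      P.root k - P.toLinearMap (P.root k) (P.coroot i) • P.root i := fun i k => by
    rw [P.root_reflectionPerm, P.reflection_apply]
    rfl
  refine ⟨β, ?_, fun m => ⟨?_, ?_⟩⟩
  -- The β span because the simple roots do, and there are as many of them as the rank.
  · refine linearIndependent_of_top_le_span_of_card_eq_finrank ?_ ?_
    · rw [← (b.toWeightBasis).span_eq, Submodule.span_le]
      rintro _ ⟨i, rfl⟩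
      have h1 : b.toWeightBasis i = α (e i) := by simp [α]
      rw [SetLike.mem_coe, h1, ← hαβ]
      exact Submodule.sum_mem _ fun j _ => Submodule.smul_mem _ _ (Submodule.subset_span ⟨j, rfl⟩)
    · rw [Module.finrank_eq_card_basis (b.toWeightBasis.reindex e)]
  · rintro ⟨k, rfl⟩
    -- Abstract roots are generated from the simple ones by reflections, which act on the
    -- coordinates as on the lattice roots.
    refine b.induction_reflect (p := fun k => ∃ v ∈ doubledRoots, ∑ j, (v j : ℂ) • β j = P.root k) k
      ?_ ?_ ?_
    · rintro i ⟨v, hv, hvi⟩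
      refine ⟨-v, neg_mem_doubledRoots hv, ?_⟩
      rw [hneg, hvi, P.root_reflectionPerm, P.reflection_apply_self]
    · intro i hi
      refine ⟨doubledSimple (e ⟨i, hi⟩), doubledSimple_mem _, ?_⟩
      rw [hαβ]
      simp [α]
    · rintro i j ⟨v, hv, hvi⟩ hj
      obtain ⟨p, hp⟩ := four_dvd_dotProduct ((mem_doubledRoots_iff v).mp hv).1 (e ⟨j, hj⟩)
      refine ⟨v - p • doubledSimple (e ⟨j, hj⟩), sub_smul_mem_doubledRoots hv hp, ?_⟩
      have h1 := hpair v (e ⟨j, hj⟩)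
      rw [hp, hvi, e.symm_apply_apply] at h1
      rw [hsub, hrefl, h1, hvi]
      simp [α]
  · rintro ⟨v, hv, rfl⟩
    -- Conversely the concrete roots are generated by the same reflections, so none is missed.
    refine doubledRoots_induction (P := fun v => ∑ j, (v j : ℂ) • β j ∈ Set.range P.root) ?_ ?_ ?_ hv
    · intro i
      rw [hαβ]
      exact ⟨_, rfl⟩
    · rintro v ⟨k, hk⟩
      refine ⟨P.reflectionPerm k k, ?_⟩
      rw [hneg, ← hk, P.root_reflectionPerm, P.reflection_apply_self]
    · rintro v - i p hp ⟨k, hk⟩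
      refine ⟨P.reflectionPerm (e.symm i) k, ?_⟩
      have h1 : (v - p • doubledSimple i) ⬝ᵥ doubledSimple i = 4 * -p := by
        rw [sub_dotProduct, smul_dotProduct, hp, dotProduct_doubledSimple_self, smul_eq_mul]
        ring
      rw [hrefl, hk, hpair, h1, hsub]
      push_cast
      simp only [α]
      module

/-- Independence of the β makes coordinates unique, so the two index sets match without
multiplicity. -/
theorem sum_root_eq (b : P.Base) (e : b.support ≃ Fin 8)
    (h : b.cartanMatrix.reindex e e = CartanMatrix.E₈) :
    ∃ β : Fin 8 → M, ∀ f : M → ℂ,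
      ∑ i, f (P.root i) = ∑ v ∈ doubledRoots, f (∑ j, (v j : ℂ) • β j) := by
  classical
  obtain ⟨β, hβ, hr⟩ := exists_coordinates b e h
  refine ⟨β, fun f => ?_⟩
  have hinj : Set.InjOn (fun v : Fin 8 → ℤ => ∑ j, (v j : ℂ) • β j) doubledRoots := by
    intro v _ w _ hvw
    have h1 := Fintype.linearIndependent_iff.mp hβ (fun j => (v j : ℂ) - w j) (by
      simp only [sub_smul, Finset.sum_sub_distrib]
      exact sub_eq_zero.mpr hvw)
    funext j
    exact_mod_cast sub_eq_zero.mp (h1 j)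
  rw [← Finset.sum_image (f := f) (g := fun v : Fin 8 → ℤ => ∑ j, (v j : ℂ) • β j) hinj,
    ← Finset.sum_image (f := f) (g := P.root) fun _ _ _ _ h => P.root.injective h]
  refine Finset.sum_congr ?_ fun _ _ => rfl
  ext m
  rw [Finset.mem_image, Finset.mem_image, ← hr]
  simp

end RootCoordinates

/-! ### Traces of ad on a Cartan subalgebra -/

section CartanTraces

open LieAlgebra LieModule LieAlgebra.IsKilling

variable {L : Type*} [LieRing L] [LieAlgebra ℂ L] [FiniteDimensional ℂ L] [IsKilling ℂ L]
  (H : LieSubalgebra ℂ L) [H.IsCartanSubalgebra]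

/-- The trace of a power of the adjoint action of an element of a Cartan subalgebra. -/
theorem trace_ad_pow (h : H) (k : ℕ) :
    LinearMap.trace ℂ L (ad ℂ L h ^ k) =
      ∑ χ : Weight ℂ H L, (Module.finrank ℂ (genWeightSpace L χ) : ℂ) * χ h ^ k := by
  classical
  have hpow : ∀ (χ : Weight ℂ H L) (k : ℕ) (x : L), x ∈ genWeightSpace L χ →
      (ad ℂ L h ^ k) x = χ h ^ k • x := fun χ k x hx => by
    induction k with
    | zero => simp
    | succ k ih =>
      rw [pow_succ', Module.End.mul_apply, ih, map_smul, ad_apply]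
      -- Over a Killing algebra h acts on a generalised weight space by a scalar, with no nilpotent
      -- part.
      have h1 : ⁅(h : L), x⁆ = χ h • x := lie_eq_smul_of_mem_rootSpace hx h
      rw [h1, smul_smul, pow_succ]
  have hmaps : ∀ χ : Weight ℂ H L, Set.MapsTo (ad ℂ L h ^ k) (genWeightSpace L χ).toSubmodule
      (genWeightSpace L χ).toSubmodule := fun χ x hx => by
    rw [hpow χ k x hx]
    exact Submodule.smul_mem _ _ hx
  have hds := DirectSum.isInternal_submodule_of_iSupIndep_of_iSup_eq_top
    (LieSubmodule.iSupIndep_toSubmodule.mpr <| iSupIndep_genWeightSpace' ℂ H L)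
    (LieSubmodule.iSup_toSubmodule_eq_top.mpr <| iSup_genWeightSpace_eq_top' ℂ H L)
  rw [LinearMap.trace_eq_sum_trace_restrict hds hmaps]
  refine Finset.sum_congr rfl fun χ _ => ?_
  have h1 : (ad ℂ L h ^ k).restrict (hmaps χ) = χ h ^ k • LinearMap.id := by
    ext x
    exact hpow χ k x x.2
  rw [h1, map_smul, LinearMap.trace_id, smul_eq_mul, mul_comm]
  rfl

theorem trace_ad_pow_eq_sum_root (h : H) {k : ℕ} (hk : k ≠ 0) :
    LinearMap.trace ℂ L (ad ℂ L h ^ k) = ∑ α : H.root, (rootSystem H).root α h ^ k := by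
  classical
  have h0 : ∑ α : H.root, (rootSystem H).root α h ^ k = ∑ α ∈ H.root, α h ^ k :=
    Finset.sum_coe_sort H.root fun α => α h ^ k
  rw [h0, trace_ad_pow,
    ← Finset.sum_filter_add_sum_filter_not (p := fun χ : Weight ℂ H L => χ.IsNonZero),
    Finset.sum_eq_zero (s := Finset.filter (fun χ : Weight ℂ H L => ¬χ.IsNonZero) _), add_zero]
  · refine Finset.sum_congr rfl fun χ hχ => ?_
    rw [finrank_rootSpace_eq_one χ (Finset.mem_filter.mp hχ).2, Nat.cast_one, one_mul]
  · intro χ hχ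
    have h1 : χ.IsZero := not_not.mp (Finset.mem_filter.mp hχ).2
    rw [h1, Pi.zero_apply, zero_pow hk, mul_zero]

theorem finrank_eq_add_card_root [Nontrivial L] :
    Module.finrank ℂ L = Module.finrank ℂ H + H.root.card := by
  classical
  -- With exponent 0 every weight contributes 0⁰ = 1 times its multiplicity, so the trace formula
  -- counts dimensions.
  have h := trace_ad_pow H 0 0
  rw [pow_zero, LinearMap.trace_one,
    ← Finset.sum_filter_add_sum_filter_not (p := fun χ : Weight ℂ H L => χ.IsNonZero),
    Finset.sum_eq_single_of_mem (s := Finset.filter (fun χ : Weight ℂ H L => ¬χ.IsNonZero) _) 0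
      (by simp [Weight.isZero_zero])] at h
  · have h0 : Module.finrank ℂ (genWeightSpace L (0 : Weight ℂ H L)) = Module.finrank ℂ H := by
      rw [FunLike.coe_zero]
      exact congrArg (fun K : LieSubmodule ℂ H L => Module.finrank ℂ K) (rootSpace_zero_eq ℂ L H)
    rw [h0, Finset.sum_congr rfl fun χ hχ => by
      rw [finrank_rootSpace_eq_one χ (Finset.mem_filter.mp hχ).2, Nat.cast_one, one_mul, pow_zero]]
      at h
    rw [Finset.sum_const, nsmul_one, pow_zero, mul_one] at h
    have h1 : (Module.finrank ℂ L : ℂ) = ((Module.finrank ℂ H + H.root.card : ℕ) : ℂ) := by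
      rw [h, add_comm]
      push_cast
      rfl
    exact Nat.cast_injective h1
  · intro χ hχ hne
    exact absurd (Weight.ext fun x => congrFun (not_not.mp (Finset.mem_filter.mp hχ).2) x) hne

theorem finrank_of_cartanMatrix_E8 (b : (rootSystem H).Base) (e : b.support ≃ Fin 8)
    (hb : b.cartanMatrix.reindex e e = CartanMatrix.E₈) : Module.finrank ℂ L = 248 := by
  obtain ⟨β, hβ⟩ := sum_root_eq b e hb
  have h1 : H.root.card = 240 := by
    have h := hβ fun _ => 1
    rw [Finset.sum_const, Finset.sum_const, nsmul_one, nsmul_one, (sum_doubledRoots_pow_eq 0).1,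
      Finset.card_univ, Fintype.card_coe] at h
    exact Nat.cast_injective h
  have h2 : Module.finrank ℂ H = 8 := by
    rw [← Subspace.dual_finrank_eq, Module.finrank_eq_card_basis (b.toWeightBasis.reindex e),
      Fintype.card_fin]
  have : Nontrivial H := Module.nontrivial_of_finrank_pos (R := ℂ) (by omega)
  have : Nontrivial L := (Subtype.val_injective : Function.Injective ((↑) : H → L)).nontrivial
  rw [finrank_eq_add_card_root H, h1, h2]

/-- Root power sums give the constants: 576 = 240²/100 and 1920 = 240³/7200. -/
theorem trace_ad_pow_of_cartanMatrix_E8 (b : (rootSystem H).Base) (e : b.support ≃ Fin 8)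
    (hb : b.cartanMatrix.reindex e e = CartanMatrix.E₈) (h : H) :
    LinearMap.trace ℂ L (ad ℂ L h ^ 4) = LinearMap.trace ℂ L (ad ℂ L h ^ 2) ^ 2 / 100 ∧
    LinearMap.trace ℂ L (ad ℂ L h ^ 6) = LinearMap.trace ℂ L (ad ℂ L h ^ 2) ^ 3 / 7200 := by
  obtain ⟨β, hβ⟩ := sum_root_eq b e hb
  have h1 : ∀ k, k ≠ 0 → LinearMap.trace ℂ L (ad ℂ L h ^ k) =
      ∑ v ∈ doubledRoots, (∑ j, (v j : ℂ) * β j h) ^ k := fun k hk => by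
    rw [trace_ad_pow_eq_sum_root H h hk, hβ fun m => m h ^ k]
    simp [LinearMap.sum_apply]
  obtain ⟨-, h2, h4, h6⟩ := sum_doubledRoots_pow_eq fun j => β j h
  rw [h1 2 two_ne_zero, h1 4 four_ne_zero, h1 6 (by norm_num), h2, h4, h6]
  constructor <;> ring

/-- For a regular element `h` of a Cartan subalgebra `H`, `L = [L, h] + H`. -/
theorem exists_regular : ∃ h : H, ∀ y : L, ∃ z : L, ∃ h' : H, y = ⁅z, (h : L)⁆ + h' := by
  -- Choose h off the finitely many root hyperplanes.
  obtain ⟨h, hh⟩ := Module.Dual.exists_forall_ne_zero_of_forall_exists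
    (f := fun α : H.root => (α : Weight ℂ H L).toLinear) fun α => by
      by_contra! hc
      exact H.isNonZero_coe_root α (funext hc)
  refine ⟨h, fun y => ?_⟩
  have htop : (⊤ : Submodule ℂ L) ≤ LinearMap.range (ad ℂ L h) ⊔ H.toSubmodule := by
    rw [← LieSubmodule.iSup_toSubmodule_eq_top.mpr <| iSup_genWeightSpace_eq_top' ℂ H L, iSup_le_iff]
    intro χ x hx
    by_cases hχ : χ.IsZero
    · refine Submodule.mem_sup_right ?_
      rw [hχ] at hx
      have h1 : (rootSpace H (0 : H → ℂ)).toSubmodule = H.toSubmodule := by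
        rw [rootSpace_zero_eq ℂ L H]
        rfl
      exact h1 ▸ hx
    -- Regularity makes ad h invertible on each root space.
    · refine Submodule.mem_sup_left ⟨(χ h)⁻¹ • x, ?_⟩
      have h1 : ⁅(h : L), x⁆ = χ h • x := lie_eq_smul_of_mem_rootSpace hx h
      have h2 : χ h ≠ 0 := hh ⟨χ, by simpa using hχ⟩
      rw [map_smul, ad_apply, h1, smul_smul, inv_mul_cancel₀ h2, one_smul]
  obtain ⟨_, ⟨z, rfl⟩, h', hh', hy⟩ := Submodule.mem_sup.mp (htop (Submodule.mem_top (x := y)))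
  exact ⟨-z, ⟨h', hh'⟩, by rw [neg_lie, lie_skew]; exact hy.symm⟩

end CartanTraces

/-! ### Conjugation-invariant functions vanishing on a Cartan subalgebra -/

section Conjugation

open Filter Topology NormedSpace

variable {E : Type*} [NormedAddCommGroup E] [NormedSpace ℂ E] [FiniteDimensional ℂ E]

theorem exp_neg_mul_exp (A : E →L[ℂ] E) : exp (-A) * exp A = 1 := by
  have hd : ∀ t : ℂ, HasDerivAt (fun t : ℂ => exp (t • -A) * exp (t • A)) 0 t := fun t => by
    refine ((hasDerivAt_exp_smul_const (-A) t).mul (hasDerivAt_exp_smul_const' A t)).congr_deriv ?_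
    noncomm_ring
  have hc := is_const_of_deriv_eq_zero (fun t => (hd t).differentiableAt) (fun t => (hd t).deriv) 1 0
  simpa using hc

theorem exp_mul_exp_neg (A : E →L[ℂ] E) : exp A * exp (-A) = 1 := by
  simpa using exp_neg_mul_exp (-A)

/-- The flow of `ad z` acts on `ad y` by conjugation. -/
theorem exp_mul_ad_mul_exp (B : E →L[ℂ] E →L[ℂ] E)
    (hB : ∀ z y, B (B z y) = B z * B y - B y * B z) (z y : E) :
    B (exp (B z) y) = exp (B z) * B y * exp (-B z) := by
  -- Conjugating back by the flow gives a curve with zero derivative, because B carries the bracket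
  -- to the commutator.
  have hd : ∀ t : ℂ, HasDerivAt (fun t : ℂ => exp (t • -B z) * B (exp (t • B z) y) * exp (t • B z))
      0 t := fun t => by
    have h1 := hasDerivAt_exp_smul_const (-B z) t
    have h2 := hasDerivAt_exp_smul_const' (B z) t
    have h3 : HasDerivAt (fun t : ℂ => B (exp (t • B z) y)) (B (B z (exp (t • B z) y))) t := by
      have h4 := (h2.clm_apply (hasDerivAt_const t y))
      simp only [map_zero, add_zero] at h4
      exact B.hasFDerivAt.comp_hasDerivAt t h4
    have h5 := (h1.mul h3).mul (hasDerivAt_exp_smul_const' (B z) t)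
    refine h5.congr_deriv ?_
    rw [hB, Pi.mul_apply]
    noncomm_ring
  have hc := is_const_of_deriv_eq_zero (fun t => (hd t).differentiableAt) (fun t => (hd t).deriv) 1 0
  simp only [one_smul, zero_smul, exp_zero, one_mul, mul_one] at hc
  have h6 := congrArg (fun A => exp (B z) * A * exp (-B z)) hc
  simp only [← mul_assoc, exp_mul_exp_neg, one_mul] at h6
  rw [mul_assoc, exp_mul_exp_neg, mul_one] at h6
  rw [h6]
  rfl

/-- A conjugation invariant differentiable function of `ad y` which vanishes on a subspace `H`
vanishes identically if `[E, h] + H = E` for some `h ∈ H`. -/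
theorem eq_zero_of_conjugation_invariant (B : E →L[ℂ] E →L[ℂ] E)
    (hB : ∀ z y, B (B z y) = B z * B y - B y * B z) (H : Submodule ℂ E) (h : H)
    (hreg : ∀ y : E, ∃ z : E, ∃ h' : H, y = B z h + h') (f : (E →L[ℂ] E) → ℂ)
    (hf : Differentiable ℂ f)
    (hinv : ∀ g g' A : E →L[ℂ] E, g * g' = 1 → g' * g = 1 → f (g * A * g') = f A)
    (hH : ∀ h' : H, f (B h') = 0) (y : E) : f (B y) = 0 := by
  -- The map (z, h') ↦ exp(B z) h' has surjective derivative at (0, h) by regularity. Its values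
  -- therefore cover a neighbourhood of h, and on them f vanishes by invariance.
  have hloc : ∀ᶠ x in 𝓝 (h : E), f (B x) = 0 := by
    let Ψ : E × H → E := fun p => exp (B p.1) (p.2 : E)
    let Ψ' : E × H →L[ℂ] E := (B.flip h).comp (ContinuousLinearMap.fst ℂ E H)
      + H.subtypeL.comp (ContinuousLinearMap.snd ℂ E H)
    have h1 : HasStrictFDerivAt Ψ Ψ' (0, h) := by
      have e1 : HasStrictFDerivAt (fun p : E × H => exp (B p.1))
          (B.comp (ContinuousLinearMap.fst ℂ E H)) (0, h) := by
        have e2 : HasStrictFDerivAt (exp : (E →L[ℂ] E) → (E →L[ℂ] E)) (1 : (E →L[ℂ] E) →L[ℂ] _)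
            (B.comp (ContinuousLinearMap.fst ℂ E H) (0, h)) := by
          simpa using hasStrictFDerivAt_exp_zero
        exact e2.comp (0, h) (B.comp (ContinuousLinearMap.fst ℂ E H)).hasStrictFDerivAt
      refine (e1.clm_apply
        (H.subtypeL.comp (ContinuousLinearMap.snd ℂ E H)).hasStrictFDerivAt).congr_fderiv ?_
      ext p <;> simp [Ψ']
    have h2 : LinearMap.range (Ψ' : E × H →ₗ[ℂ] E) = ⊤ := by
      rw [LinearMap.range_eq_top]
      intro y
      obtain ⟨z, h', rfl⟩ := hreg y
      exact ⟨(z, h'), rfl⟩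
    have h3 := h1.map_nhds_eq_of_surj h2
    have h4 : Ψ (0, h) = h := by simp [Ψ]
    rw [h4] at h3
    rw [← h3, eventually_map]
    refine Eventually.of_forall fun p => ?_
    change f (B (exp (B p.1) (p.2 : E))) = 0
    rw [exp_mul_ad_mul_exp B hB, hinv _ _ _ (exp_mul_exp_neg _) (exp_neg_mul_exp _), hH]
  -- The identity theorem on the complex line through h and y carries the vanishing from t near 0 to
  -- t = 1.
  let u : ℂ → ℂ := fun t => f (B ((h : E) + t • (y - h)))
  have hu : Differentiable ℂ u := by
    refine hf.comp ?_
    fun_prop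
  have hu0 : ∀ᶠ t in 𝓝 (0 : ℂ), u t = 0 := by
    have hc : Tendsto (fun t : ℂ => (h : E) + t • (y - h)) (𝓝 0) (𝓝 h) := by
      have : Continuous fun t : ℂ => (h : E) + t • (y - h) := by fun_prop
      simpa using this.tendsto 0
    exact hc.eventually hloc
  have h5 : AnalyticOnNhd ℂ u Set.univ := fun t _ => hu.analyticAt t
  have h6 := h5.eqOn_zero_of_preconnected_of_eventuallyEq_zero isPreconnected_univ (Set.mem_univ 0) hu0
  have h7 := h6 (Set.mem_univ 1)
  simpa [u] using h7

end Conjugation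

/-! ### Trace relations on the whole complex Lie algebra -/

section AdjointTraces

open LieAlgebra

/-- Polynomial relations between the traces of powers of `ad y` follow from the relations on a
Cartan subalgebra. -/
theorem trace_relation_of_cartan {L : Type*} [LieRing L] [LieAlgebra ℂ L] [FiniteDimensional ℂ L]
    [IsKilling ℂ L] (H : LieSubalgebra ℂ L) [H.IsCartanSubalgebra] (m : ℕ) (c : ℂ)
    (hH : ∀ h : H, LinearMap.trace ℂ L (ad ℂ L h ^ (2 * m)) =
      LinearMap.trace ℂ L (ad ℂ L h ^ 2) ^ m / c) (y : L) :
    LinearMap.trace ℂ L (ad ℂ L y ^ (2 * m)) = LinearMap.trace ℂ L (ad ℂ L y ^ 2) ^ m / c := by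
  obtain ⟨h, hreg⟩ := exists_regular H
  -- Coordinates are chosen only to have a norm, for the exponential and for differentiability.
  let E := Fin (Module.finrank ℂ L) → ℂ
  let e : L ≃ₗ[ℂ] E := (Module.finBasis ℂ L).equivFun
  let adj : L →ₗ[ℂ] Module.End ℂ L :=
    { toFun := fun z => ad ℂ L z, map_add' := map_add _, map_smul' := map_smul _ }
  let B : E →L[ℂ] E →L[ℂ] E := LinearMap.toContinuousLinearMap
    (LinearMap.toContinuousLinearMap.toLinearMap ∘ₗ e.conj.toLinearMap ∘ₗ adj ∘ₗ e.symm.toLinearMap)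
  have hB : ∀ z w : L, B (e z) (e w) = e ⁅z, w⁆ := fun z w => by
    simp [B, adj, LinearEquiv.conj_apply]
  let tr : (E →L[ℂ] E) →ₗ[ℂ] ℂ := LinearMap.trace ℂ E ∘ₗ ContinuousLinearMap.coeLM ℂ
  have htr : ∀ (z : L) (k : ℕ), tr (B (e z) ^ k) = LinearMap.trace ℂ L (ad ℂ L z ^ k) :=
    fun z k => by
      rw [← LinearMap.trace_conj' (ad ℂ L z ^ k) e]
      refine congrArg (LinearMap.trace ℂ E) ?_
      have h1 : (B (e z) : E →ₗ[ℂ] E) = e.conj (ad ℂ L z) := by simp [B, adj]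
      have h2 : ((B (e z) ^ k : E →L[ℂ] E) : E →ₗ[ℂ] E) = (B (e z) : E →ₗ[ℂ] E) ^ k :=
        ContinuousLinearMap.toLinearMap_pow _ _
      change ((B (e z) ^ k : E →L[ℂ] E) : E →ₗ[ℂ] E) = _
      rw [h2, h1]
      exact (map_pow e.conjRingEquiv _ _).symm
  have htrd : Differentiable ℂ tr := (LinearMap.toContinuousLinearMap tr).differentiable
  have hinv : ∀ (g g' A : E →L[ℂ] E) (k : ℕ), g * g' = 1 → g' * g = 1 →
      tr ((g * A * g') ^ k) = tr (A ^ k) := fun g g' A k h1 h2 => by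
    have h3 : (g * A * g') ^ k = g * A ^ k * g' := by
      induction k with
      | zero => simp [h1]
      | succ k ih =>
        rw [pow_succ, ih, pow_succ, mul_assoc, ← mul_assoc g', ← mul_assoc g', h2]
        noncomm_ring
    rw [h3]
    have h4 : tr (g * A ^ k * g') = tr (g' * (g * A ^ k)) := LinearMap.trace_mul_comm ℂ _ _
    rw [h4, ← mul_assoc, h2, one_mul]
  have key := eq_zero_of_conjugation_invariant B ?_ (H.toSubmodule.map e.toLinearMap)
    ⟨e h, (h : L), h.2, rfl⟩ ?_ (fun A => tr (A ^ (2 * m)) - tr (A ^ 2) ^ m / c) ?_ ?_ ?_ (e y)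
  · simp only [htr] at key
    exact sub_eq_zero.mp key
  · intro z w
    obtain ⟨z, rfl⟩ := e.surjective z
    obtain ⟨w, rfl⟩ := e.surjective w
    refine ContinuousLinearMap.ext fun x => ?_
    obtain ⟨x, rfl⟩ := e.surjective x
    rw [sub_apply, mul_apply_eq_comp, mul_apply_eq_comp]
    simp only [hB, ← map_sub, lie_lie]
  · intro w
    obtain ⟨w, rfl⟩ := e.surjective w
    obtain ⟨z, h', rfl⟩ := hreg w
    exact ⟨e z, ⟨e h', (h' : L), h'.2, rfl⟩, by rw [map_add, hB]⟩
  · have hpow : ∀ k : ℕ, Differentiable ℂ fun A : E →L[ℂ] E => A ^ k := fun k => by fun_prop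
    have htrp : ∀ k : ℕ, Differentiable ℂ fun A : E →L[ℂ] E => tr (A ^ k) := fun k =>
      htrd.comp (hpow k)
    have htr2 : Differentiable ℂ fun A : E →L[ℂ] E => tr (A ^ 2) ^ m := (htrp 2).fun_pow m
    simp only [div_eq_mul_inv]
    exact (htrp (2 * m)).sub (htr2.mul_const c⁻¹)
  · intro g g' A h1 h2
    simp only [hinv g g' A _ h1 h2]
  · rintro ⟨_, h', hh', rfl⟩
    have := hH ⟨h', hh'⟩
    simp only [LinearEquiv.coe_coe, htr]
    exact sub_eq_zero.mpr this

end AdjointTraces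

/-! ### Descending to the real Lie algebra -/

section RealForm

variable {𝔤 : Type*} [LieRing 𝔤] [LieAlgebra ℝ 𝔤] [FiniteDimensional ℝ 𝔤]

theorem trace_ad_tmul_pow (F : 𝔤) (k : ℕ) :
    LinearMap.trace ℂ (ℂ ⊗[ℝ] 𝔤) (LieAlgebra.ad ℂ (ℂ ⊗[ℝ] 𝔤) (1 ⊗ₜ F) ^ k) =
      (((adMatrix F ^ k).trace : ℝ) : ℂ) := by
  have h1 : LieAlgebra.ad ℂ (ℂ ⊗[ℝ] 𝔤) (1 ⊗ₜ F) = (LieAlgebra.ad ℝ 𝔤 F).baseChange ℂ :=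
    LieModule.toEnd_baseChange ℝ ℂ 𝔤 𝔤 F
  have h2 : adMatrix F ^ k = LinearMap.toMatrix (Module.finBasis ℝ 𝔤) (Module.finBasis ℝ 𝔤)
      (LieAlgebra.ad ℝ 𝔤 F ^ k) := by
    rw [adMatrix, LinearMap.toMatrix_pow]
  rw [h1, ← LinearMap.baseChange_pow, LinearMap.trace_baseChange, h2,
    ← LinearMap.trace_eq_matrix_trace]
  rfl

theorem IsTypeE8.finrank_eq (h : IsTypeE8 𝔤) : Module.finrank ℝ 𝔤 = 248 := by
  obtain ⟨_, H, _, b, e, hb⟩ := h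
  rw [← finrank_of_cartanMatrix_E8 H b e hb, Module.finrank_baseChange]

/-- The relations hold for every element of the complexification, in particular at 1 ⊗ F, where the
traces are the real ones; no real Cartan subalgebra has to contain F. -/
theorem IsTypeE8.trace_adMatrix (h : IsTypeE8 𝔤) (F : 𝔤) :
    (adMatrix F ^ 4).trace = (adMatrix F ^ 2).trace ^ 2 / 100 ∧
    (adMatrix F ^ 6).trace = (adMatrix F ^ 2).trace ^ 3 / 7200 := by
  obtain ⟨_, H, _, b, e, hb⟩ := h
  have h1 := fun h => trace_ad_pow_of_cartanMatrix_E8 H b e hb h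
  have h4 := trace_relation_of_cartan H 2 100 (fun h => (h1 h).1) (1 ⊗ₜ F)
  have h6 := trace_relation_of_cartan H 3 7200 (fun h => (h1 h).2) (1 ⊗ₜ F)
  rw [trace_ad_tmul_pow, trace_ad_tmul_pow] at h4 h6
  exact ⟨by exact_mod_cast h4, by exact_mod_cast h6⟩

end RealForm

end HoravaWitten

theorem mainTheorem8 {𝔤 : Type*} [LieRing 𝔤] [LieAlgebra ℝ 𝔤] [FiniteDimensional ℝ 𝔤]
    (ε : ℝ) (hε : ε = 1 ∨ ε = -1) :
    -- The polynomial of the untwisted and twisted fields, for an arbitrary gauge algebra.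
    (∀ R : Matrix (Fin 10) (Fin 10) ℝ, (HoravaWitten.flatMetric ε).IsSkewAdjoint R → ∀ F : 𝔤,
      HoravaWitten.fieldsPoly R (HoravaWitten.adMatrix F) =
        ((-(1 / (2 * (2 * Real.pi) ^ 5 * 720)) *
          ((496 - 2 * (Module.finrank ℝ 𝔤 : ℝ)) / 1008 * (R ^ 6).trace
            + (-224 - 2 * (Module.finrank ℝ 𝔤 : ℝ)) / 768 * ((R ^ 4).trace * (R ^ 2).trace)
            + (320 - 10 * (Module.finrank ℝ 𝔤 : ℝ)) / 9216 * (R ^ 2).trace ^ 3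
            + 1 / 16 * ((R ^ 4).trace * (HoravaWitten.adMatrix F ^ 2).trace)
            + 5 / 64 * ((R ^ 2).trace ^ 2 * (HoravaWitten.adMatrix F ^ 2).trace)
            - 5 / 8 * ((R ^ 2).trace * (HoravaWitten.adMatrix F ^ 4).trace)
            + (HoravaWitten.adMatrix F ^ 6).trace) : ℝ) : ℂ)) ∧
    -- The irreducible term `tr R⁶` is absent exactly in dimension 248.
    ((∃ Q : ℝ → ℝ → 𝔤 → ℂ, ∀ R : Matrix (Fin 10) (Fin 10) ℝ,
        (HoravaWitten.flatMetric ε).IsSkewAdjoint R → ∀ F : 𝔤,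
          HoravaWitten.fieldsPoly R (HoravaWitten.adMatrix F)
            = Q (R ^ 2).trace (R ^ 4).trace F) ↔
      Module.finrank ℝ 𝔤 = 248) ∧
    (HoravaWitten.IsTypeE8 𝔤 →
      -- Factorisation for gauge group `E₈`.
      (Module.finrank ℝ 𝔤 = 248 ∧
        ∀ R : Matrix (Fin 10) (Fin 10) ℝ, (HoravaWitten.flatMetric ε).IsSkewAdjoint R →
          ∀ F : 𝔤, HoravaWitten.fieldsPoly R (HoravaWitten.adMatrix F) =
            ((-(Real.pi / 3) * HoravaWitten.fourForm R (HoravaWitten.adMatrix F) ^ 3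
              - HoravaWitten.fourForm R (HoravaWitten.adMatrix F) * HoravaWitten.eightForm R
              : ℝ) : ℂ)) ∧
      ∀ kap : ℝ, 0 < kap → ∀ γ b : ℝ,
        -- The inflow from the topological and the Green-Schwarz term.
        (∀ U : Set (Fin 10 → ℝ), IsOpen U →
          ∀ Φ : HoravaWitten.Config (Module.finrank ℝ 𝔤), HoravaWitten.IsFieldConfig 𝔤 U Φ →
          ∀ Λ : HoravaWitten.Param (Module.finrank ℝ 𝔤), HoravaWitten.IsGaugeParam 𝔤 U Λ →
          ∀ ρ : ℕ → ℝ → ℝ, HoravaWitten.IsDeltaSequence ρ →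
            (∀ n, Set.EqOn (HoravaWitten.extD (HoravaWitten.fieldG γ b (ρ n) Φ))
              (γ • ∑ i, HoravaWitten.deltaForm (ρ n) i *
                HoravaWitten.pullBack (HoravaWitten.planeFour Φ i))
              (HoravaWitten.bulkRegion U)) ∧
            (∀ n, Set.EqOn
              (HoravaWitten.variation fun s => HoravaWitten.fieldG γ b (ρ n)
                (HoravaWitten.transformed γ b (ρ n) Λ Φ s))
              0 (HoravaWitten.bulkRegion U)) ∧
            Filter.Tendsto
              (fun n => HoravaWitten.actionVariation U
                (HoravaWitten.topLagrangian kap γ b (ρ n)) γ b (ρ n) Λ Φ)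
              Filter.atTop
              (nhds (∑ i, HoravaWitten.planeIntegral U (HoravaWitten.topTen kap γ b
                Λ.L (Λ.g i) (HoravaWitten.planeSpin Φ i) (Φ.A i)))) ∧
            Filter.Tendsto
              (fun n => HoravaWitten.actionVariation U
                (HoravaWitten.gsLagrangian kap γ b (ρ n)) γ b (ρ n) Λ Φ)
              Filter.atTop
              (nhds (∑ i, HoravaWitten.planeIntegral U (HoravaWitten.gsTen kap γ
                Λ.L (HoravaWitten.planeSpin Φ i) (Φ.A i))))) ∧
        -- The twelve-forms of these two variations.
        HoravaWitten.IsDescent 𝔤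
          (fun _ R F => HoravaWitten.topPoly kap γ b R F)
          (fun _ w a => HoravaWitten.topEleven kap γ b w a)
          (fun _ u v w a => HoravaWitten.topTen kap γ b u v w a) ∧
        HoravaWitten.IsDescent 𝔤
          (fun _ R F => HoravaWitten.gsPoly kap γ R F)
          (fun _ w a => HoravaWitten.gsEleven kap γ w a)
          (fun _ u _ w a => HoravaWitten.gsTen kap γ u w a) ∧
        -- Cancellation of the first part, of the second part, and of the whole anomaly of a plane.
        ((∀ R : Matrix (Fin 10) (Fin 10) ℝ, (HoravaWitten.flatMetric ε).IsSkewAdjoint R →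
            ∀ F : 𝔤, -(Real.pi / 3) * HoravaWitten.fourForm R (HoravaWitten.adMatrix F) ^ 3
              - HoravaWitten.topPoly kap γ b R (HoravaWitten.adMatrix F) = 0) ↔
          b ≠ 0 ∧ γ = -(32 * Real.pi * kap ^ 2 / b ^ 2) ^ (1 / 3 : ℝ)) ∧
        ((∀ R : Matrix (Fin 10) (Fin 10) ℝ, (HoravaWitten.flatMetric ε).IsSkewAdjoint R →
            ∀ F : 𝔤, -(HoravaWitten.fourForm R (HoravaWitten.adMatrix F) *
                HoravaWitten.eightForm R)
              - HoravaWitten.gsPoly kap γ R (HoravaWitten.adMatrix F) = 0) ↔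
          γ = -(32 * Real.pi * kap ^ 2) ^ (1 / 3 : ℝ)) ∧
        ((∀ R : Matrix (Fin 10) (Fin 10) ℝ, (HoravaWitten.flatMetric ε).IsSkewAdjoint R →
            ∀ F : 𝔤, HoravaWitten.planeAnomaly kap γ b R (HoravaWitten.adMatrix F) = 0) ↔
          γ = -(32 * Real.pi * kap ^ 2) ^ (1 / 3 : ℝ) ∧ (b = 1 ∨ b = -1))) := by
  refine ⟨fun R hR F => ?_, HoravaWitten.fieldsPoly_reducible_iff hε, fun hE => ?_⟩
  · rw [HoravaWitten.fieldsPoly_eq hε hR, Fintype.card_fin]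
  have hfac : ∀ R : Matrix (Fin 10) (Fin 10) ℝ, (HoravaWitten.flatMetric ε).IsSkewAdjoint R →
      ∀ F : 𝔤, HoravaWitten.fieldsPoly R (HoravaWitten.adMatrix F) =
        ((-(Real.pi / 3) * HoravaWitten.fourForm R (HoravaWitten.adMatrix F) ^ 3
          - HoravaWitten.fourForm R (HoravaWitten.adMatrix F) * HoravaWitten.eightForm R
          : ℝ) : ℂ) := fun R hR F =>
    HoravaWitten.fieldsPoly_factorisation hε hE.finrank_eq (fun F => (hE.trace_adMatrix F).1)
      (fun F => (hE.trace_adMatrix F).2) hR F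
  refine ⟨⟨hE.finrank_eq, hfac⟩, fun kap hk γ b => ⟨fun U hU Φ hΦ Λ hΛ ρ hρ => ⟨fun n y hy => ?_,
    fun n y hy => ?_, hΦ.tendsto_topLagrangian hU hΛ hρ kap γ b,
    hΦ.tendsto_gsLagrangian hU hΛ hρ kap γ b⟩, HoravaWitten.isDescent_top 𝔤 kap γ b,
    HoravaWitten.isDescent_gs 𝔤 kap γ, HoravaWitten.topPoly_cancel_iff hk γ b,
    HoravaWitten.gsPoly_cancel_iff hk γ, HoravaWitten.planeAnomaly_eq_zero_iff hk γ b hfac⟩⟩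
  · simpa using (hΦ.fieldG_hasExtD hU (hρ.smooth n) γ b hy).extD_eq
  · simpa using HoravaWitten.variation_eq (hΦ.fieldG_hasVariation γ b hU hΛ (hρ.smooth n) hy)
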